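/- Let $\mathbf k$ be the algebraic closure of $\mathbb C(q)$ in $\bigcup_{m>0}\mathbb C((q^{1/m}))$. Let $\mathsf A=(a_{ij})_{i,j\in I}$, $a_{ij}=\langle h_i,\alpha_j\rangle$, be a symmetrizable generalized Cartan matrix of affine type, $\delta=\sum_i d_i\alpha_i$ the null root, $c=\sum_i c_ih_i$ the canonical central element, $P_{\mathrm{cl}}=P/\mathbb Z\delta$, and let $0\in I$ be the affine vertex (the leftmost vertex of Kac's tables, up to diagram automorphism, and the vertex of the longest simple root for $A_{2n}^{(2)}$); $I_0=I\setminus\{0\}$. The form is normalized by $(\delta,\lambda)=\langle c,\lambda\rangle$, so that $q_i=q^{(\alpha_i,\alpha_i)/2}=q^{c_i/d_i}$, and $[n]_i=(q_i^n-q_i^{-n})/(q_i-q_i^{-1})$. Let $U_q'(\mathfrak g)$ be the $\mathbf k$-algebra generated by $e_i,f_i,K_i^{\pm1}$ $(i\in I)$ with the Drinfeld–Jimbo relations. For $r\in I_0$ let $\varpi_r=\gcd(c_0,c_r)^{-1}\,\mathrm{cl}(c_0\Lambda_r-c_r\Lambda_0)\in P_{\mathrm{cl}}$. The fundamental representation $V(\varpi_r)$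 is the simple finite-dimensional integrable $U_q'(\mathfrak g)$-module generated by a vector $u_{\varpi_r}$ with $V(\varpi_r)_{\varpi_r}=\mathbf k\,u_{\varpi_r}\neq0$ that belongs to a family $u_\mu\in V(\varpi_r)_\mu$, $\mu\in W\varpi_r$, such that for all $j\in I$: if $\langle h_j,\mu\rangle\ge0$, then $e_ju_\mu=0$ and $f_j^{(\langle h_j,\mu\rangle)}u_\mu=u_{s_j\mu}$; if $\langle h_j,\mu\rangle<0$, then $f_ju_\mu=0$ and $e_j^{(-\langle h_j,\mu\rangle)}u_\mu=u_{s_j\mu}$. Let $B(\varpi_r)$ be the crystal (at $q=0$) of $V(\varpi_r)$, that is, the set $B$ of a crystal basis $(L,B)$ of it, with Kashiwara operators $\tilde e_i,\tilde f_i$, weight function $\mathrm{wt}$, $\varepsilon_i(b)=\max\{k\mid\tilde e_i^kb\ne\mathbf 0\}$ and $\varphi_i(b)=\max\{k\mid\tilde f_i^kb\ne\mathbf 0\}$. Let $\mathbb V(\varpi_r)$ be the $\mathbf k$-vector space with basis $(v_b)_{b\in B(\varpi_r)}$, put $v_{\mathbf 0}=0$, and let $K_iv_b=q_i^{\langle h_i,\mathrm{wt}(b)\rangle}v_b$.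 (1) (Affine minuscule case.) Suppose that $\mathfrak g$ is dual to an untwisted affine type and that $r\in I_0$ is the image of $0$ under an automorphism of the affine Dynkin diagram. Then $V(\varpi_r)$ exists and has a crystal basis, and for each crystal basis of it the formulas $$e_iv_b=v_{\tilde e_ib},\qquad f_iv_b=v_{\tilde f_ib}$$ make $\mathbb V(\varpi_r)$ a $U_q'(\mathfrak g)$-module, which is isomorphic to $V(\varpi_r)$. (2) (Affine adjoint case.) Suppose that $\mathfrak g$ is not of type $A_n^{(1)}$ and that $r\in I_0$ is adjacent to $0$ in the Dynkin diagram. Let $x_{\alpha_j}$ denote the element of $B(\varpi_r)$ of weight $\mathrm{cl}(\alpha_j)$ and $y_j=\tilde f_jx_{\alpha_j}$, which has weight $0$; if $\mathrm{cl}(\alpha_j)$ is not a weight of $B(\varpi_r)$, then $y_j=\mathbf 0$. Then $V(\varpi_r)$ exists and has a crystal basis, and for each crystal basis of it the formulas $$e_iv_b=\begin{cases}0&\tilde e_ib=\mathbf 0,\\ [\varphi_i(b)+1]_i\,v_{\tilde e_ib}&\tilde e_ib\ne\mathbf 0,\ \mathrm{wt}(\tilde e_ib)\neq0,\\ v_{y_i}+\sum_{j\neq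 i,\,a_{ij}\ne0}\frac{[-a_{ij}]_i}{[2]_j}v_{y_j}&\text{otherwise,}\end{cases}\qquad f_iv_b=\begin{cases}0&\tilde f_ib=\mathbf 0,\\ [\varepsilon_i(b)+1]_i\,v_{\tilde f_ib}&\tilde f_ib\ne\mathbf 0,\ \mathrm{wt}(\tilde f_ib)\neq0,\\ v_{y_i}+\sum_{j\neq i,\,a_{ij}\ne0}\frac{[-a_{ij}]_i}{[2]_j}v_{y_j}&\text{otherwise}\end{cases}$$ make $\mathbb V(\varpi_r)$ a $U_q'(\mathfrak g)$-module, which is isomorphic to $V(\varpi_r)$. -/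

import Mathlib

universe u v

noncomputable section

namespace QuantumAffine

/-! ### The base field

The field `ℂ((q^{1/m}))` is realized inside the field of Hahn series in `q` with rational
exponents. The base field is the algebraic closure of `ℂ(q)` in `⋃ₘ ℂ((q^{1/m}))`. -/

/-- The order embedding `n ↦ n / m` of `ℤ` in `ℚ`. -/
def divHom (m : ℕ+) : ℤ →+ ℚ :=
  (AddMonoidHom.mulRight ((m : ℚ)⁻¹)).comp (Int.castAddHom ℚ)

theorem divHom_apply (m : ℕ+) (n : ℤ) : divHom m n = (n : ℚ) * ((m : ℕ) : ℚ)⁻¹ := rfl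

theorem divHom_le_iff (m : ℕ+) (a b : ℤ) : divHom m a ≤ divHom m b ↔ a ≤ b := by
  have hm : (0 : ℚ) < ((m : ℕ) : ℚ)⁻¹ := inv_pos.mpr (by exact_mod_cast m.pos)
  rw [divHom_apply, divHom_apply, mul_le_mul_iff_left₀ hm]
  exact Int.cast_le

theorem divHom_injective (m : ℕ+) : Function.Injective (divHom m) := fun a b h =>
  le_antisymm ((divHom_le_iff m a b).1 h.le) ((divHom_le_iff m b a).1 h.ge)

/-- The embedding of `ℂ((q))` in the Hahn series that sends `q` to `q^{1/m}`;
its range is `ℂ((q^{1/m}))`. -/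
def laurentEmb (m : ℕ+) : HahnSeries ℤ ℂ →+* HahnSeries ℚ ℂ :=
  HahnSeries.embDomainRingHom (divHom m) (divHom_injective m) (divHom_le_iff m)

/-- The field `⋃ₘ ℂ((q^{1/m}))` (the union is directed, so it is the supremum of subfields). -/
def PuiseuxField : Subfield (HahnSeries ℚ ℂ) :=
  ⨆ m : ℕ+, (laurentEmb m).fieldRange

theorem single_mem_puiseux (x : ℚ) : HahnSeries.single x (1 : ℂ) ∈ PuiseuxField := by
  have h : (laurentEmb ⟨x.den, x.den_pos⟩).fieldRange ≤ PuiseuxField :=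
    le_iSup (fun m : ℕ+ => (laurentEmb m).fieldRange) _
  refine h ⟨HahnSeries.single x.num 1, ?_⟩
  refine (HahnSeries.embDomain_single (f := ⟨⟨divHom _, divHom_injective _⟩,
    fun {a b} => divHom_le_iff ⟨x.den, x.den_pos⟩ a b⟩)).trans ?_
  refine congrArg (fun y => HahnSeries.single y (1 : ℂ)) ?_
  change (x.num : ℚ) * ((x.den : ℕ) : ℚ)⁻¹ = x
  rw [← div_eq_mul_inv, Rat.num_div_den]

/-- The Puiseux monomial `q^x`, `x ∈ ℚ`. -/
def qMono (x : ℚ) : PuiseuxField := ⟨HahnSeries.single x 1, single_mem_puiseux x⟩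

theorem qMono_pow (x : ℚ) (n : ℕ) : qMono x ^ n = qMono (n * x) := by
  apply Subtype.ext
  change (HahnSeries.single x (1 : ℂ)) ^ n = HahnSeries.single ((n : ℚ) * x) (1 : ℂ)
  rw [HahnSeries.single_pow, one_pow, nsmul_eq_mul]

theorem qMono_mul (x y : ℚ) : qMono x * qMono y = qMono (x + y) := by
  apply Subtype.ext
  change HahnSeries.single x (1 : ℂ) * HahnSeries.single y 1 = HahnSeries.single (x + y) 1
  rw [HahnSeries.single_mul_single, one_mul]

theorem qMono_zero : qMono 0 = 1 := rfl

/-- The subfield `ℂ(q)`. -/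
def CqField : Subfield PuiseuxField :=
  Subfield.closure (insert (qMono 1) {x | ∃ a : ℂ, (x : HahnSeries ℚ ℂ) = HahnSeries.C a})

/-- The base field: the algebraic closure of `ℂ(q)` in `⋃ₘ ℂ((q^{1/m}))`. -/
def BaseField : Type := algebraicClosure CqField PuiseuxField

instance : Field BaseField := inferInstanceAs (Field (algebraicClosure CqField PuiseuxField))

/-- The inclusion of the base field in the Hahn series. -/
def toHahn : BaseField →+* HahnSeries ℚ ℂ :=
  PuiseuxField.subtype.comp
    ((algebraicClosure CqField PuiseuxField).val :
      algebraicClosure CqField PuiseuxField →+* PuiseuxField)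

theorem qMono_int_mem (n : ℤ) : qMono (n : ℚ) ∈ CqField := by
  have h1 : qMono 1 ∈ CqField := Subfield.subset_closure (Set.mem_insert _ _)
  have hnat : ∀ k : ℕ, qMono (k : ℚ) ∈ CqField := fun k => by
    have := pow_mem h1 k
    rwa [qMono_pow, mul_one] at this
  obtain ⟨k, rfl | rfl⟩ := n.eq_nat_or_neg
  · exact_mod_cast hnat k
  · have h2 : qMono (((-(k : ℤ) : ℤ)) : ℚ) = (qMono (k : ℚ))⁻¹ := by
      apply eq_inv_of_mul_eq_one_left
      rw [qMono_mul]
      push_cast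
      rw [neg_add_cancel, qMono_zero]
    rw [h2]
    exact inv_mem (hnat k)

theorem qMono_mem (x : ℚ) : qMono x ∈ algebraicClosure CqField PuiseuxField := by
  rw [mem_algebraicClosure_iff]
  have h : qMono x ^ x.den = algebraMap CqField PuiseuxField ⟨_, qMono_int_mem x.num⟩ := by
    rw [qMono_pow, mul_comm, Rat.mul_den_eq_num]
    rfl
  refine IsAlgebraic.of_pow x.den_pos ?_
  rw [h]
  exact isAlgebraic_algebraMap _

/-- The element `q^x` of the base field, `x ∈ ℚ`. -/
def qPow (x : ℚ) : BaseField := ⟨qMono x, qMono_mem x⟩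

/-- The local ring `𝐀₀` of elements of the base field that are regular at `q = 0`. -/
def A0 : Subring BaseField where
  carrier := {x | 0 ≤ (toHahn x).orderTop}
  mul_mem' {x y} hx hy := by
    simp only [Set.mem_ofPred_eq, map_mul, HahnSeries.orderTop_mul] at *
    exact add_nonneg hx hy
  one_mem' := by simp
  add_mem' {x y} hx hy := by
    simp only [Set.mem_ofPred_eq, map_add] at *
    exact le_trans (le_min hx hy) HahnSeries.min_orderTop_le_orderTop_add
  zero_mem' := by simp
  neg_mem' {x} hx := by simpa using hx

/-- The maximal ideal of `𝐀₀`: the elements that vanish at `q = 0`. -/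
def m0 : Ideal A0 where
  carrier := {x | 0 < (toHahn x).orderTop}
  add_mem' {x y} hx hy := by
    simp only [Set.mem_ofPred_eq, Subring.coe_add, map_add] at *
    exact lt_of_lt_of_le (lt_min hx hy) HahnSeries.min_orderTop_le_orderTop_add
  zero_mem' := by simp
  smul_mem' c x hx := by
    simp only [Set.mem_ofPred_eq, smul_eq_mul, Subring.coe_mul, map_mul,
      HahnSeries.orderTop_mul] at *
    exact lt_of_lt_of_le hx (le_add_of_nonneg_left c.2)

/-! ### Affine Cartan data -/

/-- A generalized Cartan matrix of affine type with the vertex `0` and the (co)marks.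
The entry `A i j` is `⟨h_i, α_j⟩`. -/
structure AffineDatum (I : Type u) [Fintype I] where
  A : Matrix I I ℤ
  diag : ∀ i, A i i = 2
  off_diag : ∀ i j, i ≠ j → A i j ≤ 0
  zero_iff : ∀ i j, A i j = 0 ↔ A j i = 0
  symmetrizable : ∃ s : I → ℕ, (∀ i, 0 < s i) ∧ ∀ i j, (s i : ℤ) * A i j = (s j : ℤ) * A j i
  indecomposable : ∀ S : Set I, S.Nonempty → S ≠ Set.univ → ∃ i ∈ S, ∃ j ∉ S, A i j ≠ 0
  /-- the coefficients of `δ = ∑ d_i α_i` -/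
  d : I → ℕ
  d_pos : ∀ i, 0 < d i
  d_gcd : Finset.univ.gcd d = 1
  d_null : ∀ i, ∑ j, A i j * (d j : ℤ) = 0
  /-- the coefficients of the canonical central element `c = ∑ c_i h_i` -/
  c : I → ℕ
  c_pos : ∀ i, 0 < c i
  c_gcd : Finset.univ.gcd c = 1
  c_null : ∀ j, ∑ i, (c i : ℤ) * A i j = 0
  /-- the affine vertex `0` -/
  zero : I
  d_zero : d zero = 1
  /-- The vertices with `d_i = c_i = 1` are the images of the leftmost vertex of Kac's tables
  under the automorphisms of the Dynkin diagram. The second alternative is the type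
  `A_{2n}^{(2)}` with `α_0` the longest simple root; there `d = (1, 2, …, 2)`. -/
  c_zero : c zero = 1 ∨ ∀ i, i ≠ zero → d i = 2

/-- The lattice `P_cl = P / ℤδ = ⨁ ℤ cl(Λ_i)`: the weight `μ` is given by
its values `μ i = ⟨h_i, μ⟩`. -/
abbrev Pcl (I : Type u) : Type u := I → ℤ

/-- The class of the simple root `α_j` in `P_cl` for the matrix `A`. -/
def clRoot {I : Type u} (A : Matrix I I ℤ) (j : I) : Pcl I := fun i => A i j

/-- The simple reflection `s_i` on `P_cl` for the matrix `A`. -/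
def reflect {I : Type u} (A : Matrix I I ℤ) (i : I) (μ : Pcl I) : Pcl I := μ - μ i • clRoot A i

/-- `WeylOrbit A J μ ν` means that `ν` lies in the orbit of `μ` under the group generated by
the (involutive) reflections `s_i`, `i ∈ J`. -/
inductive WeylOrbit {I : Type u} (A : Matrix I I ℤ) (J : Set I) (μ : Pcl I) : Pcl I → Prop
  | refl : WeylOrbit A J μ μ
  | step {ν : Pcl I} (i : I) (hi : i ∈ J) (h : WeylOrbit A J μ ν) :
      WeylOrbit A J μ (reflect A i ν)

/-- The roots of the finite-type algebra `𝔤₀` attached to `I₀ = I \ {z}`, as classes in `P_cl`. -/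
def finiteRoots {I : Type u} (A : Matrix I I ℤ) (z : I) : Set (Pcl I) :=
  {β | ∃ j, j ≠ z ∧ WeylOrbit A {z}ᶜ (clRoot A j) β}

/-- The affine matrix `A` with affine vertex `z` is of untwisted type: modulo `δ`,
`-α_z` is the highest root of the finite root system attached to `I \ {z}`. -/
def IsUntwisted {I : Type u} (A : Matrix I I ℤ) (z : I) : Prop :=
  -clRoot A z ∈ finiteRoots A z ∧ ∀ i, i ≠ z → -clRoot A z + clRoot A i ∉ finiteRoots A z

namespace AffineDatum

variable {I : Type u} [Fintype I] (D : AffineDatum I)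

/-- `q_i = q^{(α_i, α_i)/2}`. For the form with `(δ, λ) = ⟨c, λ⟩` one has
`(α_i, α_i)/2 = c_i / d_i`. -/
def qi (i : I) : BaseField := qPow ((D.c i : ℚ) / (D.d i : ℚ))

/-- The `q`-integer `[n]_i`. -/
def qInt (i : I) (n : ℕ) : BaseField :=
  (D.qi i ^ n - (D.qi i)⁻¹ ^ n) / (D.qi i - (D.qi i)⁻¹)

/-- The `q`-factorial `[n]_i!`. -/
def qFact (i : I) (n : ℕ) : BaseField := ∏ k ∈ Finset.Icc 1 n, D.qInt i k

/-- The divided power `x^{(n)} = x^n / [n]_i!`. -/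
def divPow (i : I) {R : Type*} [Semiring R] [Module BaseField R] (x : R) (n : ℕ) : R :=
  (D.qFact i n)⁻¹ • x ^ n

/-- The level zero fundamental weight `ϖ_r = gcd(c_0, c_r)⁻¹ cl(c_0 Λ_r - c_r Λ_0)`. -/
def varpi [DecidableEq I] (r : I) : Pcl I :=
  Pi.single r (((D.c D.zero / Nat.gcd (D.c D.zero) (D.c r) : ℕ)) : ℤ)
    - Pi.single D.zero (((D.c r / Nat.gcd (D.c D.zero) (D.c r) : ℕ)) : ℤ)

/-- `𝔤` is of type `A_n^{(1)}` for some `n ≥ 1`: these are the affine types all of whose marks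
and comarks are `1`. -/
def IsTypeA1 : Prop := ∀ i, D.d i = 1 ∧ D.c i = 1

/-- `𝔤` is dual to an untwisted affine type, and `r ∈ I₀` is the image of `0` under an
automorphism of the affine Dynkin diagram. -/
def IsMinusculeNode (r : I) : Prop :=
  IsUntwisted D.A.transpose D.zero ∧ r ≠ D.zero ∧
    ∃ σ : Equiv.Perm I, (∀ i j, D.A (σ i) (σ j) = D.A i j) ∧ σ D.zero = r

/-- `𝔤` is not of type `A_n^{(1)}`, and `r ∈ I₀` is adjacent to `0` in the Dynkin diagram. -/
def IsAdjointNode (r : I) : Prop :=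
  ¬ D.IsTypeA1 ∧ r ≠ D.zero ∧ D.A D.zero r ≠ 0

end AffineDatum

/-! ### The quantum affine algebra -/

/-- The generators `e_i`, `f_i`, `K_i`, `K_i⁻¹`. -/
inductive Gen (I : Type u) : Type u
  | e (i : I)
  | f (i : I)
  | K (i : I)
  | Kinv (i : I)

section Algebra

variable {I : Type u} [Fintype I] [DecidableEq I] (D : AffineDatum I)

/-- The generators in the free algebra. -/
abbrev fe (i : I) : FreeAlgebra BaseField (Gen I) := FreeAlgebra.ι BaseField (Gen.e i)
/-- The generators in the free algebra. -/
abbrev ff (i : I) : FreeAlgebra BaseField (Gen I) := FreeAlgebra.ι BaseField (Gen.f i)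
/-- The generators in the free algebra. -/
abbrev fK (i : I) : FreeAlgebra BaseField (Gen I) := FreeAlgebra.ι BaseField (Gen.K i)
/-- The generators in the free algebra. -/
abbrev fKinv (i : I) : FreeAlgebra BaseField (Gen I) := FreeAlgebra.ι BaseField (Gen.Kinv i)

/-- The quantum Serre element in `x = x_i` and `y = x_j`. -/
def serre (i j : I) (x y : FreeAlgebra BaseField (Gen I)) : FreeAlgebra BaseField (Gen I) :=
  ∑ k ∈ Finset.range ((1 - D.A i j).toNat + 1),
    (-1) ^ k * (D.divPow i x ((1 - D.A i j).toNat - k) * y * D.divPow i x k)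

/-- The defining relations of `U_q'(𝔤)`. -/
inductive Rel : FreeAlgebra BaseField (Gen I) → FreeAlgebra BaseField (Gen I) → Prop
  | K_Kinv (i : I) : Rel (fK i * fKinv i) 1
  | Kinv_K (i : I) : Rel (fKinv i * fK i) 1
  | K_comm (i j : I) : Rel (fK i * fK j) (fK j * fK i)
  | K_e (i j : I) : Rel (fK i * fe j * fKinv i) (D.qi i ^ (D.A i j) • fe j)
  | K_f (i j : I) : Rel (fK i * ff j * fKinv i) (D.qi i ^ (-D.A i j) • ff j)
  | e_f_same (i : I) : Rel (fe i * ff i - ff i * fe i)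
      ((D.qi i - (D.qi i)⁻¹)⁻¹ • (fK i - fKinv i))
  | e_f_ne (i j : I) (h : i ≠ j) : Rel (fe i * ff j - ff j * fe i) 0
  | serre_e (i j : I) (h : i ≠ j) : Rel (serre D i j (fe i) (fe j)) 0
  | serre_f (i j : I) (h : i ≠ j) : Rel (serre D i j (ff i) (ff j)) 0

/-- The quantum affine algebra `U_q'(𝔤)`. -/
abbrev Uq : Type u := RingQuot (Rel D)

/-- The generator `e_i` of `U_q'(𝔤)`. -/
def ge (i : I) : Uq D := RingQuot.mkAlgHom BaseField (Rel D) (fe i)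
/-- The generator `f_i` of `U_q'(𝔤)`. -/
def gf (i : I) : Uq D := RingQuot.mkAlgHom BaseField (Rel D) (ff i)
/-- The generator `K_i` of `U_q'(𝔤)`. -/
def gK (i : I) : Uq D := RingQuot.mkAlgHom BaseField (Rel D) (fK i)

end Algebra

/-! ### Integrable modules, fundamental representations

A `U_q'(𝔤)`-module is a vector space `V` with an algebra homomorphism `Uq D → End V`. -/

section Modules

variable {I : Type u} [Fintype I] [DecidableEq I] {D : AffineDatum I}
  {V : Type v} [AddCommGroup V] [Module BaseField V]
  (ρ : Uq D →ₐ[BaseField] Module.End BaseField V)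

/-- The weight space `V_μ`. -/
def wtSpace (μ : Pcl I) : Submodule BaseField V where
  carrier := {x | ∀ i, ρ (gK D i) x = D.qi i ^ (μ i) • x}
  add_mem' {x y} hx hy i := by rw [map_add, hx i, hy i, smul_add]
  zero_mem' i := by simp
  smul_mem' a x hx i := by rw [map_smul, hx i, smul_comm]

/-- Integrable modules. -/
structure IsIntegrable : Prop where
  weights : ⨆ μ : Pcl I, wtSpace ρ μ = ⊤
  nilp_e : ∀ i x, ∃ n : ℕ, (ρ (ge D i) ^ n) x = 0
  nilp_f : ∀ i x, ∃ n : ℕ, (ρ (gf D i) ^ n) x = 0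

/-- Submodules of the `U_q'(𝔤)`-module `V`. -/
def IsInvariant (N : Submodule BaseField V) : Prop := ∀ x : Uq D, ∀ y ∈ N, ρ x y ∈ N

/-- Simple modules. -/
def IsSimpleRep : Prop :=
  Nontrivial V ∧ ∀ N : Submodule BaseField V, IsInvariant ρ N → N = ⊥ ∨ N = ⊤

/-- `V` is the fundamental representation `V(ϖ_r)`: the simple finite-dimensional integrable
module with dominant extremal weight `ϖ_r` and with extremal vectors `u_μ`, `μ ∈ W ϖ_r`. -/
structure IsFundamental (D : AffineDatum I) (r : I)
    (ρ : Uq D →ₐ[BaseField] Module.End BaseField V) : Prop where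
  finite : FiniteDimensional BaseField V
  integrable : IsIntegrable ρ
  simple : IsSimpleRep ρ
  extremal : ∃ w : Pcl I → V,
    w (D.varpi r) ≠ 0 ∧
    wtSpace ρ (D.varpi r) = Submodule.span BaseField {w (D.varpi r)} ∧
    (∀ μ, WeylOrbit D.A Set.univ (D.varpi r) μ → w μ ∈ wtSpace ρ μ) ∧
    (∀ μ, WeylOrbit D.A Set.univ (D.varpi r) μ → ∀ j, 0 ≤ μ j →
      ρ (ge D j) (w μ) = 0 ∧
      D.divPow j (ρ (gf D j)) (μ j).toNat (w μ) = w (reflect D.A j μ)) ∧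
    (∀ μ, WeylOrbit D.A Set.univ (D.varpi r) μ → ∀ j, μ j < 0 →
      ρ (gf D j) (w μ) = 0 ∧
      D.divPow j (ρ (ge D j)) (-μ j).toNat (w μ) = w (reflect D.A j μ)) ∧
    (∀ N : Submodule BaseField V, IsInvariant ρ N → w (D.varpi r) ∈ N → N = ⊤)

/-! ### Crystal bases -/

/-- `T` is the Kashiwara operator `ẽ_i`. An integrable module is spanned by the vectors
`f_i^{(n)} x` with `x ∈ V_μ`, `e_i x = 0` and `n ≤ ⟨h_i, μ⟩`. -/
def IsKashiwaraE (i : I) (T : Module.End BaseField V) : Prop :=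
  ∀ (μ : Pcl I) (x : V) (n : ℕ), x ∈ wtSpace ρ μ → ρ (ge D i) x = 0 → (n : ℤ) ≤ μ i →
    T (D.divPow i (ρ (gf D i)) n x) =
      if n = 0 then 0 else D.divPow i (ρ (gf D i)) (n - 1) x

/-- `T` is the Kashiwara operator `f̃_i`. -/
def IsKashiwaraF (i : I) (T : Module.End BaseField V) : Prop :=
  ∀ (μ : Pcl I) (x : V) (n : ℕ), x ∈ wtSpace ρ μ → ρ (ge D i) x = 0 → (n : ℤ) ≤ μ i →
    T (D.divPow i (ρ (gf D i)) n x) = D.divPow i (ρ (gf D i)) (n + 1) x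

open Classical in
/-- The Kashiwara operator `ẽ_i` on an integrable module. -/
def eTilde (i : I) : Module.End BaseField V :=
  if h : ∃ T, IsKashiwaraE ρ i T then h.choose else 0

open Classical in
/-- The Kashiwara operator `f̃_i` on an integrable module. -/
def fTilde (i : I) : Module.End BaseField V :=
  if h : ∃ T, IsKashiwaraF ρ i T then h.choose else 0

/-- Crystal lattices of `V`. -/
structure CrystalLattice where
  L : Submodule A0 V
  /-- `L` is a free `𝐀₀`-module and generates `V` -/
  free : ∃ (ι : Type v) (b : Module.Basis ι BaseField V), L = Submodule.span A0 (Set.range b)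
  weights : L = ⨆ μ : Pcl I, L ⊓ (wtSpace ρ μ).restrictScalars A0
  stable_e : ∀ i, ∀ x ∈ L, eTilde ρ i x ∈ L
  stable_f : ∀ i, ∀ x ∈ L, fTilde ρ i x ∈ L

namespace CrystalLattice

variable {ρ} (Λ : CrystalLattice ρ)

/-- `L / 𝔪 L`, the specialization of the lattice at `q = 0`. -/
abbrev Fiber : Type v := Λ.L ⧸ (m0 • (⊤ : Submodule A0 Λ.L))

/-- The map induced on `L / 𝔪 L` by a linear map that preserves `L`. -/
def induced (T : Module.End BaseField V) (hT : ∀ x ∈ Λ.L, T x ∈ Λ.L) :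
    Λ.Fiber →ₗ[A0] Λ.Fiber :=
  Submodule.mapQ _ _ ((T.restrictScalars A0).restrict hT) (by
    rw [← Submodule.map_le_iff_le_comap, Submodule.map_smul'']
    exact Submodule.smul_mono le_rfl le_top)

/-- `ẽ_i` on `L / 𝔪 L`. -/
def eBar (i : I) : Λ.Fiber →ₗ[A0] Λ.Fiber := Λ.induced (eTilde ρ i) (Λ.stable_e i)

/-- `f̃_i` on `L / 𝔪 L`. -/
def fBar (i : I) : Λ.Fiber →ₗ[A0] Λ.Fiber := Λ.induced (fTilde ρ i) (Λ.stable_f i)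

/-- `x ∈ L / 𝔪 L` is the class of an element of `L` of weight `μ`. -/
def HasWeight (x : Λ.Fiber) (μ : Pcl I) : Prop :=
  ∃ y : Λ.L, (y : V) ∈ wtSpace ρ μ ∧ Submodule.Quotient.mk y = x

end CrystalLattice

/-- Crystal bases `(L, B)` of `V`. -/
structure CrystalBasis extends CrystalLattice ρ where
  B : Set toCrystalLattice.Fiber
  linInd : LinearIndependent (A0 ⧸ m0) ((↑) : B → toCrystalLattice.Fiber)
  span : Submodule.span (A0 ⧸ m0) B = ⊤
  hasWeight : ∀ b ∈ B, ∃ μ, toCrystalLattice.HasWeight b μ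
  eBar_mem : ∀ i, ∀ b ∈ B, toCrystalLattice.eBar i b ∈ B ∨ toCrystalLattice.eBar i b = 0
  fBar_mem : ∀ i, ∀ b ∈ B, toCrystalLattice.fBar i b ∈ B ∨ toCrystalLattice.fBar i b = 0
  eBar_fBar : ∀ i, ∀ b ∈ B, ∀ b' ∈ B,
    toCrystalLattice.fBar i b = b' ↔ toCrystalLattice.eBar i b' = b

namespace CrystalBasis

variable {ρ} (C : CrystalBasis ρ)

open Classical in
/-- The weight of an element of the crystal. -/
def wt (b : C.Fiber) : Pcl I :=
  if h : ∃ μ, C.HasWeight b μ then h.choose else 0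

/-- `ε_i(b) = max {k | ẽ_i^k b ≠ 0}`. -/
def eps (i : I) (b : C.Fiber) : ℕ := sSup {k | (C.eBar i ^ k) b ≠ 0}

/-- `φ_i(b) = max {k | f̃_i^k b ≠ 0}`. -/
def phi (i : I) (b : C.Fiber) : ℕ := sSup {k | (C.fBar i ^ k) b ≠ 0}

/-- The vector space with basis `v_b`, `b ∈ B`. -/
abbrev Space : Type v := C.B →₀ BaseField

open Classical in
/-- The vector `v_b`, with `v_0 = 0`. -/
def vec (b : C.Fiber) : C.Space :=
  if h : b ∈ C.B then Finsupp.single ⟨b, h⟩ 1 else 0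

open Classical in
/-- The element `x_{α_j}` of `B` of weight `α_j`, and `0` if there is none. -/
def xRoot (j : I) : C.Fiber :=
  if h : ∃ b ∈ C.B, C.wt b = clRoot D.A j then h.choose else 0

/-- The element `y_j = f̃_j x_{α_j}` of weight zero, so that `x_{α_j} → y_j → x_{-α_j}`
are the arrows with label `j`; it is `0` if there is no `x_{α_j}`. -/
def yElt (j : I) : C.Fiber := C.fBar j (C.xRoot j)

/-- The vector `v_{y_i} + ∑_{j ∼ i} [-a_{ij}]_i / [2]_j v_{y_j}`. -/
def zeroVec (i : I) : C.Space :=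
  C.vec (C.yElt i) + ∑ j with j ≠ i ∧ D.A i j ≠ 0,
    (D.qInt i (-D.A i j).toNat / D.qInt j 2) • C.vec (C.yElt j)

/-- The action of `e_i` on `v_b` in the minuscule case. -/
def minusculeE (i : I) (b : C.B) : C.Space := C.vec (C.eBar i b)

/-- The action of `f_i` on `v_b` in the minuscule case. -/
def minusculeF (i : I) (b : C.B) : C.Space := C.vec (C.fBar i b)

open Classical in
/-- The action of `e_i` on `v_b` in the adjoint case. -/
def adjointE (i : I) (b : C.B) : C.Space :=
  if C.eBar i b = 0 then 0
  else if C.wt (C.eBar i b) ≠ 0 then D.qInt i (C.phi i b + 1) • C.vec (C.eBar i b)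
  else C.zeroVec i

open Classical in
/-- The action of `f_i` on `v_b` in the adjoint case. -/
def adjointF (i : I) (b : C.B) : C.Space :=
  if C.fBar i b = 0 then 0
  else if C.wt (C.fBar i b) ≠ 0 then D.qInt i (C.eps i b + 1) • C.vec (C.fBar i b)
  else C.zeroVec i

/-- The given action of `e_i`, `f_i` on the `v_b`, together with
`K_i v_b = q_i^{⟨h_i, wt(b)⟩} v_b`, defines a `U_q'(𝔤)`-module structure on the space with
basis `(v_b)`, and this module is isomorphic to `V`. -/
def RealizesModule (eAct fAct : I → C.B → C.Space) : Prop :=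
  ∃ σ : Uq D →ₐ[BaseField] Module.End BaseField C.Space,
    (∀ (i : I) (b : C.B),
      σ (ge D i) (Finsupp.single b 1) = eAct i b ∧
      σ (gf D i) (Finsupp.single b 1) = fAct i b ∧
      σ (gK D i) (Finsupp.single b 1) = D.qi i ^ (C.wt b i) • Finsupp.single b 1) ∧
    ∃ Φ : C.Space ≃ₗ[BaseField] V, ∀ (x : Uq D) (y : C.Space), Φ (σ x y) = ρ x (Φ y)

end CrystalBasis

end Modules

/-- The fundamental representation `V(ϖ_r)` exists and has a crystal basis. -/
def FundamentalExists {I : Type u} [Fintype I] [DecidableEq I] (D : AffineDatum I) (r : I) :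
    Prop :=
  ∃ (V : Type) (_ : AddCommGroup V) (_ : Module BaseField V)
    (ρ : Uq D →ₐ[BaseField] Module.End BaseField V),
    IsFundamental D r ρ ∧ Nonempty (CrystalBasis ρ)

end QuantumAffine

end

/-!
The finite-dimensional modules in question are written down explicitly, and every other
fundamental representation and every other crystal basis is identified with the explicit one.

**The weights.** A string system (`AffineDatum.StringSystem`) is a finite set `R` of nonzero
level-zero weights that contains the Weyl group orbit of `ϖ_r` and whose root strings behave like
those of a module with one-dimensional spaces of nonzero weight. In the minuscule case `R` is the
orbit itself. Its weights have all pairings `⟨h_i, μ⟩` in `{0, ±1}` (`minuscule_bound`), because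
these pairings are differences of the coefficients of a real root of the dual, untwisted type at
two vertices of mark one (`IsRealRoot.sub_le_one`); so the strings have at most two members
(`minusculeSystem`). In the adjoint case `-α_0` is `ϖ_r` or `2 ϖ_r`, and `R`
consists of the orbit of `ϖ_r` and the orbits of the simple roots shorter than `ϖ_r`. Its strings
are found from the invariant form: a short simple root has squared length `1/2` or `1/3` of that
of `ϖ_r` (`adjointLattice`), and lengths together with the divisibility of the pairings decide
which sums of weights and roots are weights (`exists_adjointSystem`).

**The module.** A string system defines a module with one basis vector `v_μ` for each `μ ∈ R` and
one basis vector `y_j` of weight `0` for each simple root `α_j ∈ R`. The operators move along the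
strings with `q`-integers as coefficients, and `f_i v_{α_i} = e_i v_{-α_i}` is the combination
`z_i` of the `y_j` in the statement. Only the commutators of `e_i` and `f_j` have to be checked:
the operators `e_i`, `f_i`, `K_i` are locally nilpotent triples of quantum `sl₂`, and the Serre
element commutes with `f_i` and has positive weight, so it vanishes (`serre_eq_zero`). The module
is simple, and the `v_μ` with `μ` in the orbit are extremal (`IsModel.isFundamental`).

**Uniqueness.** In the product of two fundamental representations take the extremal vectors
`(u_μ, u'_μ)`. Together with the vectors of weight `0` on the strings of the simple roots in the
orbit they generate, under the operators that belong to the simple roots shorter than `ϖ_r`, a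
subspace that turns out to be invariant (`ExtremalFamily.E_mem_hull`), and whose vectors of weight
`ϖ_r` are the multiples of `(u_{ϖ_r}, u'_{ϖ_r})` (`ExtremalFamily.hull_le`). Both factors being
simple, it is the graph of an isomorphism (`IsFundamental.exists_equiv`).

**Crystal bases.** The Kashiwara operators of the explicit module move its basis along a graph,
except that they map `v_{±α_i}` to `z_i` instead of `y_i` (`kE_basis`, `kF_basis`). The
off-diagonal coefficients of the `z_i` vanish at `q = 0` (`ord_zCoeff_pos`), so the basis spans a
crystal lattice and its classes form a crystal. Conversely, the crystal of any crystal basis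
contains the class of a vector of weight `ϖ_r`, by Nakayama's lemma (`IsModel.exists_top`), and
after rescaling it the Kashiwara operators produce the whole standard crystal basis
(`IsModel.exists_isStd`). The formulas for `e_i v_b` and `f_i v_b` are then the definition of the
operators, as `φ_i` and `ε_i` count the steps to the ends of the strings
(`realizesModule_minuscule`, `realizesModule_adjoint`).
-/

noncomputable section

set_option linter.unusedSectionVars false

namespace QuantumAffine

/-! ### The local ring `𝐀₀` and `q`-integers -/

/-- The order of vanishing at `q = 0`. -/
def ord (x : BaseField) : WithTop ℚ := (toHahn x).orderTop

theorem ord_mul (x y : BaseField) : ord (x * y) = ord x + ord y := by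
  simp [ord, HahnSeries.orderTop_mul]

theorem ord_eq_top {x : BaseField} : ord x = ⊤ ↔ x = 0 := by
  simp [ord]

theorem ord_one : ord 1 = 0 := by simp [ord]

theorem mem_A0 {x : BaseField} : x ∈ A0 ↔ 0 ≤ ord x := Iff.rfl

theorem mem_m0 {x : A0} : x ∈ m0 ↔ 0 < ord (x : BaseField) := Iff.rfl

theorem toHahn_qPow (x : ℚ) : toHahn (qPow x) = HahnSeries.single x 1 := rfl

theorem ord_qPow (x : ℚ) : ord (qPow x) = (x : WithTop ℚ) := by
  rw [ord, toHahn_qPow, HahnSeries.orderTop_single one_ne_zero]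

theorem qPow_ne_zero (x : ℚ) : qPow x ≠ 0 := fun h => by
  have := ord_qPow x
  rw [h, ord_eq_top.2 rfl] at this
  exact WithTop.top_ne_coe this

theorem qPow_mul (x y : ℚ) : qPow x * qPow y = qPow (x + y) :=
  Subtype.ext (qMono_mul x y)

theorem qPow_zero : qPow 0 = 1 := rfl

theorem qPow_inv (x : ℚ) : (qPow x)⁻¹ = qPow (-x) :=
  inv_eq_of_mul_eq_one_right (by rw [qPow_mul, add_neg_cancel, qPow_zero])

theorem qPow_pow (x : ℚ) (n : ℕ) : qPow x ^ n = qPow (n * x) :=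
  Subtype.ext (qMono_pow x n)

theorem qPow_zpow (x : ℚ) (n : ℤ) : qPow x ^ n = qPow (n * x) := by
  obtain ⟨k, rfl | rfl⟩ := n.eq_nat_or_neg
  · rw [zpow_natCast, qPow_pow, Int.cast_natCast]
  · rw [zpow_neg, zpow_natCast, qPow_pow, qPow_inv]
    push_cast
    rw [neg_mul]

theorem ord_qPow_sub {x y : ℚ} (h : x < y) : ord (qPow x - qPow y) = (x : WithTop ℚ) := by
  rw [ord, map_sub, toHahn_qPow, toHahn_qPow, HahnSeries.orderTop_sub,
    HahnSeries.orderTop_single one_ne_zero]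
  rw [HahnSeries.orderTop_single one_ne_zero, HahnSeries.orderTop_single one_ne_zero]
  exact WithTop.coe_lt_coe.2 h

theorem qPow_injective : Function.Injective qPow := fun x y h => by
  have := ord_qPow x
  rw [h, ord_qPow] at this
  exact (WithTop.coe_injective this).symm

theorem ord_inv {x : BaseField} (hx : x ≠ 0) {t : ℚ} (h : ord x = (t : WithTop ℚ)) :
    ord x⁻¹ = ((-t : ℚ) : WithTop ℚ) := by
  have h1 : ord (x * x⁻¹) = 0 := by rw [mul_inv_cancel₀ hx, ord_one]
  rw [ord_mul, h] at h1
  have h2 : ord x⁻¹ ≠ ⊤ := fun h => inv_ne_zero hx (ord_eq_top.1 h)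
  lift ord x⁻¹ to ℚ using h2 with s
  norm_cast at h1 ⊢
  linarith

theorem ord_of_ne_zero {x : BaseField} (hx : x ≠ 0) : ∃ t : ℚ, ord x = (t : WithTop ℚ) := by
  have h2 : ord x ≠ ⊤ := fun h => hx (ord_eq_top.1 h)
  lift ord x to ℚ using h2 with s
  exact ⟨s, rfl⟩

theorem inv_ord_pos_of_notMem {x : BaseField} (hx : x ∉ A0) : 0 < ord x⁻¹ := by
  have h0 : x ≠ 0 := fun h => hx (h ▸ A0.zero_mem)
  obtain ⟨t, ht⟩ := ord_of_ne_zero h0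
  rw [ord_inv h0 ht]
  rw [mem_A0, ht, not_le] at hx
  have : t < 0 := by exact_mod_cast hx
  exact_mod_cast (neg_pos.2 this)

theorem inv_mem_of_notMem_m0 {x : A0} (hx : x ∉ m0) : (x : BaseField)⁻¹ ∈ A0 ∧ (x : BaseField) ≠ 0 := by
  have h0 : (x : BaseField) ≠ 0 := fun h => hx (by
    rw [mem_m0, h, ord_eq_top.2 rfl]; exact WithTop.coe_lt_top 0)
  obtain ⟨t, ht⟩ := ord_of_ne_zero h0
  refine ⟨?_, h0⟩
  rw [mem_A0, ord_inv h0 ht]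
  rw [mem_m0, ht, not_lt] at hx
  have : t ≤ 0 := by exact_mod_cast hx
  exact_mod_cast (neg_nonneg.2 this)

theorem isUnit_of_notMem_m0 {x : A0} (hx : x ∉ m0) : IsUnit x := by
  obtain ⟨h1, h2⟩ := inv_mem_of_notMem_m0 hx
  exact IsUnit.of_mul_eq_one ⟨_, h1⟩ (Subtype.ext (mul_inv_cancel₀ h2))

theorem one_notMem_m0 : (1 : A0) ∉ m0 := by
  rw [mem_m0]
  simp [ord_one]

theorem m0_le_jacobson : m0 ≤ (⊥ : Ideal A0).jacobson := fun x hx => by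
  rw [Ideal.mem_jacobson_bot]
  intro y
  apply isUnit_of_notMem_m0
  intro h
  refine one_notMem_m0 ?_
  have := m0.sub_mem h (m0.mul_mem_right y hx)
  rwa [add_sub_cancel_left] at this

instance : Nontrivial (A0 ⧸ m0) :=
  Ideal.Quotient.nontrivial_iff.2 ((Ideal.ne_top_iff_one _).2 one_notMem_m0)

/-- The `q`-integer `[n]`, for an integer `n`. -/
def qNum (q : BaseField) (n : ℤ) : BaseField := (q ^ n - q ^ (-n)) / (q - q⁻¹)

theorem qNum_zero (q : BaseField) : qNum q 0 = 0 := by simp [qNum]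

theorem qNum_neg (q : BaseField) (n : ℤ) : qNum q (-n) = -qNum q n := by
  rw [qNum, qNum, neg_neg, ← neg_sub, neg_div]

theorem qNum_one {q : BaseField} (h : q - q⁻¹ ≠ 0) : qNum q 1 = 1 := by
  rw [qNum, zpow_one, zpow_neg_one, div_self h]

theorem qNum_sl2 {q : BaseField} (hq : q ≠ 0) (a b : ℤ) :
    qNum q a * qNum q (b + 1) - qNum q b * qNum q (a + 1) = qNum q (a - b) := by
  by_cases h0 : q - q⁻¹ = 0
  · simp [qNum, h0]
  rw [qNum, qNum, qNum, qNum, qNum, div_mul_div_comm, div_mul_div_comm, ← sub_div,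
    div_eq_div_iff (mul_ne_zero h0 h0) h0]
  have e2 : q ^ (a - b) = q ^ a * (q ^ b)⁻¹ := by rw [zpow_sub₀ hq, div_eq_mul_inv]
  have e3 : q ^ (b + 1) = q ^ b * q := by rw [zpow_add₀ hq, zpow_one]
  have e4 : q ^ (a + 1) = q ^ a * q := by rw [zpow_add₀ hq, zpow_one]
  rw [zpow_neg, zpow_neg, zpow_neg, zpow_neg, zpow_neg, e2, e3, e4]
  have hn : q ^ a ≠ 0 := zpow_ne_zero _ hq
  have hh : q ^ b ≠ 0 := zpow_ne_zero _ hq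
  field_simp
  ring

namespace AffineDatum

variable {I : Type u} [Fintype I] (D : AffineDatum I)

/-- Half the squared length of `α_i`, in the normalization in which `q_i = q^{(α_i, α_i)/2}`. -/
def len (i : I) : ℚ := (D.c i : ℚ) / (D.d i : ℚ)

theorem len_pos (i : I) : 0 < D.len i :=
  div_pos (by exact_mod_cast D.c_pos i) (by exact_mod_cast D.d_pos i)

theorem qi_eq (i : I) : D.qi i = qPow (D.len i) := rfl

theorem qi_ne_zero (i : I) : D.qi i ≠ 0 := qPow_ne_zero _

theorem qi_sub_ne_zero (i : I) : D.qi i - (D.qi i)⁻¹ ≠ 0 := by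
  rw [qi_eq, qPow_inv, sub_ne_zero]
  intro h
  have := qPow_injective h
  have := D.len_pos i
  linarith

theorem qi_zpow_injective (i : I) : Function.Injective fun n : ℤ => D.qi i ^ n := fun m n h => by
  simp only [qi_eq, qPow_zpow] at h
  have := mul_right_cancel₀ (D.len_pos i).ne' (qPow_injective h)
  exact_mod_cast this

theorem qInt_eq (i : I) (n : ℕ) : D.qInt i n = qNum (D.qi i) n := by
  rw [qInt, qNum, zpow_neg, zpow_natCast, inv_pow]

theorem qInt_zero (i : I) : D.qInt i 0 = 0 := by simp [qInt]

theorem qInt_one (i : I) : D.qInt i 1 = 1 := by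
  rw [qInt, pow_one, pow_one, div_self (D.qi_sub_ne_zero i)]

theorem ord_qInt (i : I) {n : ℕ} (hn : 0 < n) :
    ord (D.qInt i n) = (((1 - n : ℚ) * D.len i : ℚ) : WithTop ℚ) := by
  have hl := D.len_pos i
  have hn' : (0 : ℚ) < n := by exact_mod_cast hn
  have h1 : D.qInt i n * (qPow (-D.len i) - qPow (D.len i)) =
      qPow (-(n * D.len i)) - qPow (n * D.len i) := by
    rw [qInt, qi_eq, qPow_inv, qPow_pow, qPow_pow, div_mul_eq_mul_div, div_eq_iff]
    · rw [mul_neg]; ring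
    · rw [← qPow_inv, ← qi_eq]
      exact D.qi_sub_ne_zero i
  have h2 := congrArg ord h1
  rw [ord_mul, ord_qPow_sub (by linarith), ord_qPow_sub (by nlinarith)] at h2
  have h3 : ord (D.qInt i n) ≠ ⊤ := fun h => by
    rw [h, WithTop.top_add] at h2
    exact WithTop.top_ne_coe h2
  lift ord (D.qInt i n) to ℚ using h3 with t
  rw [← WithTop.coe_add, WithTop.coe_inj] at h2
  rw [WithTop.coe_inj]
  linarith

theorem qInt_ne_zero (i : I) {n : ℕ} (hn : 0 < n) : D.qInt i n ≠ 0 := fun h => by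
  have := D.ord_qInt i hn
  rw [h, ord_eq_top.2 rfl] at this
  exact WithTop.top_ne_coe this

theorem qFact_zero (i : I) : D.qFact i 0 = 1 := by simp [qFact]

theorem qFact_succ (i : I) (n : ℕ) : D.qFact i (n + 1) = D.qFact i n * D.qInt i (n + 1) := by
  rw [qFact, qFact, Finset.prod_Icc_succ_top (by omega)]

theorem qFact_ne_zero (i : I) (n : ℕ) : D.qFact i n ≠ 0 :=
  Finset.prod_ne_zero_iff.2 fun _ hk => D.qInt_ne_zero i (Finset.mem_Icc.1 hk).1

/-- `[n]_i / [2]_j` vanishes at `q = 0` as soon as `(n - 1) (α_i, α_i) < (α_j, α_j)`. -/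
theorem ord_qInt_div_pos (i j : I) {n : ℕ} (hn : 0 < n) (h : (n - 1 : ℚ) * D.len i < D.len j) :
    0 < ord (D.qInt i n / D.qInt j 2) := by
  rw [div_eq_mul_inv, ord_mul, D.ord_qInt i hn,
    ord_inv (D.qInt_ne_zero j two_pos) (D.ord_qInt j two_pos)]
  norm_cast
  push_cast
  linarith

end AffineDatum

/-! ### The invariant form of an affine Cartan matrix -/

namespace AffineDatum

variable {I : Type u} [Fintype I] (D : AffineDatum I)

/-- The value `⟨h_i, x⟩` for `x = ∑ x_j α_j`. -/
def pair (x : I → ℚ) (i : I) : ℚ := ∑ j, (D.A i j : ℚ) * x j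

/-- Two vectors in the left kernel of the Cartan matrix are proportional. -/
theorem left_kernel (t : I → ℚ) (ht : ∀ j, ∑ i, t i * D.A i j = 0) : ∃ κ : ℚ, ∀ i, t i = κ * D.c i := by
  obtain ⟨i0, -, hi0⟩ := Finset.exists_min_image Finset.univ (fun i => t i / D.c i) ⟨D.zero, Finset.mem_univ _⟩
  refine ⟨t i0 / D.c i0, ?_⟩
  have hc : ∀ i, (0 : ℚ) < D.c i := fun i => by exact_mod_cast D.c_pos i
  set κ := t i0 / D.c i0
  set w : I → ℚ := fun i => t i - κ * D.c i with hw
  have hw0 : ∀ i, 0 ≤ w i := fun i => by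
    have := hi0 i (Finset.mem_univ i)
    rw [le_div_iff₀ (hc i)] at this
    simp only [hw]; linarith
  have hwA : ∀ j, ∑ i, w i * D.A i j = 0 := fun j => by
    have h2 : (∑ i, (D.c i : ℚ) * D.A i j) = 0 := by exact_mod_cast D.c_null j
    simp only [hw, sub_mul, Finset.sum_sub_distrib, ht, mul_assoc, ← Finset.mul_sum, h2]
    simp
  have hS : {i | w i = 0} = Set.univ := by
    by_contra hne
    obtain ⟨i, hi, j, hj, hij⟩ := D.indecomposable {i | w i = 0}
      ⟨i0, by simp only [Set.mem_ofPred_eq, hw, κ]; field_simp [(hc i0).ne']; ring⟩ hne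
    have hle : ∀ k ∈ Finset.univ, w k * D.A k i ≤ 0 := fun k _ => by
      by_cases hk : k = i
      · rw [hk, show w i = 0 from hi, zero_mul]
      · exact mul_nonpos_of_nonneg_of_nonpos (hw0 k) (by exact_mod_cast D.off_diag k i hk)
    have := (Finset.sum_eq_zero_iff_of_nonpos hle).1 (hwA i) j (Finset.mem_univ j)
    rcases mul_eq_zero.1 this with h | h
    · exact hj h
    · exact hij ((D.zero_iff j i).1 (by exact_mod_cast h))
  intro i
  have : w i = 0 := by
    have : i ∈ {i | w i = 0} := hS ▸ Set.mem_univ i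
    exact this
  simp only [hw] at this
  linarith

theorem d_null' (i : I) : ∑ j, (D.A i j : ℚ) * D.d j = 0 := by exact_mod_cast D.d_null i

/-- The symmetrizability of the Cartan matrix, with the explicit symmetrizer `c_i / d_i`. -/
theorem len_symm (i j : I) : D.len i * D.A i j = D.len j * D.A j i := by
  obtain ⟨s, hs, hsA⟩ := D.symmetrizable
  have hsA' : ∀ i j, (s i : ℚ) * D.A i j = s j * D.A j i := fun i j => by exact_mod_cast hsA i j
  obtain ⟨κ, hκ⟩ := D.left_kernel (fun i => s i * D.d i) (fun j => by
    have : ∀ i, (s i * D.d i : ℚ) * D.A i j = s j * (D.A j i * D.d i) := fun i => by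
      linear_combination (D.d i : ℚ) * hsA' i j
    simp only [this, ← Finset.mul_sum, D.d_null', mul_zero])
  have hκ0 : κ ≠ 0 := fun h => by
    have := hκ i
    rw [h, zero_mul] at this
    have h1 : (0 : ℚ) < s i := by exact_mod_cast hs i
    have h2 : (0 : ℚ) < D.d i := by exact_mod_cast D.d_pos i
    exact (mul_pos h1 h2).ne' this
  have hl : ∀ i, κ * D.len i = s i := fun i => by
    have h2 : (0 : ℚ) < D.d i := by exact_mod_cast D.d_pos i
    rw [len, ← mul_div_assoc, ← hκ i, mul_div_assoc, div_self h2.ne', mul_one]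
  apply mul_left_cancel₀ hκ0
  rw [← mul_assoc, ← mul_assoc, hl, hl, hsA']

/-- The invariant form on `⨁ ℚ α_i`, with `(α_i, α_i) = 2 c_i / d_i`. -/
def form (x y : I → ℚ) : ℚ := ∑ i, D.len i * x i * D.pair y i

theorem pair_add (x y : I → ℚ) (i : I) : D.pair (x + y) i = D.pair x i + D.pair y i := by
  simp [pair, mul_add, Finset.sum_add_distrib]

theorem pair_smul (t : ℚ) (x : I → ℚ) (i : I) : D.pair (t • x) i = t * D.pair x i := by
  simp only [pair, Pi.smul_apply, smul_eq_mul, Finset.mul_sum]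
  exact Finset.sum_congr rfl fun _ _ => by ring

theorem pair_neg (x : I → ℚ) (i : I) : D.pair (-x) i = -D.pair x i := by
  rw [← neg_one_smul ℚ x, pair_smul, neg_one_mul]

theorem pair_sub (x y : I → ℚ) (i : I) : D.pair (x - y) i = D.pair x i - D.pair y i := by
  rw [sub_eq_add_neg, pair_add, pair_neg, sub_eq_add_neg]

theorem pair_zero (i : I) : D.pair 0 i = 0 := by simp [pair]

theorem form_comm (x y : I → ℚ) : D.form x y = D.form y x := by
  simp only [form, pair, Finset.mul_sum]
  rw [Finset.sum_comm]
  refine Finset.sum_congr rfl fun i _ => Finset.sum_congr rfl fun j _ => ?_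
  linear_combination x j * y i * D.len_symm j i

theorem form_add_right (x y z : I → ℚ) : D.form x (y + z) = D.form x y + D.form x z := by
  simp only [form, pair_add, mul_add, Finset.sum_add_distrib]

theorem form_smul_right (t : ℚ) (x y : I → ℚ) : D.form x (t • y) = t * D.form x y := by
  simp only [form, pair_smul, Finset.mul_sum]
  exact Finset.sum_congr rfl fun _ _ => by ring

theorem form_neg_right (x y : I → ℚ) : D.form x (-y) = -D.form x y := by
  rw [← neg_one_smul ℚ y, form_smul_right, neg_one_mul]

theorem form_sub_right (x y z : I → ℚ) : D.form x (y - z) = D.form x y - D.form x z := by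
  rw [sub_eq_add_neg, form_add_right, form_neg_right, sub_eq_add_neg]

theorem form_add_left (x y z : I → ℚ) : D.form (x + y) z = D.form x z + D.form y z := by
  rw [form_comm, form_add_right, D.form_comm z, D.form_comm z]

theorem form_smul_left (t : ℚ) (x y : I → ℚ) : D.form (t • x) y = t * D.form x y := by
  rw [form_comm, form_smul_right, form_comm]

theorem form_neg_left (x y : I → ℚ) : D.form (-x) y = -D.form x y := by
  rw [form_comm, form_neg_right, form_comm]

theorem form_sub_left (x y z : I → ℚ) : D.form (x - y) z = D.form x z - D.form y z := by
  rw [form_comm, form_sub_right, D.form_comm z, D.form_comm z]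

/-- The null root `δ`. -/
def delta : I → ℚ := fun i => D.d i

theorem pair_delta (i : I) : D.pair D.delta i = 0 := D.d_null' i

theorem form_delta_right (x : I → ℚ) : D.form x D.delta = 0 := by
  simp [form, pair_delta]

theorem form_delta_left (x : I → ℚ) : D.form D.delta x = 0 := by
  rw [form_comm, form_delta_right]

/-- The form as a sum of squares; the off-diagonal coefficients are nonnegative. -/
theorem form_eq_sum_sq (x : I → ℚ) : D.form x x =
    ∑ i, ∑ j, -(1 / 2) * (D.len i * D.A i j * D.d i * D.d j) * (x i / D.d i - x j / D.d j) ^ 2 := by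
  have hd : ∀ i, (D.d i : ℚ) ≠ 0 := fun i => by exact_mod_cast (D.d_pos i).ne'
  have h1 : ∀ i j, -(1 / 2) * (D.len i * D.A i j * D.d i * D.d j) * (x i / D.d i - x j / D.d j) ^ 2 =
      D.len i * x i * (D.A i j * x j) - (1 / 2) * (D.len i * x i ^ 2 / D.d i) * (D.A i j * D.d j)
        - (1 / 2) * (D.len j * x j ^ 2 / D.d j) * (D.A j i * D.d i) := fun i j => by
    have := D.len_symm i j
    have hi := hd i
    have hj := hd j
    field_simp
    linear_combination (-(D.d i : ℚ) ^ 2 * x j ^ 2) * this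
  simp only [h1, Finset.sum_sub_distrib]
  rw [Finset.sum_comm (f := fun i j => (1 / 2) * (D.len j * x j ^ 2 / D.d j) * (D.A j i * D.d i))]
  simp only [← Finset.mul_sum, D.d_null', mul_zero, Finset.sum_const_zero, sub_zero]
  rfl

theorem sq_term_nonneg (x : I → ℚ) (i j : I) :
    0 ≤ -(1 / 2) * (D.len i * D.A i j * D.d i * D.d j) * (x i / D.d i - x j / D.d j) ^ 2 := by
  by_cases hij : i = j
  · simp [hij]
  have hA : (D.A i j : ℚ) ≤ 0 := by exact_mod_cast D.off_diag i j hij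
  have h3 : 0 ≤ D.len i * D.d i * D.d j * -(D.A i j : ℚ) :=
    mul_nonneg (mul_nonneg (mul_nonneg (D.len_pos i).le (by positivity)) (by positivity))
      (by linarith)
  have h4 := mul_nonneg h3 (sq_nonneg (x i / D.d i - x j / D.d j))
  linarith

theorem form_nonneg (x : I → ℚ) : 0 ≤ D.form x x := by
  rw [form_eq_sum_sq]
  exact Finset.sum_nonneg fun i _ => Finset.sum_nonneg fun j _ => D.sq_term_nonneg x i j

/-- The radical of the form is spanned by `δ`. -/
theorem eq_smul_delta {x : I → ℚ} (hx : D.form x x = 0) : x = (x D.zero) • D.delta := by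
  rw [form_eq_sum_sq, Finset.sum_eq_zero_iff_of_nonneg fun i _ =>
    Finset.sum_nonneg fun j _ => D.sq_term_nonneg x i j] at hx
  have hd : ∀ i, (D.d i : ℚ) ≠ 0 := fun i => by exact_mod_cast (D.d_pos i).ne'
  have hadj : ∀ i j, D.A i j ≠ 0 → x i / D.d i = x j / D.d j := fun i j hij => by
    have h1 := (Finset.sum_eq_zero_iff_of_nonneg fun j _ => D.sq_term_nonneg x i j).1
      (hx i (Finset.mem_univ i)) j (Finset.mem_univ j)
    have hA : (D.A i j : ℚ) ≠ 0 := by exact_mod_cast hij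
    have := mul_eq_zero.1 h1
    rcases this with h | h
    · exfalso
      have h5 : D.len i * D.A i j * D.d i * D.d j ≠ 0 :=
        mul_ne_zero (mul_ne_zero (mul_ne_zero (D.len_pos i).ne' hA) (hd i)) (hd j)
      apply h5
      linarith
    · exact sub_eq_zero.1 (pow_eq_zero_iff two_ne_zero |>.1 h)
  have hS : {i | x i / D.d i = x D.zero / D.d D.zero} = Set.univ := by
    by_contra hne
    obtain ⟨i, hi, j, hj, hij⟩ := D.indecomposable {i | x i / D.d i = x D.zero / D.d D.zero}
      ⟨D.zero, rfl⟩ hne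
    exact hj ((hadj i j hij).symm.trans (show x i / D.d i = x D.zero / D.d D.zero from hi))
  funext i
  have hi : i ∈ {i | x i / D.d i = x D.zero / D.d D.zero} := hS ▸ Set.mem_univ i
  have hi' : x i / D.d i = x D.zero / D.d D.zero := hi
  rw [D.d_zero, Nat.cast_one, div_one, div_eq_iff (hd i)] at hi'
  rw [hi', Pi.smul_apply, smul_eq_mul]
  rfl

theorem pair_eq_zero_of_form {x : I → ℚ} (hx : D.form x x = 0) (i : I) : D.pair x i = 0 := by
  rw [D.eq_smul_delta hx, pair_smul, pair_delta, mul_zero]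

/-- A vector without pairings with the coroots is a multiple of `δ`. -/
theorem eq_smul_delta_of_pair {x : I → ℚ} (hx : ∀ i, D.pair x i = 0) :
    x = (x D.zero) • D.delta :=
  D.eq_smul_delta (by simp [form, hx])

/-- The Cauchy–Schwarz inequality, with its case of equality. -/
theorem form_sq_le (x y : I → ℚ) : D.form x y ^ 2 ≤ D.form x x * D.form y y := by
  by_cases hy : D.form y y = 0
  · have : D.form x y = 0 := by
      rw [D.eq_smul_delta hy, form_smul_right, form_delta_right, mul_zero]
    rw [this, hy]; simp
  have hy' : 0 < D.form y y := lt_of_le_of_ne (D.form_nonneg y) (Ne.symm hy)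
  have h := D.form_nonneg (D.form y y • x - D.form x y • y)
  simp only [form_sub_left, form_sub_right, form_smul_left, form_smul_right, D.form_comm y x] at h
  have : 0 ≤ D.form y y * (D.form x x * D.form y y - D.form x y ^ 2) := by linarith
  have := nonneg_of_mul_nonneg_right this hy'
  linarith

theorem pair_eq_of_form_sq {x y : I → ℚ} (h : D.form x y ^ 2 = D.form x x * D.form y y) (i : I) :
    D.form y y * D.pair x i = D.form x y * D.pair y i := by
  have h2 : D.form (D.form y y • x - D.form x y • y) (D.form y y • x - D.form x y • y) = 0 := by
    simp only [form_sub_left, form_sub_right, form_smul_left, form_smul_right, D.form_comm y x]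
    linear_combination -D.form y y * h
  have := D.pair_eq_zero_of_form h2 i
  rw [pair_sub, pair_smul, pair_smul] at this
  linarith

variable [DecidableEq I]

/-- The simple root `α_i` in `⨁ ℚ α_j`. -/
def sr (i : I) : I → ℚ := Pi.single i 1

theorem pair_sr (i j : I) : D.pair (sr j) i = D.A i j := by
  simp [pair, sr, Pi.single_apply]

theorem form_sr_left (i : I) (x : I → ℚ) : D.form (sr i) x = D.len i * D.pair x i := by
  simp [form, sr, Pi.single_apply]

theorem form_sr_right (i : I) (x : I → ℚ) : D.form x (sr i) = D.len i * D.pair x i := by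
  rw [form_comm, form_sr_left]

theorem pair_sr_self (i : I) : D.pair (sr i) i = 2 := by
  rw [pair_sr, D.diag]; norm_num

/-- The simple reflection on `⨁ ℚ α_j`. -/
def srefl (i : I) (x : I → ℚ) : I → ℚ := x - D.pair x i • sr i

theorem pair_srefl (i j : I) (x : I → ℚ) :
    D.pair (D.srefl i x) j = D.pair x j - D.pair x i * D.A j i := by
  rw [srefl, pair_sub, pair_smul, pair_sr]

theorem form_srefl (i : I) (x y : I → ℚ) : D.form (D.srefl i x) (D.srefl i y) = D.form x y := by
  simp only [srefl, form_sub_left, form_sub_right, form_smul_left, form_smul_right, form_sr_left,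
    form_sr_right, pair_sub, pair_smul, pair_sr_self]
  ring

theorem srefl_srefl (i : I) (x : I → ℚ) : D.srefl i (D.srefl i x) = x := by
  rw [srefl, pair_srefl, D.diag, srefl]
  funext j
  simp only [Pi.sub_apply, Pi.smul_apply, smul_eq_mul]
  push_cast
  ring

theorem srefl_add (i : I) (x y : I → ℚ) : D.srefl i (x + y) = D.srefl i x + D.srefl i y := by
  rw [srefl, srefl, srefl, pair_add, add_smul]; abel

theorem srefl_smul (i : I) (t : ℚ) (x : I → ℚ) : D.srefl i (t • x) = t • D.srefl i x := by
  rw [srefl, srefl, pair_smul, smul_sub, smul_smul]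

theorem srefl_neg (i : I) (x : I → ℚ) : D.srefl i (-x) = -D.srefl i x := by
  rw [← neg_one_smul ℚ x, srefl_smul, neg_one_smul]

theorem srefl_sub (i : I) (x y : I → ℚ) : D.srefl i (x - y) = D.srefl i x - D.srefl i y := by
  rw [sub_eq_add_neg, srefl_add, srefl_neg, sub_eq_add_neg]

theorem srefl_delta (i : I) : D.srefl i D.delta = D.delta := by
  rw [srefl, pair_delta, zero_smul, sub_zero]

theorem srefl_sr (i : I) : D.srefl i (sr i) = -sr i := by
  rw [srefl, pair_sr_self, two_smul]; abel

theorem form_sr_self (i : I) : D.form (sr i) (sr i) = 2 * D.len i := by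
  rw [form_sr_left, pair_sr_self, mul_comm]

end AffineDatum

/-! ### Real roots -/

/-- The integers inside `ℚ`. -/
def intQ : Subring ℚ := (Int.castRingHom ℚ).range

theorem int_mem_intQ (n : ℤ) : (n : ℚ) ∈ intQ := ⟨n, rfl⟩

theorem nat_mem_intQ (n : ℕ) : (n : ℚ) ∈ intQ := ⟨n, by simp⟩

theorem exists_int_of_mem {x : ℚ} (h : x ∈ intQ) : ∃ n : ℤ, x = n := by
  obtain ⟨n, hn⟩ := h
  exact ⟨n, hn.symm⟩

theorem one_le_of_mem_intQ {x : ℚ} (h : x ∈ intQ) (hx : 0 < x) : 1 ≤ x := by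
  obtain ⟨n, rfl⟩ := exists_int_of_mem h
  have : (0 : ℤ) < n := by exact_mod_cast hx
  exact_mod_cast this

namespace AffineDatum

variable {I : Type u} [Fintype I] [DecidableEq I] (D : AffineDatum I)

/-- `D.RootOrbit J y x` means that `x` lies in the orbit of the vector `y` of the root lattice
under the group generated by the reflections `s_i`, `i ∈ J`. -/
inductive RootOrbit (J : Set I) (y : I → ℚ) : (I → ℚ) → Prop
  | refl : RootOrbit J y y
  | step {x : I → ℚ} (i : I) (hi : i ∈ J) (h : RootOrbit J y x) : RootOrbit J y (D.srefl i x)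

variable {D}

namespace RootOrbit

variable {J : Set I} {x y z : I → ℚ}

theorem mono {J' : Set I} (hJ : J ⊆ J') (h : D.RootOrbit J y x) : D.RootOrbit J' y x := by
  induction h with
  | refl => exact refl
  | step i hi _ ih => exact ih.step i (hJ hi)

theorem trans (h1 : D.RootOrbit J z y) (h2 : D.RootOrbit J y x) : D.RootOrbit J z x := by
  induction h2 with
  | refl => exact h1
  | step i hi _ ih => exact ih.step i hi

theorem symm (h : D.RootOrbit J y x) : D.RootOrbit J x y := by
  induction h with
  | refl => exact refl
  | @step x i hi _ ih =>
    have h1 : D.RootOrbit J (D.srefl i x) x := by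
      have := (refl (D := D) (J := J) (y := D.srefl i x)).step i hi
      rwa [srefl_srefl] at this
    exact h1.trans ih

theorem form_eq (h : D.RootOrbit J y x) : D.form x x = D.form y y := by
  induction h with
  | refl => rfl
  | step i _ _ ih => rw [form_srefl, ih]

theorem neg (h : D.RootOrbit J y x) : D.RootOrbit J (-y) (-x) := by
  induction h with
  | refl => exact refl
  | step i hi _ ih => rw [← srefl_neg]; exact ih.step i hi

theorem smul (t : ℚ) (h : D.RootOrbit J y x) : D.RootOrbit J (t • y) (t • x) := by
  induction h with
  | refl => exact refl
  | step i hi _ ih => rw [← srefl_smul]; exact ih.step i hi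

theorem add_delta (t : ℚ) (h : D.RootOrbit J y x) :
    D.RootOrbit J (y + t • D.delta) (x + t • D.delta) := by
  induction h with
  | refl => exact refl
  | @step x i hi _ ih =>
    have h2 : D.srefl i x + t • D.delta = D.srefl i (x + t • D.delta) := by
      rw [srefl_add, srefl_smul, srefl_delta]
    rw [h2]
    exact ih.step i hi

theorem neg_self {p : I} (hp : p ∈ J) (h : D.RootOrbit J (sr p) x) :
    D.RootOrbit J (sr p) (-x) := by
  have h1 := (refl (D := D) (J := J) (y := sr p)).step p hp
  rw [srefl_sr] at h1
  exact h1.trans h.neg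

/-- The coordinate at a vertex whose reflection is not used is constant. -/
theorem apply_eq {k : I} (hk : k ∉ J) (h : D.RootOrbit J y x) : x k = y k := by
  induction h with
  | refl => rfl
  | @step x i hi _ ih =>
    have hki : k ≠ i := fun hki => hk (hki ▸ hi)
    rw [← ih]
    simp [srefl, sr, hki]

theorem int (h : D.RootOrbit J y x) (hy : ∀ q, y q ∈ intQ) : ∀ q, x q ∈ intQ := by
  induction h with
  | refl => exact hy
  | @step x i _ _ ih =>
    intro q
    refine intQ.sub_mem (ih q) (intQ.mul_mem ?_ ?_)
    · exact intQ.sum_mem fun j _ => intQ.mul_mem (int_mem_intQ _) (ih j)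
    · by_cases hq : q = i
      · subst hq; simp [sr, intQ.one_mem]
      · simp [sr, hq]

theorem int_sr {p : I} (h : D.RootOrbit J (sr p) x) (q : I) : x q ∈ intQ :=
  h.int (fun q => by
    by_cases hq : q = p
    · subst hq; simp [sr, intQ.one_mem]
    · simp [sr, hq]) q

end RootOrbit

theorem pair_mem_intQ {x : I → ℚ} (h : ∀ q, x q ∈ intQ) (i : I) : D.pair x i ∈ intQ :=
  intQ.sum_mem fun j _ => intQ.mul_mem (int_mem_intQ _) (h j)

/-- If the coefficients `x_q (α_q, α_q)` are divisible by `n`, so are the numbers `2 (x, α_i)`. -/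
theorem len_pair_mem {x : I → ℚ} {n : ℚ} (h : ∀ q, x q * D.len q / n ∈ intQ) (i : I) :
    D.pair x i * D.len i / n ∈ intQ := by
  have : D.pair x i * D.len i / n = ∑ j, (D.A j i : ℚ) * (x j * D.len j / n) := by
    rw [pair, Finset.sum_mul, Finset.sum_div]
    refine Finset.sum_congr rfl fun j _ => ?_
    linear_combination x j / n * D.len_symm i j
  rw [this]
  exact intQ.sum_mem fun j _ => intQ.mul_mem (int_mem_intQ _) (h j)

/-- The coefficients of the coroot `x^∨` are integers. -/
theorem RootOrbit.len_mem {J : Set I} {x y : I → ℚ} {n : ℚ} (h : D.RootOrbit J y x)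
    (hy : ∀ q, y q * D.len q / n ∈ intQ) : ∀ q, x q * D.len q / n ∈ intQ := by
  induction h with
  | refl => exact hy
  | @step x i _ _ ih =>
    intro q
    have h1 : D.srefl i x q * D.len q / n = x q * D.len q / n - D.pair x i * sr i q * D.len q / n := by
      simp only [srefl, Pi.sub_apply, Pi.smul_apply, smul_eq_mul]
      ring
    rw [h1]
    refine intQ.sub_mem (ih q) ?_
    by_cases hq : q = i
    · subst hq
      simpa [sr] using D.len_pair_mem ih q
    · simp [sr, hq]

theorem RootOrbit.len_mem_sr {J : Set I} {x : I → ℚ} {p : I} (h : D.RootOrbit J (sr p) x) (q : I) :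
    x q * D.len q / D.len p ∈ intQ :=
  h.len_mem (fun q => by
    by_cases hq : q = p
    · subst hq
      simp [sr, div_self (D.len_pos q).ne', intQ.one_mem]
    · simp [sr, hq]) q

/-- The squared length of a lattice vector all of whose coefficients are those of a vector in a
lattice of multiples of `n` is divisible by `2 n`. -/
theorem form_div_mem {v : I → ℚ} {n : ℚ} (h1 : ∀ q, v q ∈ intQ)
    (h2 : ∀ q, v q * D.len q / n ∈ intQ) : D.form v v / (2 * n) ∈ intQ := by
  have key : ∀ s : Finset I, D.form (∑ q ∈ s, v q • sr q) (∑ q ∈ s, v q • sr q) / (2 * n) ∈ intQ := by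
    intro s
    induction s using Finset.induction_on with
    | empty => simp [form, pair_zero]
    | insert i s hi ih =>
      rw [Finset.sum_insert hi]
      set w := ∑ q ∈ s, v q • (sr q : I → ℚ) with hw
      have hwint : ∀ q, w q ∈ intQ := fun q => by
        rw [hw, Finset.sum_apply]
        refine intQ.sum_mem fun j _ => intQ.mul_mem (h1 j) ?_
        by_cases hq : q = j
        · subst hq; simp [sr, intQ.one_mem]
        · simp [sr, hq]
      have : D.form (v i • sr i + w) (v i • sr i + w) / (2 * n) =
          D.form w w / (2 * n) + (v i * D.len i / n) * D.pair w i + v i * (v i * D.len i / n) := by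
        simp only [form_add_left, form_add_right, form_smul_left, form_smul_right, form_sr_left,
          form_sr_right, pair_add, pair_smul, pair_sr_self]
        ring
      rw [this]
      exact intQ.add_mem (intQ.add_mem ih (intQ.mul_mem (h2 i) (pair_mem_intQ hwint i)))
        (intQ.mul_mem (h1 i) (h2 i))
  have hv : ∑ q, v q • (sr q : I → ℚ) = v := by
    funext j
    simp [Finset.sum_apply, sr, Pi.single_apply]
  have := key Finset.univ
  rwa [hv] at this

/-- A real root is a nonnegative or a nonpositive combination of simple roots: otherwise its
positive and its negative part would both be at least as long as the root. -/
theorem RootOrbit.sign {J : Set I} {x : I → ℚ} {p : I} (h : D.RootOrbit J (sr p) x) :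
    (∀ q, 0 ≤ x q) ∨ ∀ q, x q ≤ 0 := by
  by_contra hcon
  push Not at hcon
  obtain ⟨⟨i, hi⟩, j, hj⟩ := hcon
  set a : I → ℚ := fun q => max (x q) 0 with ha
  set b : I → ℚ := fun q => max (-x q) 0 with hb
  have hx : x = a - b := by
    funext q
    simp only [ha, hb, Pi.sub_apply]
    rcases le_total (x q) 0 with h | h
    · rw [max_eq_right h, max_eq_left (by linarith)]; ring
    · rw [max_eq_left h, max_eq_right (by linarith)]; ring
  have hmax : ∀ {t : ℚ}, t ∈ intQ → max t 0 ∈ intQ := fun {t} ht => by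
    rcases max_choice t 0 with h | h <;> rw [h]
    · exact ht
    · exact intQ.zero_mem
  have hmaxl : ∀ {t l : ℚ}, 0 ≤ l → t * l ∈ intQ → max t 0 * l ∈ intQ := fun {t l} hl ht => by
    rw [max_mul_of_nonneg _ _ hl, zero_mul]
    exact hmax ht
  have hp := D.len_pos p
  have hlq : ∀ q, 0 ≤ D.len q / D.len p := fun q => (div_pos (D.len_pos q) hp).le
  have ha2 := D.form_div_mem (v := a) (n := D.len p) (fun q => hmax (h.int_sr q)) fun q => by
    rw [mul_div_assoc]
    exact hmaxl (hlq q) (by rw [← mul_div_assoc]; exact h.len_mem_sr q)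
  have hb2 := D.form_div_mem (v := b) (n := D.len p) (fun q => hmax (intQ.neg_mem (h.int_sr q)))
    fun q => by
      rw [mul_div_assoc]
      refine hmaxl (hlq q) ?_
      rw [neg_mul, ← mul_div_assoc]
      exact intQ.neg_mem (h.len_mem_sr q)
  have hd : ∀ q, (0 : ℚ) < D.d q := fun q => by exact_mod_cast D.d_pos q
  have hab0 : ∀ q, a q * b q = 0 := fun q => by
    simp only [ha, hb]
    rcases le_total (x q) 0 with h | h
    · rw [max_eq_right h, zero_mul]
    · rw [max_eq_right (a := -x q) (by linarith), mul_zero]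
  have hapos : 0 < a j := by simp only [ha]; exact lt_max_of_lt_left hj
  have hbpos : 0 < b i := by simp only [hb]; exact lt_max_of_lt_left (by linarith)
  have pos : ∀ v : I → ℚ, (∃ q, v q = 0) → (∃ q, v q ≠ 0) → 0 < D.form v v := by
    rintro v ⟨q, hq⟩ ⟨q', hq'⟩
    refine lt_of_le_of_ne (D.form_nonneg v) fun h0 => hq' ?_
    have h1 := D.eq_smul_delta h0.symm
    have h2 := congrFun h1 q
    rw [hq, Pi.smul_apply, smul_eq_mul, delta] at h2
    have h3 : v D.zero = 0 := by
      rcases mul_eq_zero.1 h2.symm with h | h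
      · exact h
      · exact absurd h (hd q).ne'
    rw [h1, h3]; simp
  have e1 := one_le_of_mem_intQ ha2 (div_pos (pos a
    ⟨i, (mul_eq_zero.1 (hab0 i)).resolve_right hbpos.ne'⟩ ⟨j, hapos.ne'⟩) (by linarith))
  have e2 := one_le_of_mem_intQ hb2 (div_pos (pos b
    ⟨j, (mul_eq_zero.1 (hab0 j)).resolve_left hapos.ne'⟩ ⟨i, hbpos.ne'⟩) (by linarith))
  rw [le_div_iff₀ (by linarith)] at e1 e2
  have e3 : D.form a b ≤ 0 := by
    simp only [form, pair, Finset.mul_sum]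
    refine Finset.sum_nonpos fun q _ => Finset.sum_nonpos fun q' _ => ?_
    by_cases hqq : q = q'
    · subst hqq
      have : D.len q * a q * (D.A q q * b q) = D.len q * D.A q q * (a q * b q) := by ring
      rw [this, hab0, mul_zero]
    · have hA : (D.A q q' : ℚ) ≤ 0 := by exact_mod_cast D.off_diag q q' hqq
      have h0a : 0 ≤ a q := le_max_right _ _
      have h0b : 0 ≤ b q' := le_max_right _ _
      exact mul_nonpos_of_nonneg_of_nonpos (mul_nonneg (D.len_pos q).le h0a)
        (mul_nonpos_of_nonpos_of_nonneg hA h0b)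
  have e4 := h.form_eq
  rw [form_sr_self, hx, form_sub_left, form_sub_right, form_sub_right, D.form_comm b a] at e4
  linarith

/-- The reflection in a vector `β`. -/
def grefl (D : AffineDatum I) (β x : I → ℚ) : I → ℚ := x - (2 * D.form x β / D.form β β) • β

theorem grefl_sr (p : I) (x : I → ℚ) : D.grefl (sr p) x = D.srefl p x := by
  have := D.len_pos p
  rw [grefl, srefl, form_sr_right, form_sr_self]
  congr 2
  field_simp

/-- The reflection in a real root belongs to the Weyl group. -/
theorem RootOrbit.grefl {J : Set I} {p : I} (hp : p ∈ J) {β : I → ℚ} (hβ : D.RootOrbit J (sr p) β) :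
    ∀ {y x : I → ℚ}, D.RootOrbit J y x → D.RootOrbit J y (D.grefl β x) := by
  induction hβ with
  | refl => intro y x h; rw [grefl_sr]; exact h.step p hp
  | @step β i hi _ ih =>
    intro y x h
    have h1 := (ih (h.step i hi)).step i hi
    have h2 : D.form (D.srefl i x) β = D.form x (D.srefl i β) := by
      rw [← D.form_srefl i x, srefl_srefl]
    rw [AffineDatum.grefl, srefl_sub, srefl_srefl, srefl_smul, h2] at h1
    rw [AffineDatum.grefl, form_srefl]
    exact h1

/-- Every vertex pairs non-trivially with some vector of the orbit of a vector that is not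
orthogonal to all roots. -/
theorem RootOrbit.exists_pair_ne_zero {x : I → ℚ} (hx : ∃ i, D.pair x i ≠ 0) (j : I) :
    ∃ y, D.RootOrbit Set.univ x y ∧ D.pair y j ≠ 0 := by
  by_contra hcon
  push Not at hcon
  obtain ⟨i, hi⟩ := hx
  obtain ⟨a, ha, b, hb, hab⟩ := D.indecomposable
    {j | ∃ y, D.RootOrbit Set.univ x y ∧ D.pair y j ≠ 0} ⟨i, x, .refl, hi⟩ (fun h => by
      obtain ⟨y, hy, hy'⟩ := (Set.ext_iff.1 h j).2 (Set.mem_univ j)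
      exact hy' (hcon y hy))
  obtain ⟨y, hy, hya⟩ := ha
  have hb' : ∀ y, D.RootOrbit Set.univ x y → D.pair y b = 0 := fun y hy => by
    by_contra h
    exact hb ⟨y, hy, h⟩
  have h1 := hb' _ (hy.step a (Set.mem_univ a))
  rw [pair_srefl, hb' y hy, zero_sub, neg_eq_zero, mul_eq_zero] at h1
  rcases h1 with h1 | h1
  · exact hya h1
  · exact hab ((D.zero_iff b a).1 (by exact_mod_cast h1))

/-- Real roots are primitive: if `t v` is a real root and `v` is integral, then `1 / t` is an
integer. -/
theorem RootOrbit.eq_one_of_smul {J : Set I} {p : I} {v : I → ℚ} {t : ℚ} (hv : ∀ q, v q ∈ intQ)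
    (h : D.RootOrbit J (sr p) (t • v)) : t ≠ 0 ∧ t⁻¹ ∈ intQ := by
  have ht : t ≠ 0 := fun h0 => by
    have := h.form_eq
    rw [h0, zero_smul, form_sr_self] at this
    have h1 := D.len_pos p
    simp [form] at this
    linarith
  have h2 := (h.symm.smul t⁻¹)
  rw [smul_smul, inv_mul_cancel₀ ht, one_smul] at h2
  have := h2.int hv p
  simp [sr] at this
  exact ⟨ht, this⟩

end AffineDatum

/-! ### Real roots of untwisted affine types -/

namespace AffineDatum

variable {I : Type u} [Fintype I] [DecidableEq I] {D : AffineDatum I}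

theorem RootOrbit.weylOrbit {J : Set I} {p : I} {x : I → ℚ} (h : D.RootOrbit J (sr p) x) :
    ∃ β, WeylOrbit D.A J (clRoot D.A p) β ∧ ∀ i, (β i : ℚ) = D.pair x i := by
  induction h with
  | refl => exact ⟨_, .refl, fun i => by rw [pair_sr]; rfl⟩
  | @step x i hi _ ih =>
    obtain ⟨β, hβ, hβx⟩ := ih
    refine ⟨_, hβ.step i hi, fun j => ?_⟩
    rw [pair_srefl, ← hβx, ← hβx]
    simp [reflect, clRoot]

theorem exists_rootOrbit_of_weylOrbit {J : Set I} {p : I} {β : Pcl I}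
    (h : WeylOrbit D.A J (clRoot D.A p) β) :
    ∃ x, D.RootOrbit J (sr p) x ∧ ∀ i, (β i : ℚ) = D.pair x i := by
  induction h with
  | refl => exact ⟨_, .refl, fun i => by rw [pair_sr]; rfl⟩
  | @step β i hi _ ih =>
    obtain ⟨x, hx, hβx⟩ := ih
    refine ⟨_, hx.step i hi, fun j => ?_⟩
    rw [pair_srefl, ← hβx, ← hβx]
    simp [reflect, clRoot]

/-- The lift `δ - α_0` of the root `-α_0`. -/
def theta (D : AffineDatum I) : I → ℚ := D.delta - sr D.zero

theorem theta_zero : D.theta D.zero = 0 := by simp [theta, delta, sr, D.d_zero]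

theorem theta_of_ne {i : I} (hi : i ≠ D.zero) : D.theta i = D.d i := by
  simp [theta, delta, sr, hi]

theorem pair_theta (i : I) : D.pair D.theta i = -D.A i D.zero := by
  rw [theta, pair_sub, pair_delta, pair_sr, zero_sub]

theorem form_theta (x : I → ℚ) : D.form x D.theta = -(D.len D.zero * D.pair x D.zero) := by
  rw [theta, form_sub_right, form_delta_right, form_sr_right, zero_sub]

theorem form_theta_self : D.form D.theta D.theta = 2 * D.len D.zero := by
  rw [form_theta, pair_theta, D.diag]; push_cast; ring

theorem IsUntwisted.theta_mem (h : IsUntwisted D.A D.zero) :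
    ∃ j, j ≠ D.zero ∧ D.RootOrbit {D.zero}ᶜ (sr j) D.theta := by
  obtain ⟨⟨j, hj, hw⟩, -⟩ := h
  obtain ⟨x, hx, hxp⟩ := exists_rootOrbit_of_weylOrbit hw
  refine ⟨j, hj, ?_⟩
  have h0 : x D.zero = 0 := by
    rw [hx.apply_eq (by simp)]
    simp [sr, Ne.symm hj]
  have h1 := D.eq_smul_delta_of_pair (x := x + sr D.zero) fun i => by
    rw [pair_add, ← hxp, pair_sr]
    simp [clRoot]
  have h2 : x = D.theta := by
    rw [theta, eq_sub_iff_add_eq, h1]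
    simp [h0, sr]
  rwa [← h2]

/-- The orbits of `α_0` and of `θ = δ - α_0` make up a set of roots invariant under translation
by `δ`. -/
theorem orbit_zero_add_delta (hU : IsUntwisted D.A D.zero) {x : I → ℚ}
    (h : D.RootOrbit Set.univ (sr D.zero) x ∨ D.RootOrbit Set.univ D.theta x) :
    (D.RootOrbit Set.univ (sr D.zero) (x + D.delta) ∨ D.RootOrbit Set.univ D.theta (x + D.delta)) ∧
    (D.RootOrbit Set.univ (sr D.zero) (x - D.delta) ∨ D.RootOrbit Set.univ D.theta (x - D.delta)) := by
  obtain ⟨j, hj, hθ⟩ := IsUntwisted.theta_mem hU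
  replace hθ := hθ.mono (Set.subset_univ _)
  have hnθ : D.RootOrbit Set.univ D.theta (-D.theta) := hθ.symm.trans (hθ.neg_self (Set.mem_univ j))
  have hn0 : D.RootOrbit Set.univ (sr D.zero) (-sr D.zero) :=
    RootOrbit.refl.neg_self (Set.mem_univ _)
  have e1 : ∀ y : I → ℚ, y + (1 : ℚ) • D.delta = y + D.delta := fun y => by rw [one_smul]
  have e2 : ∀ y : I → ℚ, y + (-1 : ℚ) • D.delta = y - D.delta := fun y => by
    rw [neg_one_smul, sub_eq_add_neg]
  rcases h with h | h
  · constructor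
    · right
      have := (hn0.symm.trans h).add_delta 1
      rwa [e1, e1, show -sr D.zero + D.delta = D.theta by rw [theta]; abel] at this
    · right
      have := h.add_delta (-1)
      rw [e2, e2, show sr D.zero - D.delta = -D.theta by rw [theta]; abel] at this
      exact hnθ.trans this
  · constructor
    · left
      have := (hnθ.symm.trans h).add_delta 1
      rwa [e1, e1, show -D.theta + D.delta = sr D.zero by rw [theta]; abel] at this
    · left
      have := h.add_delta (-1)
      rw [e2, e2, show D.theta - D.delta = -sr D.zero by rw [theta]; abel] at this
      exact hn0.trans this

theorem orbit_zero_add_int (hU : IsUntwisted D.A D.zero) {x : I → ℚ}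
    (h : D.RootOrbit Set.univ (sr D.zero) x ∨ D.RootOrbit Set.univ D.theta x) (n : ℤ) :
    D.RootOrbit Set.univ (sr D.zero) (x + (n : ℚ) • D.delta) ∨
      D.RootOrbit Set.univ D.theta (x + (n : ℚ) • D.delta) := by
  induction n using Int.induction_on with
  | zero => simpa using h
  | succ k ih =>
    have := (orbit_zero_add_delta hU ih).1
    rwa [show x + ((k : ℤ) : ℚ) • D.delta + D.delta = x + (((k : ℤ) + 1 : ℤ) : ℚ) • D.delta by
      push_cast; module] at this
  | pred k ih =>
    have := (orbit_zero_add_delta hU ih).2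
    rwa [show x + ((-(k : ℤ) : ℤ) : ℚ) • D.delta - D.delta =
      x + ((-(k : ℤ) - 1 : ℤ) : ℚ) • D.delta by push_cast; module] at this

/-- `x` is a real root. -/
def IsRealRoot (D : AffineDatum I) (x : I → ℚ) : Prop := ∃ p, D.RootOrbit Set.univ (sr p) x

theorem IsRealRoot.neg {x : I → ℚ} (h : D.IsRealRoot x) : D.IsRealRoot (-x) := by
  obtain ⟨p, hp⟩ := h
  exact ⟨p, hp.neg_self (Set.mem_univ p)⟩

theorem IsRealRoot.sign {x : I → ℚ} (h : D.IsRealRoot x) : (∀ q, 0 ≤ x q) ∨ ∀ q, x q ≤ 0 := by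
  obtain ⟨p, hp⟩ := h
  exact hp.sign

theorem IsRealRoot.of_orbit_zero (hU : IsUntwisted D.A D.zero) {x : I → ℚ}
    (h : D.RootOrbit Set.univ (sr D.zero) x ∨ D.RootOrbit Set.univ D.theta x) : D.IsRealRoot x := by
  rcases h with h | h
  · exact ⟨_, h⟩
  · obtain ⟨j, -, hθ⟩ := IsUntwisted.theta_mem hU
    exact ⟨j, (hθ.mono (Set.subset_univ _)).trans h⟩

/-- In untwisted type, if no simple root is longer than `α_0`, the set of real roots is invariant
under translation by `δ`: the translations by `⟨h_0, x⟩ δ` are compositions of two reflections, and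
`⟨h_0, x⟩ = ±1` for some root of the orbit unless the orbit meets `±α_0 + ℤ δ`. -/
theorem IsRealRoot.add_delta (hU : IsUntwisted D.A D.zero)
    (hlen : ∀ p, D.len p ≤ D.len D.zero) {x : I → ℚ} (h : D.IsRealRoot x) :
    D.IsRealRoot (x + D.delta) ∧ D.IsRealRoot (x - D.delta) := by
  obtain ⟨p, hp⟩ := h
  have hx2 := hp.form_eq
  rw [form_sr_self] at hx2
  have hlp := D.len_pos p
  have hl0 := D.len_pos D.zero
  have hlp0 := hlen p
  have hex : ∃ i, D.pair x i ≠ 0 := by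
    by_contra hcon
    push Not at hcon
    have : D.form x x = 0 := by simp [form, hcon]
    linarith
  obtain ⟨y, hxy, hy0⟩ := RootOrbit.exists_pair_ne_zero hex D.zero
  have hy2 := hxy.form_eq
  have hyp := hp.trans hxy
  obtain ⟨n, hn⟩ := exists_int_of_mem (pair_mem_intQ (D := D) hyp.int_sr D.zero)
  have hCS := D.form_sq_le y (sr D.zero)
  rw [form_sr_right, form_sr_self, hy2, hx2, hn] at hCS
  have hn4 : (n : ℚ) ^ 2 ≤ 4 := by
    have : D.len D.zero * (D.len D.zero * (n : ℚ) ^ 2) ≤ D.len D.zero * (D.len D.zero * 4) := by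
      nlinarith
    have := le_of_mul_le_mul_left this hl0
    exact le_of_mul_le_mul_left this hl0
  have hn4' : n ^ 2 ≤ 4 := by exact_mod_cast hn4
  have hn0 : n ≠ 0 := fun h0 => hy0 (by rw [hn, h0]; simp)
  have hnle : n ≤ 2 := by nlinarith
  have hnge : -2 ≤ n := by nlinarith
  have hcases : (n = 2 ∨ n = -2) ∨ (n = 1 ∨ n = -1) := by omega
  rcases hcases with hn2 | hn1
  · -- equality holds in the Cauchy–Schwarz inequality
    have hz : D.form (y - ((n : ℚ) / 2) • sr D.zero) (y - ((n : ℚ) / 2) • sr D.zero) = 0 := by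
      apply le_antisymm _ (D.form_nonneg _)
      simp only [form_sub_left, form_sub_right, form_smul_left, form_smul_right, form_sr_left,
        form_sr_right, pair_sub, pair_smul, pair_sr_self, hy2, hx2, hn]
      have : (n : ℚ) ^ 2 = 4 := by
        rcases hn2 with h | h <;> rw [h] <;> norm_num
      nlinarith
    have hy := D.eq_smul_delta hz
    set t := (y - ((n : ℚ) / 2) • sr D.zero) D.zero with ht
    obtain ⟨m, hm⟩ : ∃ m : ℤ, t = m := by
      apply exists_int_of_mem
      rw [ht]
      refine intQ.sub_mem (hyp.int_sr _) ?_
      rcases hn2 with h | h <;> rw [h] <;> simp [sr, intQ.one_mem]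
    have hbase : D.RootOrbit Set.univ (sr D.zero) (((n : ℚ) / 2) • sr D.zero) := by
      rcases hn2 with h | h <;> rw [h]
      · norm_num
        exact .refl
      · norm_num
        exact RootOrbit.refl.neg_self (Set.mem_univ _)
    have hPy := orbit_zero_add_int hU (Or.inl hbase) m
    rw [← hm, ← hy, add_sub_cancel] at hPy
    have hPx : D.RootOrbit Set.univ (sr D.zero) x ∨ D.RootOrbit Set.univ D.theta x :=
      hPy.imp (fun h => h.trans hxy.symm) fun h => h.trans hxy.symm
    have := orbit_zero_add_delta hU hPx
    exact ⟨.of_orbit_zero hU this.1, .of_orbit_zero hU this.2⟩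
  · obtain ⟨j, -, hθ⟩ := IsUntwisted.theta_mem hU
    replace hθ := hθ.mono (Set.subset_univ _)
    have h1 : D.RootOrbit Set.univ y (D.grefl D.theta (D.srefl D.zero y)) :=
      hθ.grefl (Set.mem_univ j) (RootOrbit.refl.step _ (Set.mem_univ _))
    have h2 : D.grefl D.theta (D.srefl D.zero y) = y + (-(n : ℚ)) • D.delta := by
      rw [AffineDatum.grefl, form_theta, form_theta_self, pair_srefl, D.diag, hn, srefl, hn]
      have : 2 * -(D.len D.zero * ((n : ℚ) - n * ((2 : ℤ) : ℚ))) / (2 * D.len D.zero) = n := by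
        field_simp
        push_cast
        ring
      rw [this, theta]
      module
    rw [h2] at h1
    have h3 : D.RootOrbit Set.univ x (x + (-(n : ℚ)) • D.delta) :=
      (hxy.trans h1).trans (hxy.symm.add_delta _)
    have h4 : D.RootOrbit Set.univ x (x + (n : ℚ) • D.delta) := by
      have := (h3.add_delta (n : ℚ)).symm
      rwa [add_assoc, ← add_smul, neg_add_cancel, zero_smul, add_zero] at this
    rcases hn1 with h | h <;> rw [h] at h3 h4 <;> norm_num at h3 h4
    · exact ⟨⟨p, hp.trans h4⟩, ⟨p, by rw [sub_eq_add_neg]; exact hp.trans h3⟩⟩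
    · exact ⟨⟨p, hp.trans h3⟩, ⟨p, by rw [sub_eq_add_neg]; exact hp.trans h4⟩⟩

theorem IsRealRoot.add_int (hU : IsUntwisted D.A D.zero)
    (hlen : ∀ p, D.len p ≤ D.len D.zero) {x : I → ℚ} (h : D.IsRealRoot x) (n : ℤ) :
    D.IsRealRoot (x + (n : ℚ) • D.delta) := by
  induction n using Int.induction_on with
  | zero => simpa using h
  | succ k ih =>
    have := (ih.add_delta hU hlen).1
    rwa [show x + ((k : ℤ) : ℚ) • D.delta + D.delta = x + (((k : ℤ) + 1 : ℤ) : ℚ) • D.delta by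
      push_cast; module] at this
  | pred k ih =>
    have := (ih.add_delta hU hlen).2
    rwa [show x + ((-(k : ℤ) : ℤ) : ℚ) • D.delta - D.delta =
      x + ((-(k : ℤ) - 1 : ℤ) : ℚ) • D.delta by push_cast; module] at this

/-- If `d_r = 1`, the coefficients of a real root at `r` and at `0` differ by at most one:
after a translation the root `β` has coefficient `0` at the vertex `0`, and the coefficients of
the root `δ - β` have the same sign. -/
theorem IsRealRoot.sub_le_one (hU : IsUntwisted D.A D.zero)
    (hlen : ∀ p, D.len p ≤ D.len D.zero) {r : I} (hr : D.d r = 1) {x : I → ℚ}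
    (h : D.IsRealRoot x) : x r - x D.zero ≤ 1 := by
  by_contra hcon
  push Not at hcon
  obtain ⟨p, hp⟩ := h
  obtain ⟨n, hn⟩ := exists_int_of_mem (hp.int_sr D.zero)
  have h1 := (IsRealRoot.add_int hU hlen (IsRealRoot.neg ⟨p, hp⟩) (n + 1))
  rcases h1.sign with h | h
  · have := h r
    simp [delta, hr] at this
    rw [hn] at hcon
    linarith
  · have := h D.zero
    simp [delta, D.d_zero, hn] at this
    linarith

end AffineDatum

namespace AffineDatum

variable {I : Type u} [Fintype I] [DecidableEq I] {D : AffineDatum I}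

/-- Finiteness of the set of lattice vectors of bounded length modulo `δ`. -/
theorem finite_bounded (D : AffineDatum I) (C : ℚ) :
    {x : I → ℚ | x D.zero = 0 ∧ D.form x x ≤ C ∧ ∀ i, D.pair x i ∈ intQ}.Finite := by
  classical
  set S := {x : I → ℚ | x D.zero = 0 ∧ D.form x x ≤ C ∧ ∀ i, D.pair x i ∈ intQ}
  have hinj : Set.InjOn (fun x i => D.pair x i) S := by
    intro x hx y hy hxy
    have := D.eq_smul_delta_of_pair (x := x - y) fun i => by
      rw [pair_sub, sub_eq_zero]; exact congrFun hxy i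
    rw [← sub_eq_zero, this]
    simp [hx.1, hy.1]
  refine Set.Finite.of_finite_image ?_ hinj
  have hbound : ∀ i, ∃ B : ℤ, ∀ x ∈ S, ∀ n : ℤ, D.pair x i = n → -B ≤ n ∧ n ≤ B := fun i => by
    obtain ⟨B, hB⟩ := exists_nat_gt (2 * C / D.len i)
    refine ⟨B + 1, fun x hx n hn => ?_⟩
    have hl := D.len_pos i
    have hCS := D.form_sq_le x (sr i)
    rw [form_sr_right, form_sr_self, hn] at hCS
    have h1 : (n : ℚ) ^ 2 ≤ B := by
      rw [div_lt_iff₀ hl] at hB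
      have h2 : D.len i * (D.len i * (n : ℚ) ^ 2) ≤ D.len i * (2 * C) := by
        have := mul_le_mul_of_nonneg_right hx.2.1 (by linarith : (0 : ℚ) ≤ 2 * D.len i)
        nlinarith
      have h3 := le_of_mul_le_mul_left h2 hl
      have h4 : D.len i * (n : ℚ) ^ 2 ≤ D.len i * B := by linarith
      exact le_of_mul_le_mul_left h4 hl
    have h5 : n ^ 2 ≤ B := by exact_mod_cast h1
    constructor <;> nlinarith
  choose B hB using hbound
  have hfin : (Set.Icc (fun i => -B i) B : Set (I → ℤ)).Finite := Set.finite_Icc _ _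
  refine (hfin.image fun n i => ((n i : ℤ) : ℚ)).subset ?_
  rintro _ ⟨x, hx, rfl⟩
  choose n hn using fun i => exists_int_of_mem (hx.2.2 i)
  exact ⟨n, ⟨fun i => (hB i x hx _ (hn i)).1, fun i => (hB i x hx _ (hn i)).2⟩,
    funext fun i => (hn i).symm⟩

/-- The orbit of a simple root of `𝔤₀` contains a dominant element. -/
theorem exists_dominant {p : I} (hp : p ≠ D.zero) :
    ∃ β, D.RootOrbit {D.zero}ᶜ (sr p) β ∧ ∀ i, i ≠ D.zero → 0 ≤ D.pair β i := by
  have hfin : {x | D.RootOrbit {D.zero}ᶜ (sr p) x}.Finite := by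
    refine (D.finite_bounded (2 * D.len p)).subset fun x hx => ⟨?_, ?_, ?_⟩
    · rw [RootOrbit.apply_eq (by simp) hx]
      simp [sr, Ne.symm hp]
    · rw [RootOrbit.form_eq hx, form_sr_self]
    · exact pair_mem_intQ (RootOrbit.int_sr hx)
  obtain ⟨β, hβ, hmax⟩ := Set.exists_max_image _ (fun x : I → ℚ => ∑ q, x q) hfin ⟨sr p, .refl⟩
  refine ⟨β, hβ, fun i hi => ?_⟩
  have := hmax _ (RootOrbit.step i (by simpa using hi) hβ)
  simp only [srefl, Pi.sub_apply, Pi.smul_apply, smul_eq_mul, Finset.sum_sub_distrib,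
    ← Finset.mul_sum, sr, Finset.sum_pi_single', Finset.mem_univ, if_true] at this
  linarith

/-- A step in the proof that `θ` is a long root: if `θ + γ` is a root with `γ` positive and
orthogonal to `θ`, then `γ` can be reflected down to a simple root. -/
theorem theta_add_descent (hU : IsUntwisted D.A D.zero) {p : I} (hp : p ≠ D.zero) (n : ℕ) :
    ∀ γ : I → ℚ, D.IsRealRoot γ → (∀ q, 0 ≤ γ q) → γ D.zero = 0 → D.form D.theta γ = 0 →
      D.RootOrbit {D.zero}ᶜ (sr p) (D.theta + γ) → ∑ q, γ q ≤ n → False := by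
  induction n with
  | zero =>
    intro γ hγ hpos _ _ _ hsum
    have h0 : ∀ q ∈ Finset.univ, γ q = 0 := by
      refine (Finset.sum_eq_zero_iff_of_nonneg fun q _ => hpos q).1 (le_antisymm (by simpa using hsum)
        (Finset.sum_nonneg fun q _ => hpos q))
    obtain ⟨j, hj⟩ := hγ
    have := hj.form_eq
    rw [form_sr_self, show γ = 0 from funext fun q => h0 q (Finset.mem_univ q)] at this
    have hl := D.len_pos j
    simp [form] at this
    linarith
  | succ n ih =>
    intro γ hγ hpos hγ0 hθγ hroot hsum
    obtain ⟨j, hj⟩ := hγ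
    have hnorm := hj.form_eq
    rw [form_sr_self] at hnorm
    have hlj := D.len_pos j
    obtain ⟨i, hi⟩ : ∃ i, 0 < D.len i * γ i * D.pair γ i := by
      by_contra hcon
      push Not at hcon
      have : D.form γ γ ≤ 0 := Finset.sum_nonpos fun i _ => hcon i
      linarith
    have hli := D.len_pos i
    have hγi : 0 < γ i := by
      rcases (hpos i).lt_or_eq with h | h
      · exact h
      · rw [← h] at hi; simp at hi
    have hpi : 0 < D.pair γ i := by
      by_contra h
      have := mul_nonpos_of_nonneg_of_nonpos (mul_pos hli hγi).le (not_lt.1 h)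
      linarith
    have hi0 : i ≠ D.zero := fun h => by rw [h, hγ0] at hγi; exact lt_irrefl _ hγi
    have hθi : D.pair D.theta i = 0 := by
      have hterm : ∀ q ∈ Finset.univ, 0 ≤ D.len q * γ q * D.pair D.theta q := fun q _ => by
        by_cases hq : q = D.zero
        · rw [hq, hγ0]; simp
        · refine mul_nonneg (mul_nonneg (D.len_pos q).le (hpos q)) ?_
          rw [pair_theta]
          have : (D.A q D.zero : ℚ) ≤ 0 := by exact_mod_cast D.off_diag q _ hq
          linarith
      rw [form_comm] at hθγ
      have := (Finset.sum_eq_zero_iff_of_nonneg hterm).1 hθγ i (Finset.mem_univ i)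
      exact (mul_eq_zero.1 this).resolve_left (mul_pos hli hγi).ne'
    have hrefl : D.srefl i D.theta = D.theta := by rw [srefl, hθi, zero_smul, sub_zero]
    have hroot' : D.RootOrbit {D.zero}ᶜ (sr p) (D.theta + D.srefl i γ) := by
      have := hroot.step i (by simpa using hi0)
      rwa [srefl_add, hrefl] at this
    have hne : ∀ q, q ≠ i → D.srefl i γ q = γ q := fun q hq => by simp [srefl, sr, hq]
    have hj' := hj.step i (Set.mem_univ i)
    rcases hj'.sign with h | h
    · refine ih (D.srefl i γ) ⟨j, hj'⟩ h ?_ ?_ hroot' ?_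
      · rw [hne _ (Ne.symm hi0), hγ0]
      · rw [← hrefl, form_srefl, hθγ]
      · have h1 : ∑ q, D.srefl i γ q = ∑ q, γ q - D.pair γ i := by
          simp only [srefl, Pi.sub_apply, Pi.smul_apply, smul_eq_mul, Finset.sum_sub_distrib,
            ← Finset.mul_sum, sr, Finset.sum_pi_single', Finset.mem_univ, if_true, mul_one]
        have h2 := one_le_of_mem_intQ (pair_mem_intQ (D := D) hj.int_sr i) hpi
        rw [h1]
        push_cast at hsum
        linarith
    · have hγe : γ = γ i • sr i := by
        funext q
        by_cases hq : q = i
        · subst hq; simp [sr]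
        · have h1 := h q
          rw [hne q hq] at h1
          simp [sr, hq, le_antisymm h1 (hpos q)]
      have hint : γ i ∈ intQ := hj.int_sr i
      rw [hγe] at hj
      obtain ⟨-, hinv⟩ := RootOrbit.eq_one_of_smul (v := sr i)
        (fun q => RootOrbit.int_sr (D := D) (J := Set.univ) (p := i) .refl q) hj
      have h1 := one_le_of_mem_intQ hint hγi
      have h2 := one_le_of_mem_intQ hinv (inv_pos.2 hγi)
      have h3 : γ i = 1 := le_antisymm (by rwa [one_le_inv₀ hγi] at h2) h1
      rw [h3, one_smul] at hγe
      rw [hγe] at hroot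
      obtain ⟨β, hβ, hβp⟩ := hroot.weylOrbit
      refine hU.2 i hi0 ⟨p, hp, ?_⟩
      convert hβ using 1
      funext k
      have := hβp k
      rw [pair_add, pair_theta, pair_sr] at this
      simp only [Pi.add_apply, Pi.neg_apply, clRoot]
      exact_mod_cast this.symm

/-- In untwisted type, and in the presence of a vertex `r` equivalent to `0`, the root `α_0` is
long: otherwise some `θ + α_i` would be a root of `𝔤₀`. -/
theorem len_le_of_untwisted (hU : IsUntwisted D.A D.zero) {r : I} (hr0 : r ≠ D.zero)
    (hdr : D.d r = 1) (hlr : D.len r = D.len D.zero) (p : I) : D.len p ≤ D.len D.zero := by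
  by_contra hcon
  push Not at hcon
  have hp : p ≠ D.zero := fun h => by rw [h] at hcon; exact lt_irrefl _ hcon
  have hl0 := D.len_pos D.zero
  have hlp := D.len_pos p
  obtain ⟨β, hβ, hdom⟩ := exists_dominant (D := D) hp
  obtain ⟨j, hj0, hθ⟩ := IsUntwisted.theta_mem hU
  have hβ0 : β D.zero = 0 := by
    rw [hβ.apply_eq (by simp)]; simp [sr, Ne.symm hp]
  have hββ : D.form β β = 2 * D.len p := by rw [hβ.form_eq, form_sr_self]
  have hθj : D.len j = D.len D.zero := by
    have := hθ.form_eq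
    rw [form_theta_self, form_sr_self] at this
    linarith
  have hd : ∀ q, (0 : ℚ) < D.d q := fun q => by exact_mod_cast D.d_pos q
  -- `(β, θ) > 0`
  have hpos : 0 < D.form D.theta β := by
    have hterm : ∀ q ∈ Finset.univ, 0 ≤ D.len q * D.theta q * D.pair β q := fun q _ => by
      by_cases hq : q = D.zero
      · rw [hq, theta_zero]; simp
      · rw [theta_of_ne hq]
        exact mul_nonneg (mul_nonneg (D.len_pos q).le (hd q).le) (hdom q hq)
    refine lt_of_le_of_ne (Finset.sum_nonneg hterm) fun h0 => ?_
    have h1 := (Finset.sum_eq_zero_iff_of_nonneg hterm).1 h0.symm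
    have h2 : D.form β β = 0 := Finset.sum_eq_zero fun q _ => by
      by_cases hq : q = D.zero
      · rw [hq, hβ0]; simp
      · have := h1 q (Finset.mem_univ q)
        rw [theta_of_ne hq] at this
        rw [(mul_eq_zero.1 this).resolve_left (mul_pos (D.len_pos q) (hd q)).ne', mul_zero]
    linarith
  set w := D.form D.theta β with hw
  have ha : w / D.len p ∈ intQ := by
    have : w / D.len p = ∑ q, D.theta q * (D.pair β q * D.len q / D.len p) := by
      rw [hw, form, Finset.sum_div]
      exact Finset.sum_congr rfl fun q _ => by ring
    rw [this]
    exact intQ.sum_mem fun q _ => intQ.mul_mem (hθ.int_sr q) (len_pair_mem hβ.len_mem_sr q)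
  have hb : w / D.len D.zero ∈ intQ := by
    have : w / D.len D.zero = ∑ q, β q * (D.pair D.theta q * D.len q / D.len j) := by
      rw [hw, form_comm, form, Finset.sum_div, hθj]
      exact Finset.sum_congr rfl fun q _ => by ring
    rw [this]
    exact intQ.sum_mem fun q _ => intQ.mul_mem (hβ.int_sr q) (len_pair_mem hθ.len_mem_sr q)
  obtain ⟨a, ha⟩ := exists_int_of_mem ha
  obtain ⟨b, hb⟩ := exists_int_of_mem hb
  rw [div_eq_iff hlp.ne'] at ha
  rw [div_eq_iff hl0.ne'] at hb
  have hCS := D.form_sq_le D.theta β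
  rw [← hw, form_theta_self, hββ] at hCS
  have hab : a * b ≤ 4 := by
    have h1 : (a * b : ℚ) * (D.len p * D.len D.zero) ≤ 4 * (D.len p * D.len D.zero) := by
      have : w ^ 2 = (a * b : ℚ) * (D.len p * D.len D.zero) := by
        rw [sq]; nth_rewrite 1 [ha]; rw [hb]; ring
      rw [← this]; linarith
    exact_mod_cast le_of_mul_le_mul_right h1 (mul_pos hlp hl0)
  have ha0 : 0 < a := by
    have : (0 : ℚ) < a := by
      by_contra h
      have := mul_nonpos_of_nonpos_of_nonneg (not_lt.1 h) hlp.le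
      linarith
    exact_mod_cast this
  have hba : a < b := by
    have h1 : (a : ℚ) < b := by
      by_contra h
      have h2 := mul_le_mul_of_nonneg_right (not_lt.1 h) hl0.le
      have h3 : (0 : ℚ) < a := by exact_mod_cast ha0
      have h4 := mul_lt_mul_of_pos_left hcon h3
      linarith
    exact_mod_cast h1
  have ha1 : a = 1 := by nlinarith
  have hb4 : b ≤ 4 := by rw [ha1] at hab; linarith
  have hwp : w = D.len p := by rw [ha, ha1]; simp
  have hrefl : D.grefl β D.theta = D.theta - β := by
    rw [AffineDatum.grefl, ← hw, hββ, hwp, div_self (by linarith), one_smul]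
  have hγ : D.IsRealRoot (β - D.theta) := by
    have h1 := (hβ.grefl (by simpa using hp) hθ).mono (Set.subset_univ _)
    rw [hrefl] at h1
    have := IsRealRoot.neg ⟨j, h1⟩
    rwa [neg_sub] at this
  have hsub0 : (β - D.theta) D.zero = 0 := by rw [Pi.sub_apply, hβ0, theta_zero, sub_zero]
  have hγpos : ∀ q, 0 ≤ (β - D.theta) q := by
    rcases hγ.sign with h | h
    · exact h
    · exfalso
      have h1 : D.form (β - D.theta) β ≤ 0 := Finset.sum_nonpos fun q _ => by
        by_cases hq : q = D.zero
        · rw [hq, hsub0]; simp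
        · exact mul_nonpos_of_nonpos_of_nonneg
            (mul_nonpos_of_nonneg_of_nonpos (D.len_pos q).le (h q)) (hdom q hq)
      rw [form_sub_left, ← hw, hββ, hwp] at h1
      linarith
  have hb234 : b = 2 ∨ b = 3 ∨ b = 4 := by omega
  rcases hb234 with hb' | hb' | hb'
  · refine theta_add_descent hU hp ⌈∑ q, (β - D.theta) q⌉₊ (β - D.theta) hγ hγpos hsub0 ?_ ?_
      (Nat.le_ceil _)
    · rw [form_sub_right, ← hw, form_theta_self, hb, hb']; push_cast; ring
    · rwa [add_sub_cancel]
  · -- `|β|² = 3 |θ|²`: then `γ - θ` is a positive root with `(γ - θ, θ) < 0`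
    have hθu := hθ.mono (Set.subset_univ _)
    have h3 : D.len p = 3 * D.len D.zero := by rw [← hwp, hb, hb']; push_cast; ring
    have hγθ : D.form (β - D.theta) D.theta = D.len D.zero := by
      rw [form_sub_left, D.form_comm β, ← hw, form_theta_self, hwp, h3]; ring
    obtain ⟨p', hγ'⟩ := hγ
    have h4 := hθu.grefl (Set.mem_univ j) hγ'
    rw [AffineDatum.grefl, hγθ, form_theta_self, div_self (by linarith), one_smul] at h4
    have hβr : (3 : ℚ) ≤ β r := by
      have h5 := hβ.len_mem_sr r
      rw [hlr, h3] at h5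
      have h6 : β r * D.len D.zero / (3 * D.len D.zero) = β r / 3 := by field_simp
      rw [h6] at h5
      have h7 := hγpos r
      rw [Pi.sub_apply, theta_of_ne hr0, hdr] at h7
      push_cast at h7
      have := one_le_of_mem_intQ h5 (by linarith)
      linarith
    have h8 : ∀ q, 0 ≤ (β - D.theta - D.theta) q := by
      rcases h4.sign with h | h
      · exact h
      · exfalso
        have := h r
        simp only [Pi.sub_apply, theta_of_ne hr0, hdr] at this
        push_cast at this
        linarith
    have h9 : 0 ≤ D.form (β - D.theta - D.theta) D.theta := Finset.sum_nonneg fun q _ => by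
      by_cases hq : q = D.zero
      · rw [hq, Pi.sub_apply, hsub0, theta_zero]; simp
      · refine mul_nonneg (mul_nonneg (D.len_pos q).le (h8 q)) ?_
        rw [pair_theta]
        have : (D.A q D.zero : ℚ) ≤ 0 := by exact_mod_cast D.off_diag q _ hq
        linarith
    rw [form_sub_left, hγθ, form_theta_self] at h9
    linarith
  · -- `β = 2 θ`, which is impossible because real roots are primitive
    have h4 : D.len p = 4 * D.len D.zero := by rw [← hwp, hb, hb']; push_cast; ring
    have heq : w ^ 2 = D.form D.theta D.theta * D.form β β := by
      rw [form_theta_self, hββ, hwp, h4]; ring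
    have h5 : β = (2 : ℚ) • D.theta := by
      have := D.eq_smul_delta_of_pair (x := β - (2 : ℚ) • D.theta) fun i => by
        have h6 := D.pair_eq_of_form_sq heq i
        rw [hββ, ← hw, hwp] at h6
        rw [pair_sub, pair_smul]
        apply mul_left_cancel₀ hlp.ne'
        linarith
      rw [← sub_eq_zero, this]
      simp [hβ0, theta_zero]
    rw [h5] at hβ
    obtain ⟨-, h6⟩ := RootOrbit.eq_one_of_smul hθ.int_sr hβ
    have := one_le_of_mem_intQ h6 (by norm_num)
    norm_num at this

end AffineDatum

/-! ### Systems of weights with root strings -/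

section Strings

variable {I : Type u} [Fintype I] [DecidableEq I]

theorem reflect_apply (A : Matrix I I ℤ) (i j : I) (μ : Pcl I) :
    reflect A i μ j = μ j - μ i * A j i := by
  simp [reflect, clRoot]

theorem WeylOrbit.trans {A : Matrix I I ℤ} {J : Set I} {μ ν κ : Pcl I} (h1 : WeylOrbit A J μ ν)
    (h2 : WeylOrbit A J ν κ) : WeylOrbit A J μ κ := by
  induction h2 with
  | refl => exact h1
  | step i hi _ ih => exact ih.step i hi

namespace AffineDatum

variable (D : AffineDatum I)

theorem clRoot_self (i : I) : clRoot D.A i i = 2 := D.diag i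

theorem reflect_reflect (i : I) (μ : Pcl I) : reflect D.A i (reflect D.A i μ) = μ := by
  funext j
  rw [reflect_apply, reflect_apply, reflect_apply, D.diag]
  ring

theorem reflect_add (i : I) (μ ν : Pcl I) :
    reflect D.A i (μ + ν) = reflect D.A i μ + reflect D.A i ν := by
  funext j
  simp only [reflect_apply, Pi.add_apply]; ring

theorem reflect_neg (i : I) (μ : Pcl I) : reflect D.A i (-μ) = -reflect D.A i μ := by
  funext j
  simp only [reflect_apply, Pi.neg_apply]; ring

theorem reflect_clRoot (i : I) : reflect D.A i (clRoot D.A i) = -clRoot D.A i := by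
  funext j
  simp only [reflect_apply, Pi.neg_apply, clRoot, D.diag]; ring

/-- The class of `∑ n_j α_j`. -/
def rootComb (n : I → ℤ) : Pcl I := ∑ j, n j • clRoot D.A j

theorem rootComb_apply (n : I → ℤ) (i : I) : D.rootComb n i = ∑ j, D.A i j * n j := by
  simp [rootComb, clRoot, mul_comm]

theorem rootComb_cast (n : I → ℤ) (i : I) :
    (D.rootComb n i : ℚ) = D.pair (fun j => (n j : ℚ)) i := by
  rw [rootComb_apply, pair]; push_cast; rfl

/-- The number of steps `μ + α_i`, `μ + 2 α_i`, … inside `R`. -/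
def strUp (R : Finset (Pcl I)) (i : I) (μ : Pcl I) : ℕ := sSup {k : ℕ | μ + (k : ℤ) • clRoot D.A i ∈ R}

/-- The number of steps `μ - α_i`, `μ - 2 α_i`, … inside `R`. -/
def strDown (R : Finset (Pcl I)) (i : I) (μ : Pcl I) : ℕ :=
  sSup {k : ℕ | μ - (k : ℤ) • clRoot D.A i ∈ R}

theorem sSup_of_iff_le {S : Set ℕ} {n : ℕ} (h : ∀ k, k ∈ S ↔ k ≤ n) : sSup S = n := by
  rw [show S = Set.Iic n from Set.ext h, csSup_Iic]

/-- A finite set `R` of nonzero level-zero weights that looks like the set of nonzero weights of a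
module with one-dimensional spaces of nonzero weight, in which the string through `±α_i` passes
through the weight `0`. The set contains the Weyl group orbit of `ϖ`, whose weights are extremal.
The vertices in `short` are those whose simple root is shorter than `ϖ`. -/
structure StringSystem (D : AffineDatum I) (ϖ : Pcl I) where
  R : Finset (Pcl I)
  zero_notMem : 0 ∉ R
  string : ∀ μ ∈ R, ∀ i, μ ≠ clRoot D.A i → μ ≠ -clRoot D.A i → ∃ p q : ℕ, (p : ℤ) - q = μ i ∧
    ∀ k : ℤ, μ + k • clRoot D.A i ∈ R ↔ -(p : ℤ) ≤ k ∧ k ≤ q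
  string_root : ∀ i, clRoot D.A i ∈ R → ∀ k : ℤ, k • clRoot D.A i ∈ R ↔ k = 1 ∨ k = -1
  neg_root : ∀ i, -clRoot D.A i ∈ R → clRoot D.A i ∈ R
  sub_notMem : ∀ i j, i ≠ j → clRoot D.A j - clRoot D.A i ∉ R
  root_add_ne : ∀ i j, i ≠ j → clRoot D.A i ∈ R → clRoot D.A i + clRoot D.A j ≠ 0
  adj : ∀ i j, i ≠ j → clRoot D.A i ∈ R → clRoot D.A j ∈ R → D.A i j ≠ 0 → D.A i j = -1 ∨ D.A j i = -1
  square : ∀ μ ∈ R, ∀ i j, i ≠ j → μ ≠ clRoot D.A j → μ ≠ -clRoot D.A i →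
    μ + clRoot D.A i - clRoot D.A j ∈ R →
    (μ + clRoot D.A i ∈ R ↔ μ - clRoot D.A j ∈ R) ∧ (μ + clRoot D.A i ∈ R →
      D.qInt j (D.strUp R j μ + 1) * D.qInt i (D.strDown R i (μ - clRoot D.A j) + 1) =
      D.qInt i (D.strDown R i μ + 1) * D.qInt j (D.strUp R j (μ + clRoot D.A i) + 1))
  conn : ∀ P : Pcl I → Prop, P ϖ → (∀ μ ∈ R, ∀ i, P μ → μ + clRoot D.A i ∈ R → P (μ + clRoot D.A i)) →
    (∀ μ ∈ R, ∀ i, P μ → μ - clRoot D.A i ∈ R → P (μ - clRoot D.A i)) →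
    (∀ i, clRoot D.A i ∈ R → P (clRoot D.A i) → P (-clRoot D.A i)) →
    (∀ i, clRoot D.A i ∈ R → P (-clRoot D.A i) → P (clRoot D.A i)) → ∀ μ ∈ R, P μ
  orbit_mem : ∀ μ, WeylOrbit D.A Set.univ ϖ μ → μ ∈ R
  extremal_up : ∀ μ, WeylOrbit D.A Set.univ ϖ μ → ∀ j, 0 ≤ μ j → μ + clRoot D.A j ∉ R
  extremal_down : ∀ μ, WeylOrbit D.A Set.univ ϖ μ → ∀ j, μ j ≤ 0 → μ - clRoot D.A j ∉ R
  short : Set I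
  weight_long : ∀ l, l ∉ short → ∀ μ, WeylOrbit D.A Set.univ ϖ μ →
    (-1 ≤ μ l ∧ μ l ≤ 1) ∨ μ = clRoot D.A l ∨ μ = -clRoot D.A l
  long_sum : ∀ k l, k ∉ short → l ∉ short → WeylOrbit D.A Set.univ ϖ (clRoot D.A k) →
    WeylOrbit D.A Set.univ ϖ (-clRoot D.A l) → ∀ n : I → ℤ, (∀ j, j ∉ short → n j = 0) →
    clRoot D.A k + D.rootComb n ≠ -clRoot D.A l
  dominant_short : ∀ n : I → ℕ, (∀ j, j ∉ short → n j = 0) →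
    WeylOrbit D.A Set.univ ϖ (ϖ + D.rootComb fun j => (n j : ℤ)) → ∀ j, n j = 0
  ne_rootComb : ∀ n : I → ℤ, (∀ j, j ∉ short → n j = 0) → ϖ ≠ D.rootComb n

/-- The strings in a set of weights `μ` with all `⟨h_i, μ⟩ ∈ {0, ±1}`. -/
theorem minuscule_string {R : Finset (Pcl I)} (hR : ∀ μ ∈ R, ∀ i, reflect D.A i μ ∈ R)
    (hb : ∀ μ ∈ R, ∀ i, -1 ≤ μ i ∧ μ i ≤ 1) {μ : Pcl I} (hμ : μ ∈ R) (i : I) (k : ℤ) :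
    μ + k • clRoot D.A i ∈ R ↔ k = 0 ∨ k = -μ i := by
  constructor
  · intro h
    have h1 := hb _ h i
    have h2 := hb _ hμ i
    simp only [Pi.add_apply, Pi.smul_apply, D.clRoot_self, smul_eq_mul] at h1
    omega
  · rintro (rfl | rfl)
    · simpa using hμ
    · rw [neg_smul, ← sub_eq_add_neg]; exact hR _ hμ i

/-- A finite Weyl orbit with all `⟨h_i, μ⟩ ∈ {0, ±1}` is a string system. -/
def minusculeSystem (ϖ : Pcl I) (h0 : ϖ ≠ 0)
    (hb : ∀ μ, WeylOrbit D.A Set.univ ϖ μ → ∀ i, -1 ≤ μ i ∧ μ i ≤ 1) : D.StringSystem ϖ := by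
  classical
  have hfin : {μ | WeylOrbit D.A Set.univ ϖ μ}.Finite :=
    (Set.finite_Icc (fun _ => -1 : Pcl I) (fun _ => 1)).subset
      fun μ hμ => ⟨fun i => (hb μ hμ i).1, fun i => (hb μ hμ i).2⟩
  have hmem : ∀ {μ}, μ ∈ hfin.toFinset ↔ WeylOrbit D.A Set.univ ϖ μ := fun {μ} => by simp
  have hR : ∀ μ ∈ hfin.toFinset, ∀ i, reflect D.A i μ ∈ hfin.toFinset := fun μ hμ i =>
    hmem.2 ((hmem.1 hμ).step i (Set.mem_univ i))
  have hb' : ∀ μ ∈ hfin.toFinset, ∀ i, -1 ≤ μ i ∧ μ i ≤ 1 := fun μ hμ => hb μ (hmem.1 hμ)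
  have hstr := fun {μ} (hμ : μ ∈ hfin.toFinset) i k => D.minuscule_string hR hb' hμ i k
  have hroot : ∀ i, clRoot D.A i ∉ hfin.toFinset := fun i hi => by
    have := hb' _ hi i
    rw [clRoot_self] at this
    omega
  have hnroot : ∀ i, -clRoot D.A i ∉ hfin.toFinset := fun i hi => by
    have := hb' _ hi i
    rw [Pi.neg_apply, clRoot_self] at this
    omega
  have hup : ∀ {μ}, μ ∈ hfin.toFinset → ∀ i, μ + clRoot D.A i ∈ hfin.toFinset ↔ μ i = -1 := by
    intro μ hμ i
    have := hstr hμ i 1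
    rw [one_smul] at this
    rw [this]; omega
  have hdown : ∀ {μ}, μ ∈ hfin.toFinset → ∀ i, μ - clRoot D.A i ∈ hfin.toFinset ↔ μ i = 1 := by
    intro μ hμ i
    have := hstr hμ i (-1)
    rw [neg_one_smul, ← sub_eq_add_neg] at this
    rw [this]; omega
  have hstrUp : ∀ {μ}, μ ∈ hfin.toFinset → ∀ i, 0 ≤ μ i → D.strUp hfin.toFinset i μ = 0 := by
    intro μ hμ i h
    refine sSup_of_iff_le fun k => ?_
    rw [Set.mem_ofPred_eq, hstr hμ]; omega
  have hstrDown : ∀ {μ}, μ ∈ hfin.toFinset → ∀ i, μ i ≤ 0 → D.strDown hfin.toFinset i μ = 0 := by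
    intro μ hμ i h
    refine sSup_of_iff_le fun k => ?_
    rw [Set.mem_ofPred_eq, sub_eq_add_neg, ← neg_smul, hstr hμ]; omega
  exact
  { R := hfin.toFinset
    zero_notMem := fun h => h0 (by
      have : ∀ μ, WeylOrbit D.A Set.univ ϖ μ → μ = 0 → ϖ = 0 := by
        intro μ hμ
        induction hμ with
        | refl => exact id
        | @step ν i _ _ ih =>
          intro h
          have := D.reflect_reflect i ν
          rw [h] at this
          exact ih (by rw [← this]; simp [reflect])
      exact this _ (hmem.1 h) rfl)
    string := fun μ hμ i _ _ => by
      have := hb' μ hμ i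
      refine ⟨(μ i).toNat, (-μ i).toNat, by omega, fun k => ?_⟩
      rw [hstr hμ]; omega
    string_root := fun i hi => absurd hi (hroot i)
    neg_root := fun i hi => absurd hi (hnroot i)
    sub_notMem := fun i j hij h => by
      have h1 := hb' _ h j
      have h2 := D.off_diag j i (Ne.symm hij)
      simp only [Pi.sub_apply, clRoot, D.diag] at h1
      omega
    root_add_ne := fun i j _ hi => absurd hi (hroot i)
    adj := fun i j _ hi => absurd hi (hroot i)
    square := fun μ hμ i j hij _ _ h3 => by
      have hij' := D.off_diag i j hij
      have hji' := D.off_diag j i (Ne.symm hij)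
      have hz := D.zero_iff i j
      constructor
      · rw [hup hμ, hdown hμ]
        constructor
        · intro hi
          have h1 := (hdown ((hup hμ i).2 hi) j).1 h3
          have h2 := hb' μ hμ j
          simp only [Pi.add_apply, clRoot] at h1
          omega
        · intro hj
          rw [show μ + clRoot D.A i - clRoot D.A j = μ - clRoot D.A j + clRoot D.A i by abel] at h3
          have h1 := (hup ((hdown hμ j).2 hj) i).1 h3
          have h2 := hb' μ hμ i
          simp only [Pi.sub_apply, clRoot] at h1
          omega
      · intro hi
        have h1 := (hdown hi j).1 h3
        rw [hup hμ] at hi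
        have hi' := (hup hμ i).2 hi
        have h2 := hb' μ hμ j
        have h4 : (μ + clRoot D.A i) j = μ j + D.A j i := rfl
        have hj : μ j = 1 := by omega
        have h5 : (μ - clRoot D.A j) i = μ i - D.A i j := rfl
        rw [hstrUp hμ j (by omega), hstrUp hi' j (by omega), hstrDown hμ i (by omega),
          hstrDown ((hdown hμ j).2 hj) i (by omega)]
        ring
    conn := fun P hP h1 h2 _ _ μ hμ => by
      have : ∀ μ, WeylOrbit D.A Set.univ ϖ μ → P μ := by
        intro μ hμ
        induction hμ with
        | refl => exact hP
        | @step ν i hi hν ih =>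
          have hν' := hmem.2 hν
          have hr := hR ν hν' i
          have h3 := hb' ν hν' i
          have h4 : ν i = 0 ∨ ν i = 1 ∨ ν i = -1 := by omega
          rcases h4 with h4 | h4 | h4 <;> rw [reflect, h4] at hr ⊢
          · simpa using ih
          · rw [one_smul] at hr ⊢
            exact h2 ν hν' i ih hr
          · rw [neg_one_smul, sub_neg_eq_add] at hr ⊢
            exact h1 ν hν' i ih hr
      exact this μ (hmem.1 hμ)
    orbit_mem := fun μ => hmem.2
    extremal_up := fun μ hμ j hj h => by
      rw [hup (hmem.2 hμ)] at h; omega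
    extremal_down := fun μ hμ j hj h => by
      rw [hdown (hmem.2 hμ)] at h; omega
    short := ∅
    weight_long := fun l _ μ hμ => Or.inl (hb μ hμ l)
    long_sum := fun k l _ _ hk => absurd (hmem.2 hk) (hroot k)
    dominant_short := fun n hn _ j => hn j (by simp)
    ne_rootComb := fun n hn h => h0 (by
      rw [h, rootComb]
      exact Finset.sum_eq_zero fun j _ => by rw [hn j (by simp), zero_smul]) }

/-! ### The minuscule weights -/

/-- The vectors of marks of a diagram automorphism are invariant. -/
theorem c_perm (σ : Equiv.Perm I) (hσ : ∀ i j, D.A (σ i) (σ j) = D.A i j) (i : I) :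
    D.c (σ i) = D.c i := by
  obtain ⟨κ, hκ⟩ := D.left_kernel (fun i => D.c (σ i)) fun j => by
    have h1 : (∑ i, (D.c (σ i) : ℚ) * D.A (σ i) (σ j)) = ∑ i, (D.c i : ℚ) * D.A i (σ j) :=
      Equiv.sum_comp σ fun i => (D.c i : ℚ) * D.A i (σ j)
    have h2 : (∑ i, (D.c i : ℚ) * D.A i (σ j)) = 0 := by exact_mod_cast D.c_null (σ j)
    rw [← h2, ← h1]
    simp only [hσ]
  have hsum : ∑ i, (D.c (σ i) : ℚ) = ∑ i, (D.c i : ℚ) := Equiv.sum_comp σ fun i => (D.c i : ℚ)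
  have hpos : (0 : ℚ) < ∑ i, (D.c i : ℚ) :=
    Finset.sum_pos (fun i _ => by exact_mod_cast D.c_pos i) ⟨i, Finset.mem_univ i⟩
  simp only [hκ, ← Finset.mul_sum] at hsum
  have hκ1 : κ = 1 := by
    apply mul_right_cancel₀ hpos.ne'
    rw [hsum, one_mul]
  have := hκ i
  rw [hκ1, one_mul] at this
  exact_mod_cast this

/-- The dual affine datum. -/
def dual (h : D.c D.zero = 1) : AffineDatum I where
  A := D.A.transpose
  diag := D.diag
  off_diag i j hij := D.off_diag j i (Ne.symm hij)
  zero_iff i j := D.zero_iff j i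
  symmetrizable := by
    obtain ⟨s, hs, hsA⟩ := D.symmetrizable
    refine ⟨fun i => ∏ k ∈ Finset.univ.erase i, s k, fun i => Finset.prod_pos fun k _ => hs k,
      fun i j => ?_⟩
    have hP : ∀ i, (s i : ℤ) * (∏ k ∈ Finset.univ.erase i, s k : ℕ) = (∏ k, s k : ℕ) := fun i => by
      exact_mod_cast Finset.mul_prod_erase _ _ (Finset.mem_univ i)
    have hi : (s i : ℤ) ≠ 0 := by exact_mod_cast (hs i).ne'
    have hj : (s j : ℤ) ≠ 0 := by exact_mod_cast (hs j).ne'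
    apply mul_left_cancel₀ (mul_ne_zero hi hj)
    have h1 := hP i
    have h2 := hP j
    have h3 := hsA i j
    simp only [Matrix.transpose_apply]
    linear_combination s j * D.A j i * h1 - s i * D.A i j * h2 - (∏ k, s k : ℕ) * h3
  indecomposable S hS hne := by
    obtain ⟨i, hi, j, hj, h⟩ := D.indecomposable S hS hne
    exact ⟨i, hi, j, hj, fun h' => h ((D.zero_iff i j).2 h')⟩
  d := D.c
  d_pos := D.c_pos
  d_gcd := D.c_gcd
  d_null i := by
    rw [← D.c_null i]
    exact Finset.sum_congr rfl fun j _ => mul_comm _ _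
  c := D.d
  c_pos := D.d_pos
  c_gcd := D.d_gcd
  c_null j := by
    rw [← D.d_null j]
    exact Finset.sum_congr rfl fun i _ => mul_comm _ _
  zero := D.zero
  d_zero := h
  c_zero := Or.inl D.d_zero

theorem c_zero_of_untwisted (hU : IsUntwisted D.A.transpose D.zero) : D.c D.zero = 1 := by
  obtain ⟨⟨j, hj, hw⟩, -⟩ := hU
  have key : ∀ β, WeylOrbit D.A.transpose {D.zero}ᶜ (clRoot D.A.transpose j) β →
      ∃ n : I → ℤ, n D.zero = 0 ∧ ∀ k, β k = ∑ i, n i * D.A i k := by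
    intro β hβ
    induction hβ with
    | refl => exact ⟨Pi.single j 1, by simp [Ne.symm hj], fun k => by
        simp [clRoot, Pi.single_apply]⟩
    | @step β i hi _ ih =>
      obtain ⟨n, hn0, hn⟩ := ih
      have hi0 : D.zero ≠ i := fun h => hi h.symm
      refine ⟨n - β i • Pi.single i 1, by simp [hn0, hi0], fun k => ?_⟩
      rw [reflect_apply, hn k]
      simp [sub_mul, Finset.sum_sub_distrib, Pi.single_apply]
  obtain ⟨n, hn0, hn⟩ := key _ hw
  obtain ⟨κ, hκ⟩ := D.left_kernel (fun i => n i + (if i = D.zero then 1 else 0)) fun k => by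
    have h1 : (∑ i, (n i : ℚ) * D.A i k) = -(D.A D.zero k) := by
      have := hn k
      simp only [Pi.neg_apply, clRoot, Matrix.transpose_apply] at this
      have h2 : ((∑ i, n i * D.A i k : ℤ) : ℚ) = ((-D.A D.zero k : ℤ) : ℚ) := by rw [← this]
      push_cast at h2
      exact h2
    simp [add_mul, Finset.sum_add_distrib, h1]
  have h0 := hκ D.zero
  simp only [hn0, if_true] at h0
  have hdvd : ∀ k ∈ Finset.univ, D.c D.zero ∣ D.c k := fun k _ => by
    have h1 := hκ k
    have h2 : ((n k + (if k = D.zero then 1 else 0) : ℤ) : ℚ) * D.c D.zero = D.c k := by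
      push_cast
      rw [h1]
      push_cast at h0
      linear_combination -(D.c k : ℚ) * h0
    have h3 : (n k + (if k = D.zero then 1 else 0) : ℤ) * D.c D.zero = D.c k := by exact_mod_cast h2
    have h4 : (D.c D.zero : ℤ) ∣ D.c k := ⟨_, by rw [← h3, mul_comm]⟩
    exact_mod_cast h4
  have := Finset.dvd_gcd hdvd
  rw [D.c_gcd] at this
  exact Nat.dvd_one.1 this

/-- The weights of the orbit of `ϖ_r` pair with the simple coroots like `ϖ_r` with real coroots. -/
theorem orbit_pairing (h : D.c D.zero = 1) {ϖ μ : Pcl I} (hμ : WeylOrbit D.A Set.univ ϖ μ) :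
    ∀ x, (D.dual h).IsRealRoot x →
      ∃ y, (D.dual h).IsRealRoot y ∧ ∑ i, x i * (μ i : ℚ) = ∑ i, y i * (ϖ i : ℚ) := by
  induction hμ with
  | refl => exact fun x hx => ⟨x, hx, rfl⟩
  | @step ν i _ _ ih =>
    rintro x ⟨p, hx⟩
    obtain ⟨y, hy, hxy⟩ := ih _ ⟨p, hx.step i (Set.mem_univ i)⟩
    refine ⟨y, hy, hxy ▸ ?_⟩
    simp only [reflect_apply, srefl, Pi.sub_apply, Pi.smul_apply, smul_eq_mul, sub_mul,
      Finset.sum_sub_distrib, Int.cast_sub, Int.cast_mul, mul_sub]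
    congr 1
    have h1 : ∀ k, (D.dual h).pair x i * sr i k * (ν k : ℚ) =
        if k = i then (D.dual h).pair x i * ν i else 0 := fun k => by
      by_cases hk : k = i
      · subst hk; simp [sr]
      · simp [sr, hk]
    rw [Finset.sum_congr rfl fun k _ => h1 k, Finset.sum_ite_eq', if_pos (Finset.mem_univ i), pair,
      Finset.sum_mul]
    refine Finset.sum_congr rfl fun k _ => ?_
    simp only [dual, Matrix.transpose_apply]
    ring

theorem minuscule_bound {r : I} (hr : D.IsMinusculeNode r) {μ : Pcl I}
    (hμ : WeylOrbit D.A Set.univ (D.varpi r) μ) (j : I) : -1 ≤ μ j ∧ μ j ≤ 1 := by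
  obtain ⟨hU, hr0, σ, hσ, hσ0⟩ := hr
  have hc0 := D.c_zero_of_untwisted hU
  have hcr : D.c r = 1 := by rw [← hσ0, D.c_perm σ hσ, hc0]
  have hdr : D.d r = 1 := by
    rw [← hσ0, ← D.d_zero]
    exact (D.dual hc0).c_perm σ (fun i j => hσ j i) D.zero
  have hU' : IsUntwisted (D.dual hc0).A (D.dual hc0).zero := hU
  have hlen : ∀ p, (D.dual hc0).len p ≤ (D.dual hc0).len (D.dual hc0).zero :=
    len_le_of_untwisted hU' (r := r) hr0 hcr (by
      change (D.d r : ℚ) / D.c r = (D.d D.zero : ℚ) / D.c D.zero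
      rw [hcr, hdr, hc0, D.d_zero])
  have hϖ : ∀ y : I → ℚ, ∑ i, y i * (D.varpi r i : ℚ) = y r - y D.zero := fun y => by
    simp only [varpi, hc0, hcr, Nat.gcd_self, Nat.div_self one_pos, Nat.cast_one, Pi.sub_apply,
      Int.cast_sub, mul_sub, Finset.sum_sub_distrib, Pi.single_apply]
    simp
  have key : ∀ x, (D.dual hc0).IsRealRoot x → ∑ i, x i * (μ i : ℚ) ≤ 1 := fun x hx => by
    obtain ⟨y, hy, hxy⟩ := D.orbit_pairing hc0 hμ x hx
    rw [hxy, hϖ]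
    exact IsRealRoot.sub_le_one hU' hlen hcr hy
  have hs : (D.dual hc0).IsRealRoot (sr j) := ⟨j, .refl⟩
  have h1 := key _ hs
  have h2 := key _ hs.neg
  have h3 : ∑ i, sr j i * (μ i : ℚ) = μ j := by
    simp [sr, Pi.single_apply]
  have h4 : ∑ i, (-sr j) i * (μ i : ℚ) = -μ j := by
    rw [← h3]; simp
  rw [h3] at h1
  rw [h4] at h2
  have h5 : ((-μ j : ℤ) : ℚ) ≤ ((1 : ℤ) : ℚ) := by push_cast; exact h2
  have h6 := Int.cast_le.1 h5
  exact ⟨by omega, by exact_mod_cast h1⟩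

theorem varpi_ne_zero {r : I} (hr : r ≠ D.zero) : D.varpi r ≠ 0 := fun h => by
  have := congrFun h r
  simp only [varpi, Pi.sub_apply, Pi.single_eq_same, Pi.single_eq_of_ne hr, sub_zero,
    Pi.zero_apply, Nat.cast_eq_zero, Nat.div_eq_zero_iff] at this
  have h1 := D.c_pos D.zero
  have h2 := Nat.gcd_le_left (D.c r) h1
  have h3 : 0 < Nat.gcd (D.c D.zero) (D.c r) := Nat.gcd_pos_of_pos_left _ h1
  omega

end AffineDatum
end Strings

/-! ### The neighbour of the affine vertex -/

namespace AffineDatum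

variable {I : Type u} [Fintype I] [DecidableEq I] (D : AffineDatum I)

theorem row_le (i : I) (s : Finset I) (hi : i ∉ s) : ∑ j ∈ s, -(D.A i j) * (D.d j : ℤ) ≤ 2 * D.d i := by
  have h := D.d_null i
  rw [← Finset.add_sum_erase _ _ (Finset.mem_univ i), D.diag] at h
  have h1 : ∑ j ∈ s, -(D.A i j) * (D.d j : ℤ) ≤ ∑ j ∈ Finset.univ.erase i, -(D.A i j) * (D.d j : ℤ) := by
    refine Finset.sum_le_sum_of_subset_of_nonneg (fun j hj => ?_) fun j hj _ => ?_
    · exact Finset.mem_erase.2 ⟨fun h => hi (h ▸ hj), Finset.mem_univ j⟩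
    · have := D.off_diag i j (Ne.symm (Finset.ne_of_mem_erase hj))
      exact mul_nonneg (by omega) (by positivity)
  simp only [neg_mul, Finset.sum_neg_distrib] at h1 ⊢
  linarith

theorem col_le (i : I) (s : Finset I) (hi : i ∉ s) : ∑ j ∈ s, -(D.A j i) * (D.c j : ℤ) ≤ 2 * D.c i := by
  have h := D.c_null i
  rw [← Finset.add_sum_erase _ _ (Finset.mem_univ i), D.diag] at h
  have h1 : ∑ j ∈ s, -(D.A j i) * (D.c j : ℤ) ≤ ∑ j ∈ Finset.univ.erase i, -(D.A j i) * (D.c j : ℤ) := by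
    refine Finset.sum_le_sum_of_subset_of_nonneg (fun j hj => ?_) fun j hj _ => ?_
    · exact Finset.mem_erase.2 ⟨fun h => hi (h ▸ hj), Finset.mem_univ j⟩
    · have := D.off_diag j i (Finset.ne_of_mem_erase hj)
      exact mul_nonneg (by omega) (by positivity)
  simp only [neg_mul, Finset.sum_neg_distrib] at h1 ⊢
  have h2 : ∑ j ∈ Finset.univ.erase i, D.A j i * (D.c j : ℤ) = ∑ j ∈ Finset.univ.erase i, (D.c j : ℤ) * D.A j i :=
    Finset.sum_congr rfl fun _ _ => mul_comm _ _
  linarith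

theorem neg_entry_pos {i j : I} (hij : i ≠ j) (h : D.A i j ≠ 0) : 1 ≤ -D.A i j := by
  have := D.off_diag i j hij
  omega

/-- If two simple roots are opposite in `P_cl`, the type is `A_1^{(1)}`. -/
theorem clRoot_add_ne (hA : ¬ D.IsTypeA1) {i j : I} (hij : i ≠ j) :
    clRoot D.A i + clRoot D.A j ≠ 0 := by
  intro h
  have hk : ∀ k, D.A k i + D.A k j = 0 := fun k => congrFun h k
  have hS : ∀ k, k = i ∨ k = j := by
    by_contra hcon
    push Not at hcon
    obtain ⟨k, hki, hkj⟩ := hcon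
    obtain ⟨a, ha, b, hb, hab⟩ := D.indecomposable {i, j} ⟨i, by simp⟩ (fun h => by
      have : k ∈ ({i, j} : Set I) := h ▸ Set.mem_univ k
      simp at this; tauto)
    simp only [Set.mem_insert_iff, Set.mem_singleton_iff, not_or] at ha hb
    have h1 := hk b
    have h2 := D.off_diag b i hb.1
    have h3 := D.off_diag b j hb.2
    have h4 : D.A b a = 0 := by rcases ha with rfl | rfl <;> omega
    exact hab ((D.zero_iff a b).2 h4)
  have hji : D.A j i = -2 := by have := hk j; rw [D.diag] at this; omega
  have hij' : D.A i j = -2 := by have := hk i; rw [D.diag] at this; omega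
  have hd1 := D.row_le i {j} (by simpa using hij)
  have hd2 := D.row_le j {i} (by simpa using hij.symm)
  have hc1 := D.col_le i {j} (by simpa using hij)
  have hc2 := D.col_le j {i} (by simpa using hij.symm)
  simp only [Finset.sum_singleton, hji, hij'] at hd1 hd2 hc1 hc2
  have hd : D.d i = D.d j := by omega
  have hc : D.c i = D.c j := by omega
  apply hA
  have hci : D.c i = 1 := by
    have h1 : D.c i ∣ Finset.univ.gcd D.c := Finset.dvd_gcd fun k _ => by
      rcases hS k with rfl | rfl
      · rfl
      · rw [hc]
    rw [D.c_gcd] at h1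
    exact Nat.dvd_one.1 h1
  have hdi : D.d i = 1 := by
    rcases hS D.zero with h | h
    · rw [← h, D.d_zero]
    · rw [hd, ← h, D.d_zero]
  intro k
  rcases hS k with rfl | rfl
  · exact ⟨hdi, hci⟩
  · exact ⟨hd ▸ hdi, hc ▸ hci⟩

/-- If the affine vertex has two neighbours, the diagram is a cycle with all marks `1`. -/
theorem adjoint_row (hA : ¬ D.IsTypeA1) {r : I} (hr : r ≠ D.zero) (hr0 : D.A D.zero r ≠ 0) :
    -(D.A D.zero r) * (D.d r : ℤ) = 2 ∧ ∀ j, j ≠ D.zero → j ≠ r → D.A D.zero j = 0 := by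
  have hdpos : ∀ j, (1 : ℤ) ≤ D.d j := fun j => by exact_mod_cast D.d_pos j
  have hcpos : ∀ j, (1 : ℤ) ≤ D.c j := fun j => by exact_mod_cast D.c_pos j
  have key : ∀ j, j ≠ D.zero → j ≠ r → D.A D.zero j = 0 := by
    intro j hj hjr
    by_contra hj0
    apply hA
    have hp := D.neg_entry_pos hr.symm hr0
    have hpj := D.neg_entry_pos hj.symm hj0
    have hrow := D.row_le D.zero {r, j} (by simp [hr.symm, hj.symm])
    rw [Finset.sum_pair hjr.symm, D.d_zero] at hrow
    have hdr := hdpos r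
    have hdj := hdpos j
    have e1 : (1 : ℤ) ≤ -(D.A D.zero r) * D.d r := by nlinarith
    have e2 : (1 : ℤ) ≤ -(D.A D.zero j) * D.d j := by nlinarith
    push_cast at hrow
    have hdr1 : D.d r = 1 := by
      have : (D.d r : ℤ) ≤ 1 := by nlinarith
      omega
    have har : D.A D.zero r = -1 := by
      rw [hdr1] at e1 hrow
      push_cast at hrow
      linarith
    have hc0 : D.c D.zero = 1 := by
      rcases D.c_zero with h | h
      · exact h
      · have := h r hr; omega
    have hr0' : D.A r D.zero ≠ 0 := fun h => hr0 ((D.zero_iff _ _).2 h)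
    have hcol := D.col_le D.zero {r, j} (by simp [hr.symm, hj.symm])
    rw [Finset.sum_pair hjr.symm, hc0] at hcol
    have hp' := D.neg_entry_pos hr hr0'
    have hpj' := D.neg_entry_pos hj (fun h => hj0 ((D.zero_iff _ _).2 h))
    have hcr := hcpos r
    have hcj := hcpos j
    have e3 : (1 : ℤ) ≤ -(D.A r D.zero) * D.c r := by nlinarith
    have e4 : (1 : ℤ) ≤ -(D.A j D.zero) * D.c j := by nlinarith
    push_cast at hcol
    have hcr1 : D.c r = 1 := by
      have : (D.c r : ℤ) ≤ 1 := by nlinarith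
      omega
    have har' : D.A r D.zero = -1 := by
      rw [hcr1] at e3 hcol
      push_cast at hcol
      linarith
    have hS : {i | D.d i = 1 ∧ D.c i = 1 ∧ ∃ i', i' ≠ i ∧ D.d i' = 1 ∧ D.c i' = 1 ∧ D.A i i' = -1 ∧
        D.A i' i = -1} = Set.univ := by
      by_contra hne
      obtain ⟨a, ha, b, hb, hab⟩ := D.indecomposable _
        ⟨D.zero, show _ ∧ _ ∧ _ from ⟨D.d_zero, hc0, r, hr, hdr1, hcr1, har, har'⟩⟩ hne
      obtain ⟨hda, hca, a', haa, hda', hca', h1, h2⟩ := ha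
      apply hb
      have hba : b ≠ a := fun h => hb (h ▸ ⟨hda, hca, a', haa, hda', hca', h1, h2⟩)
      by_cases hba' : b = a'
      · subst hba'
        exact ⟨hda', hca', a, haa.symm, hda, hca, h2, h1⟩
      · have f1 := D.row_le a {a', b} (by simp [haa.symm, hba.symm])
        have f2 := D.col_le a {a', b} (by simp [haa.symm, hba.symm])
        rw [Finset.sum_pair (Ne.symm hba'), h1, hda, hda'] at f1
        rw [Finset.sum_pair (Ne.symm hba'), h2, hca, hca'] at f2
        have g1 := D.neg_entry_pos hba.symm hab
        have g2 := D.neg_entry_pos hba (fun h => hab ((D.zero_iff _ _).2 h))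
        have g3 := hdpos b
        have g4 := hcpos b
        push_cast at f1 f2
        have k1 : (D.d b : ℤ) ≤ 1 := by nlinarith
        have k2 : (D.c b : ℤ) ≤ 1 := by nlinarith
        have k3 : D.d b = 1 := by omega
        have k4 : D.c b = 1 := by omega
        rw [k3] at f1
        rw [k4] at f2
        push_cast at f1 f2
        exact ⟨k3, k4, a, hba.symm, hda, hca, by linarith, by linarith⟩
    intro i
    have : i ∈ {i | D.d i = 1 ∧ D.c i = 1 ∧ ∃ i', i' ≠ i ∧ D.d i' = 1 ∧ D.c i' = 1 ∧ D.A i i' = -1 ∧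
        D.A i' i = -1} := hS ▸ Set.mem_univ i
    exact ⟨this.1, this.2.1⟩
  refine ⟨?_, key⟩
  have h := D.d_null D.zero
  rw [← Finset.add_sum_erase _ _ (Finset.mem_univ D.zero),
    Finset.sum_eq_single_of_mem r (Finset.mem_erase.2 ⟨hr, Finset.mem_univ r⟩) (fun j hj hjr => by
      rw [key j (Finset.ne_of_mem_erase hj) hjr, zero_mul]), D.diag, D.d_zero] at h
  push_cast at h
  linarith

theorem entry_mul_le (i j : I) : D.A i j * D.A j i ≤ 4 := by
  have h := D.form_sq_le (sr i) (sr j)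
  rw [form_sr_left, form_sr_self, form_sr_self, pair_sr] at h
  have h1 := D.len_symm i j
  have hi := D.len_pos i
  have hj := D.len_pos j
  have h2 : (D.len i * D.len j) * (D.A i j * D.A j i : ℚ) ≤ (D.len i * D.len j) * 4 := by
    have : (D.len i * D.A i j : ℚ) ^ 2 = (D.len i * D.len j) * (D.A i j * D.A j i : ℚ) := by
      rw [sq]; nth_rewrite 2 [h1]; ring
    linarith
  exact_mod_cast le_of_mul_le_mul_left h2 (mul_pos hi hj)

/-- The numerical properties of a vertex `r` adjacent to the affine vertex in a diagram that is not
of type `A_n^{(1)}`, with `ϖ = ϖ_r` and `-α_0 = k ϖ`. -/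
structure AdjointData (D : AffineDatum I) (r : I) (ϖ : Pcl I) (k : ℤ) : Prop where
  k_eq : k = 1 ∨ k = 2
  root_eq : -clRoot D.A D.zero = k • ϖ
  odd : ∃ i, Odd (ϖ i)
  ne : r ≠ D.zero
  len_le : D.len D.zero ≤ k ^ 2 * D.len r
  row : -(D.A D.zero r) * (D.d r : ℤ) = 2
  dom : ∀ j, j ≠ D.zero → 0 ≤ ϖ j
  add_ne : ∀ i j, i ≠ j → clRoot D.A i + clRoot D.A j ≠ 0
  len_zero : k = 1 → D.len D.zero = 1

theorem adjointData {r : I} (h : D.IsAdjointNode r) : ∃ k, D.AdjointData r (D.varpi r) k := by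
  obtain ⟨hA, hr, hr0⟩ := h
  obtain ⟨hrow, hother⟩ := D.adjoint_row hA hr hr0
  have hg : 0 < Nat.gcd (D.c D.zero) (D.c r) := Nat.gcd_pos_of_pos_left _ (D.c_pos _)
  obtain ⟨g, x, y, -, hcop, hx, hy⟩ := Nat.exists_coprime' hg
  have hgg : Nat.gcd (D.c D.zero) (D.c r) = g := by
    have : Nat.gcd (x * g) (y * g) = g := by
      rw [Nat.gcd_mul_right, Nat.Coprime.gcd_eq_one hcop, one_mul]
    rw [hx, hy]; exact this
  have hgpos : 0 < g := hgg ▸ hg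
  have hϖr : D.varpi r r = x := by
    simp only [varpi, Pi.sub_apply, Pi.single_eq_same, Pi.single_eq_of_ne hr, sub_zero, hgg]
    rw [hx, Nat.mul_div_cancel _ hgpos]
  have hϖ0 : D.varpi r D.zero = -y := by
    simp only [varpi, Pi.sub_apply, Pi.single_eq_same, Pi.single_eq_of_ne hr.symm, zero_sub, hgg]
    rw [hy, Nat.mul_div_cancel _ hgpos]
  have hϖj : ∀ j, j ≠ D.zero → j ≠ r → D.varpi r j = 0 := fun j hj hjr => by
    simp [varpi, hj, hjr]
  have hcol : 2 * (D.c D.zero : ℤ) = -(D.A r D.zero) * D.c r := by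
    have h := D.c_null D.zero
    rw [← Finset.add_sum_erase _ _ (Finset.mem_univ D.zero),
      Finset.sum_eq_single_of_mem r (Finset.mem_erase.2 ⟨hr, Finset.mem_univ r⟩) (fun j hj hjr => by
        rw [(D.zero_iff _ _).1 (hother j (Finset.ne_of_mem_erase hj) hjr), mul_zero]), D.diag] at h
    linarith
  have hr0' : D.A r D.zero ≠ 0 := fun h => hr0 ((D.zero_iff _ _).2 h)
  have hp := D.neg_entry_pos hr hr0'
  have hp0 := D.neg_entry_pos hr.symm hr0
  have hxy : 2 * (x : ℤ) = -(D.A r D.zero) * y := by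
    have hgz : (g : ℤ) ≠ 0 := by exact_mod_cast hgpos.ne'
    apply mul_right_cancel₀ hgz
    have h1 : (D.c D.zero : ℤ) = x * g := by exact_mod_cast hx
    have h2 : (D.c r : ℤ) = y * g := by exact_mod_cast hy
    rw [h1, h2] at hcol
    linarith
  have hy2 : y ∣ 2 := by
    have h1 : (y : ℤ) ∣ 2 * x := ⟨-(D.A r D.zero), by rw [hxy, mul_comm]⟩
    have h2 : y ∣ 2 * x := by exact_mod_cast h1
    exact Nat.Coprime.dvd_of_dvd_mul_right hcop.symm h2
  have hsymm := D.len_symm D.zero r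
  have hl0 := D.len_pos D.zero
  have hlr := D.len_pos r
  have h4 := D.entry_mul_le D.zero r
  have hodd : y = 2 → Odd x := fun h2 => by
    rw [h2] at hcop
    exact Nat.coprime_two_right.1 hcop
  -- in the exceptional case `c_0 ≠ 1` the entry `a_{r0}` is even
  have hc0 : y = 2 → D.c D.zero = 1 := fun h2 => by
    rcases D.c_zero with h | h
    · exact h
    · exfalso
      have hrr := D.d_null r
      rw [← Finset.add_sum_erase _ _ (Finset.mem_univ D.zero), D.d_zero] at hrr
      have : ∑ j ∈ Finset.univ.erase D.zero, D.A r j * (D.d j : ℤ) =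
          2 * ∑ j ∈ Finset.univ.erase D.zero, D.A r j := by
        rw [Finset.mul_sum]
        refine Finset.sum_congr rfl fun j hj => ?_
        rw [h j (Finset.ne_of_mem_erase hj)]
        push_cast; ring
      rw [this] at hrr
      obtain ⟨t, ht⟩ := hodd h2
      rw [h2] at hxy
      push_cast at hxy hrr
      omega
  have hlen : ∀ k : ℤ, 0 < k → -(D.A r D.zero) ≤ k ^ 2 * -(D.A D.zero r) →
      D.len D.zero ≤ k ^ 2 * D.len r := fun k _ hk => by
    have hk' : (-(D.A r D.zero) : ℚ) ≤ (k : ℚ) ^ 2 * -(D.A D.zero r) := by exact_mod_cast hk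
    have hp' : (1 : ℚ) ≤ -D.A D.zero r := by exact_mod_cast hp0
    have h1 : -(D.A D.zero r : ℚ) * D.len D.zero ≤ -(D.A D.zero r : ℚ) * (k ^ 2 * D.len r) := by
      have := mul_le_mul_of_nonneg_right hk' hlr.le
      nlinarith
    exact le_of_mul_le_mul_left h1 (by linarith)
  have hdom : ∀ j, j ≠ D.zero → 0 ≤ D.varpi r j := fun j hj => by
    by_cases hjr : j = r
    · rw [hjr, hϖr]; positivity
    · rw [hϖj j hj hjr]
  have hroot : ∀ k : ℤ, k * y = 2 → -clRoot D.A D.zero = k • D.varpi r := fun k hk => by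
    funext j
    simp only [Pi.neg_apply, clRoot, Pi.smul_apply, smul_eq_mul]
    by_cases hj : j = D.zero
    · rw [hj, D.diag, hϖ0]; linarith
    by_cases hjr : j = r
    · rw [hjr, hϖr]
      have : (y : ℤ) ≠ 0 := fun h => by rw [h, mul_zero] at hk; omega
      apply mul_right_cancel₀ this
      linear_combination -hxy - x * hk
    · rw [hϖj j hj hjr, (D.zero_iff _ _).1 (hother j hj hjr)]; simp
  have hcases : y = 1 ∨ y = 2 := by
    have := Nat.le_of_dvd two_pos hy2
    have : y ≠ 0 := fun h => by rw [h] at hy2; omega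
    omega
  rcases hcases with hy1 | hy1
  · refine ⟨2, Or.inr rfl, hroot 2 (by rw [hy1]; norm_num), ⟨D.zero, by rw [hϖ0, hy1]; decide⟩, hr,
      hlen 2 two_pos ?_, hrow, hdom, fun i j => D.clRoot_add_ne hA, fun h => by omega⟩
    nlinarith
  · have hc := hc0 hy1
    refine ⟨1, Or.inl rfl, hroot 1 (by rw [hy1]; norm_num), ⟨r, by rw [hϖr]; exact_mod_cast hodd hy1⟩,
      hr, hlen 1 one_pos ?_, hrow, hdom, fun i j => D.clRoot_add_ne hA, fun _ => by
        rw [len, hc, D.d_zero]; norm_num⟩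
    have hx1 : x = 1 := Nat.eq_one_of_mul_eq_one_right (hx ▸ hc)
    rw [hx1, hy1] at hxy
    push_cast at hxy
    linarith

end AffineDatum

/-! ### Squared lengths of level-zero weights -/

namespace AffineDatum

variable {I : Type u} [Fintype I] [DecidableEq I] (D : AffineDatum I)

/-- `x` is a lift of the weight `μ` to the rational span of the simple roots. -/
def IsLift (x : I → ℚ) (μ : Pcl I) : Prop := ∀ i, (μ i : ℚ) = D.pair x i

/-- The weight `μ` lies in the rational span of the roots and has squared length `n`. -/
def HasNorm (μ : Pcl I) (n : ℚ) : Prop := ∃ x, D.IsLift x μ ∧ D.form x x = n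

variable {D}

theorem IsLift.neg {x : I → ℚ} {μ : Pcl I} (h : D.IsLift x μ) : D.IsLift (-x) (-μ) := fun i => by
  rw [pair_neg, ← h i]; simp

theorem IsLift.add {x y : I → ℚ} {μ ν : Pcl I} (h : D.IsLift x μ) (h' : D.IsLift y ν) :
    D.IsLift (x + y) (μ + ν) := fun i => by
  rw [pair_add, ← h i, ← h' i]; simp

theorem IsLift.smul {x : I → ℚ} {μ : Pcl I} (h : D.IsLift x μ) (k : ℤ) :
    D.IsLift ((k : ℚ) • x) (k • μ) := fun i => by
  rw [pair_smul, ← h i]; simp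

theorem isLift_sr (j : I) : D.IsLift (sr j) (clRoot D.A j) := fun i => by
  rw [pair_sr, clRoot]

theorem IsLift.reflect {x : I → ℚ} {μ : Pcl I} (h : D.IsLift x μ) (i : I) :
    D.IsLift (D.srefl i x) (reflect D.A i μ) := fun j => by
  rw [pair_srefl, reflect_apply, ← h i, ← h j]; push_cast; rfl

theorem isLift_rootComb (n : I → ℤ) : D.IsLift (fun j => (n j : ℚ)) (D.rootComb n) :=
  D.rootComb_cast n

/-- Two lifts of a weight differ by a multiple of `δ`. -/
theorem IsLift.eq_add {x y : I → ℚ} {μ : Pcl I} (h : D.IsLift x μ) (h' : D.IsLift y μ) :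
    ∃ t : ℚ, y = x + t • D.delta := by
  have h1 := D.eq_smul_delta_of_pair (x := y - x) fun i => by rw [pair_sub, ← h i, ← h' i, sub_self]
  exact ⟨_, by rw [← h1]; abel⟩

theorem IsLift.form_eq {x y : I → ℚ} {μ : Pcl I} (h : D.IsLift x μ) (h' : D.IsLift y μ) :
    D.form y y = D.form x x := by
  obtain ⟨t, rfl⟩ := h.eq_add h'
  simp only [form_add_left, form_add_right, form_smul_left, form_smul_right, form_delta_left,
    form_delta_right]
  ring

theorem HasNorm.unique {μ : Pcl I} {n n' : ℚ} (h : D.HasNorm μ n) (h' : D.HasNorm μ n') : n = n' := by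
  obtain ⟨x, hx, rfl⟩ := h
  obtain ⟨y, hy, rfl⟩ := h'
  exact hy.form_eq hx

theorem HasNorm.neg {μ : Pcl I} {n : ℚ} (h : D.HasNorm μ n) : D.HasNorm (-μ) n := by
  obtain ⟨x, hx, rfl⟩ := h
  exact ⟨-x, hx.neg, by rw [form_neg_left, form_neg_right, neg_neg]⟩

theorem HasNorm.reflect {μ : Pcl I} {n : ℚ} (h : D.HasNorm μ n) (i : I) :
    D.HasNorm (reflect D.A i μ) n := by
  obtain ⟨x, hx, rfl⟩ := h
  exact ⟨_, hx.reflect i, D.form_srefl i x x⟩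

theorem HasNorm.add_smul {μ : Pcl I} {n : ℚ} (h : D.HasNorm μ n) (i : I) (k : ℤ) :
    D.HasNorm (μ + k • clRoot D.A i) (n + 2 * D.len i * (k * (μ i + k) : ℤ)) := by
  obtain ⟨x, hx, rfl⟩ := h
  refine ⟨_, hx.add ((isLift_sr i).smul k), ?_⟩
  simp only [form_add_left, form_add_right, form_smul_left, form_smul_right, form_sr_left,
    form_sr_right, pair_add, pair_smul, pair_sr_self, ← hx i]
  push_cast
  ring

theorem hasNorm_clRoot (i : I) : D.HasNorm (clRoot D.A i) (2 * D.len i) :=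
  ⟨_, isLift_sr i, D.form_sr_self i⟩

theorem hasNorm_zero : D.HasNorm 0 0 := ⟨0, fun i => by simp [pair_zero], by simp [form]⟩

theorem hasNorm_smul_clRoot (i : I) (k : ℤ) :
    D.HasNorm (k • clRoot D.A i) (2 * D.len i * (k * k : ℤ)) := by
  have := (hasNorm_zero (D := D)).add_smul i k
  simpa using this

theorem HasNorm.eq_zero {μ : Pcl I} (h : D.HasNorm μ 0) : μ = 0 := by
  obtain ⟨x, hx, h0⟩ := h
  funext i
  have := hx i
  rw [D.pair_eq_zero_of_form h0] at this
  exact_mod_cast this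

/-- The Cauchy–Schwarz inequality for a weight and a simple root. -/
theorem HasNorm.sq_le {μ : Pcl I} {n : ℚ} (h : D.HasNorm μ n) (i : I) :
    D.len i * (μ i * μ i : ℤ) ≤ 2 * n := by
  obtain ⟨x, hx, rfl⟩ := h
  have h1 := D.form_sq_le x (sr i)
  rw [form_sr_right, form_sr_self, ← hx i] at h1
  have := D.len_pos i
  push_cast
  refine le_of_mul_le_mul_left (a := D.len i) ?_ this
  linarith

/-- Equality in the Cauchy–Schwarz inequality: the weight is a multiple of the simple root. -/
theorem HasNorm.eq_smul {μ : Pcl I} {n : ℚ} (h : D.HasNorm μ n) {i : I}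
    (he : D.len i * (μ i * μ i : ℤ) = 2 * n) (k : ℤ) (hk : μ i = 2 * k) : μ = k • clRoot D.A i := by
  obtain ⟨x, hx, rfl⟩ := h
  push_cast at he
  have h1 := D.pair_eq_of_form_sq (x := x) (y := sr i) (by
    rw [form_sr_right, form_sr_self, ← hx i]
    linear_combination D.len i * he)
  funext j
  have h2 := h1 j
  rw [form_sr_self, form_sr_right, ← hx i, ← hx j, pair_sr, hk] at h2
  have := D.len_pos i
  have h3 : (μ j : ℚ) = k * D.A j i := by
    apply mul_left_cancel₀ (mul_pos two_pos this).ne'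
    rw [h2]; push_cast; ring
  simp only [Pi.smul_apply, smul_eq_mul, clRoot]
  exact_mod_cast h3

theorem HasNorm.of_weylOrbit {J : Set I} {μ ν : Pcl I} {n : ℚ} (h : D.HasNorm μ n)
    (hν : WeylOrbit D.A J μ ν) : D.HasNorm ν n := by
  induction hν with
  | refl => exact h
  | step i _ _ ih => exact ih.reflect i

theorem _root_.QuantumAffine.WeylOrbit.symm {J : Set I} {μ ν : Pcl I} (h : WeylOrbit D.A J μ ν) :
    WeylOrbit D.A J ν μ := by
  induction h with
  | refl => exact .refl
  | @step ν i hi _ ih =>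
    have h1 : WeylOrbit D.A J (QuantumAffine.reflect D.A i ν) ν := by
      have := (WeylOrbit.refl (A := D.A) (J := J) (μ := QuantumAffine.reflect D.A i ν)).step i hi
      rwa [reflect_reflect] at this
    exact h1.trans ih

theorem _root_.QuantumAffine.WeylOrbit.neg {J : Set I} {μ ν : Pcl I} (h : WeylOrbit D.A J μ ν) :
    WeylOrbit D.A J (-μ) (-ν) := by
  induction h with
  | refl => exact .refl
  | step i hi _ ih => rw [← reflect_neg]; exact ih.step i hi

theorem exists_lift_of_weylOrbit {ϖ μ : Pcl I} {x0 : I → ℚ} (h0 : D.IsLift x0 ϖ)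
    (h : WeylOrbit D.A Set.univ ϖ μ) : ∃ x, D.RootOrbit Set.univ x0 x ∧ D.IsLift x μ := by
  induction h with
  | refl => exact ⟨x0, .refl, h0⟩
  | step i hi _ ih =>
    obtain ⟨x, hx, hl⟩ := ih
    exact ⟨_, hx.step i hi, hl.reflect i⟩

theorem exists_weylOrbit_of_rootOrbit {ϖ : Pcl I} {x x0 : I → ℚ} (h0 : D.IsLift x0 ϖ)
    (h : D.RootOrbit Set.univ x0 x) : ∃ μ, WeylOrbit D.A Set.univ ϖ μ ∧ D.IsLift x μ := by
  induction h with
  | refl => exact ⟨ϖ, .refl, h0⟩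
  | step i hi _ ih =>
    obtain ⟨x, hx, hl⟩ := ih
    exact ⟨_, hx.step i hi, hl.reflect i⟩

theorem exists_weylOrbit_ne_zero {ϖ : Pcl I} {n : ℚ} (h0 : D.HasNorm ϖ n) (hn : n ≠ 0) (j : I) :
    ∃ μ, WeylOrbit D.A Set.univ ϖ μ ∧ μ j ≠ 0 := by
  obtain ⟨x, hx, hxn⟩ := h0
  have h1 : ∃ i, D.pair x i ≠ 0 := by
    by_contra hcon
    push Not at hcon
    exact hn (by rw [← hxn]; simp [form, hcon])
  obtain ⟨y, hy, hyj⟩ := RootOrbit.exists_pair_ne_zero h1 j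
  obtain ⟨μ, hμ, hl⟩ := exists_weylOrbit_of_rootOrbit hx hy
  exact ⟨μ, hμ, fun h => hyj (by rw [← hl j, h]; simp)⟩

theorem _root_.QuantumAffine.WeylOrbit.exists_odd {J : Set I} {ϖ μ : Pcl I} (h0 : ∃ i, Odd (ϖ i))
    (h : WeylOrbit D.A J ϖ μ) : ∃ i, Odd (μ i) := by
  induction h with
  | refl => exact h0
  | @step ν i _ _ ih =>
    by_contra hcon
    push Not at hcon
    simp only [Int.not_odd_iff_even] at hcon
    obtain ⟨j, hj⟩ := ih
    have h1 := hcon i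
    rw [reflect_apply, D.diag] at h1
    have h3 : Even (ν i) := by
      obtain ⟨a, ha⟩ := h1
      exact ⟨-a, by omega⟩
    have h2 := hcon j
    rw [reflect_apply] at h2
    have h4 : Even (ν j) := by
      have := h2.add (h3.mul_right (D.A j i))
      rwa [sub_add_cancel] at this
    exact (Int.not_even_iff_odd.2 hj) h4

/-! ### The orbit of the adjoint weight -/

/-- The metric properties of the orbit of an adjoint weight `ϖ` of squared length `N`: a simple root
that is shorter than `ϖ` has squared length `u = N / m` with `m ∈ {2, 3}`. -/
structure AdjointLattice (D : AffineDatum I) (r : I) (ϖ : Pcl I) (m : ℤ) (N u : ℚ) : Prop where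
  m_eq : m = 2 ∨ m = 3
  u_pos : 0 < u
  N_eq : N = m * u
  norm : D.HasNorm ϖ N
  neg : WeylOrbit D.A Set.univ ϖ (-ϖ)
  short_eq : ∀ j, 2 * D.len j < N → 2 * D.len j = u
  short_weight : ∀ j, 2 * D.len j < N → ∀ μ, WeylOrbit D.A Set.univ ϖ μ → m ∣ μ j
  /-- There is a lattice that contains the orbit but no difference of two short simple roots. -/
  lattice : ∃ L : AddSubgroup (Pcl I), (∀ μ, WeylOrbit D.A Set.univ ϖ μ → μ ∈ L) ∧
    ∀ i j, i ≠ j → 2 * D.len i < N → 2 * D.len j < N → clRoot D.A i - clRoot D.A j ∉ L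
  /-- A sum of a long and a short weight is a short weight as soon as it has the right length. -/
  mid : ∀ j, 2 * D.len j < N → ∀ μ, WeylOrbit D.A Set.univ ϖ μ →
    ∀ ν, WeylOrbit D.A Set.univ (clRoot D.A j) ν → D.HasNorm (μ + ν) u →
      WeylOrbit D.A Set.univ (clRoot D.A j) (μ + ν)
  zero_long : N ≤ 2 * D.len D.zero
  node_long : N ≤ 2 * D.len r
  ne : r ≠ D.zero
  dom : ∀ j, j ≠ D.zero → 0 ≤ ϖ j
  add_ne : ∀ i j, i ≠ j → clRoot D.A i + clRoot D.A j ≠ 0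
  row : -(D.A D.zero r) * (D.d r : ℤ) = 2
  prop : ∃ k : ℤ, k ≠ 0 ∧ -clRoot D.A D.zero = k • ϖ

namespace AdjointData

variable {r : I} {ϖ : Pcl I} {k : ℤ} (h : D.AdjointData r ϖ k)
include h

theorem k_pos : 0 < (k : ℚ) := by
  rcases h.k_eq with rfl | rfl <;> norm_num

theorem isLift : D.IsLift (-(1 / k : ℚ) • sr D.zero) ϖ := fun i => by
  have h1 := congrFun h.root_eq i
  have hk := h.k_pos.ne'
  simp only [Pi.neg_apply, clRoot, Pi.smul_apply, smul_eq_mul] at h1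
  have h2 : -(D.A i D.zero : ℚ) = k * ϖ i := by exact_mod_cast h1
  rw [pair_smul, pair_sr]
  field_simp
  linarith

theorem hasNorm : D.HasNorm ϖ (2 * D.len D.zero / k ^ 2) := by
  refine ⟨_, h.isLift, ?_⟩
  have hk := h.k_pos.ne'
  rw [form_smul_left, form_smul_right, form_sr_self]
  field_simp

/-- The weights of the orbit have lifts `x` with `x_q (α_q, α_q) / 2` divisible by `(α_0, α_0) /
(2 k)`. -/
theorem orbit_lift {μ : Pcl I} (hμ : WeylOrbit D.A Set.univ ϖ μ) :
    ∃ x, D.IsLift x μ ∧ ∀ q, x q * D.len q / (D.len D.zero / k) ∈ intQ := by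
  obtain ⟨x, hx, hl⟩ := exists_lift_of_weylOrbit h.isLift hμ
  refine ⟨x, hl, hx.len_mem fun q => ?_⟩
  by_cases hq : q = D.zero
  · subst hq
    have := D.len_pos D.zero
    have hk := h.k_pos.ne'
    have h1 : (-(1 / k : ℚ) • (sr D.zero : I → ℚ)) D.zero * D.len D.zero / (D.len D.zero / k) = -1 := by
      simp [sr]
      field_simp
    rw [h1]
    exact intQ.neg_mem intQ.one_mem
  · simp [sr, hq, intQ.zero_mem]

theorem weight_mem {μ : Pcl I} (hμ : WeylOrbit D.A Set.univ ϖ μ) (j : I) :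
    ∃ t : ℤ, (μ j : ℚ) * D.len j * k = t * D.len D.zero := by
  obtain ⟨x, hl, hx⟩ := h.orbit_lift hμ
  obtain ⟨t, ht⟩ := exists_int_of_mem (D.len_pair_mem hx j)
  refine ⟨t, ?_⟩
  rw [← hl j] at ht
  have := D.len_pos D.zero
  have hk := h.k_pos
  field_simp at ht
  linarith

/-- If some simple root is shorter than `ϖ`, then `ϖ = -α_0`. -/
theorem k_eq_one {j : I} (hj : 2 * D.len j < 2 * D.len D.zero / k ^ 2) : k = 1 := by
  rcases h.k_eq with hk | hk
  · exact hk
  exfalso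
  have hN := h.hasNorm
  have h0 := D.len_pos D.zero
  have hlj := D.len_pos j
  subst hk
  push_cast at hj hN
  -- For `k = 2` the number `t = 2 μ_j len_j / len_0` is a nonzero integer, too large for the
  -- Cauchy–Schwarz inequality.
  obtain ⟨μ, hμ, hμj⟩ := exists_weylOrbit_ne_zero hN (by positivity) j
  obtain ⟨t, ht⟩ := h.weight_mem hμ j
  have h1 := (hN.of_weylOrbit hμ).sq_le j
  push_cast at ht h1
  have ht0 : t ≠ 0 := fun h => by
    rw [h] at ht
    have h2 : (μ j : ℚ) ≠ 0 := by exact_mod_cast hμj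
    simp at ht
    rcases ht with h | h
    · exact hμj h
    · linarith
  have ht1 : (1 : ℚ) ≤ (t : ℚ) ^ 2 := by
    have : 1 ≤ t ^ 2 := Int.add_one_le_iff.2 (lt_of_le_of_ne (sq_nonneg t) (pow_ne_zero 2 ht0).symm)
    exact_mod_cast this
  have h2 : (t : ℚ) ^ 2 * D.len D.zero ^ 2 = (D.len j * (μ j * μ j)) * (4 * D.len j) := by
    rw [← mul_pow, ← ht]; ring
  have h3 : D.len D.zero ^ 2 ≤ (t : ℚ) ^ 2 * D.len D.zero ^ 2 :=
    le_mul_of_one_le_left (by positivity) ht1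
  have h4 : (D.len j * (μ j * μ j)) * (4 * D.len j) ≤ D.len D.zero * (4 * D.len j) :=
    mul_le_mul_of_nonneg_right (by linarith) (by linarith)
  nlinarith

/-- A simple root shorter than `ϖ` has squared length `2 / 2` or `2 / 3`, when `(ϖ, ϖ) = 2`. -/
theorem short_ratio {j : I} (hj : 2 * D.len j < 2 * D.len D.zero / k ^ 2) :
    ∃ m : ℤ, (m = 2 ∨ m = 3) ∧ m * D.len j = 1 := by
  have hk := h.k_eq_one hj
  have hN := h.hasNorm
  have h1 := h.len_zero hk
  have hlj := D.len_pos j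
  subst hk
  rw [h1] at hj hN
  push_cast at hj hN
  norm_num at hj hN
  obtain ⟨μ, hμ, hμj⟩ := exists_weylOrbit_ne_zero hN (by norm_num) j
  obtain ⟨t, ht⟩ := h.weight_mem hμ j
  have hn := hN.of_weylOrbit hμ
  have h2 := hn.sq_le j
  rw [h1] at ht
  push_cast at ht h2
  have hμj' : (μ j : ℚ) ≠ 0 := by exact_mod_cast hμj
  have h3 : (t : ℚ) * μ j = D.len j * (μ j * μ j) := by linear_combination -(μ j : ℚ) * ht
  have h4 : (0 : ℚ) < t * μ j := by
    rw [h3]; exact mul_pos hlj (mul_self_pos.2 hμj')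
  have h5 : t * μ j ≤ 4 := by
    have : (t : ℚ) * μ j ≤ 4 := by rw [h3]; linarith
    exact_mod_cast this
  have h4' : 0 < t * μ j := by exact_mod_cast h4
  -- `μ_j = t / len j` has absolute value greater than `|t|`
  have h6 : t * t < t * μ j := by
    have : (t : ℚ) * t < t * μ j := by
      have h7 : (t : ℚ) * t = (t * μ j) * D.len j := by linear_combination -(t : ℚ) * ht
      rw [h7]
      exact mul_lt_of_lt_one_right h4 hj
    exact_mod_cast this
  have ht1 : t = 1 ∨ t = -1 := by
    have h8 : t ≠ 0 := fun h => by rw [h, zero_mul] at h4'; omega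
    have : -2 < t := by nlinarith
    have : t < 2 := by nlinarith
    omega
  have key : ∀ s : ℤ, (s = t * μ j) → s * D.len j = 1 := fun s hs => by
    rw [hs]; push_cast
    rw [mul_assoc, mul_comm (μ j : ℚ), mul_comm (D.len j)]
    have : (μ j : ℚ) * D.len j = t := by linarith
    rw [this]
    rcases ht1 with rfl | rfl <;> norm_num
  refine ⟨t * μ j, ?_, key _ rfl⟩
  -- The value `4` would mean equality in the Cauchy–Schwarz inequality, `μ = ±2 α_j`, but some
  -- coordinate of `μ` is odd.
  have hne4 : t * μ j ≠ 4 := fun h4 => by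
    have h5 := key 4 h4.symm
    push_cast at h5
    obtain ⟨i, hi⟩ := hμ.exists_odd h.odd
    obtain ⟨e, he⟩ : ∃ e : ℤ, μ j = 2 * e := by
      rcases ht1 with rfl | rfl
      · exact ⟨2, by omega⟩
      · exact ⟨-2, by omega⟩
    have hee : e = 2 ∨ e = -2 := by rcases ht1 with rfl | rfl <;> omega
    have h9 := hn.eq_smul (i := j) (by
      push_cast; rw [he]; push_cast
      rcases hee with rfl | rfl <;> push_cast <;> linarith) e he
    rw [h9] at hi
    simp only [Pi.smul_apply, smul_eq_mul] at hi
    rcases hee with rfl | rfl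
    · exact Int.not_even_iff_odd.2 hi (even_two.mul_right _)
    · exact Int.not_even_iff_odd.2 hi ((by decide : Even (-2 : ℤ)).mul_right _)
  have : t * t = 1 := by rcases ht1 with rfl | rfl <;> norm_num
  omega

/-- The short simple roots have the same length: the ratio `3 / 2` of squared lengths is
impossible. -/
theorem short_len_eq {i j : I} (hi : 2 * D.len i < 2 * D.len D.zero / k ^ 2)
    (hj : 2 * D.len j < 2 * D.len D.zero / k ^ 2) : D.len i = D.len j := by
  have key : ∀ i j, ¬ ((2 : ℚ) * D.len i = 1 ∧ (3 : ℚ) * D.len j = 1) := by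
    rintro i j ⟨hi, hj⟩
    obtain ⟨μ, hμ, hμj⟩ := exists_weylOrbit_ne_zero (hasNorm_clRoot (D := D) i) (by linarith) j
    obtain ⟨x, hx, hl⟩ := exists_lift_of_weylOrbit (isLift_sr i) hμ
    obtain ⟨t, ht⟩ := exists_int_of_mem (D.len_pair_mem hx.len_mem_sr j)
    rw [← hl j] at ht
    have h2 := ((hasNorm_clRoot (D := D) i).of_weylOrbit hμ).sq_le j
    have hi' : D.len i = 1 / 2 := by linarith
    have hj' : D.len j = 1 / 3 := by linarith
    rw [hi', hj'] at ht h2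
    have h3 : (2 * μ j : ℚ) = 3 * t := by linarith
    have h4 : 2 * μ j = 3 * t := by exact_mod_cast h3
    have h5 : ((μ j * μ j : ℤ) : ℚ) ≤ (6 : ℤ) := by push_cast at h2 ⊢; linarith
    have h6 : μ j * μ j ≤ 6 := by exact_mod_cast h5
    have : -3 < μ j := by nlinarith
    have : μ j < 3 := by nlinarith
    omega
  obtain ⟨m, hm, hmi⟩ := h.short_ratio hi
  obtain ⟨m', hm', hmj⟩ := h.short_ratio hj
  rcases hm with rfl | rfl <;> rcases hm' with rfl | rfl <;> push_cast at hmi hmj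
  · linarith
  · exact absurd ⟨hmi, hmj⟩ (key i j)
  · exact absurd ⟨hmj, hmi⟩ (key j i)
  · linarith

/-- The orbit of the weight of an adjoint node has the metric properties of `AdjointLattice`, with
`N = (α_0, α_0) / k²`. -/
theorem adjointLattice : ∃ m u, D.AdjointLattice r ϖ m (2 * D.len D.zero / k ^ 2) u := by
  have hk0 := h.k_pos
  have h0 := D.len_pos D.zero
  have hNpos : 0 < 2 * D.len D.zero / k ^ 2 := by positivity
  have hsplit : ∃ m : ℤ, ∃ u : ℚ, (m = 2 ∨ m = 3) ∧ 0 < u ∧ 2 * D.len D.zero / k ^ 2 = m * u ∧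
      ∀ j, 2 * D.len j < 2 * D.len D.zero / k ^ 2 → 2 * D.len j = u ∧ k = 1 ∧ m * D.len j = 1 := by
    -- Without short simple roots the value of `m` is arbitrary.
    by_cases hs : ∃ j, 2 * D.len j < 2 * D.len D.zero / k ^ 2
    · obtain ⟨j, hj⟩ := hs
      obtain ⟨m, hm, hmj⟩ := h.short_ratio hj
      have hk := h.k_eq_one hj
      refine ⟨m, 2 * D.len j, hm, by linarith [D.len_pos j], ?_, fun i hi => ?_⟩
      · rw [h.len_zero hk, hk]; push_cast; linarith
      · rw [h.short_len_eq hi hj]; exact ⟨rfl, hk, hmj⟩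
    · push Not at hs
      exact ⟨2, 2 * D.len D.zero / k ^ 2 / 2, Or.inl rfl, by positivity, by push_cast; ring,
        fun j hj => absurd hj (not_lt.2 (hs j))⟩
  obtain ⟨m, u, hm, hu, hN, hshort⟩ := hsplit
  have hk2 : (1 : ℚ) ≤ k ^ 2 := by rcases h.k_eq with rfl | rfl <;> norm_num
  have hz : 2 * D.len D.zero / k ^ 2 ≤ 2 * D.len D.zero := div_le_self (by linarith) hk2
  have hroot0 : reflect D.A D.zero ϖ = -ϖ := by
    have h1 := congrFun h.root_eq D.zero
    simp only [Pi.neg_apply, clRoot, D.diag, Pi.smul_apply, smul_eq_mul] at h1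
    have h2 : clRoot D.A D.zero = -(k • ϖ) := by rw [← h.root_eq, neg_neg]
    rw [reflect, h2, smul_neg, sub_neg_eq_add, smul_smul, mul_comm, ← h1]
    funext j; simp; ring
  refine ⟨m, u, hm, hu, hN, h.hasNorm, ?_, fun j hj => (hshort j hj).1, fun j hj μ hμ => ?_, ?_,
    fun j hj μ hμ => ?_, hz, ?_, h.ne, h.dom, h.add_ne, h.row, k, fun hk => ?_, h.root_eq⟩
  · have := (WeylOrbit.refl (A := D.A) (J := Set.univ) (μ := ϖ)).step D.zero (Set.mem_univ _)
    rwa [hroot0] at this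
  · obtain ⟨-, hk, hmj⟩ := hshort j hj
    obtain ⟨t, ht⟩ := h.weight_mem hμ j
    rw [h.len_zero hk, hk] at ht
    refine ⟨t, ?_⟩
    have : (μ j : ℚ) = m * t := by
      push_cast at ht
      linear_combination (m : ℚ) * ht - (μ j : ℚ) * hmj
    exact_mod_cast this
  -- The lattice of weights with lifts as in `orbit_lift`.
  · refine ⟨⟨⟨⟨{μ | ∃ x, D.IsLift x μ ∧ ∀ q, x q * D.len q / (D.len D.zero / k) ∈ intQ}, ?_⟩, ?_⟩, ?_⟩,
      fun μ hμ => h.orbit_lift hμ, ?_⟩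
    · rintro μ ν ⟨x, hx, hx'⟩ ⟨y, hy, hy'⟩
      refine ⟨x + y, hx.add hy, fun q => ?_⟩
      rw [Pi.add_apply, add_mul, add_div]
      exact intQ.add_mem (hx' q) (hy' q)
    · exact ⟨0, fun i => by simp [pair_zero], fun q => by simp [intQ.zero_mem]⟩
    · rintro μ ⟨x, hx, hx'⟩
      refine ⟨-x, hx.neg, fun q => ?_⟩
      rw [Pi.neg_apply, neg_mul, neg_div]
      exact intQ.neg_mem (hx' q)
    · rintro i j hij hi hj ⟨x, hx, hx'⟩
      obtain ⟨-, hk, hmi⟩ := hshort i hi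
      have hl0 := h.len_zero hk
      have hl : D.IsLift (sr i + -sr j) (clRoot D.A i - clRoot D.A j) := by
        rw [sub_eq_add_neg]; exact (isLift_sr i).add (isLift_sr j).neg
      obtain ⟨t, rfl⟩ := hl.eq_add hx
      have hi0 : D.zero ≠ i := fun h => by rw [← h] at hi; linarith
      have hj0 : D.zero ≠ j := fun h => by rw [← h] at hj; linarith
      have e1 := hx' D.zero
      have e2 := hx' i
      rw [hl0, hk] at e1 e2
      simp [sr, hi0, hj0, hij, delta, D.d_zero] at e1 e2
      have e3 : (D.d i : ℚ) * D.len i = D.c i := by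
        have : (D.d i : ℚ) ≠ 0 := by exact_mod_cast (D.d_pos i).ne'
        rw [len]; field_simp
      -- A lift of `α_i - α_j` in that lattice would make `len i = 1 / m` an integer.
      have e4 : D.len i ∈ intQ := by
        have := intQ.sub_mem e2 (intQ.mul_mem e1 (nat_mem_intQ (D.c i)))
        have h5 : (1 + t * (D.d i : ℚ)) * D.len i - t * D.c i = D.len i := by
          rw [← e3]; ring
        rwa [h5] at this
      have e5 := one_le_of_mem_intQ e4 (D.len_pos i)
      rcases hm with rfl | rfl <;> push_cast at hmi <;> linarith
  · obtain ⟨hju, hk, hmi⟩ := hshort j hj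
    -- By induction along the orbit; at `ϖ = -α_0` the condition on the length means `⟨h_0, ν⟩ =
    -- 1`, and `ϖ + ν = s_0 ν`.
    induction hμ with
    | refl =>
      intro ν hν hn
      have h1 : ϖ = -clRoot D.A D.zero := by rw [h.root_eq, hk, one_smul]
      have h2 := (((hasNorm_clRoot (D := D) j).of_weylOrbit hν).add_smul D.zero (-1)).unique
        (n' := u) (by rwa [neg_one_smul, ← h1, add_comm])
      rw [hju] at h2
      have h3 : ((-1 * (ν D.zero + -1) : ℤ) : ℚ) = 0 := by
        have : 2 * D.len D.zero * ((-1 * (ν D.zero + -1) : ℤ) : ℚ) = 0 := by linarith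
        exact (mul_eq_zero.1 this).resolve_left (by linarith)
      have h4 : -1 * (ν D.zero + -1) = 0 := by exact_mod_cast h3
      have h5 : ϖ + ν = reflect D.A D.zero ν := by
        rw [reflect, show ν D.zero = 1 by omega, one_smul, h1]; abel
      rw [h5]
      exact hν.step _ (Set.mem_univ _)
    | @step μ i hi _ ih =>
      intro ν hν hn
      have h1 : reflect D.A i μ + ν = reflect D.A i (μ + reflect D.A i ν) := by
        rw [reflect_add, reflect_reflect]
      rw [h1] at hn ⊢
      have h2 := hn.reflect i
      rw [reflect_reflect] at h2
      exact (ih _ (hν.step i hi) h2).step i hi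
  · have := h.len_le
    rw [div_le_iff₀ (by positivity)]
    linarith
  · rw [hk] at hk0; norm_num at hk0

end AdjointData
end AffineDatum

/-! ### The weights of the adjoint module -/

namespace AffineDatum

variable {I : Type u} [Fintype I] [DecidableEq I] {D : AffineDatum I}

theorem strUp_eq {R : Finset (Pcl I)} {i : I} {μ : Pcl I} {p q : ℕ}
    (h : ∀ k : ℤ, μ + k • clRoot D.A i ∈ R ↔ -(p : ℤ) ≤ k ∧ k ≤ q) : D.strUp R i μ = q :=
  sSup_of_iff_le fun k => by rw [Set.mem_ofPred_eq, h]; omega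

theorem strDown_eq {R : Finset (Pcl I)} {i : I} {μ : Pcl I} {p q : ℕ}
    (h : ∀ k : ℤ, μ + k • clRoot D.A i ∈ R ↔ -(p : ℤ) ≤ k ∧ k ≤ q) : D.strDown R i μ = p :=
  sSup_of_iff_le fun k => by
    rw [Set.mem_ofPred_eq, sub_eq_add_neg, ← neg_smul, h]; omega

theorem reflect_add_smul (i : I) (μ : Pcl I) (k : ℤ) :
    reflect D.A i (μ + k • clRoot D.A i) = μ + (-μ i - k) • clRoot D.A i := by
  funext j
  simp only [reflect_apply, Pi.add_apply, Pi.smul_apply, smul_eq_mul, clRoot, D.diag]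
  ring

theorem reflect_eq (i : I) (μ : Pcl I) : reflect D.A i μ = μ + (-μ i) • clRoot D.A i := by
  rw [reflect, neg_smul, sub_eq_add_neg]

/-- A product of two off-diagonal entries is less than four unless two roots are opposite. -/
theorem entry_cases (hne : ∀ i j, i ≠ j → clRoot D.A i + clRoot D.A j ≠ 0) {i j : I} (hij : i ≠ j) :
    ¬ (D.A i j = -2 ∧ D.A j i = -2) := by
  rintro ⟨h1, h2⟩
  have hs := D.len_symm i j
  rw [h1, h2] at hs
  have h3 := (hasNorm_clRoot (D := D) i).add_smul j 1
  have h4 : 2 * D.len i + 2 * D.len j * ((1 * (clRoot D.A i j + 1) : ℤ) : ℚ) = 0 := by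
    rw [clRoot, h2]; push_cast at hs ⊢; linarith
  rw [h4, one_smul] at h3
  exact hne i j hij h3.eq_zero

theorem entry_adj (hne : ∀ i j, i ≠ j → clRoot D.A i + clRoot D.A j ≠ 0) {i j : I} (hij : i ≠ j)
    (h0 : D.A i j ≠ 0) : D.A i j = -1 ∨ D.A j i = -1 := by
  have h1 := D.entry_mul_le i j
  have h2 := D.neg_entry_pos hij h0
  have h3 := D.neg_entry_pos hij.symm (fun h => h0 ((D.zero_iff i j).2 h))
  have h4 := entry_cases hne hij
  by_contra hcon
  push Not at hcon
  have h5 : D.A i j ≤ -2 := by omega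
  have h6 : D.A j i ≤ -2 := by omega
  have : -3 < D.A i j := by nlinarith
  have : -3 < D.A j i := by nlinarith
  omega

namespace AdjointLattice

variable {r : I} {ϖ : Pcl I} {m : ℤ} {N u : ℚ}

/-- The weights of the adjoint module: the orbit of `ϖ` and the orbits of the short simple roots. -/
def IsWeight (D : AffineDatum I) (ϖ : Pcl I) (N : ℚ) (μ : Pcl I) : Prop :=
  WeylOrbit D.A Set.univ ϖ μ ∨ ∃ j, 2 * D.len j < N ∧ WeylOrbit D.A Set.univ (clRoot D.A j) μ

theorem IsWeight.reflect {μ : Pcl I} (hμ : IsWeight D ϖ N μ) (i : I) :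
    IsWeight D ϖ N (reflect D.A i μ) := by
  rcases hμ with hμ | ⟨j, hj, hμ⟩
  · exact Or.inl (hμ.step i (Set.mem_univ i))
  · exact Or.inr ⟨j, hj, hμ.step i (Set.mem_univ i)⟩

theorem IsWeight.of_reflect {μ : Pcl I} (i : I) (hμ : IsWeight D ϖ N (QuantumAffine.reflect D.A i μ)) :
    IsWeight D ϖ N μ := by
  have := hμ.reflect i
  rwa [reflect_reflect] at this

variable (h : D.AdjointLattice r ϖ m N u)
include h

theorem m_ge : 2 ≤ m := by rcases h.m_eq with rfl | rfl <;> norm_num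

theorem m_ge' : (2 : ℚ) ≤ m := by exact_mod_cast h.m_ge

theorem u_lt : u < N := by
  have := h.m_ge'
  have := h.u_pos
  rw [h.N_eq]; nlinarith

theorem N_pos : 0 < N := h.u_pos.trans h.u_lt

theorem orbit_neg {μ : Pcl I} (hμ : WeylOrbit D.A Set.univ ϖ μ) : WeylOrbit D.A Set.univ ϖ (-μ) :=
  h.neg.trans hμ.neg

theorem long_norm {μ : Pcl I} (hμ : WeylOrbit D.A Set.univ ϖ μ) : D.HasNorm μ N :=
  h.norm.of_weylOrbit hμ

theorem short_norm {μ : Pcl I} {j : I} (hj : 2 * D.len j < N)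
    (hμ : WeylOrbit D.A Set.univ (clRoot D.A j) μ) : D.HasNorm μ u :=
  h.short_eq j hj ▸ (hasNorm_clRoot j).of_weylOrbit hμ

theorem norm_cases {μ : Pcl I} (hμ : IsWeight D ϖ N μ) :
    (WeylOrbit D.A Set.univ ϖ μ ∧ D.HasNorm μ N) ∨
      ((∃ j, 2 * D.len j < N ∧ WeylOrbit D.A Set.univ (clRoot D.A j) μ) ∧ D.HasNorm μ u) := by
  rcases hμ with hμ | ⟨j, hj, hμ⟩
  · exact Or.inl ⟨hμ, h.long_norm hμ⟩
  · exact Or.inr ⟨⟨j, hj, hμ⟩, h.short_norm hj hμ⟩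

theorem exists_norm {μ : Pcl I} (hμ : IsWeight D ϖ N μ) :
    ∃ n, D.HasNorm μ n ∧ 0 < n ∧ n ≤ N ∧ (n = N ∨ n = u) := by
  rcases h.norm_cases hμ with ⟨-, hn⟩ | ⟨-, hn⟩
  · exact ⟨N, hn, h.N_pos, le_rfl, Or.inl rfl⟩
  · exact ⟨u, hn, h.u_pos, h.u_lt.le, Or.inr rfl⟩

theorem weight_neg {μ : Pcl I} (hμ : IsWeight D ϖ N μ) : IsWeight D ϖ N (-μ) := by
  rcases hμ with hμ | ⟨j, hj, hμ⟩
  · exact Or.inl (h.orbit_neg hμ)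
  · refine Or.inr ⟨j, hj, ?_⟩
    have h1 := (WeylOrbit.refl (A := D.A) (J := Set.univ) (μ := clRoot D.A j)).step j (Set.mem_univ _)
    rw [reflect_clRoot] at h1
    exact h1.trans hμ.neg

theorem ne_zero {μ : Pcl I} (hμ : IsWeight D ϖ N μ) : μ ≠ 0 := by
  rintro rfl
  obtain ⟨n, hn, hpos, -⟩ := h.exists_norm hμ
  exact hpos.ne' (hn.unique hasNorm_zero)

theorem norm_eq_u {μ : Pcl I} (hμ : IsWeight D ϖ N μ) {n : ℚ} (hn : D.HasNorm μ n) : n = N ∨ n = u := by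
  obtain ⟨n', hn', -, -, hc⟩ := h.exists_norm hμ
  rwa [hn.unique hn']

theorem norm_le {μ : Pcl I} (hμ : IsWeight D ϖ N μ) {n : ℚ} (hn : D.HasNorm μ n) : n ≤ N := by
  rcases h.norm_eq_u hμ hn with rfl | rfl
  · exact le_rfl
  · exact h.u_lt.le

/-- A multiple of a simple root in the system is the root or its negative. -/
theorem smul_root {i : I} {k k' : ℤ} (hk : IsWeight D ϖ N (k • clRoot D.A i))
    (hk' : IsWeight D ϖ N (k' • clRoot D.A i)) : k' = k ∨ k' = -k := by
  have h1 := h.norm_eq_u hk (hasNorm_smul_clRoot i k)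
  have h2 := h.norm_eq_u hk' (hasNorm_smul_clRoot i k')
  have hm := h.N_eq
  have hl := D.len_pos i
  have key : ∀ a b : ℤ, 2 * D.len i * (a * a : ℤ) = u → 2 * D.len i * (b * b : ℤ) = N → False := by
    intro a b ha hb
    have e1 : 2 * D.len i * ((b * b : ℤ) : ℚ) = 2 * D.len i * ((m * (a * a) : ℤ) : ℚ) := by
      rw [hb, hm, ← ha]; push_cast; ring
    have e2 : b * b = m * (a * a) := by
      have := mul_left_cancel₀ (by linarith : (2 * D.len i) ≠ 0) e1
      exact_mod_cast this
    have ha0 : a ≠ 0 := fun h0 => by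
      rw [h0] at ha; have := h.u_pos; norm_num at ha; linarith
    -- Neither `2` nor `3` is a square.
    have hsq : IsSquare (m : ℤ) := by
      have h3 : a ∣ b := by
        rw [← Int.pow_dvd_pow_iff two_ne_zero]
        exact ⟨m, by rw [sq, sq, e2]; ring⟩
      obtain ⟨c, rfl⟩ := h3
      refine ⟨c, ?_⟩
      apply mul_right_cancel₀ (mul_ne_zero ha0 ha0)
      rw [← e2]; ring
    obtain ⟨c, hc⟩ := hsq
    rcases h.m_eq with rfl | rfl
    · have : -2 < c := by nlinarith
      have : c < 2 := by nlinarith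
      interval_cases c <;> omega
    · have : -2 < c := by nlinarith
      have : c < 2 := by nlinarith
      interval_cases c <;> omega
  have fin : 2 * D.len i * ((k' * k' : ℤ) : ℚ) = 2 * D.len i * ((k * k : ℤ) : ℚ) →
      k' = k ∨ k' = -k := fun he => by
    have := mul_left_cancel₀ (by linarith : (2 * D.len i) ≠ 0) he
    exact mul_self_eq_mul_self_iff.1 (by exact_mod_cast this)
  rcases h1 with h1 | h1 <;> rcases h2 with h2 | h2
  · exact fin (h2.trans h1.symm)
  · exact (key _ _ h2 h1).elim
  · exact (key _ _ h1 h2).elim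
  · exact fin (h2.trans h1.symm)

theorem root_iff {i : I} {k : ℤ} (hk : IsWeight D ϖ N (k • clRoot D.A i)) {k' : ℤ} :
    IsWeight D ϖ N (k' • clRoot D.A i) ↔ k' = k ∨ k' = -k := by
  refine ⟨h.smul_root hk, ?_⟩
  rintro (rfl | rfl)
  · exact hk
  · rw [neg_smul]; exact h.weight_neg hk

/-- Equality in the Cauchy–Schwarz inequality for a weight not longer than `α_i`. -/
theorem eq_root_of_two {μ : Pcl I} {n : ℚ} (hn : D.HasNorm μ n) {i : I} (hi : n ≤ 2 * D.len i)
    (h2 : 2 ≤ |μ i|) : μ = clRoot D.A i ∨ μ = -clRoot D.A i := by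
  have hl := D.len_pos i
  have h3 := hn.sq_le i
  have h4 : ((μ i * μ i : ℤ) : ℚ) ≤ (4 : ℤ) := by
    apply le_of_mul_le_mul_left _ hl
    push_cast at h3 ⊢
    linarith
  have h5 : μ i * μ i ≤ 4 := by exact_mod_cast h4
  have h6 : |μ i| * |μ i| ≤ 4 := by rwa [abs_mul_abs_self]
  have h7 : |μ i| = 2 := by nlinarith
  rcases (abs_eq (by norm_num)).1 h7 with h8 | h8
  · left
    have := hn.eq_smul (i := i) (by rw [h8] at h3 ⊢; push_cast at h3 ⊢; linarith) 1 (by omega)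
    rwa [one_smul] at this
  · right
    have := hn.eq_smul (i := i) (by rw [h8] at h3 ⊢; push_cast at h3 ⊢; linarith) (-1) (by omega)
    rwa [neg_one_smul] at this

/-- The weights pair with a long simple coroot as small as possible. -/
theorem long_bound {i : I} (hi : N ≤ 2 * D.len i) {μ : Pcl I} (hμ : IsWeight D ϖ N μ)
    (h1 : μ ≠ clRoot D.A i) (h2 : μ ≠ -clRoot D.A i) : |μ i| ≤ 1 := by
  by_contra hcon
  obtain ⟨n, hn, -, hle, -⟩ := h.exists_norm hμ
  rcases h.eq_root_of_two hn (hle.trans hi) (by omega) with h3 | h3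
  · exact h1 h3
  · exact h2 h3

/-- The short weights pair with a short simple coroot as small as possible. -/
theorem short_bound {i : I} (hi : 2 * D.len i < N) {μ : Pcl I} (hμ : D.HasNorm μ u)
    (h1 : μ ≠ clRoot D.A i) (h2 : μ ≠ -clRoot D.A i) : |μ i| ≤ 1 := by
  by_contra hcon
  rcases h.eq_root_of_two hμ (h.short_eq i hi).ge (by omega) with h3 | h3
  · exact h1 h3
  · exact h2 h3

/-- The long weights pair with a short simple coroot to `0` or `±m`. -/
theorem long_cases {j : I} (hj : 2 * D.len j < N) {μ : Pcl I} (hμ : WeylOrbit D.A Set.univ ϖ μ) :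
    μ j = 0 ∨ μ j = m ∨ μ j = -m := by
  obtain ⟨t, ht⟩ := h.short_weight j hj μ hμ
  have h1 := (h.long_norm hμ).sq_le j
  have h2 := h.short_eq j hj
  have hl := D.len_pos j
  have h3 : ((μ j * μ j : ℤ) : ℚ) ≤ (4 * m : ℤ) := by
    apply le_of_mul_le_mul_left _ hl
    rw [h.N_eq, ← h2] at h1
    push_cast at h1 ⊢
    linarith
  have h4 : μ j * μ j ≤ 4 * m := by exact_mod_cast h3
  have hm := h.m_ge
  rw [ht] at h4 ⊢
  have h5 : t * t < 4 := by
    have : m * (m * (t * t)) ≤ m * 4 := by linarith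
    have := le_of_mul_le_mul_left this (by omega)
    rcases h.m_eq with rfl | rfl <;> nlinarith
  have : -2 < t := by nlinarith
  have : t < 2 := by nlinarith
  have : t = 0 ∨ t = 1 ∨ t = -1 := by omega
  rcases this with rfl | rfl | rfl <;> simp

theorem short_of_long {j : I} (hj : 2 * D.len j < N) {μ : Pcl I} (hμ : WeylOrbit D.A Set.univ ϖ μ)
    (hμj : μ j = -m) : WeylOrbit D.A Set.univ (clRoot D.A j) (μ + clRoot D.A j) := by
  refine h.mid j hj μ hμ _ .refl ?_
  have h1 := (h.long_norm hμ).add_smul j 1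
  rw [one_smul, h.short_eq j hj, hμj, h.N_eq] at h1
  convert h1 using 1
  push_cast; ring

theorem norm_notMem {μ : Pcl I} {n : ℚ} (hn : D.HasNorm μ n) (hlt : N < n) : ¬ IsWeight D ϖ N μ :=
  fun hμ => absurd (h.norm_le hμ hn) (not_le.2 hlt)

/-- The string through a long weight with `⟨h_j, μ⟩ = -m`. -/
theorem long_string {j : I} (hj : 2 * D.len j < N) {μ : Pcl I} (hμ : WeylOrbit D.A Set.univ ϖ μ)
    (hμj : μ j = -m) (k : ℤ) : IsWeight D ϖ N (μ + k • clRoot D.A j) ↔ 0 ≤ k ∧ k ≤ m := by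
  have hu := h.u_pos
  have h1 : IsWeight D ϖ N (μ + (1 : ℤ) • clRoot D.A j) := by
    rw [one_smul]; exact Or.inr ⟨j, hj, h.short_of_long hj hμ hμj⟩
  have h0 : IsWeight D ϖ N (μ + (0 : ℤ) • clRoot D.A j) := by
    rw [zero_smul, add_zero]; exact Or.inl hμ
  have h2 := h1.reflect j
  have h3 := h0.reflect j
  rw [reflect_add_smul, hμj] at h2 h3
  constructor
  · intro hk
    by_contra hcon
    -- Outside the segment the weights `μ + k α_j` are longer than `ϖ`.
    refine h.norm_notMem ((h.long_norm hμ).add_smul j k) ?_ hk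
    rw [h.short_eq j hj, hμj]
    have hm := h.m_ge
    have h5 : 0 < k * (-m + k) := by
      rcases lt_or_ge k 0 with h6 | h6
      · exact mul_pos_of_neg_of_neg h6 (by omega)
      · exact mul_pos (by omega) (by omega)
    have : (0 : ℚ) < ((k * (-m + k) : ℤ) : ℚ) := by exact_mod_cast h5
    nlinarith
  · rintro ⟨hk0, hkm⟩
    -- The end points and their neighbours fill the segment because `m ≤ 3`.
    have : k = 0 ∨ k = 1 ∨ k = m ∨ k = m - 1 := by rcases h.m_eq with rfl | rfl <;> omega
    rcases this with rfl | rfl | rfl | rfl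
    · exact h0
    · exact h1
    · convert h3 using 3; ring
    · convert h2 using 3; ring

/-- The string through a weight, if the pairings along the string are small. -/
theorem small_string {i : I} {μ : Pcl I} (hμ : IsWeight D ϖ N μ)
    (hs : ∀ k : ℤ, IsWeight D ϖ N (μ + k • clRoot D.A i) → |(μ + k • clRoot D.A i) i| ≤ 1) (k : ℤ) :
    IsWeight D ϖ N (μ + k • clRoot D.A i) ↔ k = 0 ∨ k = -μ i := by
  have h0 := hs 0 (by simpa using hμ)
  simp only [zero_smul, add_zero] at h0
  constructor
  · intro hk
    have h1 := hs k hk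
    simp only [Pi.add_apply, Pi.smul_apply, D.clRoot_self, smul_eq_mul] at h1
    rw [abs_le] at h0 h1
    omega
  · rintro (rfl | rfl)
    · simpa using hμ
    · rw [← reflect_eq]; exact hμ.reflect i

/-- The weights have root strings without gaps: either the string contains a long weight with
pairing `-m`, or all pairings along it are `0` or `±1`. -/
theorem exists_string {i : I} {μ : Pcl I} (hμ : IsWeight D ϖ N μ) (h1 : μ ≠ clRoot D.A i)
    (h2 : μ ≠ -clRoot D.A i) : ∃ p q : ℕ, (p : ℤ) - q = μ i ∧
    ∀ k : ℤ, IsWeight D ϖ N (μ + k • clRoot D.A i) ↔ -(p : ℤ) ≤ k ∧ k ≤ q := by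
  have hm := h.m_ge
  by_cases hlong : ∃ k : ℤ, 2 * D.len i < N ∧ WeylOrbit D.A Set.univ ϖ (μ + k • clRoot D.A i) ∧
      (μ + k • clRoot D.A i) i = -m
  · obtain ⟨k, hi, hk, hki⟩ := hlong
    have h3 : ∀ l : ℤ, IsWeight D ϖ N (μ + l • clRoot D.A i) ↔ 0 ≤ l - k ∧ l - k ≤ m := fun l => by
      rw [← h.long_string hi hk hki, add_assoc, ← add_smul, add_sub_cancel]
    have h4 := (h3 0).1 (by simpa using hμ)
    simp only [Pi.add_apply, Pi.smul_apply, D.clRoot_self, smul_eq_mul] at hki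
    refine ⟨(-k).toNat, (k + m).toNat, by omega, fun l => ?_⟩
    rw [h3]; omega
  · push Not at hlong
    have hs : ∀ k : ℤ, IsWeight D ϖ N (μ + k • clRoot D.A i) → |(μ + k • clRoot D.A i) i| ≤ 1 := by
      intro k hk
      -- a member of the string that is `±α_i` makes all members multiples of `α_i`
      have hne : ∀ s : ℤ, s = 1 ∨ s = -1 → μ + k • clRoot D.A i ≠ s • clRoot D.A i := by
        intro s hs he
        have h3 : μ = (s - k) • clRoot D.A i := by rw [sub_smul, ← he]; abel
        rw [he] at hk
        rw [h3] at hμ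
        have h4 : s - k = 1 ∨ s - k = -1 := by
          rcases h.smul_root hk hμ with h5 | h5 <;> rcases hs with rfl | rfl <;> omega
        rcases h4 with h4 | h4
        · exact h1 (by rw [h3, h4, one_smul])
        · exact h2 (by rw [h3, h4, neg_one_smul])
      have hne1 := hne 1 (Or.inl rfl)
      have hne2 := hne (-1) (Or.inr rfl)
      rw [one_smul] at hne1
      rw [neg_one_smul] at hne2
      -- A long weight with pairing `m` would reflect to one with pairing `-m`.
      by_cases hi : 2 * D.len i < N
      · rcases h.norm_cases hk with ⟨hO, -⟩ | ⟨-, hn⟩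
        · rcases h.long_cases hi hO with h5 | h5 | h5
          · rw [h5]; norm_num
          · exfalso
            have h6 := hO.step i (Set.mem_univ i)
            have h7 : reflect D.A i (μ + k • clRoot D.A i) i = -m := by
              rw [reflect_apply, D.diag, h5]; ring
            rw [reflect_add_smul] at h6 h7
            exact hlong _ hi h6 h7
          · exact absurd h5 (hlong k hi hO)
        · exact h.short_bound hi hn hne1 hne2
      · exact h.long_bound (not_lt.1 hi) hk hne1 hne2
    have h3 := h.small_string hμ hs
    have h0 := hs 0 (by simpa using hμ)
    simp only [zero_smul, add_zero] at h0
    rw [abs_le] at h0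
    refine ⟨(μ i).toNat, (-μ i).toNat, by omega, fun k => ?_⟩
    rw [h3]; omega

/-- The long weights are extremal, for reasons of length. -/
theorem up_notMem {j : I} {μ : Pcl I} (hμ : WeylOrbit D.A Set.univ ϖ μ) (hj : 0 ≤ μ j) :
    ¬ IsWeight D ϖ N (μ + clRoot D.A j) := by
  have h1 := (h.long_norm hμ).add_smul j 1
  rw [one_smul] at h1
  refine h.norm_notMem h1 ?_
  have hl := D.len_pos j
  have : (0 : ℚ) < ((1 * (μ j + 1) : ℤ) : ℚ) := by exact_mod_cast (by omega : 0 < 1 * (μ j + 1))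
  nlinarith

theorem down_notMem {j : I} {μ : Pcl I} (hμ : WeylOrbit D.A Set.univ ϖ μ) (hj : μ j ≤ 0) :
    ¬ IsWeight D ϖ N (μ - clRoot D.A j) := fun hcon => by
  have h1 := h.weight_neg hcon
  rw [neg_sub, sub_eq_add_neg, add_comm] at h1
  exact h.up_notMem (h.orbit_neg hμ) (by simpa using hj) h1

theorem weight_finite : {μ | IsWeight D ϖ N μ}.Finite := by
  have hb : ∀ i, ∃ b : ℕ, ∀ μ, IsWeight D ϖ N μ → |μ i| ≤ b := by
    intro i
    obtain ⟨b, hb⟩ := exists_nat_gt (2 * N / D.len i)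
    refine ⟨b, fun μ hμ => ?_⟩
    obtain ⟨n, hn, -, hle, -⟩ := h.exists_norm hμ
    have h1 := hn.sq_le i
    have hl := D.len_pos i
    have h2 : ((μ i * μ i : ℤ) : ℚ) < (b : ℚ) :=
      lt_of_le_of_lt ((le_div_iff₀ hl).2 (by linarith)) hb
    have h3 : μ i * μ i < b := by exact_mod_cast h2
    rw [← abs_mul_abs_self] at h3
    nlinarith [abs_nonneg (μ i)]
  choose b hb using hb
  refine (Set.finite_Icc (fun i => -(b i : ℤ) : Pcl I) fun i => (b i : ℤ)).subset fun μ hμ => ?_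
  exact ⟨fun i => (abs_le.1 (hb i μ hμ)).1, fun i => (abs_le.1 (hb i μ hμ)).2⟩

open Classical in
/-- The finite set of weights. -/
def weights : Finset (Pcl I) := h.weight_finite.toFinset

theorem mem_weights {μ : Pcl I} : μ ∈ h.weights ↔ IsWeight D ϖ N μ := by simp [weights]

theorem weight_string {i : I} {μ : Pcl I} (hμ : IsWeight D ϖ N μ) (h1 : μ ≠ clRoot D.A i)
    (h2 : μ ≠ -clRoot D.A i) : ((D.strDown h.weights i μ : ℤ) - D.strUp h.weights i μ) = μ i ∧
    ∀ k : ℤ, IsWeight D ϖ N (μ + k • clRoot D.A i) ↔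
      -(D.strDown h.weights i μ : ℤ) ≤ k ∧ k ≤ D.strUp h.weights i μ := by
  obtain ⟨p, q, hpq, hk⟩ := h.exists_string hμ h1 h2
  have hk' : ∀ k : ℤ, μ + k • clRoot D.A i ∈ h.weights ↔ -(p : ℤ) ≤ k ∧ k ≤ q := fun k => by
    rw [mem_weights, hk]
  rw [strUp_eq hk', strDown_eq hk']
  exact ⟨hpq, hk⟩

theorem strUp_zero {i : I} {μ : Pcl I} (hμ : IsWeight D ϖ N μ) (h1 : μ ≠ clRoot D.A i)
    (h2 : μ ≠ -clRoot D.A i) (hn : ¬ IsWeight D ϖ N (μ + clRoot D.A i)) :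
    D.strUp h.weights i μ = 0 := by
  have h3 := (h.weight_string hμ h1 h2).2 1
  rw [one_smul] at h3
  by_contra hcon
  exact hn (h3.2 (by omega))

theorem strDown_zero {i : I} {μ : Pcl I} (hμ : IsWeight D ϖ N μ) (h1 : μ ≠ clRoot D.A i)
    (h2 : μ ≠ -clRoot D.A i) (hn : ¬ IsWeight D ϖ N (μ - clRoot D.A i)) :
    D.strDown h.weights i μ = 0 := by
  have h3 := (h.weight_string hμ h1 h2).2 (-1)
  rw [neg_one_smul, ← sub_eq_add_neg] at h3
  by_contra hcon
  exact hn (h3.2 (by omega))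

theorem strUp_reflect {i j : I} (hij : D.A i j = 0) (μ : Pcl I) :
    D.strUp h.weights j (reflect D.A i μ) = D.strUp h.weights j μ := by
  have hr : reflect D.A i (clRoot D.A j) = clRoot D.A j := by
    rw [reflect, clRoot, hij, zero_smul, sub_zero]
  have hr' : ∀ k : ℤ, reflect D.A i μ + k • clRoot D.A j = reflect D.A i (μ + k • clRoot D.A j) := by
    intro k
    funext l
    have := congrFun hr l
    simp only [reflect_apply, Pi.add_apply, Pi.smul_apply, smul_eq_mul, clRoot, hij]
    ring
  simp only [strUp, mem_weights, hr']
  congr 1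
  ext k
  exact ⟨fun hk => hk.of_reflect i, fun hk => hk.reflect i⟩

theorem strDown_reflect {i j : I} (hij : D.A i j = 0) (μ : Pcl I) :
    D.strDown h.weights j (reflect D.A i μ) = D.strDown h.weights j μ := by
  have hr' : ∀ k : ℤ, reflect D.A i μ - k • clRoot D.A j = reflect D.A i (μ - k • clRoot D.A j) := by
    intro k
    funext l
    simp only [reflect_apply, Pi.sub_apply, Pi.smul_apply, smul_eq_mul, clRoot, hij]
    ring
  simp only [strDown, mem_weights, hr']
  congr 1
  ext k
  exact ⟨fun hk => hk.of_reflect i, fun hk => hk.reflect i⟩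

/-- A difference of simple roots is at least as long as the two roots together; it could only be a
weight if both are short, and then the lattice excludes it from the long orbit and its length
from the short ones. -/
theorem root_sub_notMem {i j : I} (hij : i ≠ j) : ¬ IsWeight D ϖ N (clRoot D.A j - clRoot D.A i) := by
  intro hw
  have h1 := (hasNorm_clRoot (D := D) j).add_smul i (-1)
  rw [neg_one_smul, ← sub_eq_add_neg] at h1
  have h2 : (0 : ℚ) ≤ -(D.A i j : ℚ) := by
    have := D.off_diag i j hij
    have : (0 : ℤ) ≤ -D.A i j := by omega
    exact_mod_cast this
  have hli := D.len_pos i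
  have hlj := D.len_pos j
  have h3 : 2 * D.len j + 2 * D.len i ≤
      2 * D.len j + 2 * D.len i * ((-1 * (clRoot D.A j i + -1) : ℤ) : ℚ) := by
    rw [clRoot]; push_cast; nlinarith
  have h4 := h.norm_le hw h1
  have hsi : 2 * D.len i < N := by linarith
  have hsj : 2 * D.len j < N := by linarith
  have hu := h.short_eq i hsi
  have hu' := h.short_eq j hsj
  have hup := h.u_pos
  rcases h.norm_cases hw with ⟨hO, -⟩ | ⟨-, hn⟩
  · obtain ⟨L, hL, hL'⟩ := h.lattice
    exact hL' j i hij.symm hsj hsi (hL _ hO)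
  · have := hn.unique h1
    linarith

end AdjointLattice
end AffineDatum

namespace AffineDatum

variable {I : Type u} [Fintype I] [DecidableEq I] {D : AffineDatum I}

namespace AdjointLattice

variable {r : I} {ϖ : Pcl I} {m : ℤ} {N u : ℚ} (h : D.AdjointLattice r ϖ m N u)
include h

theorem ne_of_apply {μ : Pcl I} {i : I} (hi : |μ i| ≤ 1) : μ ≠ clRoot D.A i ∧ μ ≠ -clRoot D.A i := by
  constructor <;> rintro rfl
  · rw [clRoot_self] at hi; norm_num at hi
  · rw [Pi.neg_apply, clRoot_self] at hi; norm_num at hi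

/-- The identity between string lengths that expresses the commutation of `e_i` and `f_j`. -/
def SquareId (h : D.AdjointLattice r ϖ m N u) (μ : Pcl I) (i j : I) : Prop :=
  D.qInt j (D.strUp h.weights j μ + 1) * D.qInt i (D.strDown h.weights i (μ - clRoot D.A j) + 1) =
    D.qInt i (D.strDown h.weights i μ + 1) * D.qInt j (D.strUp h.weights j (μ + clRoot D.A i) + 1)

theorem root_two_notMem {i : I} : ¬ (IsWeight D ϖ N (clRoot D.A i) ∧
    IsWeight D ϖ N (clRoot D.A i + clRoot D.A i)) := by
  rintro ⟨h1, h2⟩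
  have h3 := h.smul_root (i := i) (k := 1) (k' := 2) (by rwa [one_smul]) (by rwa [two_smul])
  omega

/-- The square if `α_i` is a long root. -/
theorem square_long_left {i j : I} (hij : i ≠ j) (hi : N ≤ 2 * D.len i) {μ : Pcl I}
    (hμ : IsWeight D ϖ N μ) (h1 : μ ≠ clRoot D.A j) (h2 : μ ≠ -clRoot D.A i)
    (hμ1 : IsWeight D ϖ N (μ + clRoot D.A i))
    (hμ3 : IsWeight D ϖ N (μ + clRoot D.A i - clRoot D.A j)) :
    IsWeight D ϖ N (μ - clRoot D.A j) ∧ h.SquareId μ i j := by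
  have hμi : μ ≠ clRoot D.A i := by
    rintro rfl; exact h.root_two_notMem ⟨hμ, hμ1⟩
  -- `⟨h_i, μ⟩ = -1`, as both `μ` and `μ + α_i` pair with `h_i` to at most one in absolute value.
  have b0 := h.long_bound hi hμ hμi h2
  have h11 : μ + clRoot D.A i ≠ clRoot D.A i := fun he => h.ne_zero hμ (by simpa using he)
  have h12 : μ + clRoot D.A i ≠ -clRoot D.A i := fun he => by
    have hb := congrFun he i
    simp only [Pi.add_apply, Pi.neg_apply, D.clRoot_self] at hb
    rw [abs_le] at b0; omega
  have b1 := h.long_bound hi hμ1 h11 h12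
  have e1 : (μ + clRoot D.A i) i = μ i + 2 := by rw [Pi.add_apply, D.clRoot_self]
  have hi1 : μ i = -1 := by rw [e1] at b1; rw [abs_le] at b0 b1; omega
  have hrefl : reflect D.A i μ = μ + clRoot D.A i := by rw [reflect_eq, hi1, neg_neg, one_smul]
  have e3 : (μ + clRoot D.A i - clRoot D.A j) i = 1 - D.A i j := by
    rw [Pi.sub_apply, e1, hi1, clRoot]; ring
  have h31 : μ + clRoot D.A i - clRoot D.A j ≠ clRoot D.A i := fun he => h1 (by
    have : μ - clRoot D.A j = 0 := by rw [← sub_eq_zero.2 he]; abel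
    exact sub_eq_zero.1 this)
  have hA := D.off_diag i j hij
  have h32 : μ + clRoot D.A i - clRoot D.A j ≠ -clRoot D.A i := fun he => by
    rw [he, Pi.neg_apply, D.clRoot_self] at e3; omega
  have b3 := h.long_bound hi hμ3 h31 h32
  -- For the same reason `a_ij = 0`, and `s_i` maps one side of the square to the other.
  have hA0 : D.A i j = 0 := by rw [e3] at b3; rw [abs_le] at b3; omega
  have hrefl3 : reflect D.A i (μ - clRoot D.A j) = μ + clRoot D.A i - clRoot D.A j := by
    rw [reflect_eq, Pi.sub_apply, hi1, clRoot, hA0, sub_zero, neg_neg, one_smul]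
    abel
  have hμ2 : IsWeight D ϖ N (μ - clRoot D.A j) := by
    rw [← hrefl3] at hμ3; exact hμ3.of_reflect i
  refine ⟨hμ2, ?_⟩
  have e2 : (μ - clRoot D.A j) i = -1 := by rw [Pi.sub_apply, hi1, clRoot, hA0, sub_zero]
  have down : ∀ ν : Pcl I, IsWeight D ϖ N ν → ν i = -1 → D.strDown h.weights i ν = 0 := by
    intro ν hν hνi
    obtain ⟨n1, n2⟩ := h.ne_of_apply (μ := ν) (i := i) (by rw [hνi]; norm_num)
    refine h.strDown_zero hν n1 n2 fun hcon => ?_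
    have e : (ν - clRoot D.A i) i = -3 := by rw [Pi.sub_apply, hνi, D.clRoot_self]; norm_num
    have := h.long_bound hi hcon (fun he => by rw [he, D.clRoot_self] at e; omega)
      (fun he => by rw [he, Pi.neg_apply, D.clRoot_self] at e; omega)
    rw [e] at this; norm_num at this
  rw [SquareId, down _ hμ hi1, down _ hμ2 e2, ← hrefl, h.strUp_reflect hA0]
  ring

/-- The square if `α_j` is a long root. -/
theorem square_long_right {i j : I} (hij : i ≠ j) (hj : N ≤ 2 * D.len j) {μ : Pcl I}
    (hμ : IsWeight D ϖ N μ) (h1 : μ ≠ clRoot D.A j)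
    (hμ1 : IsWeight D ϖ N (μ + clRoot D.A i))
    (hμ3 : IsWeight D ϖ N (μ + clRoot D.A i - clRoot D.A j)) :
    IsWeight D ϖ N (μ - clRoot D.A j) ∧ h.SquareId μ i j := by
  have h11 : μ + clRoot D.A i ≠ clRoot D.A j := fun he => h.ne_zero hμ3 (by rw [he, sub_self])
  have h12 : μ + clRoot D.A i ≠ -clRoot D.A j := fun he => by
    rw [he] at hμ3 hμ1
    have := h.smul_root (i := j) (k := -1) (k' := -2) (by rwa [neg_one_smul]) (by
      convert hμ3 using 1
      rw [neg_smul, two_smul]; abel)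
    omega
  -- As in `square_long_left`, `⟨h_j, μ + α_i⟩ = 1` and `a_ij = 0`.
  have b1 := h.long_bound hj hμ1 h11 h12
  have e3 : (μ + clRoot D.A i - clRoot D.A j) j = (μ + clRoot D.A i) j - 2 := by
    rw [Pi.sub_apply, D.clRoot_self]
  have e3' := h.long_bound hj hμ3 (fun he => by
    rw [he, D.clRoot_self] at e3; rw [abs_le] at b1; omega) (fun he => h.ne_zero hμ1 (by
      have : μ + clRoot D.A i - clRoot D.A j + clRoot D.A j = 0 := by rw [he]; abel
      rwa [sub_add_cancel] at this))
  have hj1 : (μ + clRoot D.A i) j = 1 := by rw [e3] at e3'; rw [abs_le] at b1 e3'; omega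
  have e0 : μ j = 1 - D.A j i := by rw [← hj1, Pi.add_apply, clRoot]; ring
  have hA := D.off_diag j i hij.symm
  have b0 := h.long_bound hj hμ h1 (fun he => by
    rw [he, Pi.neg_apply, D.clRoot_self] at e0; omega)
  have hA0 : D.A j i = 0 := by rw [e0] at b0; rw [abs_le] at b0; omega
  have hμj : μ j = 1 := by rw [e0, hA0]; ring
  have hrefl : reflect D.A j μ = μ - clRoot D.A j := by rw [reflect, hμj, one_smul]
  refine ⟨hrefl ▸ hμ.reflect j, ?_⟩
  have up : ∀ ν : Pcl I, IsWeight D ϖ N ν → ν j = 1 → D.strUp h.weights j ν = 0 := by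
    intro ν hν hνj
    obtain ⟨n1, n2⟩ := h.ne_of_apply (μ := ν) (i := j) (by rw [hνj]; norm_num)
    refine h.strUp_zero hν n1 n2 fun hcon => ?_
    have e : (ν + clRoot D.A j) j = 3 := by rw [Pi.add_apply, hνj, D.clRoot_self]; norm_num
    have := h.long_bound hj hcon (fun he => by rw [he, D.clRoot_self] at e; omega)
      (fun he => by rw [he, Pi.neg_apply, D.clRoot_self] at e; omega)
    rw [e] at this; norm_num at this
  rw [SquareId, up _ hμ hμj, up _ hμ1 hj1, ← hrefl, h.strDown_reflect hA0]
  ring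

/-- The norm of a neighbour of a weight in a short direction. -/
theorem norm_add {i : I} (hi : 2 * D.len i < N) {μ : Pcl I} {n : ℚ} (hμ : D.HasNorm μ n) :
    D.HasNorm (μ + clRoot D.A i) (n + u * (μ i + 1 : ℤ)) := by
  have := hμ.add_smul i 1
  rwa [one_smul, h.short_eq i hi, one_mul] at this

theorem norm_sub {i : I} (hi : 2 * D.len i < N) {μ : Pcl I} {n : ℚ} (hμ : D.HasNorm μ n) :
    D.HasNorm (μ - clRoot D.A i) (n + u * (1 - μ i : ℤ)) := by
  have := hμ.add_smul i (-1)
  rw [neg_one_smul, ← sub_eq_add_neg, h.short_eq i hi] at this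
  convert this using 3
  push_cast; ring

/-- Comparison of two squared lengths in multiples of `u`. -/
theorem int_of_u {a : ℚ} {b c : ℤ} (h1 : a + u * b = a + u * c) : b = c := by
  have := mul_left_cancel₀ h.u_pos.ne' (add_left_cancel h1)
  exact_mod_cast this

theorem N_eq_u : N = u + u * (m - 1 : ℤ) := by rw [h.N_eq]; push_cast; ring

/-- The square if both roots are short. The lengths of the weights at the corners determine the
pairings, and hence the positions of the corners in their strings. -/
theorem square_short {i j : I} (hij : i ≠ j) (hi : 2 * D.len i < N) (hj : 2 * D.len j < N)
    {μ : Pcl I} (hμ : IsWeight D ϖ N μ) (h1 : μ ≠ clRoot D.A j) (h2 : μ ≠ -clRoot D.A i)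
    (hμ1 : IsWeight D ϖ N (μ + clRoot D.A i))
    (hμ3 : IsWeight D ϖ N (μ + clRoot D.A i - clRoot D.A j)) :
    IsWeight D ϖ N (μ - clRoot D.A j) ∧ h.SquareId μ i j := by
  have hlen : D.len i = D.len j := by
    have := h.short_eq i hi
    have := h.short_eq j hj
    linarith
  have hsymm : D.A j i = D.A i j := by
    have h3 := D.len_symm i j
    rw [hlen] at h3
    have := mul_left_cancel₀ (D.len_pos j).ne' h3
    exact_mod_cast this.symm
  have hA : D.A i j = 0 ∨ D.A i j = -1 := by
    by_cases h0 : D.A i j = 0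
    · exact Or.inl h0
    · rcases entry_adj h.add_ne hij h0 with h3 | h3
      · exact Or.inr h3
      · exact Or.inr (hsymm ▸ h3)
  have hm := h.m_eq
  have hNu := h.N_eq_u
  have e1i : (μ + clRoot D.A i) i = μ i + 2 := by rw [Pi.add_apply, D.clRoot_self]
  have e1j : (μ + clRoot D.A i) j = μ j + D.A i j := by rw [Pi.add_apply, clRoot, hsymm]
  have e2i : (μ - clRoot D.A j) i = μ i - D.A i j := rfl
  have e3i : (μ + clRoot D.A i - clRoot D.A j) i = μ i + 2 - D.A i j := by
    rw [Pi.sub_apply, e1i]; rfl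
  -- For `m = 2` a short weight is the end of its string if its pairing is `±1`.
  have up0 : ∀ ν : Pcl I, ∀ l, 2 * D.len l < N → D.HasNorm ν u → IsWeight D ϖ N ν → ν l = 1 →
      m = 2 → D.strUp h.weights l ν = 0 := by
    intro ν l hl hn hν hνl hm2
    obtain ⟨n1, n2⟩ := h.ne_of_apply (μ := ν) (i := l) (by rw [hνl]; norm_num)
    refine h.strUp_zero hν n1 n2 (h.norm_notMem (h.norm_add hl hn) ?_)
    rw [hνl, hNu, hm2]; push_cast; linarith [h.u_pos]
  have down0 : ∀ ν : Pcl I, ∀ l, 2 * D.len l < N → D.HasNorm ν u → IsWeight D ϖ N ν → ν l = -1 →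
      m = 2 → D.strDown h.weights l ν = 0 := by
    intro ν l hl hn hν hνl hm2
    obtain ⟨n1, n2⟩ := h.ne_of_apply (μ := ν) (i := l) (by rw [hνl]; norm_num)
    refine h.strDown_zero hν n1 n2 (h.norm_notMem (h.norm_sub hl hn) ?_)
    rw [hνl, hNu, hm2]; push_cast; linarith [h.u_pos]
  rcases h.norm_cases hμ with ⟨hO, hn⟩ | ⟨-, hn⟩
  -- `μ` is long: the string starts at `μ`, and `m = 2`, `a_ij = -1`, `⟨h_j, μ⟩ = 2`.
  · have hi' : μ i = -m := by
      have h3 : ¬ 0 ≤ μ i := fun h0 => h.up_notMem hO h0 hμ1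
      have h4 := h.long_cases hi hO
      omega
    have hn1 := h.norm_add hi hn
    rw [hi', hNu] at hn1
    have hn1' : D.HasNorm (μ + clRoot D.A i) u := by
      convert hn1 using 1; push_cast; ring
    rcases h.norm_cases hμ3 with ⟨hO3, -⟩ | ⟨-, hn3⟩
    · -- two long weights cannot differ by `α_i - α_j`
      exfalso
      obtain ⟨L, hL, hL'⟩ := h.lattice
      refine hL' i j hij hi hj ?_
      have := L.sub_mem (hL _ hO3) (hL _ hO)
      rwa [show μ + clRoot D.A i - clRoot D.A j - μ = clRoot D.A i - clRoot D.A j by abel] at this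
    · have h4 := hn3.unique (h.norm_sub hj hn1')
      have h5 : (1 : ℤ) - (μ + clRoot D.A i) j = 0 := by
        refine h.int_of_u (a := u) ?_
        rw [← h4]; push_cast; ring
      rw [e1j] at h5
      have h6 := h.long_cases hj hO
      have hAm : D.A i j = -1 ∧ m = 2 ∧ μ j = 2 := by omega
      obtain ⟨hA1, hm2, hμj⟩ := hAm
      have hneg := h.short_of_long hj (h.orbit_neg hO) (by rw [Pi.neg_apply, hμj, hm2])
      have hμ2 : IsWeight D ϖ N (μ - clRoot D.A j) := by
        have := h.weight_neg (Or.inr ⟨j, hj, hneg⟩)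
        rwa [neg_add, neg_neg, ← sub_eq_add_neg] at this
      refine ⟨hμ2, ?_⟩
      have hn2 : D.HasNorm (μ - clRoot D.A j) u := by
        have := h.norm_sub hj hn
        rw [hμj, hNu, hm2] at this
        convert this using 1; push_cast; ring
      have u1 : D.strUp h.weights j μ = 0 :=
        h.strUp_zero hμ h1 (fun he => by
          rw [he, Pi.neg_apply, D.clRoot_self] at hμj; omega) (h.up_notMem hO (by omega))
      have u2 : D.strDown h.weights i (μ - clRoot D.A j) = 0 :=
        down0 _ i hi hn2 hμ2 (by rw [e2i]; omega) hm2
      have u3 : D.strDown h.weights i μ = 0 :=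
        h.strDown_zero hμ (fun he => by rw [he, D.clRoot_self] at hi'; omega) h2
          (h.down_notMem hO (by omega))
      have u4 : D.strUp h.weights j (μ + clRoot D.A i) = 0 :=
        up0 _ j hj hn1' hμ1 (by rw [e1j]; omega) hm2
      rw [SquareId, u1, u2, u3, u4, qInt_one, qInt_one]
  · have hμi : μ ≠ clRoot D.A i := by
      rintro rfl; exact h.root_two_notMem ⟨hμ, hμ1⟩
    have b0 := h.short_bound hi hn hμi h2
    rw [abs_le] at b0
    have hμjb : μ ≠ -clRoot D.A j → -1 ≤ μ j ∧ μ j ≤ 1 := fun h3 =>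
      abs_le.1 (h.short_bound hj hn h1 h3)
    have hμjb' : μ j ≤ 1 := by
      by_cases h3 : μ = -clRoot D.A j
      · rw [h3, Pi.neg_apply, D.clRoot_self]; norm_num
      · exact (hμjb h3).2
    have hn1 := h.norm_add hi hn
    rcases h.norm_cases hμ1 with ⟨hO1, hn1'⟩ | ⟨-, hn1'⟩
    · -- the middle weight is long
      exfalso
      have h4 : m - 1 = μ i + 1 := h.int_of_u (a := u) (by rw [← hNu]; exact hn1'.unique hn1)
      have hn3 := h.norm_sub hj hn1'
      have h5 := h.long_cases hj hO1
      rcases h.norm_cases hμ3 with ⟨-, hn3'⟩ | ⟨-, hn3'⟩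
      · have h6 : (0 : ℤ) = 1 - (μ + clRoot D.A i) j := h.int_of_u (a := N) (by
          rw [← hn3'.unique hn3]; push_cast; ring)
        omega
      · have h6 : (1 - m : ℤ) = 1 - (μ + clRoot D.A i) j := h.int_of_u (a := N) (by
          rw [← hn3'.unique hn3, hNu]; push_cast; ring)
        omega
    · have h4 : μ i + 1 = 0 := h.int_of_u (a := u) (by rw [← hn1'.unique hn1]; push_cast; ring)
      have hμi1 : μ i = -1 := by omega
      have hrefl : reflect D.A i μ = μ + clRoot D.A i := by
        rw [reflect_eq, hμi1, neg_neg, one_smul]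
      have hn3 := h.norm_sub hj hn1'
      rcases h.norm_cases hμ3 with ⟨hO3, hn3'⟩ | ⟨-, hn3'⟩
      · -- the only square in which a string of length three occurs
        have h6 : m - 1 = 1 - (μ + clRoot D.A i) j := h.int_of_u (a := u) (by
          rw [← hNu]; exact hn3'.unique hn3)
        rw [e1j] at h6
        have h7 := h.long_cases hi hO3
        rw [e3i] at h7
        have hA1 : D.A i j = -1 ∧ m = 2 ∧ μ j = 1 := by omega
        obtain ⟨hA1, hm2, hμj⟩ := hA1
        have hrefl2 : reflect D.A j μ = μ - clRoot D.A j := by rw [reflect, hμj, one_smul]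
        have hμ2 : IsWeight D ϖ N (μ - clRoot D.A j) := hrefl2 ▸ hμ.reflect j
        refine ⟨hμ2, ?_⟩
        have hn2 : D.HasNorm (μ - clRoot D.A j) u := hrefl2 ▸ hn.reflect j
        have e2 : (μ - clRoot D.A j) i = 0 := by rw [e2i]; omega
        have u1 : D.strUp h.weights j μ = 0 := up0 _ j hj hn hμ hμj hm2
        have u3 : D.strDown h.weights i μ = 0 := down0 _ i hi hn hμ hμi1 hm2
        have one : ∀ ν : Pcl I, ∀ l, 2 * D.len l < N → IsWeight D ϖ N ν → D.HasNorm ν u → ν l = 0 →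
            (IsWeight D ϖ N (ν + clRoot D.A l) ∨ IsWeight D ϖ N (ν - clRoot D.A l)) →
            D.strDown h.weights l ν = 1 ∧ D.strUp h.weights l ν = 1 := by
          intro ν l hl hν hνn hνl hνw
          obtain ⟨n1, n2⟩ := h.ne_of_apply (μ := ν) (i := l) (by rw [hνl]; norm_num)
          obtain ⟨s1, s2⟩ := h.weight_string hν n1 n2
          have t1 := (s2 1).1
          have t2 := (s2 (-1)).1
          rw [one_smul] at t1
          rw [neg_one_smul, ← sub_eq_add_neg] at t2
          have t3 : ¬ IsWeight D ϖ N (ν + (2 : ℤ) • clRoot D.A l) := by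
            refine h.norm_notMem (hνn.add_smul l 2) ?_
            rw [hνl, hNu, hm2, h.short_eq l hl]; push_cast; linarith [h.u_pos]
          have t4 := (s2 2).not.1 t3
          rcases hνw with hw | hw
          · have := t1 hw; omega
          · have := t2 hw; omega
        have u2 := (one _ i hi hμ2 hn2 e2 (Or.inl (by
          rwa [show μ - clRoot D.A j + clRoot D.A i = μ + clRoot D.A i - clRoot D.A j by abel]))).1
        have u4 := (one _ j hj hμ1 hn1' (by rw [e1j]; omega) (Or.inr hμ3)).2
        rw [SquareId, u1, u2, u3, u4, qInt_eq, qInt_eq, qInt_eq, qInt_eq, qi_eq, qi_eq, hlen]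
      -- All four corners are short: `a_ij = 0`, and reflections identify opposite sides.
      · have h6 : (0 : ℤ) = 1 - (μ + clRoot D.A i) j := h.int_of_u (a := u) (by
          rw [← hn3'.unique hn3]; push_cast; ring)
        rw [e1j] at h6
        have hA0 : D.A i j = 0 := by omega
        have hμj : μ j = 1 := by omega
        have hrefl2 : reflect D.A j μ = μ - clRoot D.A j := by rw [reflect, hμj, one_smul]
        refine ⟨hrefl2 ▸ hμ.reflect j, ?_⟩
        rw [SquareId, ← hrefl, ← hrefl2, h.strUp_reflect hA0, h.strDown_reflect (hsymm.trans hA0)]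
        ring

theorem square_half {i j : I} (hij : i ≠ j) {μ : Pcl I}
    (hμ : IsWeight D ϖ N μ) (h1 : μ ≠ clRoot D.A j) (h2 : μ ≠ -clRoot D.A i)
    (hμ1 : IsWeight D ϖ N (μ + clRoot D.A i))
    (hμ3 : IsWeight D ϖ N (μ + clRoot D.A i - clRoot D.A j)) :
    IsWeight D ϖ N (μ - clRoot D.A j) ∧ h.SquareId μ i j := by
  rcases lt_or_ge (2 * D.len i) N with hi | hi
  · rcases lt_or_ge (2 * D.len j) N with hj | hj
    · exact h.square_short hij hi hj hμ h1 h2 hμ1 hμ3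
    · exact h.square_long_right hij hj hμ h1 hμ1 hμ3
  · exact h.square_long_left hij hi hμ h1 h2 hμ1 hμ3

/-- The other half of the equivalence follows from `square_half` for the negatives of the weights. -/
theorem square {i j : I} (hij : i ≠ j) {μ : Pcl I}
    (hμ : IsWeight D ϖ N μ) (h1 : μ ≠ clRoot D.A j) (h2 : μ ≠ -clRoot D.A i)
    (hμ3 : IsWeight D ϖ N (μ + clRoot D.A i - clRoot D.A j)) :
    (IsWeight D ϖ N (μ + clRoot D.A i) ↔ IsWeight D ϖ N (μ - clRoot D.A j)) ∧
      (IsWeight D ϖ N (μ + clRoot D.A i) → h.SquareId μ i j) := by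
  refine ⟨⟨fun hw => (h.square_half hij hμ h1 h2 hw hμ3).1, fun hw => ?_⟩,
    fun hw => (h.square_half hij hμ h1 h2 hw hμ3).2⟩
  have h3 := h.square_half (i := j) (j := i) hij.symm (h.weight_neg hμ)
    (fun he => h2 (by rw [← he, neg_neg])) (fun he => h1 (neg_injective he))
    (by
      have := h.weight_neg hw
      rwa [neg_sub, sub_eq_add_neg, add_comm] at this)
    (by
      have := h.weight_neg hμ3
      convert this using 1; abel)
  have h4 := h.weight_neg h3.1
  rwa [neg_sub, sub_neg_eq_add, add_comm] at h4

/-- All weights are connected by steps along root strings. -/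
theorem connected (P : Pcl I → Prop) (hP : P ϖ)
    (hup : ∀ μ, IsWeight D ϖ N μ → ∀ i, P μ → IsWeight D ϖ N (μ + clRoot D.A i) → P (μ + clRoot D.A i))
    (hdown : ∀ μ, IsWeight D ϖ N μ → ∀ i, P μ → IsWeight D ϖ N (μ - clRoot D.A i) →
      P (μ - clRoot D.A i))
    (hr : ∀ i, IsWeight D ϖ N (clRoot D.A i) → P (clRoot D.A i) → P (-clRoot D.A i))
    (hr' : ∀ i, IsWeight D ϖ N (clRoot D.A i) → P (-clRoot D.A i) → P (clRoot D.A i))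
    (μ : Pcl I) (hμ : IsWeight D ϖ N μ) : P μ := by
  have hrefl : ∀ μ, IsWeight D ϖ N μ → ∀ i, P μ → P (reflect D.A i μ) := by
    intro μ hμ i hp
    by_cases h1 : μ = clRoot D.A i
    · subst h1; rw [reflect_clRoot]; exact hr i hμ hp
    by_cases h2 : μ = -clRoot D.A i
    · subst h2
      rw [reflect_neg, reflect_clRoot, neg_neg]
      have := h.weight_neg hμ
      rw [neg_neg] at this
      exact hr' i this hp
    -- Otherwise `μ` and `s_i μ` lie in the same string, without gaps.
    obtain ⟨p, q, hpq, hk⟩ := h.exists_string hμ h1 h2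
    have up : ∀ n : ℕ, (n : ℤ) ≤ q → P (μ + (n : ℤ) • clRoot D.A i) := by
      intro n
      induction n with
      | zero => intro _; simpa using hp
      | succ n ih =>
        intro hn
        have e : μ + ((n + 1 : ℕ) : ℤ) • clRoot D.A i =
            μ + (n : ℤ) • clRoot D.A i + clRoot D.A i := by push_cast; module
        have h3 := (hk (n + 1 : ℕ)).2 (by push_cast at hn ⊢; omega)
        rw [e] at h3 ⊢
        exact hup _ ((hk n).2 (by push_cast at hn ⊢; omega)) i (ih (by push_cast at hn ⊢; omega)) h3
    have down : ∀ n : ℕ, (n : ℤ) ≤ p → P (μ + (-(n : ℤ)) • clRoot D.A i) := by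
      intro n
      induction n with
      | zero => intro _; simpa using hp
      | succ n ih =>
        intro hn
        have e : μ + (-((n + 1 : ℕ) : ℤ)) • clRoot D.A i =
            μ + (-(n : ℤ)) • clRoot D.A i - clRoot D.A i := by push_cast; module
        have h3 := (hk (-((n + 1 : ℕ) : ℤ))).2 (by push_cast at hn ⊢; omega)
        rw [e] at h3 ⊢
        exact hdown _ ((hk _).2 (by push_cast at hn ⊢; omega)) i (ih (by push_cast at hn ⊢; omega)) h3
    rw [reflect_eq]
    rcases le_total 0 (μ i) with h0 | h0
    · have := down (μ i).toNat (by omega)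
      rwa [show ((μ i).toNat : ℤ) = μ i by omega] at this
    · have := up (-μ i).toNat (by omega)
      rwa [show ((-μ i).toNat : ℤ) = -μ i by omega] at this
  have horb : ∀ μ ν, IsWeight D ϖ N μ → P μ → WeylOrbit D.A Set.univ μ ν → P ν ∧ IsWeight D ϖ N ν := by
    intro μ ν hμ hp hν
    induction hν with
    | refl => exact ⟨hp, hμ⟩
    | step i _ _ ih => exact ⟨hrefl _ ih.2 i ih.1, ih.2.reflect i⟩
  have hϖ : IsWeight D ϖ N ϖ := Or.inl .refl
  rcases hμ with hμ | ⟨j, hj, hμ⟩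
  · exact (horb _ _ hϖ hP hμ).1
  · -- a short root orbit is reached from a long weight that pairs with `h_j`
    obtain ⟨ν, hν, hνj⟩ := exists_weylOrbit_ne_zero h.norm h.N_pos.ne' j
    have : ∃ ν, WeylOrbit D.A Set.univ ϖ ν ∧ ν j = -m := by
      rcases h.long_cases hj hν with h1 | h1 | h1
      · exact absurd h1 hνj
      · exact ⟨_, hν.step j (Set.mem_univ j), by rw [reflect_apply, D.diag, h1]; ring⟩
      · exact ⟨ν, hν, h1⟩
    obtain ⟨ν, hν, hνj⟩ := this
    have h2 := h.short_of_long hj hν hνj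
    have h3 : IsWeight D ϖ N (ν + clRoot D.A j) := Or.inr ⟨j, hj, h2⟩
    have h4 := hup ν (Or.inl hν) j (horb _ _ hϖ hP hν).1 h3
    exact (horb _ _ h3 h4 (h2.symm.trans hμ)).1

/-- The weights of the adjoint module form a string system. -/
def stringSystem : D.StringSystem ϖ where
  R := h.weights
  zero_notMem := fun h0 => h.ne_zero (h.mem_weights.1 h0) rfl
  string := fun μ hμ i h1 h2 => by
    simp only [mem_weights] at hμ ⊢
    exact h.exists_string hμ h1 h2
  string_root := fun i hi k => by
    simp only [mem_weights] at hi ⊢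
    exact h.root_iff (k := 1) (by rwa [one_smul])
  neg_root := fun i hi => by
    simp only [mem_weights] at hi ⊢
    have := h.weight_neg hi
    rwa [neg_neg] at this
  sub_notMem := fun i j hij => by
    rw [mem_weights]; exact h.root_sub_notMem hij
  root_add_ne := fun i j hij _ => h.add_ne i j hij
  adj := fun i j hij _ _ h0 => entry_adj h.add_ne hij h0
  square := fun μ hμ i j hij h1 h2 h3 => by
    have := h.square hij (h.mem_weights.1 hμ) h1 h2 (h.mem_weights.1 h3)
    simp only [mem_weights]
    exact this
  conn := fun P hP h1 h2 h3 h4 μ hμ => by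
    simp only [mem_weights] at h1 h2 h3 h4 hμ
    exact h.connected P hP h1 h2 h3 h4 μ hμ
  orbit_mem := fun μ hμ => h.mem_weights.2 (Or.inl hμ)
  extremal_up := fun μ hμ j hj => by rw [mem_weights]; exact h.up_notMem hμ hj
  extremal_down := fun μ hμ j hj => by rw [mem_weights]; exact h.down_notMem hμ hj
  short := {j | 2 * D.len j < N}
  weight_long := fun l hl μ hμ => by
    by_cases h1 : μ = clRoot D.A l
    · exact Or.inr (Or.inl h1)
    by_cases h2 : μ = -clRoot D.A l
    · exact Or.inr (Or.inr h2)
    exact Or.inl (abs_le.1 (h.long_bound (not_lt.1 hl) (Or.inl hμ) h1 h2))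
  long_sum := fun a l ha hl hOa hOl n hn he => by
    have hl1 := (isLift_sr a).add (isLift_rootComb (D := D) n)
    rw [he] at hl1
    -- The equation lifts to `⨁ ℚ α_q` up to a multiple `t δ` with `t ≠ 0`. At a long vertex `q` the
    -- coordinate `t d_q` can only be cancelled by `α_a` or `α_l`, so that `q ∈ {a, l}`. Hence
    -- `{0, r} = {a, l}`, `d_r = 1`, and both `a_0r` and `a_r0` are `-2`, contrary to `entry_cases`.
    obtain ⟨t, ht⟩ := hl1.eq_add (isLift_sr l).neg
    have h0n : n D.zero = 0 := hn _ (not_lt.2 h.zero_long)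
    have hrn : n r = 0 := hn _ (not_lt.2 h.node_long)
    have hd : ∀ q, (D.d q : ℚ) ≠ 0 := fun q => by exact_mod_cast (D.d_pos q).ne'
    have hq : ∀ q, -(sr l q : ℚ) = sr a q + n q + t * D.d q := fun q => congrFun ht q
    have ht0 : t ≠ 0 := fun h0 => by
      have h1 := hq l
      have h2 : (n l : ℚ) = 0 := by exact_mod_cast hn l hl
      have h3 : (0 : ℚ) ≤ sr a l := by
        by_cases hal : l = a
        · subst hal; simp [sr]
        · simp [sr, hal]
      rw [h0, h2] at h1
      simp [sr] at h1 h3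
      linarith
    have mem : ∀ q, n q = 0 → q = a ∨ q = l := fun q hnq => by
      by_contra hcon
      push Not at hcon
      have h1 := hq q
      simp only [sr, Pi.single_eq_of_ne hcon.1, Pi.single_eq_of_ne hcon.2, hnq] at h1
      have h2 : t * (D.d q : ℚ) = 0 := by push_cast at h1; linarith
      exact (mul_ne_zero ht0 (hd q)) h2
    have hr := h.ne
    have hal : a ≠ l := by
      rintro rfl
      rcases mem _ h0n with h1 | h1 <;> rcases mem _ hrn with h2 | h2 <;> exact hr (h2.trans h1.symm)
    have coord : ∀ q, n q = 0 → t * D.d q = -1 := fun q hnq => by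
      have h1 := hq q
      rcases mem q hnq with rfl | rfl
      · simp only [sr, Pi.single_eq_same, Pi.single_eq_of_ne hal, hnq] at h1
        push_cast at h1; linarith
      · simp only [sr, Pi.single_eq_same, Pi.single_eq_of_ne hal.symm, hnq] at h1
        push_cast at h1; linarith
    have ht1 := coord _ h0n
    rw [D.d_zero] at ht1
    have htr := coord _ hrn
    have hdr : D.d r = 1 := by
      have h1 : t = -1 := by push_cast at ht1; linarith
      rw [h1] at htr
      have : (D.d r : ℚ) = 1 := by linarith
      exact_mod_cast this
    have hlen : ∀ q, n q = 0 → 2 * D.len q = N := fun q hnq => by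
      rcases mem q hnq with rfl | rfl
      · exact (hasNorm_clRoot q).unique (h.long_norm hOa)
      · have h1 := (hasNorm_clRoot (D := D) q).neg
        exact h1.unique (h.long_norm hOl)
    have h5 := h.row
    rw [hdr] at h5
    have h6 : D.A D.zero r = -2 := by push_cast at h5; omega
    have h7 := D.len_symm D.zero r
    have h8 : D.len D.zero = D.len r := by linarith [hlen _ h0n, hlen _ hrn]
    rw [h8] at h7
    have h9 := mul_left_cancel₀ (D.len_pos r).ne' h7
    have h10 : D.A D.zero r = D.A r D.zero := by exact_mod_cast h9
    exact entry_cases h.add_ne hr.symm ⟨h6, h10 ▸ h6⟩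
  dominant_short := fun n hn hO j => by
    -- `ϖ` is dominant for `𝔤₀`, so that adding `∑ n_j α_j` increases the length unless it
    -- vanishes.
    obtain ⟨x, hx, hxN⟩ := h.norm
    have hl := hx.add (isLift_rootComb (D := D) fun j => (n j : ℤ))
    obtain ⟨y, hy, hyN⟩ := h.long_norm hO
    have h1 := hy.form_eq hl
    rw [hyN] at h1
    set w : I → ℚ := fun j => ((n j : ℤ) : ℚ) with hw
    simp only [form_add_left, form_add_right, hxN, D.form_comm x w] at h1
    have h0n : n D.zero = 0 := hn _ (not_lt.2 h.zero_long)
    have h2 : 0 ≤ D.form w x := by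
      refine Finset.sum_nonneg fun q _ => ?_
      rw [← hx q]
      by_cases hq : q = D.zero
      · subst hq; simp [hw, h0n]
      · have h3 : (0 : ℚ) ≤ ϖ q := by exact_mod_cast h.dom q hq
        have := D.len_pos q
        simp only [hw]
        positivity
    have h3 := D.form_nonneg w
    have h4 := D.eq_smul_delta (x := w) (by linarith)
    have h5 : w D.zero = 0 := by simp [hw, h0n]
    rw [h5, zero_smul] at h4
    have h6 := congrFun h4 j
    simpa [hw] using h6
  ne_rootComb := fun n hn he => by
    -- The lift of `-α_0 = k ϖ` has different coordinates at the two vertices `0` and `r`.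
    obtain ⟨k, hk, hroot⟩ := h.prop
    have h1 := (isLift_rootComb (D := D) n).smul k
    rw [← he, ← hroot] at h1
    obtain ⟨t, ht⟩ := h1.eq_add (isLift_sr D.zero).neg
    have h0n : n D.zero = 0 := hn _ (not_lt.2 h.zero_long)
    have hrn : n r = 0 := hn _ (not_lt.2 h.node_long)
    have e0 := congrFun ht D.zero
    have er := congrFun ht r
    have hdr : (D.d r : ℚ) ≠ 0 := by exact_mod_cast (D.d_pos r).ne'
    simp [sr, h0n, hrn, h.ne, delta, D.d_zero, hdr] at e0 er
    rw [er] at e0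
    norm_num at e0

end AdjointLattice

/-- The weights of the fundamental representation of an adjoint node. -/
theorem exists_adjointSystem {r : I} (h : D.IsAdjointNode r) : Nonempty (D.StringSystem (D.varpi r)) := by
  obtain ⟨k, hk⟩ := D.adjointData h
  obtain ⟨m, u, hl⟩ := hk.adjointLattice
  exact ⟨hl.stringSystem⟩

end AffineDatum

/-! ### Locally nilpotent representations of quantum `sl₂` -/

/-- Operators `e`, `f` on a space with a grading `W` that satisfy the relations of quantum `sl₂`
and are locally nilpotent. -/
structure QTriple {V : Type v} [AddCommGroup V] [Module BaseField V] (q : BaseField)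
    (e f : Module.End BaseField V) (W : ℤ → Submodule BaseField V) : Prop where
  q_ne : q ≠ 0
  qNum_ne : ∀ n : ℤ, n ≠ 0 → qNum q n ≠ 0
  e_mem : ∀ h, ∀ x ∈ W h, e x ∈ W (h + 2)
  f_mem : ∀ h, ∀ x ∈ W h, f x ∈ W (h - 2)
  comm : ∀ h, ∀ x ∈ W h, e (f x) = f (e x) + qNum q h • x
  nilp_e : ∀ x, ∃ n : ℕ, (e ^ n) x = 0
  nilp_f : ∀ x, ∃ n : ℕ, (f ^ n) x = 0

namespace QTriple

variable {V : Type v} [AddCommGroup V] [Module BaseField V] {q : BaseField}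
  {e f : Module.End BaseField V} {W : ℤ → Submodule BaseField V}

theorem symm (h : QTriple q e f W) : QTriple q f e (fun n => W (-n)) where
  q_ne := h.q_ne
  qNum_ne := h.qNum_ne
  e_mem n x hx := by
    have := h.f_mem _ x hx
    rwa [show -n - 2 = -(n + 2) by ring] at this
  f_mem n x hx := by
    have := h.e_mem _ x hx
    rwa [show -n + 2 = -(n - 2) by ring] at this
  comm n x hx := by
    rw [h.comm _ x hx, qNum_neg, neg_smul]; abel
  nilp_e := h.nilp_f
  nilp_f := h.nilp_e

variable (h : QTriple q e f W)
include h

theorem f_pow_mem {n : ℤ} {x : V} (hx : x ∈ W n) (k : ℕ) : (f ^ k) x ∈ W (n - 2 * k) := by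
  induction k with
  | zero => simpa using hx
  | succ k ih =>
    rw [pow_succ', Module.End.mul_apply]
    have := h.f_mem _ _ ih
    rwa [show n - 2 * (k : ℤ) - 2 = n - 2 * ((k + 1 : ℕ) : ℤ) by push_cast; ring] at this

/-- The standard commutation formula `e f^{k+1} = f^{k+1} e + [k+1] [h-k] f^k`. -/
theorem e_f_pow {n : ℤ} {x : V} (hx : x ∈ W n) (k : ℕ) :
    e ((f ^ (k + 1)) x) = (f ^ (k + 1)) (e x) + (qNum q (k + 1) * qNum q (n - k)) • (f ^ k) x := by
  induction k with
  | zero =>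
    have h1 : qNum q 1 = 1 := by
      have h2 := h.qNum_ne 1 one_ne_zero
      refine qNum_one fun h3 => h2 ?_
      simp [qNum, h3]
    simp [h.comm n x hx, h1]
  | succ k ih =>
    rw [pow_succ', Module.End.mul_apply, h.comm _ _ (h.f_pow_mem hx (k + 1)), ih, map_add, map_smul,
      ← Module.End.mul_apply, ← pow_succ', ← Module.End.mul_apply f, ← pow_succ', add_assoc,
      ← add_smul]
    congr 2
    have h1 := qNum_sl2 h.q_ne (k + 1) (n - (k + 1))
    rw [show n - ((k : ℤ) + 1) + 1 = n - k by ring,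
      show (k : ℤ) + 1 - (n - (k + 1)) = -(n - 2 * (k + 1)) by ring, qNum_neg] at h1
    push_cast
    linear_combination h1

/-- A power of `f` is injective in sufficiently high weight. -/
theorem f_pow_injective (N : ℕ) : ∀ (n : ℤ) (k : ℕ) (x : V), x ∈ W n → (e ^ N) x = 0 → (k : ℤ) ≤ n →
    (f ^ k) x = 0 → x = 0 := by
  induction N with
  | zero => intro n k x _ hx _ _; simpa using hx
  | succ N ih =>
    intro n k x hx hN hk hf
    -- By induction on the nilpotency of `e`, the vector is a highest weight vector.
    have h1 : e x = 0 := by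
      refine ih (n + 2) (k + 1) (e x) (h.e_mem n x hx) ?_ (by push_cast; omega) ?_
      · rwa [← Module.End.mul_apply, ← pow_succ]
      · have h2 := h.e_f_pow hx k
        rw [pow_succ', Module.End.mul_apply, hf, map_zero, map_zero, smul_zero, add_zero] at h2
        rw [pow_succ']; exact h2.symm
    have key : ∀ l : ℕ, l ≤ k → (f ^ l) x = 0 → x = 0 := by
      intro l
      induction l with
      | zero => intro _ h2; simpa using h2
      | succ l ihl =>
        intro hl h2
        refine ihl (by omega) ?_
        have h3 := h.e_f_pow hx l
        rw [h2, h1, map_zero, map_zero, zero_add] at h3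
        exact (smul_eq_zero.1 h3.symm).resolve_left
          (mul_ne_zero (h.qNum_ne _ (by omega)) (h.qNum_ne _ (by omega)))
    exact key k le_rfl hf

theorem eq_zero_of_f_pow {n : ℤ} {k : ℕ} {x : V} (hx : x ∈ W n) (hk : (k : ℤ) ≤ n)
    (hf : (f ^ k) x = 0) : x = 0 := by
  obtain ⟨N, hN⟩ := h.nilp_e x
  exact h.f_pow_injective N n k x hx hN hk hf

/-- The weight of a highest weight vector determines the length of its string. -/
theorem highest {n : ℤ} {x : V} (hx : x ∈ W n) (he : e x = 0) (h0 : x ≠ 0) :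
    0 ≤ n ∧ (f ^ (n.toNat + 1)) x = 0 := by
  classical
  have hf := h.nilp_f x
  -- Let `f^l x` be the last nonzero vector of the string; then `[l + 1] [n - l] = 0`.
  obtain ⟨l, hl⟩ : ∃ l, Nat.find hf = l + 1 := by
    refine Nat.exists_eq_succ_of_ne_zero fun h1 => h0 ?_
    have := Nat.find_spec hf
    rw [h1] at this
    simpa using this
  have h1 := Nat.find_spec hf
  have h2 := Nat.find_min hf (m := l) (by omega)
  rw [hl] at h1
  have h3 := h.e_f_pow hx l
  rw [h1, he, map_zero, map_zero, zero_add] at h3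
  have h4 := (smul_eq_zero.1 h3.symm).resolve_right h2
  have h5 : n = l := by
    by_contra hne
    exact mul_ne_zero (h.qNum_ne _ (by omega)) (h.qNum_ne _ (by omega)) h4
  subst h5
  exact ⟨by omega, by simpa using h1⟩

theorem e_pow_f_pow {n : ℤ} {x : V} (hx : x ∈ W n) (he : e x = 0) (k : ℕ) (hk : (k : ℤ) ≤ n) :
    ∃ c : BaseField, c ≠ 0 ∧ (e ^ k) ((f ^ k) x) = c • x := by
  induction k with
  | zero => exact ⟨1, one_ne_zero, by simp⟩
  | succ k ih =>
    obtain ⟨c, hc, hce⟩ := ih (by push_cast at hk; omega)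
    refine ⟨_, mul_ne_zero (mul_ne_zero (h.qNum_ne (k + 1) (by omega))
      (h.qNum_ne (n - k) (by push_cast at hk; omega))) hc, ?_⟩
    rw [pow_succ e, Module.End.mul_apply, h.e_f_pow hx, he, map_zero, zero_add, map_smul, hce,
      smul_smul]

/-- The module is spanned by the strings of highest weight vectors. -/
theorem mem_of_strings (P : Submodule BaseField V)
    (hP : ∀ (n : ℤ) (u : V) (k : ℕ), u ∈ W n → e u = 0 → (f ^ k) u ∈ P) {n : ℤ} {x : V}
    (hx : x ∈ W n) : x ∈ P := by
  obtain ⟨N, hN⟩ := h.nilp_e x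
  induction N generalizing x with
  | zero =>
    have : x = 0 := by simpa using hN
    rw [this]; exact P.zero_mem
  | succ N ih =>
    have hu : (e ^ N) x ∈ W (n + 2 * N) := by
      have := h.symm.f_pow_mem (n := -n) (x := x) (by rwa [neg_neg]) N
      rwa [show -(-n - 2 * (N : ℤ)) = n + 2 * N by ring] at this
    have he : e ((e ^ N) x) = 0 := by rw [← Module.End.mul_apply, ← pow_succ']; exact hN
    by_cases hk : (N : ℤ) ≤ n + 2 * N
    -- Subtract a multiple of `f^N e^N x`, to get a vector killed by `e^N`.
    · obtain ⟨c, hc, hce⟩ := h.e_pow_f_pow hu he N hk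
      have hf : (f ^ N) ((e ^ N) x) ∈ W n := by
        have := h.f_pow_mem hu N
        rwa [show n + 2 * (N : ℤ) - 2 * N = n by ring] at this
      have h1 : x - c⁻¹ • (f ^ N) ((e ^ N) x) ∈ P := by
        refine ih ((W n).sub_mem hx ((W n).smul_mem _ hf)) ?_
        rw [map_sub, map_smul, hce, smul_smul, inv_mul_cancel₀ hc, one_smul, sub_self]
      have h2 := P.add_mem h1 (P.smul_mem c⁻¹ (hP _ _ N hu he))
      rwa [sub_add_cancel] at h2
    · have h0 : x = 0 := by
        refine h.symm.eq_zero_of_f_pow (n := -n) (k := N + 1) (by rwa [neg_neg]) ?_ hN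
        push_cast; omega
      rw [h0]; exact P.zero_mem

/-- An operator that commutes with `f` and raises the weight vanishes. -/
theorem eq_zero_of_raise (hW : ⨆ n, W n = ⊤) {T : Module.End BaseField V} {a : ℤ} (ha : 0 < a)
    (hT : ∀ n, ∀ x ∈ W n, T x ∈ W (n + a)) (hf : ∀ n, ∀ x ∈ W n, f (T x) = T (f x)) : T = 0 := by
  have hpow : ∀ (k : ℕ) (n : ℤ), ∀ x ∈ W n, (f ^ k) (T x) = T ((f ^ k) x) := by
    intro k
    induction k with
    | zero => intros; simp
    | succ k ih =>
      intro n x hx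
      rw [pow_succ, Module.End.mul_apply, Module.End.mul_apply, hf n x hx, ih _ _ (h.f_mem n x hx)]
  have hle : ⨆ n, W n ≤ LinearMap.ker T := iSup_le fun n x hx => by
    refine h.mem_of_strings _ (fun m u k hu he => ?_) hx
    rw [LinearMap.mem_ker, ← hpow k m u hu]
    by_cases h0 : u = 0
    · simp [h0]
    -- For a highest weight vector `u` of weight `m`, `f^{m+1} T u = T f^{m+1} u = 0`, while
    -- `f^{m+1}` is injective on the weight `m + a`.
    obtain ⟨hm, hmu⟩ := h.highest hu he h0
    have : T u = 0 := by
      refine h.eq_zero_of_f_pow (k := m.toNat + 1) (hT m u hu) (by push_cast; omega) ?_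
      rw [hpow _ m u hu, hmu, map_zero]
    rw [this, map_zero]
  rw [hW] at hle
  exact LinearMap.ker_eq_top.1 (top_le_iff.1 hle)

end QTriple

section Serre

variable {I : Type u} [Fintype I] (D : AffineDatum I) (i : I)
  {V : Type v} [AddCommGroup V] [Module BaseField V]
  {e f y : Module.End BaseField V} {W : ℤ → Submodule BaseField V}

theorem divPow_zero (x : Module.End BaseField V) : D.divPow i x 0 = 1 := by
  simp [AffineDatum.divPow, AffineDatum.qFact_zero]

theorem divPow_apply (x : Module.End BaseField V) (n : ℕ) (w : V) :
    D.divPow i x n w = (D.qFact i n)⁻¹ • (x ^ n) w := rfl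

theorem divPow_succ_apply (x : Module.End BaseField V) (n : ℕ) (w : V) :
    D.divPow i x (n + 1) w = (D.qInt i (n + 1))⁻¹ • x (D.divPow i x n w) := by
  rw [divPow_apply, divPow_apply, AffineDatum.qFact_succ, mul_inv, map_smul, smul_smul, pow_succ',
    Module.End.mul_apply, mul_comm]

theorem f_divPow (h : QTriple (D.qi i) e f W) {n : ℤ} {x : V} (hx : x ∈ W n) (k : ℕ) :
    f (D.divPow i e (k + 1) x) =
      D.divPow i e (k + 1) (f x) - qNum (D.qi i) (n + k) • D.divPow i e k x := by
  have h1 := h.symm.e_f_pow (n := -n) (by rwa [neg_neg]) k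
  rw [divPow_apply, divPow_apply, divPow_apply, map_smul, h1, smul_add, smul_smul, smul_smul,
    AffineDatum.qFact_succ, AffineDatum.qInt_eq, sub_eq_add_neg (G := V), ← neg_smul]
  congr 2
  have h2 := h.qNum_ne (k + 1) (by omega)
  have h3 := D.qFact_ne_zero i k
  rw [show -n - (k : ℤ) = -(n + k) by ring, qNum_neg]
  push_cast
  field_simp

theorem divPow_mem (h : QTriple (D.qi i) e f W) {n : ℤ} {x : V} (hx : x ∈ W n) (k : ℕ) :
    D.divPow i e k x ∈ W (n + 2 * k) := by
  have := h.symm.f_pow_mem (n := -n) (x := x) (by rwa [neg_neg]) k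
  rw [show -(-n - 2 * (k : ℤ)) = n + 2 * k by ring] at this
  exact (W _).smul_mem _ this

/-- The quantum Serre relation is a consequence of the other relations: the Serre element commutes
with `f_i` and raises the weight with respect to `h_i` by `2 - a_ij > 0`. -/
theorem serre_eq_zero (h : QTriple (D.qi i) e f W) (hW : ⨆ n, W n = ⊤) (a : ℤ) (ha : a ≤ 0)
    (hy : ∀ n, ∀ x ∈ W n, y x ∈ W (n + a)) (hfy : ∀ x, f (y x) = y (f x)) :
    ∑ k ∈ Finset.range ((1 - a).toNat + 1),
      (-1 : Module.End BaseField V) ^ k * (D.divPow i e ((1 - a).toNat - k) * y * D.divPow i e k) = 0 := by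
  obtain ⟨N, hN⟩ : ∃ N : ℕ, (1 - a).toNat = N + 1 := ⟨(-a).toNat, by omega⟩
  have haN : a = -N := by omega
  have hsgn : ∀ (k : ℕ) (w : V), ((-1 : Module.End BaseField V) ^ k) w = (-1 : BaseField) ^ k • w := by
    intro k w
    rcases Nat.even_or_odd k with hk | hk
    · simp [hk.neg_one_pow]
    · simp [hk.neg_one_pow]
  refine h.eq_zero_of_raise hW (a := 2 - a) (by omega) (fun n x hx => ?_) (fun n x hx => ?_)
  · rw [LinearMap.sum_apply]
    refine Submodule.sum_mem _ fun k hk => ?_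
    have hk' : k ≤ N + 1 := by rw [Finset.mem_range, hN] at hk; omega
    rw [Module.End.mul_apply, hsgn, Module.End.mul_apply, Module.End.mul_apply, hN]
    refine Submodule.smul_mem _ _ ?_
    have h1 := divPow_mem D i h (hy _ _ (divPow_mem D i h hx k)) (N + 1 - k)
    have h2 : n + 2 * (k : ℤ) + a + 2 * ((N + 1 - k : ℕ) : ℤ) = n + (2 - a) := by
      rw [Nat.cast_sub hk']; push_cast; omega
    rwa [h2] at h1
  · rw [LinearMap.sum_apply, LinearMap.sum_apply, map_sum, ← sub_eq_zero, ← Finset.sum_sub_distrib, hN]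
    -- Each summand contributes two terms to the commutator with `f`, and the sum telescopes.
    have hterm : ∀ k ∈ Finset.range (N + 1 + 1),
        f (((-1 : Module.End BaseField V) ^ k * (D.divPow i e (N + 1 - k) * y * D.divPow i e k)) x) -
          ((-1 : Module.End BaseField V) ^ k * (D.divPow i e (N + 1 - k) * y * D.divPow i e k)) (f x) =
        -((-1 : BaseField) ^ k • (if k = N + 1 then 0 else
            qNum (D.qi i) (n + k) • D.divPow i e (N - k) (y (D.divPow i e k x)))) -
          (-1 : BaseField) ^ k • (if k = 0 then 0 else
            qNum (D.qi i) (n + (k - 1)) • D.divPow i e (N + 1 - k) (y (D.divPow i e (k - 1) x))) := by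
      intro k hk
      have hk' : k ≤ N + 1 := by rw [Finset.mem_range] at hk; omega
      simp only [Module.End.mul_apply, hsgn, map_smul]
      have hA : f (D.divPow i e (N + 1 - k) (y (D.divPow i e k x))) =
          D.divPow i e (N + 1 - k) (y (f (D.divPow i e k x))) - (if k = N + 1 then 0 else
            qNum (D.qi i) (n + k) • D.divPow i e (N - k) (y (D.divPow i e k x))) := by
        split_ifs with hkN
        · subst hkN
          rw [Nat.sub_self, divPow_zero, Module.End.one_apply, Module.End.one_apply, hfy, sub_zero]
        · have h1 := f_divPow D i h (hy _ _ (divPow_mem D i h hx k)) (N - k)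
          rw [show N - k + 1 = N + 1 - k by omega, hfy,
            show n + 2 * (k : ℤ) + a + ((N - k : ℕ) : ℤ) = n + k by
              rw [Nat.cast_sub (by omega)]; omega] at h1
          exact h1
      have hB : f (D.divPow i e k x) = D.divPow i e k (f x) - (if k = 0 then 0 else
            qNum (D.qi i) (n + (k - 1)) • D.divPow i e (k - 1) x) := by
        split_ifs with hk0
        · subst hk0
          rw [divPow_zero, Module.End.one_apply, Module.End.one_apply, sub_zero]
        · obtain ⟨l, rfl⟩ := Nat.exists_eq_succ_of_ne_zero hk0
          rw [Nat.succ_eq_add_one, f_divPow D i h hx l]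
          simp
      rw [hA, hB, map_sub, map_sub, ← smul_sub]
      split_ifs <;> simp only [map_zero, map_smul, sub_zero, smul_zero, neg_zero, zero_sub, smul_sub] <;>
        abel
    rw [Finset.sum_congr rfl hterm, Finset.sum_sub_distrib, Finset.sum_neg_distrib,
      Finset.sum_range_succ, Finset.sum_range_succ' (fun k => (-1 : BaseField) ^ k • (if k = 0 then 0 else
            qNum (D.qi i) (n + (k - 1)) • D.divPow i e (N + 1 - k) (y (D.divPow i e (k - 1) x))))]
    simp only [if_true, smul_zero, add_zero]
    rw [sub_eq_zero, neg_eq_iff_add_eq_zero, ← Finset.sum_add_distrib]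
    refine Finset.sum_eq_zero fun k hk => ?_
    rw [Finset.mem_range] at hk
    rw [if_neg (by omega), if_neg (by omega), show N + 1 - (k + 1) = N - k by omega, Nat.add_sub_cancel,
      show ((k + 1 : ℕ) : ℤ) - 1 = k by push_cast; ring, pow_succ, mul_neg_one, neg_smul, add_neg_cancel]

end Serre

/-! ### The module attached to a string system -/

/-- The relations of `U_q(𝔰𝔩₂)` and local nilpotency make a quantum `𝔰𝔩₂`-triple, graded by the
eigenspaces of `K`. -/
theorem qTriple_of_relations {I : Type u} [Fintype I] (D : AffineDatum I) (i : I)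
    {V : Type v} [AddCommGroup V] [Module BaseField V] {e f K : Module.End BaseField V}
    (hKe : ∀ x, K (e x) = D.qi i ^ (2 : ℤ) • e (K x))
    (hKf : ∀ x, K (f x) = D.qi i ^ (-2 : ℤ) • f (K x))
    (hc : ∀ (n : ℤ) (x : V), K x = D.qi i ^ n • x → e (f x) = f (e x) + qNum (D.qi i) n • x)
    (he : ∀ x, ∃ n : ℕ, (e ^ n) x = 0) (hf : ∀ x, ∃ n : ℕ, (f ^ n) x = 0) :
    QTriple (D.qi i) e f fun n => K.eigenspace (D.qi i ^ n) where
  q_ne := D.qi_ne_zero i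
  qNum_ne n hn h := by
    rcases le_total 0 n with h0 | h0
    · obtain ⟨m, rfl⟩ := Int.eq_ofNat_of_zero_le h0
      rw [← D.qInt_eq] at h
      exact D.qInt_ne_zero i (by omega) h
    · obtain ⟨m, rfl⟩ := Int.exists_eq_neg_ofNat h0
      rw [qNum_neg, ← D.qInt_eq, neg_eq_zero] at h
      exact D.qInt_ne_zero i (by omega) h
  e_mem n x hx := by
    rw [Module.End.mem_eigenspace_iff] at hx ⊢
    rw [hKe, hx, map_smul, smul_smul, ← zpow_add₀ (D.qi_ne_zero i), add_comm]
  f_mem n x hx := by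
    rw [Module.End.mem_eigenspace_iff] at hx ⊢
    rw [hKf, hx, map_smul, smul_smul, ← zpow_add₀ (D.qi_ne_zero i), add_comm, sub_eq_add_neg]
  comm n x hx := hc n x (Module.End.mem_eigenspace_iff.1 hx)
  nilp_e := he
  nilp_f := hf

namespace AffineDatum

variable {I : Type u} [Fintype I] [DecidableEq I] {D : AffineDatum I} {ϖ : Pcl I}

/-- The coefficient `[|a_ij|]_i / [2]_j` of `y_j` in `f_i v_{α_i}`. -/
def zCoeff (D : AffineDatum I) (i j : I) : BaseField := D.qInt i (D.A i j).natAbs / D.qInt j 2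

theorem zCoeff_self (i : I) : D.zCoeff i i = 1 := by
  rw [zCoeff, D.diag]
  exact div_self (D.qInt_ne_zero i two_pos)

theorem zCoeff_mul (i j : I) : D.zCoeff i j * D.qInt j 2 = D.qInt i (D.A i j).natAbs :=
  div_mul_cancel₀ _ (D.qInt_ne_zero j two_pos)

theorem clRoot_ne {i j : I} (hij : i ≠ j) : clRoot D.A i ≠ clRoot D.A j := fun h => by
  have h1 := congrFun h j
  have h2 := D.off_diag j i hij.symm
  rw [clRoot_self, clRoot] at h1
  omega

theorem clRoot_ne_neg (i : I) : clRoot D.A i ≠ -clRoot D.A i := fun h => by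
  have h1 := congrFun h i
  rw [Pi.neg_apply, clRoot_self] at h1
  omega

namespace StringSystem

variable (S : D.StringSystem ϖ)

/-- The index set of the basis of the module: the nonzero weights, and one vector of weight zero for
every simple root that is a weight. -/
abbrev Idx : Type u := {μ // μ ∈ S.R} ⊕ {j // clRoot D.A j ∈ S.R}

instance : Finite S.Idx := inferInstance

/-- The weight of a basis vector. -/
def idxWt : S.Idx → Pcl I
  | .inl μ => μ.1
  | .inr _ => 0

/-- The number of steps upwards in the `i`-string of `μ`. -/
abbrev up (i : I) (μ : Pcl I) : ℕ := D.strUp S.R i μ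

/-- The number of steps downwards in the `i`-string of `μ`. -/
abbrev down (i : I) (μ : Pcl I) : ℕ := D.strDown S.R i μ

theorem str {μ : Pcl I} (hμ : μ ∈ S.R) {i : I} (h1 : μ ≠ clRoot D.A i) (h2 : μ ≠ -clRoot D.A i) :
    (S.down i μ : ℤ) - S.up i μ = μ i ∧
      ∀ k : ℤ, μ + k • clRoot D.A i ∈ S.R ↔ -(S.down i μ : ℤ) ≤ k ∧ k ≤ S.up i μ := by
  obtain ⟨p, q, hpq, hk⟩ := S.string μ hμ i h1 h2
  rw [up, down, strUp_eq hk, strDown_eq hk]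
  exact ⟨hpq, hk⟩

theorem str_shift {μ : Pcl I} (hμ : μ ∈ S.R) {i : I} (h1 : μ ≠ clRoot D.A i) (h2 : μ ≠ -clRoot D.A i)
    {k : ℤ} (hk : μ + k • clRoot D.A i ∈ S.R) :
    (S.down i (μ + k • clRoot D.A i) : ℤ) = S.down i μ + k ∧
      (S.up i (μ + k • clRoot D.A i) : ℤ) = S.up i μ - k := by
  have h3 := (S.str hμ h1 h2).2
  have h4 := (h3 k).1 hk
  have h5 : ∀ l : ℤ, μ + k • clRoot D.A i + l • clRoot D.A i ∈ S.R ↔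
      -((S.down i μ + k).toNat : ℤ) ≤ l ∧ l ≤ ((S.up i μ - k).toNat : ℤ) := fun l => by
    rw [add_assoc, ← add_smul, h3]; omega
  rw [up, down, strUp_eq h5, strDown_eq h5]
  omega

theorem neg_mem {i : I} (h : clRoot D.A i ∈ S.R) : -clRoot D.A i ∈ S.R := by
  have := (S.string_root i h (-1)).2 (Or.inr rfl)
  rwa [neg_one_smul] at this

theorem neg_mem_iff {i : I} : -clRoot D.A i ∈ S.R ↔ clRoot D.A i ∈ S.R := ⟨S.neg_root i, S.neg_mem⟩

theorem two_notMem (i : I) : clRoot D.A i ∈ S.R → clRoot D.A i + clRoot D.A i ∉ S.R := fun h h2 => by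
  have := (S.string_root i h 2).1 (by rwa [two_smul])
  omega

theorem neg_two_notMem (i : I) : clRoot D.A i ∈ S.R → -clRoot D.A i - clRoot D.A i ∉ S.R :=
  fun h h2 => by
    have := (S.string_root i h (-2)).1 (by rwa [neg_smul, two_smul, neg_add, ← sub_eq_add_neg])
    omega

theorem ne_zero {μ : Pcl I} (h : μ ∈ S.R) : μ ≠ 0 := fun h0 => S.zero_notMem (h0 ▸ h)

/-- The `i`-string of another simple root. -/
theorem root_str {i j : I} (hij : i ≠ j) (hi : clRoot D.A i ∈ S.R) (hj : clRoot D.A j ∈ S.R) :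
    S.down i (clRoot D.A j) = 0 ∧ (S.up i (clRoot D.A j) : ℤ) = -D.A i j := by
  obtain ⟨h1, h2⟩ := S.str hj (clRoot_ne hij.symm) fun h =>
    S.root_add_ne i j hij hi (by rw [h, add_neg_cancel])
  have h3 := (h2 (-1)).not.1 (by
    rw [neg_one_smul, ← sub_eq_add_neg]; exact S.sub_notMem i j hij)
  rw [clRoot] at h1
  omega

theorem neg_root_str {i j : I} (hij : i ≠ j) (hi : clRoot D.A i ∈ S.R) (hj : clRoot D.A j ∈ S.R) :
    S.up i (-clRoot D.A j) = 0 ∧ (S.down i (-clRoot D.A j) : ℤ) = -D.A i j := by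
  obtain ⟨h1, h2⟩ := S.str (S.neg_mem hj) (i := i)
    (fun h => S.root_add_ne i j hij hi (by rw [← h, neg_add_cancel]))
    fun h => clRoot_ne hij.symm (neg_injective h)
  have h3 := (h2 1).not.1 (by
    rw [one_smul, add_comm, ← sub_eq_add_neg]; exact S.sub_notMem j i hij.symm)
  rw [Pi.neg_apply, clRoot] at h1
  omega

variable {V : Type v} [AddCommGroup V] [Module BaseField V] (b : Module.Basis S.Idx BaseField V)

open Classical in
/-- The basis vector of weight `μ ≠ 0`, and `0` if `μ` is not a weight. -/
def vec (μ : Pcl I) : V := if h : μ ∈ S.R then b (.inl ⟨μ, h⟩) else 0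

open Classical in
/-- The basis vector `y_j`, and `0` if `α_j` is not a weight. -/
def yv (j : I) : V := if h : clRoot D.A j ∈ S.R then b (.inr ⟨j, h⟩) else 0

/-- The vector `f_i v_{α_i}` of weight zero. -/
def zv (i : I) : V := ∑ j, D.zCoeff i j • S.yv b j

theorem vec_of_mem {μ : Pcl I} (h : μ ∈ S.R) : S.vec b μ = b (.inl ⟨μ, h⟩) := dif_pos h
theorem vec_of_notMem {μ : Pcl I} (h : μ ∉ S.R) : S.vec b μ = 0 := dif_neg h
theorem yv_of_mem {j : I} (h : clRoot D.A j ∈ S.R) : S.yv b j = b (.inr ⟨j, h⟩) := dif_pos h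
theorem yv_of_notMem {j : I} (h : clRoot D.A j ∉ S.R) : S.yv b j = 0 := dif_neg h

open Classical in
/-- The operator `e_i`. -/
def opE (i : I) : Module.End BaseField V := b.constr BaseField fun
  | .inl μ => if μ.1 = -clRoot D.A i then S.zv b i else
      D.qInt i (S.down i μ.1 + 1) • S.vec b (μ.1 + clRoot D.A i)
  | .inr j => if j.1 = i then D.qInt i 2 • S.vec b (clRoot D.A i) else 0

open Classical in
/-- The operator `f_i`. -/
def opF (i : I) : Module.End BaseField V := b.constr BaseField fun
  | .inl μ => if μ.1 = clRoot D.A i then S.zv b i else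
      D.qInt i (S.up i μ.1 + 1) • S.vec b (μ.1 - clRoot D.A i)
  | .inr j => if j.1 = i then D.qInt i 2 • S.vec b (-clRoot D.A i) else 0

/-- The operator `K_i ^ s`. -/
def opK (i : I) (s : ℤ) : Module.End BaseField V :=
  b.constr BaseField fun x => D.qi i ^ (s * S.idxWt x i) • b x

theorem opE_vec {i : I} {μ : Pcl I} (hμ : μ ∈ S.R) (h : μ ≠ -clRoot D.A i) :
    S.opE b i (S.vec b μ) = D.qInt i (S.down i μ + 1) • S.vec b (μ + clRoot D.A i) := by
  rw [vec_of_mem S b hμ, opE, Module.Basis.constr_basis]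
  exact if_neg h

theorem opE_neg_root {i : I} (h : clRoot D.A i ∈ S.R) :
    S.opE b i (S.vec b (-clRoot D.A i)) = S.zv b i := by
  rw [vec_of_mem S b (S.neg_mem h), opE, Module.Basis.constr_basis]
  exact if_pos rfl

theorem opE_yv (i j : I) :
    S.opE b i (S.yv b j) = if j = i then D.qInt i 2 • S.vec b (clRoot D.A i) else 0 := by
  by_cases h : clRoot D.A j ∈ S.R
  · rw [yv_of_mem S b h, opE, Module.Basis.constr_basis]
  · rw [yv_of_notMem S b h, map_zero]
    split_ifs with hji
    · subst hji; rw [vec_of_notMem S b h, smul_zero]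
    · rfl

theorem opE_zv (i j : I) :
    S.opE b i (S.zv b j) = D.qInt j (D.A j i).natAbs • S.vec b (clRoot D.A i) := by
  rw [zv, map_sum, Finset.sum_eq_single_of_mem i (Finset.mem_univ i) fun k _ hk => by
    rw [map_smul, opE_yv, if_neg hk, smul_zero], map_smul, opE_yv, if_pos rfl, smul_smul, zCoeff_mul]

theorem opF_vec {i : I} {μ : Pcl I} (hμ : μ ∈ S.R) (h : μ ≠ clRoot D.A i) :
    S.opF b i (S.vec b μ) = D.qInt i (S.up i μ + 1) • S.vec b (μ - clRoot D.A i) := by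
  rw [vec_of_mem S b hμ, opF, Module.Basis.constr_basis]
  exact if_neg h

theorem opF_root {i : I} (h : clRoot D.A i ∈ S.R) :
    S.opF b i (S.vec b (clRoot D.A i)) = S.zv b i := by
  rw [vec_of_mem S b h, opF, Module.Basis.constr_basis]
  exact if_pos rfl

theorem opF_yv (i j : I) :
    S.opF b i (S.yv b j) = if j = i then D.qInt i 2 • S.vec b (-clRoot D.A i) else 0 := by
  by_cases h : clRoot D.A j ∈ S.R
  · rw [yv_of_mem S b h, opF, Module.Basis.constr_basis]
  · rw [yv_of_notMem S b h, map_zero]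
    split_ifs with hji
    · subst hji; rw [vec_of_notMem S b (S.neg_mem_iff.not.2 h), smul_zero]
    · rfl

theorem opF_zv (i j : I) :
    S.opF b i (S.zv b j) = D.qInt j (D.A j i).natAbs • S.vec b (-clRoot D.A i) := by
  rw [zv, map_sum, Finset.sum_eq_single_of_mem i (Finset.mem_univ i) fun k _ hk => by
    rw [map_smul, opF_yv, if_neg hk, smul_zero], map_smul, opF_yv, if_pos rfl, smul_smul, zCoeff_mul]

theorem opK_vec (i : I) (s : ℤ) (μ : Pcl I) :
    S.opK b i s (S.vec b μ) = D.qi i ^ (s * μ i) • S.vec b μ := by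
  by_cases h : μ ∈ S.R
  · rw [vec_of_mem S b h, opK, Module.Basis.constr_basis]; rfl
  · rw [vec_of_notMem S b h, map_zero, smul_zero]

theorem opK_yv (i : I) (s : ℤ) (j : I) : S.opK b i s (S.yv b j) = S.yv b j := by
  by_cases h : clRoot D.A j ∈ S.R
  · rw [yv_of_mem S b h, opK, Module.Basis.constr_basis]
    simp [idxWt]
  · rw [yv_of_notMem S b h, map_zero]

theorem opK_zv (i : I) (s : ℤ) (j : I) : S.opK b i s (S.zv b j) = S.zv b j := by
  simp only [zv, map_sum, map_smul, opK_yv]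

/-- Operators that agree on the vectors `v_μ` and `y_j` are equal. -/
theorem op_ext {T T' : Module.End BaseField V} (h1 : ∀ μ ∈ S.R, T (S.vec b μ) = T' (S.vec b μ))
    (h2 : ∀ j, clRoot D.A j ∈ S.R → T (S.yv b j) = T' (S.yv b j)) : T = T' := by
  refine b.ext fun x => ?_
  rcases x with ⟨μ, hμ⟩ | ⟨j, hj⟩
  · rw [← vec_of_mem S b hμ]; exact h1 μ hμ
  · rw [← yv_of_mem S b hj]; exact h2 j hj

theorem opK_mul (i : I) : S.opK b i 1 * S.opK b i (-1) = 1 ∧ S.opK b i (-1) * S.opK b i 1 = 1 := by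
  have hq := D.qi_ne_zero i
  constructor <;> refine S.op_ext b (fun μ _ => ?_) (fun j _ => ?_) <;>
    simp only [Module.End.mul_apply, opK_vec, opK_yv, map_smul, smul_smul, Module.End.one_apply,
      ← zpow_add₀ hq] <;> simp

theorem opK_comm (i j : I) : S.opK b i 1 * S.opK b j 1 = S.opK b j 1 * S.opK b i 1 := by
  refine S.op_ext b (fun μ _ => ?_) (fun k _ => ?_) <;>
    simp only [Module.End.mul_apply, opK_vec, opK_yv, map_smul, smul_smul, mul_comm]

theorem opK_opE (i j : I) :
    S.opK b i 1 * S.opE b j * S.opK b i (-1) = D.qi i ^ (D.A i j) • S.opE b j := by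
  have hq := D.qi_ne_zero i
  refine S.op_ext b (fun μ hμ => ?_) (fun k _ => ?_)
  · simp only [Module.End.mul_apply, opK_vec, map_smul, LinearMap.smul_apply]
    by_cases h : μ = -clRoot D.A j
    · subst h
      rw [S.opE_neg_root b (S.neg_mem_iff.1 hμ), opK_zv]
      simp [clRoot]
    · rw [S.opE_vec b hμ h, map_smul, opK_vec, smul_comm, smul_smul _ _ (S.vec b _),
        ← zpow_add₀ hq, smul_comm]
      congr 3
      simp [clRoot]
  · simp only [Module.End.mul_apply, opK_yv, LinearMap.smul_apply, opE_yv]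
    split_ifs
    · rw [map_smul, opK_vec, smul_comm]; simp [clRoot]
    · simp

theorem opK_opF (i j : I) :
    S.opK b i 1 * S.opF b j * S.opK b i (-1) = D.qi i ^ (-D.A i j) • S.opF b j := by
  have hq := D.qi_ne_zero i
  refine S.op_ext b (fun μ hμ => ?_) (fun k _ => ?_)
  · simp only [Module.End.mul_apply, opK_vec, map_smul, LinearMap.smul_apply]
    by_cases h : μ = clRoot D.A j
    · subst h
      rw [S.opF_root b hμ, opK_zv]
      simp [clRoot]
    · rw [S.opF_vec b hμ h, map_smul, opK_vec, smul_comm, smul_smul _ _ (S.vec b _),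
        ← zpow_add₀ hq, smul_comm]
      congr 3
      simp [clRoot]
      ring
  · simp only [Module.End.mul_apply, opK_yv, LinearMap.smul_apply, opF_yv]
    split_ifs
    · rw [map_smul, opK_vec, smul_comm]; simp [clRoot]
    · simp

/-- The commutator of `e_i` and `f_i` on the vectors of the basis. -/
theorem opE_opF_vec (i : I) {μ : Pcl I} (hμ : μ ∈ S.R) :
    S.opE b i (S.opF b i (S.vec b μ)) =
      S.opF b i (S.opE b i (S.vec b μ)) + qNum (D.qi i) (μ i) • S.vec b μ := by
  have hq := D.qi_ne_zero i
  by_cases h1 : μ = clRoot D.A i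
  · subst h1
    rw [S.opF_root b hμ, opE_zv, S.opE_vec b hμ (clRoot_ne_neg i),
      S.vec_of_notMem b (S.two_notMem i hμ), smul_zero, map_zero, zero_add, D.diag, clRoot_self,
      D.qInt_eq]
    rfl
  by_cases h2 : μ = -clRoot D.A i
  · subst h2
    have hi := S.neg_mem_iff.1 hμ
    rw [S.opE_neg_root b hi, opF_zv, S.opF_vec b hμ (clRoot_ne_neg i).symm,
      S.vec_of_notMem b (S.neg_two_notMem i hi), smul_zero, map_zero, D.diag, Pi.neg_apply,
      clRoot_self, D.qInt_eq, qNum_neg, neg_smul]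
    exact (add_neg_cancel _).symm
  -- On a string that avoids `±α_i` the commutator is the identity `qNum_sl2` for `[up + 1] [down]`
  -- and `[down + 1] [up]`.
  obtain ⟨h3, h4⟩ := S.str hμ h1 h2
  have hEF : S.opE b i (S.opF b i (S.vec b μ)) =
      (qNum (D.qi i) (S.up i μ + 1) * qNum (D.qi i) (S.down i μ)) • S.vec b μ := by
    have h5 : μ - clRoot D.A i = μ + (-1 : ℤ) • clRoot D.A i := by
      rw [neg_one_smul, sub_eq_add_neg]
    rw [S.opF_vec b hμ h1, map_smul]
    by_cases h6 : μ - clRoot D.A i ∈ S.R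
    · rw [S.opE_vec b h6 fun h => S.ne_zero hμ (by
        have : μ - clRoot D.A i + clRoot D.A i = 0 := by rw [h, neg_add_cancel]
        rwa [sub_add_cancel] at this), sub_add_cancel, smul_smul]
      have h7 := (S.str_shift hμ h1 h2 (h5 ▸ h6)).1
      rw [← h5] at h7
      rw [D.qInt_eq, D.qInt_eq]
      push_cast
      rw [h7]
      congr 3
      ring
    · have h7 := (h4 (-1)).not.1 (h5 ▸ h6)
      have h8 : S.down i μ = 0 := by omega
      rw [S.vec_of_notMem b h6, map_zero, smul_zero, h8, Nat.cast_zero, qNum_zero, mul_zero, zero_smul]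
  have hFE : S.opF b i (S.opE b i (S.vec b μ)) =
      (qNum (D.qi i) (S.down i μ + 1) * qNum (D.qi i) (S.up i μ)) • S.vec b μ := by
    have h5 : μ + clRoot D.A i = μ + (1 : ℤ) • clRoot D.A i := by rw [one_smul]
    rw [S.opE_vec b hμ h2, map_smul]
    by_cases h6 : μ + clRoot D.A i ∈ S.R
    · rw [S.opF_vec b h6 fun h => S.ne_zero hμ (by
        have : μ + clRoot D.A i - clRoot D.A i = 0 := by rw [h, sub_self]
        rwa [add_sub_cancel_right] at this), add_sub_cancel_right, smul_smul]
      have h7 := (S.str_shift hμ h1 h2 (h5 ▸ h6)).2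
      rw [← h5] at h7
      rw [D.qInt_eq, D.qInt_eq]
      push_cast
      rw [h7]
      congr 3
      ring
    · have h7 := (h4 1).not.1 (h5 ▸ h6)
      have h8 : S.up i μ = 0 := by omega
      rw [S.vec_of_notMem b h6, map_zero, smul_zero, h8, Nat.cast_zero, qNum_zero, mul_zero, zero_smul]
  rw [hEF, hFE, ← add_smul, ← h3, ← qNum_sl2 hq]
  congr 1
  ring

theorem opE_opF_yv (i j : I) : S.opE b i (S.opF b i (S.yv b j)) = S.opF b i (S.opE b i (S.yv b j)) := by
  rw [opE_yv, opF_yv]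
  split_ifs with h
  · rw [map_smul, map_smul]
    by_cases hi : clRoot D.A i ∈ S.R
    · rw [S.opE_neg_root b hi, S.opF_root b hi]
    · rw [S.vec_of_notMem b hi, S.vec_of_notMem b (S.neg_mem_iff.not.2 hi), map_zero, map_zero]
  · simp

theorem opE_opF_same (i : I) : S.opE b i * S.opF b i - S.opF b i * S.opE b i =
    (D.qi i - (D.qi i)⁻¹)⁻¹ • (S.opK b i 1 - S.opK b i (-1)) := by
  refine S.op_ext b (fun μ hμ => ?_) (fun j _ => ?_)
  · simp only [LinearMap.sub_apply, Module.End.mul_apply, LinearMap.smul_apply, opK_vec,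
      S.opE_opF_vec b i hμ, add_sub_cancel_left, ← sub_smul, smul_smul]
    rw [qNum, div_eq_inv_mul, one_mul, neg_one_mul]
  · simp only [LinearMap.sub_apply, Module.End.mul_apply, LinearMap.smul_apply, opK_yv,
      opE_opF_yv, sub_self, smul_zero]

/-- The operators `e_i` and `f_j` commute for `i ≠ j`. Away from the weight `0` this is the
condition on squares of the string system; the paths through weight `0` are compared with the
strings of the simple roots. -/
theorem opE_opF_ne {i j : I} (hij : i ≠ j) :
    S.opE b i * S.opF b j = S.opF b j * S.opE b i := by
  have hA := D.off_diag i j hij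
  have hA' := D.off_diag j i hij.symm
  have hz := D.zero_iff i j
  refine S.op_ext b (fun μ hμ => ?_) (fun k hk => ?_)
  · simp only [Module.End.mul_apply]
    by_cases h1 : μ = clRoot D.A j
    · subst h1
      -- `e_i f_j v_{α_j} = [-a_ji]_j v_{α_i}`
      rw [S.opF_root b hμ, opE_zv]
      by_cases hi : clRoot D.A i ∈ S.R
      · have hne : clRoot D.A j ≠ -clRoot D.A i := fun h =>
          S.root_add_ne i j hij hi (by rw [h, add_neg_cancel])
        obtain ⟨p1, p2⟩ := S.root_str hij hi hμ
        rw [S.opE_vec b hμ hne, map_smul, p1, zero_add, qInt_one, one_smul]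
        have hiff := (S.str hi (clRoot_ne hij) (fun h => S.root_add_ne i j hij hi (by
          rw [h, neg_add_cancel]))).2 1
        obtain ⟨q1, q2⟩ := S.root_str hij.symm hμ hi
        rw [one_smul, q1, q2] at hiff
        rw [add_comm]
        by_cases h0 : D.A j i = 0
        · rw [S.vec_of_notMem b (hiff.not.2 (by omega)), map_zero, h0]
          simp [qInt_zero]
        · have hm := hiff.2 (by omega)
          have hs := (S.str_shift hi (clRoot_ne hij) (fun h => S.root_add_ne i j hij hi (by
            rw [h, neg_add_cancel])) (k := 1) (by rwa [one_smul])).2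
          rw [one_smul, q2] at hs
          rw [S.opF_vec b hm fun h => S.ne_zero hi (by simpa using h), add_sub_cancel_right]
          congr 2
          omega
      · rw [S.vec_of_notMem b hi, smul_zero]
        by_cases h2 : clRoot D.A j = -clRoot D.A i
        · exact absurd (S.neg_mem_iff.1 (h2 ▸ hμ)) hi
        rw [S.opE_vec b hμ h2, map_smul]
        by_cases h3 : clRoot D.A j + clRoot D.A i ∈ S.R
        · rw [S.opF_vec b h3 fun h => ?_, add_sub_cancel_left, S.vec_of_notMem b hi, smul_zero, smul_zero]
          have := congrFun (add_eq_left.1 h) i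
          rw [clRoot_self] at this
          simp at this
        · rw [S.vec_of_notMem b h3, map_zero, smul_zero]
    by_cases h2 : μ = -clRoot D.A i
    · subst h2
      have hi := S.neg_mem_iff.1 hμ
      -- the mirror image of the case of `α_j`
      rw [S.opE_neg_root b hi, opF_zv, S.opF_vec b hμ h1, map_smul]
      by_cases hj : clRoot D.A j ∈ S.R
      · obtain ⟨p1, p2⟩ := S.neg_root_str hij.symm hj hi
        rw [p1, zero_add, qInt_one, one_smul]
        have hne1 : -clRoot D.A j ≠ clRoot D.A i := fun h => S.root_add_ne i j hij hi (by
          rw [← h, neg_add_cancel])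
        have hne2 : -clRoot D.A j ≠ -clRoot D.A i := fun h => clRoot_ne hij.symm (neg_injective h)
        obtain ⟨q1, q2⟩ := S.neg_root_str hij hi hj
        have hiff := (S.str (S.neg_mem hj) hne1 hne2).2 (-1)
        rw [neg_one_smul, ← sub_eq_add_neg, q1, q2] at hiff
        rw [show -clRoot D.A i - clRoot D.A j = -clRoot D.A j - clRoot D.A i by abel]
        by_cases h0 : D.A i j = 0
        · rw [S.vec_of_notMem b (hiff.not.2 (by omega)), map_zero, h0]
          simp [qInt_zero]
        · have hm := hiff.2 (by omega)
          have hs := (S.str_shift (S.neg_mem hj) hne1 hne2 (k := -1) (by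
            rwa [neg_one_smul, ← sub_eq_add_neg])).1
          rw [neg_one_smul, ← sub_eq_add_neg, q2] at hs
          rw [S.opE_vec b hm fun h => S.ne_zero (S.neg_mem hj) (by
            have : -clRoot D.A j - clRoot D.A i + clRoot D.A i = 0 := by rw [h, neg_add_cancel]
            rwa [sub_add_cancel] at this), sub_add_cancel]
          congr 2
          omega
      · have hj' := S.neg_mem_iff.not.2 hj
        rw [S.vec_of_notMem b hj', smul_zero]
        by_cases h3 : -clRoot D.A i - clRoot D.A j ∈ S.R
        · rw [S.opE_vec b h3 fun h => ?_, show -clRoot D.A i - clRoot D.A j + clRoot D.A i =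
            -clRoot D.A j by abel, S.vec_of_notMem b hj', smul_zero, smul_zero]
          have := congrFun (sub_eq_self.1 h) j
          rw [clRoot_self] at this
          simp at this
        · rw [S.vec_of_notMem b h3, map_zero, smul_zero]
    · rw [S.opF_vec b hμ h1, map_smul, S.opE_vec b hμ h2, map_smul]
      have hne1 : μ - clRoot D.A j ≠ -clRoot D.A i := fun h => S.sub_notMem i j hij (by
        have : μ = clRoot D.A j - clRoot D.A i := by
          rw [sub_eq_add_neg, ← h]; abel
        rwa [← this])
      have hne2 : μ + clRoot D.A i ≠ clRoot D.A j := fun h => S.sub_notMem i j hij (by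
        rwa [← h, add_sub_cancel_right])
      have e1 : S.opE b i (S.vec b (μ - clRoot D.A j)) = if μ - clRoot D.A j ∈ S.R then
          D.qInt i (S.down i (μ - clRoot D.A j) + 1) • S.vec b (μ + clRoot D.A i - clRoot D.A j)
          else 0 := by
        split_ifs with h
        · rw [S.opE_vec b h hne1, show μ - clRoot D.A j + clRoot D.A i =
            μ + clRoot D.A i - clRoot D.A j by abel]
        · rw [S.vec_of_notMem b h, map_zero]
      have e2 : S.opF b j (S.vec b (μ + clRoot D.A i)) = if μ + clRoot D.A i ∈ S.R then
          D.qInt j (S.up j (μ + clRoot D.A i) + 1) • S.vec b (μ + clRoot D.A i - clRoot D.A j)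
          else 0 := by
        split_ifs with h
        · rw [S.opF_vec b h hne2]
        · rw [S.vec_of_notMem b h, map_zero]
      rw [e1, e2]
      by_cases h3 : μ + clRoot D.A i - clRoot D.A j ∈ S.R
      · obtain ⟨hiff, hid⟩ := S.square μ hμ i j hij h1 h2 h3
        by_cases h4 : μ + clRoot D.A i ∈ S.R
        · rw [if_pos h4, if_pos (hiff.1 h4), smul_smul, smul_smul, hid h4]
        · rw [if_neg h4, if_neg (hiff.not.1 h4), smul_zero, smul_zero]
      · rw [S.vec_of_notMem b h3]
        simp
  · simp only [Module.End.mul_apply, opE_yv, opF_yv]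
    have hne : -clRoot D.A j ≠ -clRoot D.A i := fun h => clRoot_ne hij.symm (neg_injective h)
    have e1 : S.opE b i (S.vec b (-clRoot D.A j)) = 0 := by
      by_cases hj : -clRoot D.A j ∈ S.R
      · rw [S.opE_vec b hj hne, S.vec_of_notMem b (by
          rw [add_comm, ← sub_eq_add_neg]; exact S.sub_notMem j i hij.symm), smul_zero]
      · rw [S.vec_of_notMem b hj, map_zero]
    have e2 : S.opF b j (S.vec b (clRoot D.A i)) = 0 := by
      by_cases hi : clRoot D.A i ∈ S.R
      · rw [S.opF_vec b hi (clRoot_ne hij), S.vec_of_notMem b (S.sub_notMem j i hij.symm), smul_zero]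
      · rw [S.vec_of_notMem b hi, map_zero]
    split_ifs <;> simp [e1, e2]

end StringSystem
end AffineDatum

section Rep

variable {I : Type u} [Fintype I] [DecidableEq I] {D : AffineDatum I}
  {V : Type v} [AddCommGroup V] [Module BaseField V]

/-- The operators that represent the generators. -/
def genOp (E F K K' : I → Module.End BaseField V) : Gen I → Module.End BaseField V
  | .e i => E i
  | .f i => F i
  | .K i => K i
  | .Kinv i => K' i

/-- The representation defined by operators that satisfy the defining relations. -/
def repOfRel (E F K K' : I → Module.End BaseField V)
    (h : ∀ ⦃x y⦄, Rel D x y → FreeAlgebra.lift BaseField (genOp E F K K') x =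
      FreeAlgebra.lift BaseField (genOp E F K K') y) : Uq D →ₐ[BaseField] Module.End BaseField V :=
  RingQuot.liftAlgHom BaseField ⟨FreeAlgebra.lift BaseField (genOp E F K K'), h⟩

theorem repOfRel_gen (E F K K' : I → Module.End BaseField V)
    (h : ∀ ⦃x y⦄, Rel D x y → FreeAlgebra.lift BaseField (genOp E F K K') x =
      FreeAlgebra.lift BaseField (genOp E F K K') y) (i : I) :
    repOfRel E F K K' h (ge D i) = E i ∧ repOfRel E F K K' h (gf D i) = F i ∧
      repOfRel E F K K' h (gK D i) = K i := by
  refine ⟨?_, ?_, ?_⟩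
  · rw [ge, repOfRel, RingQuot.liftAlgHom_mkAlgHom_apply, FreeAlgebra.lift_ι_apply]; rfl
  · rw [gf, repOfRel, RingQuot.liftAlgHom_mkAlgHom_apply, FreeAlgebra.lift_ι_apply]; rfl
  · rw [gK, repOfRel, RingQuot.liftAlgHom_mkAlgHom_apply, FreeAlgebra.lift_ι_apply]; rfl

theorem map_divPow {A B : Type*} [Ring A] [Ring B] [Algebra BaseField A] [Algebra BaseField B]
    (φ : A →ₐ[BaseField] B) (i : I) (x : A) (n : ℕ) : φ (D.divPow i x n) = D.divPow i (φ x) n := by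
  simp [AffineDatum.divPow]

theorem map_serre (φ : FreeAlgebra BaseField (Gen I) →ₐ[BaseField] Module.End BaseField V) (i j : I)
    (x y : FreeAlgebra BaseField (Gen I)) : φ (serre D i j x y) =
    ∑ k ∈ Finset.range ((1 - D.A i j).toNat + 1), (-1 : Module.End BaseField V) ^ k *
      (D.divPow i (φ x) ((1 - D.A i j).toNat - k) * φ y * D.divPow i (φ x) k) := by
  simp only [serre, map_sum, map_mul, map_pow, map_neg, map_one, map_divPow]

end Rep

namespace AffineDatum

variable {I : Type u} [Fintype I] [DecidableEq I] {D : AffineDatum I} {ϖ : Pcl I}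

namespace StringSystem

variable (S : D.StringSystem ϖ) {V : Type v} [AddCommGroup V] [Module BaseField V]
  (b : Module.Basis S.Idx BaseField V)

/-- The weight space of weight `μ` of the module; it is spanned by the basis vectors of weight
`μ`. -/
def modWt (μ : Pcl I) : Submodule BaseField V := ⨅ i, (S.opK b i 1).eigenspace (D.qi i ^ μ i)

theorem mem_modWt {μ : Pcl I} {x : V} :
    x ∈ S.modWt b μ ↔ ∀ i, S.opK b i 1 x = D.qi i ^ μ i • x := by
  simp [modWt, Submodule.mem_iInf]

theorem repr_opK (i : I) (x : V) (k : S.Idx) :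
    b.repr (S.opK b i 1 x) k = D.qi i ^ S.idxWt k i * b.repr x k := by
  have h : (b.coord k).comp (S.opK b i 1) = (D.qi i ^ S.idxWt k i) • b.coord k := by
    refine b.ext fun l => ?_
    rw [LinearMap.comp_apply, opK, Module.Basis.constr_basis, map_smul, LinearMap.smul_apply, one_mul,
      Module.Basis.coord_apply, b.repr_self]
    by_cases hkl : l = k
    · subst hkl; rfl
    · simp [hkl]
  exact LinearMap.congr_fun h x

theorem mem_modWt_iff {μ : Pcl I} {x : V} :
    x ∈ S.modWt b μ ↔ ∀ k, b.repr x k ≠ 0 → S.idxWt k = μ := by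
  rw [mem_modWt]
  constructor
  · intro h k hk
    funext i
    have h1 := congrArg (fun y => b.repr y k) (h i)
    simp only [repr_opK, map_smul, Finsupp.smul_apply, smul_eq_mul] at h1
    exact D.qi_zpow_injective i (mul_right_cancel₀ hk h1)
  · intro h i
    apply b.repr.injective
    ext k
    rw [repr_opK, map_smul, Finsupp.smul_apply, smul_eq_mul]
    by_cases hk : b.repr x k = 0
    · rw [hk, mul_zero, mul_zero]
    · rw [h k hk]

theorem idx_mem_modWt (k : S.Idx) : b k ∈ S.modWt b (S.idxWt k) := by
  classical
  rw [mem_modWt_iff]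
  intro l hl
  rw [b.repr_self, Finsupp.single_apply] at hl
  rw [(ite_ne_right_iff.1 hl).1]

theorem vec_mem_modWt (μ : Pcl I) : S.vec b μ ∈ S.modWt b μ := by
  rw [mem_modWt]; intro i; rw [opK_vec, one_mul]

theorem yv_mem_modWt (j : I) : S.yv b j ∈ S.modWt b 0 := by
  rw [mem_modWt]; intro i; rw [opK_yv]; simp

/-- A weight vector of nonzero weight is a multiple of a basis vector. -/
theorem eq_smul_vec {μ : Pcl I} (hμ : μ ≠ 0) {x : V} (hx : x ∈ S.modWt b μ) :
    ∃ c : BaseField, x = c • S.vec b μ := by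
  rw [mem_modWt_iff] at hx
  by_cases hR : μ ∈ S.R
  · refine ⟨b.repr x (.inl ⟨μ, hR⟩), ?_⟩
    rw [vec_of_mem S b hR]
    conv_lhs => rw [← b.linearCombination_repr x, Finsupp.linearCombination_apply]
    rw [Finsupp.sum, Finset.sum_eq_single (Sum.inl ⟨μ, hR⟩)]
    · intro k hk hne
      have h1 := hx k (Finsupp.mem_support_iff.1 hk)
      rcases k with ⟨ν, hν⟩ | ⟨j, hj⟩
      · exact absurd (by simpa [idxWt] using h1) (fun h => hne (by simp [h]))
      · exact absurd h1.symm hμ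
    · intro h; rw [Finsupp.notMem_support_iff.1 h, zero_smul]
  · refine ⟨0, ?_⟩
    rw [zero_smul]
    apply b.repr.injective
    ext k
    rw [map_zero, Finsupp.zero_apply]
    by_contra hk
    have h1 := hx k hk
    rcases k with ⟨ν, hν⟩ | ⟨j, hj⟩
    · exact hR (h1 ▸ hν)
    · exact hμ h1.symm

theorem modWt_eq_bot {μ : Pcl I} (hμ : μ ≠ 0) (hR : μ ∉ S.R) {x : V} (hx : x ∈ S.modWt b μ) : x = 0 := by
  obtain ⟨c, rfl⟩ := S.eq_smul_vec b hμ hx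
  rw [vec_of_notMem S b hR, smul_zero]

/-- A vector of weight zero is a combination of the `y_j`. -/
theorem eq_sum_yv {x : V} (hx : x ∈ S.modWt b 0) :
    ∃ c : I → BaseField, x = ∑ j, c j • S.yv b j ∧ ∀ j, clRoot D.A j ∉ S.R → c j = 0 := by
  classical
  rw [mem_modWt_iff] at hx
  obtain ⟨c, hc, hc0⟩ : ∃ c : I → BaseField, (∀ j h, c j = b.repr x (.inr ⟨j, h⟩)) ∧
      ∀ j, clRoot D.A j ∉ S.R → c j = 0 :=
    ⟨fun j => if h : clRoot D.A j ∈ S.R then b.repr x (.inr ⟨j, h⟩) else 0, fun j h => dif_pos h,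
      fun j hj => dif_neg hj⟩
  refine ⟨c, ?_, hc0⟩
  apply b.repr.injective
  ext k
  rw [map_sum, Finsupp.finsetSum_apply]
  rcases k with ⟨ν, hν⟩ | ⟨j, hj⟩
  · have h0 : b.repr x (.inl ⟨ν, hν⟩) = 0 := by
      by_contra hk
      exact S.ne_zero hν (hx _ hk)
    rw [h0]
    refine (Finset.sum_eq_zero fun j _ => ?_).symm
    by_cases h : clRoot D.A j ∈ S.R
    · rw [yv_of_mem S b h]; simp
    · rw [yv_of_notMem S b h]; simp
  · rw [Finset.sum_eq_single_of_mem j (Finset.mem_univ j)]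
    · rw [hc j hj, yv_of_mem S b hj]; simp
    · intro l _ hl
      by_cases h : clRoot D.A l ∈ S.R
      · rw [yv_of_mem S b h, map_smul, b.repr_self]; simp [hl]
      · rw [yv_of_notMem S b h]; simp

theorem opE_mem {i : I} {μ : Pcl I} {x : V} (hx : x ∈ S.modWt b μ) :
    S.opE b i x ∈ S.modWt b (μ + clRoot D.A i) := by
  rw [mem_modWt] at hx ⊢
  intro j
  have h1 := LinearMap.congr_fun (S.opK_opE b j i) (S.opK b j 1 x)
  have h2 : S.opK b j (-1) (S.opK b j 1 x) = x := LinearMap.congr_fun (S.opK_mul b j).2 x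
  simp only [Module.End.mul_apply, LinearMap.smul_apply] at h1
  rw [h2, hx j, map_smul, smul_smul, ← zpow_add₀ (D.qi_ne_zero j)] at h1
  rw [h1, add_comm]; rfl

theorem opF_mem {i : I} {μ : Pcl I} {x : V} (hx : x ∈ S.modWt b μ) :
    S.opF b i x ∈ S.modWt b (μ - clRoot D.A i) := by
  rw [mem_modWt] at hx ⊢
  intro j
  have h1 := LinearMap.congr_fun (S.opK_opF b j i) (S.opK b j 1 x)
  have h2 : S.opK b j (-1) (S.opK b j 1 x) = x := LinearMap.congr_fun (S.opK_mul b j).2 x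
  simp only [Module.End.mul_apply, LinearMap.smul_apply] at h1
  rw [h2, hx j, map_smul, smul_smul, ← zpow_add₀ (D.qi_ne_zero j)] at h1
  rw [h1, add_comm, ← sub_eq_add_neg]; rfl

theorem iSup_modWt : ⨆ μ, S.modWt b μ = ⊤ := by
  rw [eq_top_iff, ← b.span_eq, Submodule.span_le]
  rintro _ ⟨k, rfl⟩
  exact Submodule.mem_iSup_of_mem _ (S.idx_mem_modWt b k)

/-- An operator that shifts weights by `±α_i` is nilpotent. -/
theorem nilp_of_shift {T : Module.End BaseField V} (i : I) (s : ℤ) (hs : s ≠ 0)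
    (hT : ∀ μ, ∀ x ∈ S.modWt b μ, T x ∈ S.modWt b (μ + s • clRoot D.A i)) (x : V) :
    ∃ n : ℕ, (T ^ n) x = 0 := by
  have hmem : ∀ x, x ∈ T.maxGenEigenspace 0 ↔ ∃ n : ℕ, (T ^ n) x = 0 := fun x => by
    rw [Module.End.mem_maxGenEigenspace]; simp
  rw [← hmem]
  have hle : ⨆ μ, S.modWt b μ ≤ T.maxGenEigenspace 0 := iSup_le fun μ x hx => by
    rw [hmem]
    have hpow : ∀ n : ℕ, (T ^ n) x ∈ S.modWt b (μ + (n * s : ℤ) • clRoot D.A i) := by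
      intro n
      induction n with
      | zero => simpa using hx
      | succ n ih =>
        rw [pow_succ', Module.End.mul_apply]
        have := hT _ _ ih
        rwa [add_assoc, ← add_smul, show (n * s + s : ℤ) = ((n + 1 : ℕ) : ℤ) * s by push_cast; ring]
          at this
    -- The weights `μ + n s α_i` are distinct, and only finitely many of them are weights of the
    -- module.
    have hinj : Function.Injective fun n : ℕ => μ + (n * s : ℤ) • clRoot D.A i := fun m n h => by
      have h1 := congrFun (add_left_cancel h) i
      simp only [Pi.smul_apply, clRoot_self, smul_eq_mul] at h1
      have h2 := mul_right_cancel₀ hs (mul_right_cancel₀ two_ne_zero h1)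
      exact_mod_cast h2
    obtain ⟨n, hn⟩ := ((S.R.finite_toSet.union (Set.finite_singleton 0)).preimage
      hinj.injOn).exists_notMem
    simp only [Set.mem_preimage, Set.mem_union, Finset.mem_coe, Set.mem_singleton_iff, not_or] at hn
    exact ⟨n, S.modWt_eq_bot b hn.2 hn.1 (hpow n)⟩
  rw [iSup_modWt] at hle
  exact hle Submodule.mem_top

theorem opE_nilp (i : I) (x : V) : ∃ n : ℕ, (S.opE b i ^ n) x = 0 :=
  S.nilp_of_shift b i 1 one_ne_zero (fun μ x hx => by rw [one_smul]; exact S.opE_mem b hx) x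

theorem opF_nilp (i : I) (x : V) : ∃ n : ℕ, (S.opF b i ^ n) x = 0 :=
  S.nilp_of_shift b i (-1) (by norm_num) (fun μ x hx => by
    rw [neg_one_smul, ← sub_eq_add_neg]; exact S.opF_mem b hx) x

theorem opK_inv (i : I) (n : ℤ) {x : V} (hx : S.opK b i 1 x = D.qi i ^ n • x) :
    S.opK b i (-1) x = D.qi i ^ (-n) • x := by
  have h1 := congrArg (S.opK b i (-1)) hx
  have h2 : S.opK b i (-1) (S.opK b i 1 x) = x := LinearMap.congr_fun (S.opK_mul b i).2 x
  rw [h2, map_smul] at h1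
  conv_rhs => rw [h1]
  rw [smul_smul, ← zpow_add₀ (D.qi_ne_zero i), neg_add_cancel, zpow_zero, one_smul]

theorem qTriple (i : I) : QTriple (D.qi i) (S.opE b i) (S.opF b i)
    fun n => (S.opK b i 1).eigenspace (D.qi i ^ n) := by
  have hk : ∀ x, S.opK b i (-1) (S.opK b i 1 x) = x := LinearMap.congr_fun (S.opK_mul b i).2
  refine qTriple_of_relations D i (fun x => ?_) (fun x => ?_) (fun n x hx => ?_) (S.opE_nilp b i)
    (S.opF_nilp b i)
  · have := LinearMap.congr_fun (S.opK_opE b i i) (S.opK b i 1 x)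
    simp only [Module.End.mul_apply, hk, D.diag, LinearMap.smul_apply] at this
    exact this
  · have := LinearMap.congr_fun (S.opK_opF b i i) (S.opK b i 1 x)
    simp only [Module.End.mul_apply, hk, D.diag, LinearMap.smul_apply] at this
    exact this
  · have := LinearMap.congr_fun (S.opE_opF_same b i) x
    simp only [LinearMap.sub_apply, Module.End.mul_apply, LinearMap.smul_apply, hx,
      S.opK_inv b i n hx, ← sub_smul, smul_smul] at this
    rw [qNum, div_eq_inv_mul, ← this]; abel

theorem iSup_eigenspace (i : I) : ⨆ n : ℤ, (S.opK b i 1).eigenspace (D.qi i ^ n) = ⊤ := by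
  rw [eq_top_iff, ← S.iSup_modWt b]
  refine iSup_le fun μ => le_iSup_of_le (μ i) fun x hx => ?_
  rw [Module.End.mem_eigenspace_iff]
  exact (S.mem_modWt b).1 hx i

theorem opK_shift {i : I} {n : ℤ} {T : Module.End BaseField V} {a : ℤ}
    (hT : S.opK b i 1 * T * S.opK b i (-1) = D.qi i ^ a • T) {x : V}
    (hx : x ∈ (S.opK b i 1).eigenspace (D.qi i ^ n)) :
    T x ∈ (S.opK b i 1).eigenspace (D.qi i ^ (n + a)) := by
  have hk : ∀ x, S.opK b i (-1) (S.opK b i 1 x) = x := LinearMap.congr_fun (S.opK_mul b i).2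
  rw [Module.End.mem_eigenspace_iff] at hx ⊢
  have h1 := LinearMap.congr_fun hT (S.opK b i 1 x)
  simp only [Module.End.mul_apply, hk, LinearMap.smul_apply] at h1
  rw [h1, hx, map_smul, smul_smul, ← zpow_add₀ (D.qi_ne_zero i), add_comm]

/-- The operators satisfy the defining relations; the Serre relations follow from the others by
`serre_eq_zero`. -/
theorem rel (x y : FreeAlgebra BaseField (Gen I)) (h : Rel D x y) :
    FreeAlgebra.lift BaseField (genOp (S.opE b) (S.opF b) (S.opK b · 1) (S.opK b · (-1))) x =
      FreeAlgebra.lift BaseField (genOp (S.opE b) (S.opF b) (S.opK b · 1) (S.opK b · (-1))) y := by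
  induction h with
  | K_Kinv i => simpa [genOp] using (S.opK_mul b i).1
  | Kinv_K i => simpa [genOp] using (S.opK_mul b i).2
  | K_comm i j => simpa [genOp] using S.opK_comm b i j
  | K_e i j => simpa [genOp] using S.opK_opE b i j
  | K_f i j => simpa [genOp] using S.opK_opF b i j
  | e_f_same i => simpa [genOp] using S.opE_opF_same b i
  | e_f_ne i j h => simpa [genOp, sub_eq_zero] using S.opE_opF_ne b h
  | serre_e i j h =>
    rw [map_serre, map_zero]
    simp only [FreeAlgebra.lift_ι_apply, genOp]
    exact serre_eq_zero D i (S.qTriple b i) (S.iSup_eigenspace b i) _ (D.off_diag i j h)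
      (fun n x hx => S.opK_shift b (S.opK_opE b i j) hx)
      fun x => (LinearMap.congr_fun (S.opE_opF_ne b h.symm) x).symm
  | serre_f i j h =>
    rw [map_serre, map_zero]
    simp only [FreeAlgebra.lift_ι_apply, genOp]
    refine serre_eq_zero D i (S.qTriple b i).symm ?_ _ (D.off_diag i j h)
      (fun n x hx => ?_) fun x => LinearMap.congr_fun (S.opE_opF_ne b h) x
    · rw [← S.iSup_eigenspace b i]
      exact (Equiv.neg ℤ).iSup_comp (g := fun n => (S.opK b i 1).eigenspace (D.qi i ^ n))
    · have := S.opK_shift b (S.opK_opF b i j) hx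
      rwa [show -n + -D.A i j = -(n + D.A i j) by ring] at this

/-- The representation attached to the string system. -/
def rep : Uq D →ₐ[BaseField] Module.End BaseField V :=
  repOfRel (S.opE b) (S.opF b) (S.opK b · 1) (S.opK b · (-1)) (S.rel b)

/-- A representation whose generators act by the operators attached to a string system. -/
def IsModel (ρ : Uq D →ₐ[BaseField] Module.End BaseField V) : Prop :=
  ∀ i, ρ (ge D i) = S.opE b i ∧ ρ (gf D i) = S.opF b i ∧ ρ (gK D i) = S.opK b i 1

theorem isModel_rep : S.IsModel b (S.rep b) := fun i => repOfRel_gen _ _ _ _ (S.rel b) i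

variable {S b} {ρ : Uq D →ₐ[BaseField] Module.End BaseField V}

theorem IsModel.wtSpace (h : S.IsModel b ρ) (μ : Pcl I) : wtSpace ρ μ = S.modWt b μ := by
  ext x
  rw [mem_modWt]
  exact forall_congr' fun i => by rw [(h i).2.2]

theorem IsModel.isIntegrable (h : S.IsModel b ρ) : IsIntegrable ρ where
  weights := by simp only [h.wtSpace, iSup_modWt]
  nilp_e i x := by rw [(h i).1]; exact S.opE_nilp b i x
  nilp_f i x := by rw [(h i).2.1]; exact S.opF_nilp b i x

end StringSystem
end AffineDatum

namespace AffineDatum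

variable {I : Type u} [Fintype I] [DecidableEq I] {D : AffineDatum I} {ϖ : Pcl I}

namespace StringSystem

variable (S : D.StringSystem ϖ)

/-- The off-diagonal coefficients of `z_i` vanish at `q = 0`. -/
theorem ord_zCoeff_pos {i j : I} (hij : i ≠ j) (hi : clRoot D.A i ∈ S.R) (hj : clRoot D.A j ∈ S.R) :
    0 < ord (D.zCoeff i j) := by
  have hA := D.off_diag i j hij
  by_cases h0 : D.A i j = 0
  · rw [zCoeff, h0, Int.natAbs_zero, qInt_zero, zero_div, ord_eq_top.2 rfl]
    exact WithTop.coe_lt_top _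
  · have hs := D.len_symm i j
    have hli := D.len_pos i
    have hlj := D.len_pos j
    refine D.ord_qInt_div_pos i j (by omega) ?_
    have h1 : (((D.A i j).natAbs : ℤ) : ℚ) = ((-D.A i j : ℤ) : ℚ) := by
      congr 1; omega
    rw [← Int.cast_natCast, h1]
    push_cast
    rcases S.adj i j hij hi hj h0 with h2 | h2
    · rw [h2]; push_cast; linarith
    · rw [h2] at hs; push_cast at hs; linarith

theorem zCoeff_mem {i j : I} (hi : clRoot D.A i ∈ S.R) (hj : clRoot D.A j ∈ S.R) :
    D.zCoeff i j ∈ A0 := by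
  by_cases hij : i = j
  · subst hij; rw [zCoeff_self]; exact A0.one_mem
  · exact (S.ord_zCoeff_pos hij hi hj).le

/-- The matrix that expresses the `z_i` by the `y_j`. -/
def zMatrix : Matrix {j // clRoot D.A j ∈ S.R} {j // clRoot D.A j ∈ S.R} A0 :=
  fun i j => ⟨D.zCoeff i.1 j.1, S.zCoeff_mem i.2 j.2⟩

instance : Fintype {j // clRoot D.A j ∈ S.R} := Fintype.ofFinite _

/-- The matrix of the `z_i` is the identity at `q = 0`. -/
theorem isUnit_zMatrix : IsUnit S.zMatrix := by
  rw [Matrix.isUnit_iff_isUnit_det]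
  refine isUnit_of_notMem_m0 fun h => ?_
  have h1 : (Ideal.Quotient.mk m0).mapMatrix S.zMatrix = 1 := by
    ext i j
    rw [RingHom.mapMatrix_apply, Matrix.map_apply, Matrix.one_apply]
    split_ifs with hij
    · subst hij
      have : S.zMatrix i i = 1 := Subtype.ext (zCoeff_self i.1)
      rw [this, map_one]
    · exact Ideal.Quotient.eq_zero_iff_mem.2
        (S.ord_zCoeff_pos (fun h => hij (Subtype.ext h)) i.2 j.2)
  have h2 := Ideal.Quotient.eq_zero_iff_mem.2 h
  rw [RingHom.map_det, h1, Matrix.det_one] at h2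
  exact one_ne_zero h2

variable {V : Type v} [AddCommGroup V] [Module BaseField V] (b : Module.Basis S.Idx BaseField V)

theorem zv_eq_sum {i : I} (hi : clRoot D.A i ∈ S.R) :
    S.zv b i = ∑ j : {j // clRoot D.A j ∈ S.R}, S.zMatrix ⟨i, hi⟩ j • S.yv b j.1 := by
  classical
  have h1 : S.zv b i = ∑ j ∈ Finset.univ.filter (fun j => clRoot D.A j ∈ S.R), D.zCoeff i j • S.yv b j := by
    rw [zv]
    refine (Finset.sum_subset (Finset.subset_univ _) fun j _ hj => ?_).symm
    rw [yv_of_notMem S b (by simpa using hj), smul_zero]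
  rw [h1]
  exact Finset.sum_subtype _ (by simp) _

/-- The `y_j` are combinations of the `z_i` with coefficients in the local ring. -/
theorem yv_mem_of_zv (L : Submodule A0 V) (hL : ∀ i, clRoot D.A i ∈ S.R → S.zv b i ∈ L) {j : I}
    (hj : clRoot D.A j ∈ S.R) : S.yv b j ∈ L := by
  classical
  obtain ⟨N, -, hN⟩ := isUnit_iff_exists.1 S.isUnit_zMatrix
  have h1 : ∑ i : {j // clRoot D.A j ∈ S.R}, N ⟨j, hj⟩ i • S.zv b i.1 = S.yv b j := by
    have h2 : ∀ i : {j // clRoot D.A j ∈ S.R}, N ⟨j, hj⟩ i • S.zv b i.1 =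
        ∑ l : {j // clRoot D.A j ∈ S.R}, (N ⟨j, hj⟩ i * S.zMatrix i l) • S.yv b l.1 := fun i => by
      rw [S.zv_eq_sum b i.2, Finset.smul_sum]
      exact Finset.sum_congr rfl fun l _ => smul_smul _ _ _
    rw [Finset.sum_congr rfl fun i _ => h2 i, Finset.sum_comm]
    simp only [← Finset.sum_smul, ← Matrix.mul_apply, hN, Matrix.one_apply]
    rw [Finset.sum_eq_single ⟨j, hj⟩ (fun l _ hl => by rw [if_neg (Ne.symm hl), zero_smul])
      (fun h => absurd (Finset.mem_univ _) h), if_pos rfl, one_smul]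
  rw [← h1]
  exact L.sum_mem fun i _ => L.smul_mem _ (hL i.1 i.2)

theorem vec_ne_zero {μ : Pcl I} (h : μ ∈ S.R) : S.vec b μ ≠ 0 := by
  rw [vec_of_mem S b h]; exact b.ne_zero _

/-! ### Divided powers on strings -/

theorem up_eq_zero {μ : Pcl I} (hμ : μ ∈ S.R) {i : I} (h1 : μ ≠ clRoot D.A i) (h2 : μ ≠ -clRoot D.A i)
    (h : μ + clRoot D.A i ∉ S.R) : S.up i μ = 0 := by
  have h3 := ((S.str hμ h1 h2).2 1).not.1 (by rwa [one_smul])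
  omega

theorem down_eq_zero {μ : Pcl I} (hμ : μ ∈ S.R) {i : I} (h1 : μ ≠ clRoot D.A i)
    (h2 : μ ≠ -clRoot D.A i) (h : μ - clRoot D.A i ∉ S.R) : S.down i μ = 0 := by
  have h3 := ((S.str hμ h1 h2).2 (-1)).not.1 (by rwa [neg_one_smul, ← sub_eq_add_neg])
  omega

/-- No member of a string is `±α_i` unless all are. -/
theorem str_ne {μ : Pcl I} (hμ : μ ∈ S.R) {i : I} (h1 : μ ≠ clRoot D.A i) (h2 : μ ≠ -clRoot D.A i)
    {k : ℤ} (hk : μ + k • clRoot D.A i ∈ S.R) :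
    μ + k • clRoot D.A i ≠ clRoot D.A i ∧ μ + k • clRoot D.A i ≠ -clRoot D.A i := by
  have key : ∀ s : ℤ, s = 1 ∨ s = -1 → μ + k • clRoot D.A i ≠ s • clRoot D.A i := fun s hs he => by
    have hi : clRoot D.A i ∈ S.R := by
      rcases hs with rfl | rfl
      · rwa [he, one_smul] at hk
      · rw [he, neg_one_smul] at hk; exact S.neg_root i hk
    have h3 : μ = (s - k) • clRoot D.A i := by rw [sub_smul, ← he]; abel
    rcases (S.string_root i hi (s - k)).1 (h3 ▸ hμ) with h4 | h4
    · exact h1 (by rw [h3, h4, one_smul])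
    · exact h2 (by rw [h3, h4, neg_one_smul])
  have k1 := key 1 (Or.inl rfl)
  have k2 := key (-1) (Or.inr rfl)
  rw [one_smul] at k1
  rw [neg_one_smul] at k2
  exact ⟨k1, k2⟩

/-- Divided powers of `f_i` move the vector at the top of a string down the string, without
coefficients: in `opF` the coefficient at the `n`-th step is `[n + 1]_i`. -/
theorem divPow_opF_vec {μ : Pcl I} (hμ : μ ∈ S.R) {i : I} (h1 : μ ≠ clRoot D.A i)
    (h2 : μ ≠ -clRoot D.A i) (h : μ + clRoot D.A i ∉ S.R) (n : ℕ) :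
    D.divPow i (S.opF b i) n (S.vec b μ) = S.vec b (μ - (n : ℤ) • clRoot D.A i) := by
  induction n with
  | zero => simp [divPow_zero]
  | succ n ih =>
    rw [divPow_succ_apply, ih]
    have e1 : μ - (n : ℤ) • clRoot D.A i = μ + (-(n : ℤ)) • clRoot D.A i := by
      rw [neg_smul, sub_eq_add_neg]
    have e2 : μ - ((n + 1 : ℕ) : ℤ) • clRoot D.A i = μ - (n : ℤ) • clRoot D.A i - clRoot D.A i := by
      push_cast; module
    by_cases hn : μ - (n : ℤ) • clRoot D.A i ∈ S.R
    · have hne := S.str_ne hμ h1 h2 (e1 ▸ hn)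
      have hs := (S.str_shift hμ h1 h2 (e1 ▸ hn)).2
      rw [← e1] at hne hs
      rw [S.up_eq_zero hμ h1 h2 h] at hs
      rw [S.opF_vec b hn hne.1, smul_smul, show S.up i (μ - (n : ℤ) • clRoot D.A i) = n by omega,
        inv_mul_cancel₀ (D.qInt_ne_zero i n.succ_pos), one_smul, e2]
    · have hn' : μ - ((n + 1 : ℕ) : ℤ) • clRoot D.A i ∉ S.R := fun hc => by
        have h3 := (S.str hμ h1 h2).2
        rw [sub_eq_add_neg, ← neg_smul, h3] at hc hn
        omega
      rw [S.vec_of_notMem b hn, S.vec_of_notMem b hn', map_zero, smul_zero]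

/-- Divided powers of `e_i` move the vector at the bottom of a string up the string, without
coefficients. -/
theorem divPow_opE_vec {μ : Pcl I} (hμ : μ ∈ S.R) {i : I} (h1 : μ ≠ clRoot D.A i)
    (h2 : μ ≠ -clRoot D.A i) (h : μ - clRoot D.A i ∉ S.R) (n : ℕ) :
    D.divPow i (S.opE b i) n (S.vec b μ) = S.vec b (μ + (n : ℤ) • clRoot D.A i) := by
  induction n with
  | zero => simp [divPow_zero]
  | succ n ih =>
    rw [divPow_succ_apply, ih]
    have e2 : μ + ((n + 1 : ℕ) : ℤ) • clRoot D.A i = μ + (n : ℤ) • clRoot D.A i + clRoot D.A i := by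
      push_cast; module
    by_cases hn : μ + (n : ℤ) • clRoot D.A i ∈ S.R
    · have hne := S.str_ne hμ h1 h2 hn
      have hs := (S.str_shift hμ h1 h2 hn).1
      rw [S.down_eq_zero hμ h1 h2 h] at hs
      rw [S.opE_vec b hn hne.2, smul_smul, show S.down i (μ + (n : ℤ) • clRoot D.A i) = n by omega,
        inv_mul_cancel₀ (D.qInt_ne_zero i n.succ_pos), one_smul, e2]
    · have hn' : μ + ((n + 1 : ℕ) : ℤ) • clRoot D.A i ∉ S.R := fun hc => by
        have h3 := (S.str hμ h1 h2).2
        rw [h3] at hc hn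
        omega
      rw [S.vec_of_notMem b hn, S.vec_of_notMem b hn', map_zero, smul_zero]

/-- The string through `α_i` passes through the weight `0` and consists of `v_{α_i}`, `z_i` and
`v_{-α_i}`. -/
theorem divPow_opF_root {i : I} (hi : clRoot D.A i ∈ S.R) :
    D.divPow i (S.opF b i) 1 (S.vec b (clRoot D.A i)) = S.zv b i ∧
    D.divPow i (S.opF b i) 2 (S.vec b (clRoot D.A i)) = S.vec b (-clRoot D.A i) ∧
    D.divPow i (S.opF b i) 3 (S.vec b (clRoot D.A i)) = 0 := by
  have h1 : D.divPow i (S.opF b i) 1 (S.vec b (clRoot D.A i)) = S.zv b i := by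
    rw [show 1 = 0 + 1 from rfl, divPow_succ_apply, divPow_zero, Module.End.one_apply,
      S.opF_root b hi, zero_add, qInt_one, inv_one, one_smul]
  have h2 : D.divPow i (S.opF b i) 2 (S.vec b (clRoot D.A i)) = S.vec b (-clRoot D.A i) := by
    rw [show 2 = 1 + 1 from rfl, divPow_succ_apply, h1, opF_zv, D.diag, smul_smul]
    exact (congrArg (· • _) (inv_mul_cancel₀ (D.qInt_ne_zero i two_pos))).trans (one_smul _ _)
  refine ⟨h1, h2, ?_⟩
  rw [show 3 = 2 + 1 from rfl, divPow_succ_apply, h2, S.opF_vec b (S.neg_mem hi) (clRoot_ne_neg i).symm,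
    S.vec_of_notMem b (S.neg_two_notMem i hi), smul_zero, smul_zero]

theorem divPow_opE_neg_root {i : I} (hi : clRoot D.A i ∈ S.R) :
    D.divPow i (S.opE b i) 2 (S.vec b (-clRoot D.A i)) = S.vec b (clRoot D.A i) := by
  have h1 : D.divPow i (S.opE b i) 1 (S.vec b (-clRoot D.A i)) = S.zv b i := by
    rw [show 1 = 0 + 1 from rfl, divPow_succ_apply, divPow_zero, Module.End.one_apply,
      S.opE_neg_root b hi, zero_add, qInt_one, inv_one, one_smul]
  rw [show 2 = 1 + 1 from rfl, divPow_succ_apply, h1, opE_zv, D.diag, smul_smul]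
  exact (congrArg (· • _) (inv_mul_cancel₀ (D.qInt_ne_zero i two_pos))).trans (one_smul _ _)

/-! ### The module is a fundamental representation -/

section Fundamental

variable {b} {ρ : Uq D →ₐ[BaseField] Module.End BaseField V} {S}
  (h : S.IsModel b ρ)
include h

theorem IsModel.opE_mem_of_invariant {N : Submodule BaseField V} (hN : IsInvariant ρ N) (i : I) {x : V}
    (hx : x ∈ N) : S.opE b i x ∈ N := by
  have := hN (ge D i) x hx
  rwa [(h i).1] at this

theorem IsModel.opF_mem_of_invariant {N : Submodule BaseField V} (hN : IsInvariant ρ N) (i : I) {x : V}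
    (hx : x ∈ N) : S.opF b i x ∈ N := by
  have := hN (gf D i) x hx
  rwa [(h i).2.1] at this

theorem IsModel.vec_add_mem {N : Submodule BaseField V} (hN : IsInvariant ρ N) (i : I) {μ : Pcl I}
    (hμ : μ ∈ S.R) (hμi : μ + clRoot D.A i ∈ S.R) (hx : S.vec b μ ∈ N) : S.vec b (μ + clRoot D.A i) ∈ N := by
  have h1 := h.opE_mem_of_invariant hN i hx
  rw [S.opE_vec b hμ fun he => S.ne_zero hμi (by rw [he, neg_add_cancel])] at h1
  exact (N.smul_mem_iff (D.qInt_ne_zero i (Nat.succ_pos _))).1 h1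

theorem IsModel.vec_sub_mem {N : Submodule BaseField V} (hN : IsInvariant ρ N) (i : I) {μ : Pcl I}
    (hμ : μ ∈ S.R) (hμi : μ - clRoot D.A i ∈ S.R) (hx : S.vec b μ ∈ N) : S.vec b (μ - clRoot D.A i) ∈ N := by
  have h1 := h.opF_mem_of_invariant hN i hx
  rw [S.opF_vec b hμ fun he => S.ne_zero hμi (by rw [he, sub_self])] at h1
  exact (N.smul_mem_iff (D.qInt_ne_zero i (Nat.succ_pos _))).1 h1

theorem IsModel.vec_neg_mem {N : Submodule BaseField V} (hN : IsInvariant ρ N) {i : I}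
    (hi : clRoot D.A i ∈ S.R) : S.vec b (clRoot D.A i) ∈ N ↔ S.vec b (-clRoot D.A i) ∈ N := by
  constructor
  · intro hx
    have h1 := h.opF_mem_of_invariant hN i (h.opF_mem_of_invariant hN i hx)
    rw [S.opF_root b hi, opF_zv, D.diag] at h1
    exact (N.smul_mem_iff (D.qInt_ne_zero i two_pos)).1 h1
  · intro hx
    have h1 := h.opE_mem_of_invariant hN i (h.opE_mem_of_invariant hN i hx)
    rw [S.opE_neg_root b hi, opE_zv, D.diag] at h1
    exact (N.smul_mem_iff (D.qInt_ne_zero i two_pos)).1 h1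

/-- The vector of weight `ϖ` generates the module: it generates all `v_μ` because the set of
weights is connected, hence all `z_j`, and these span the space of weight `0`. -/
theorem IsModel.eq_top_of_vec_mem {N : Submodule BaseField V} (hN : IsInvariant ρ N)
    (hϖ : S.vec b ϖ ∈ N) : N = ⊤ := by
  have hv : ∀ μ ∈ S.R, S.vec b μ ∈ N :=
    S.conn (fun μ => S.vec b μ ∈ N) hϖ (fun μ hμ i hx hμi => h.vec_add_mem hN i hμ hμi hx)
      (fun μ hμ i hx hμi => h.vec_sub_mem hN i hμ hμi hx) (fun i hi => (h.vec_neg_mem hN hi).1)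
      (fun i hi => (h.vec_neg_mem hN hi).2)
  have hy : ∀ j, clRoot D.A j ∈ S.R → S.yv b j ∈ N := fun j hj => by
    refine S.yv_mem_of_zv b (N.restrictScalars A0) (fun i hi => ?_) hj
    have := h.opF_mem_of_invariant hN i (hv _ hi)
    rwa [S.opF_root b hi] at this
  rw [eq_top_iff, ← b.span_eq, Submodule.span_le]
  rintro _ ⟨⟨μ, hμ⟩ | ⟨j, hj⟩, rfl⟩
  · rw [← vec_of_mem S b hμ]; exact hv μ hμ
  · rw [← yv_of_mem S b hj]; exact hy j hj

/-- Every vector `v_μ` generates `v_ϖ`, since the steps that connect `ϖ` with `μ` can be reversed. -/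
theorem IsModel.vec_mem_of_mem {N : Submodule BaseField V} (hN : IsInvariant ρ N) {μ : Pcl I}
    (hμ : μ ∈ S.R) (hx : S.vec b μ ∈ N) : S.vec b ϖ ∈ N := by
  refine S.conn (fun μ => S.vec b μ ∈ N → S.vec b ϖ ∈ N) id ?_ ?_ ?_ ?_ μ hμ hx
  · intro μ hμ i ih hμi hx
    refine ih ?_
    have := h.vec_sub_mem hN i hμi (by rwa [add_sub_cancel_right]) hx
    rwa [add_sub_cancel_right] at this
  · intro μ hμ i ih hμi hx
    refine ih ?_
    have := h.vec_add_mem hN i hμi (by rwa [sub_add_cancel]) hx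
    rwa [sub_add_cancel] at this
  · exact fun i hi ih hx => ih ((h.vec_neg_mem hN hi).2 hx)
  · exact fun i hi ih hx => ih ((h.vec_neg_mem hN hi).1 hx)

/-- An invariant subspace that is not zero contains a weight vector. -/
theorem IsModel.exists_weight_vector {N : Submodule BaseField V} (hN : IsInvariant ρ N) (n : ℕ) :
    ∀ x ∈ N, x ≠ 0 → (b.repr x).support.card ≤ n → ∃ μ, ∃ y ∈ N, y ≠ 0 ∧ y ∈ S.modWt b μ := by
  induction n with
  | zero =>
    intro x _ hx0 hc
    rw [Nat.le_zero, Finset.card_eq_zero, Finsupp.support_eq_empty] at hc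
    exact absurd (b.repr.map_eq_zero_iff.1 hc) hx0
  | succ n ih =>
    intro x hx hx0 hc
    obtain ⟨k, hk⟩ : ∃ k, b.repr x k ≠ 0 := by
      by_contra hcon
      push Not at hcon
      exact hx0 (b.repr.map_eq_zero_iff.1 (Finsupp.ext hcon))
    by_cases hall : ∀ l, b.repr x l ≠ 0 → S.idxWt l = S.idxWt k
    · exact ⟨S.idxWt k, x, hx, hx0, (S.mem_modWt_iff b).2 hall⟩
    · push Not at hall
      obtain ⟨l, hl, hlk⟩ := hall
      obtain ⟨i, hi⟩ := Function.ne_iff.1 hlk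
      -- subtracting a multiple removes the component `k` and keeps the component `l`
      set y := S.opK b i 1 x - D.qi i ^ S.idxWt k i • x with hy
      have hrepr : ∀ m, b.repr y m = (D.qi i ^ S.idxWt m i - D.qi i ^ S.idxWt k i) * b.repr x m := fun m => by
        rw [hy, map_sub, Finsupp.sub_apply, repr_opK, map_smul, Finsupp.smul_apply, smul_eq_mul, sub_mul]
      have hyN : y ∈ N := by
        have := hN (gK D i) x hx
        rw [(h i).2.2] at this
        exact N.sub_mem this (N.smul_mem _ hx)
      refine ih y hyN (fun h0 => ?_) ?_
      · have h1 := hrepr l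
        rw [h0, map_zero, Finsupp.zero_apply] at h1
        have h2 := (mul_eq_zero.1 h1.symm).resolve_right hl
        exact hi (D.qi_zpow_injective i (sub_eq_zero.1 h2))
      · have hsub : (b.repr y).support ⊂ (b.repr x).support := by
          refine (Finset.ssubset_iff_of_subset fun m hm => ?_).2 ⟨k, Finsupp.mem_support_iff.2 hk, ?_⟩
          · rw [Finsupp.mem_support_iff, hrepr] at hm
            exact Finsupp.mem_support_iff.2 (right_ne_zero_of_mul hm)
          · rw [Finsupp.notMem_support_iff, hrepr, sub_self, zero_mul]
        have := Finset.card_lt_card hsub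
        omega

/-- The module is simple: an invariant subspace contains a weight vector, and therefore `v_ϖ`. -/
theorem IsModel.isSimpleRep : IsSimpleRep ρ := by
  have hϖ := S.orbit_mem ϖ .refl
  refine ⟨⟨S.vec b ϖ, 0, S.vec_ne_zero b hϖ⟩, fun N hN => ?_⟩
  by_cases hbot : N = ⊥
  · exact Or.inl hbot
  right
  obtain ⟨x, hx, hx0⟩ := Submodule.exists_mem_ne_zero_of_ne_bot hbot
  obtain ⟨μ, y, hy, hy0, hyμ⟩ := h.exists_weight_vector hN _ x hx hx0 le_rfl
  refine h.eq_top_of_vec_mem hN ?_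
  by_cases hμ : μ = 0
  · subst hμ
    obtain ⟨c, rfl, hc⟩ := S.eq_sum_yv b hyμ
    -- A vector of weight `0` with nonzero coefficient at `y_j` is mapped by `e_j` to a nonzero
    -- multiple of `v_{α_j}`, since `e_j` annihilates the other `y_k`.
    obtain ⟨j, hj⟩ : ∃ j, c j ≠ 0 := by
      by_contra hcon
      push Not at hcon
      exact hy0 (Finset.sum_eq_zero fun j _ => by rw [hcon j, zero_smul])
    have hjR : clRoot D.A j ∈ S.R := by
      by_contra hn
      exact hj (hc j hn)
    have h1 := h.opE_mem_of_invariant hN j hy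
    rw [map_sum, Finset.sum_eq_single_of_mem j (Finset.mem_univ j) fun k _ hk => by
      rw [map_smul, opE_yv, if_neg hk, smul_zero], map_smul, opE_yv, if_pos rfl,
      N.smul_mem_iff hj, N.smul_mem_iff (D.qInt_ne_zero j two_pos)] at h1
    exact h.vec_mem_of_mem hN hjR h1
  · obtain ⟨c, rfl⟩ := S.eq_smul_vec b hμ hyμ
    have hc : c ≠ 0 := fun h0 => hy0 (by rw [h0, zero_smul])
    have hμR : μ ∈ S.R := by
      by_contra hn
      exact hy0 (by rw [S.vec_of_notMem b hn, smul_zero])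
    exact h.vec_mem_of_mem hN hμR ((N.smul_mem_iff hc).1 hy)

theorem IsModel.wtSpace_eq_span {μ : Pcl I} (hμ : μ ∈ S.R) :
    QuantumAffine.wtSpace ρ μ = Submodule.span BaseField {S.vec b μ} := by
  rw [h.wtSpace]
  refine le_antisymm (fun x hx => ?_) ?_
  · obtain ⟨c, rfl⟩ := S.eq_smul_vec b (S.ne_zero hμ) hx
    exact Submodule.smul_mem _ _ (Submodule.mem_span_singleton_self _)
  · rw [Submodule.span_singleton_le_iff_mem]
    exact S.vec_mem_modWt b μ

/-- The extremal vectors of the module. -/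
theorem IsModel.extremal_nonneg {μ : Pcl I} (hμ : WeylOrbit D.A Set.univ ϖ μ) {j : I} (hj : 0 ≤ μ j) :
    S.opE b j (S.vec b μ) = 0 ∧
      D.divPow j (S.opF b j) (μ j).toNat (S.vec b μ) = S.vec b (reflect D.A j μ) := by
  have hR := S.orbit_mem μ hμ
  have hup := S.extremal_up μ hμ j hj
  have hne2 : μ ≠ -clRoot D.A j := fun he => by
    rw [he, Pi.neg_apply, clRoot_self] at hj; omega
  refine ⟨by rw [S.opE_vec b hR hne2, S.vec_of_notMem b hup, smul_zero], ?_⟩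
  by_cases hne1 : μ = clRoot D.A j
  · subst hne1
    rw [reflect_clRoot, clRoot_self]
    exact (S.divPow_opF_root b hR).2.1
  · rw [S.divPow_opF_vec b hR hne1 hne2 hup, Int.toNat_of_nonneg hj]; rfl

theorem IsModel.extremal_neg {μ : Pcl I} (hμ : WeylOrbit D.A Set.univ ϖ μ) {j : I} (hj : μ j < 0) :
    S.opF b j (S.vec b μ) = 0 ∧
      D.divPow j (S.opE b j) (-μ j).toNat (S.vec b μ) = S.vec b (reflect D.A j μ) := by
  have hR := S.orbit_mem μ hμ
  have hup := S.extremal_down μ hμ j hj.le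
  have hne1 : μ ≠ clRoot D.A j := fun he => by
    rw [he, clRoot_self] at hj; omega
  refine ⟨by rw [S.opF_vec b hR hne1, S.vec_of_notMem b hup, smul_zero], ?_⟩
  by_cases hne2 : μ = -clRoot D.A j
  · subst hne2
    rw [reflect_neg, reflect_clRoot, neg_neg, Pi.neg_apply, clRoot_self, neg_neg]
    exact S.divPow_opE_neg_root b (S.neg_mem_iff.1 hR)
  · rw [S.divPow_opE_vec b hR hne1 hne2 hup, Int.toNat_of_nonneg (by omega), reflect, neg_smul,
      ← sub_eq_add_neg]

end Fundamental

/-- The vectors `v_μ`, `μ ∈ W ϖ`, are the extremal vectors. -/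
theorem IsModel.isFundamental {r : I} {S : D.StringSystem (D.varpi r)}
    {b : Module.Basis S.Idx BaseField V} {ρ : Uq D →ₐ[BaseField] Module.End BaseField V}
    (h : S.IsModel b ρ) : IsFundamental D r ρ where
  finite := Module.Finite.of_basis b
  integrable := h.isIntegrable
  simple := h.isSimpleRep
  extremal := by
    have hϖ := S.orbit_mem _ .refl
    refine ⟨S.vec b, S.vec_ne_zero b hϖ, h.wtSpace_eq_span hϖ, fun μ _ => ?_, fun μ hμ j hj => ?_,
      fun μ hμ j hj => ?_, fun N hN hx => h.eq_top_of_vec_mem hN hx⟩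
    · rw [h.wtSpace]; exact S.vec_mem_modWt b μ
    · rw [(h j).1, (h j).2.1]; exact h.extremal_nonneg hμ hj
    · rw [(h j).1, (h j).2.1]; exact h.extremal_neg hμ hj

end StringSystem
end AffineDatum

namespace AffineDatum

variable {I : Type u} [Fintype I] [DecidableEq I] {D : AffineDatum I} {ϖ : Pcl I}

namespace StringSystem

/-! ### The Kashiwara operators of the module -/

variable (S : D.StringSystem ϖ) {V : Type v} [AddCommGroup V] [Module BaseField V]
  (b : Module.Basis S.Idx BaseField V)

open Classical in
/-- The Kashiwara operator `ẽ_i` of the module. -/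
def kE (i : I) : Module.End BaseField V := b.constr BaseField fun
  | .inl μ => if μ.1 = -clRoot D.A i then S.zv b i else S.vec b (μ.1 + clRoot D.A i)
  | .inr j => if j.1 = i then S.vec b (clRoot D.A i) else 0

open Classical in
/-- The Kashiwara operator `f̃_i` of the module. -/
def kF (i : I) : Module.End BaseField V := b.constr BaseField fun
  | .inl μ => if μ.1 = clRoot D.A i then S.zv b i else S.vec b (μ.1 - clRoot D.A i)
  | .inr j => if j.1 = i then S.vec b (-clRoot D.A i) else 0

theorem kE_vec {i : I} {μ : Pcl I} (hμ : μ ∈ S.R) (h : μ ≠ -clRoot D.A i) :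
    S.kE b i (S.vec b μ) = S.vec b (μ + clRoot D.A i) := by
  rw [vec_of_mem S b hμ, kE, Module.Basis.constr_basis]
  exact if_neg h

theorem kE_neg_root {i : I} (h : clRoot D.A i ∈ S.R) :
    S.kE b i (S.vec b (-clRoot D.A i)) = S.zv b i := by
  rw [vec_of_mem S b (S.neg_mem h), kE, Module.Basis.constr_basis]
  exact if_pos rfl

theorem kE_yv (i j : I) : S.kE b i (S.yv b j) = if j = i then S.vec b (clRoot D.A i) else 0 := by
  by_cases h : clRoot D.A j ∈ S.R
  · rw [yv_of_mem S b h, kE, Module.Basis.constr_basis]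
  · rw [yv_of_notMem S b h, map_zero]
    split_ifs with hji
    · subst hji; rw [vec_of_notMem S b h]
    · rfl

theorem kE_zv (i : I) : S.kE b i (S.zv b i) = S.vec b (clRoot D.A i) := by
  rw [zv, map_sum, Finset.sum_eq_single_of_mem i (Finset.mem_univ i) fun k _ hk => by
    rw [map_smul, kE_yv, if_neg hk, smul_zero], map_smul, kE_yv, if_pos rfl, zCoeff_self, one_smul]

theorem kF_vec {i : I} {μ : Pcl I} (hμ : μ ∈ S.R) (h : μ ≠ clRoot D.A i) :
    S.kF b i (S.vec b μ) = S.vec b (μ - clRoot D.A i) := by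
  rw [vec_of_mem S b hμ, kF, Module.Basis.constr_basis]
  exact if_neg h

theorem kF_root {i : I} (h : clRoot D.A i ∈ S.R) : S.kF b i (S.vec b (clRoot D.A i)) = S.zv b i := by
  rw [vec_of_mem S b h, kF, Module.Basis.constr_basis]
  exact if_pos rfl

theorem kF_yv (i j : I) : S.kF b i (S.yv b j) = if j = i then S.vec b (-clRoot D.A i) else 0 := by
  by_cases h : clRoot D.A j ∈ S.R
  · rw [yv_of_mem S b h, kF, Module.Basis.constr_basis]
  · rw [yv_of_notMem S b h, map_zero]
    split_ifs with hji
    · subst hji; rw [vec_of_notMem S b (S.neg_mem_iff.not.2 h)]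
    · rfl

theorem kF_zv (i : I) : S.kF b i (S.zv b i) = S.vec b (-clRoot D.A i) := by
  rw [zv, map_sum, Finset.sum_eq_single_of_mem i (Finset.mem_univ i) fun k _ hk => by
    rw [map_smul, kF_yv, if_neg hk, smul_zero], map_smul, kF_yv, if_pos rfl, zCoeff_self, one_smul]

/-- The weight vectors killed by `e_i` are, up to scalars, vectors of weight zero killed by both
`f_i` and the Kashiwara operators, or vectors `v_μ` at the top of their string. -/
theorem highest_cases {i : I} {μ : Pcl I} {x : V} (hx : x ∈ S.modWt b μ) (he : S.opE b i x = 0) :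
    x = 0 ∨ (μ = 0 ∧ S.kE b i x = 0 ∧ S.kF b i x = 0 ∧ S.opF b i x = 0) ∨
      ∃ c : BaseField, x = c • S.vec b μ ∧ μ ∈ S.R ∧
        (μ = -clRoot D.A i ∨ μ + clRoot D.A i ∉ S.R) := by
  by_cases hμ : μ = 0
  · subst hμ
    obtain ⟨c, rfl, hc⟩ := S.eq_sum_yv b hx
    have key : ∀ T : Module.End BaseField V, ∀ w : V, (∀ j, T (S.yv b j) = if j = i then w else 0) →
        T (∑ j, c j • S.yv b j) = c i • w := fun T w hT => by
      rw [map_sum, Finset.sum_eq_single_of_mem i (Finset.mem_univ i) fun k _ hk => by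
        rw [map_smul, hT, if_neg hk, smul_zero], map_smul, hT, if_pos rfl]
    rw [key _ _ (S.opE_yv b i)] at he
    have hci : c i = 0 := by
      by_cases hi : clRoot D.A i ∈ S.R
      · exact (smul_eq_zero.1 he).resolve_right
          (smul_ne_zero (D.qInt_ne_zero i two_pos) (S.vec_ne_zero b hi))
      · exact hc i hi
    exact Or.inr (Or.inl ⟨rfl, by rw [key _ _ (S.kE_yv b i), hci, zero_smul],
      by rw [key _ _ (S.kF_yv b i), hci, zero_smul], by rw [key _ _ (S.opF_yv b i), hci, zero_smul]⟩)
  · obtain ⟨c, rfl⟩ := S.eq_smul_vec b hμ hx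
    by_cases hc : c = 0
    · left; rw [hc, zero_smul]
    by_cases hR : μ ∈ S.R
    · refine Or.inr (Or.inr ⟨c, rfl, hR, ?_⟩)
      by_contra hcon
      push Not at hcon
      rw [map_smul, S.opE_vec b hR hcon.1] at he
      exact smul_ne_zero hc (smul_ne_zero (D.qInt_ne_zero i (Nat.succ_pos _))
        (S.vec_ne_zero b hcon.2)) he
    · left; rw [S.vec_of_notMem b hR, smul_zero]

variable {b} {S} {ρ : Uq D →ₐ[BaseField] Module.End BaseField V}

/-- The operator `kE` moves the divided powers `f_i^{(n)} u` of the highest weight vectors `u` of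
quantum `sl₂`, which are classified by `highest_cases`. -/
theorem IsModel.isKashiwaraE (h : S.IsModel b ρ) (i : I) : IsKashiwaraE ρ i (S.kE b i) := by
  intro μ x n hx he hn
  rw [h.wtSpace] at hx
  rw [(h i).1] at he
  rw [(h i).2.1]
  rcases S.highest_cases b hx he with rfl | ⟨rfl, h1, -, -⟩ | ⟨c, rfl, hR, h1⟩
  · simp
  · have : n = 0 := by rw [Pi.zero_apply] at hn; omega
    subst this
    simp [divPow_zero, h1]
  · have hne : μ ≠ -clRoot D.A i := fun h2 => by
      rw [h2, Pi.neg_apply, clRoot_self] at hn; omega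
    have hup := h1.resolve_left hne
    simp only [map_smul]
    rw [show (if n = 0 then 0 else c • D.divPow i (S.opF b i) (n - 1) (S.vec b μ)) =
      c • (if n = 0 then 0 else D.divPow i (S.opF b i) (n - 1) (S.vec b μ)) by split_ifs <;> simp]
    congr 1
    by_cases h2 : μ = clRoot D.A i
    · subst h2
      rw [clRoot_self] at hn
      obtain ⟨p1, p2, -⟩ := S.divPow_opF_root b hR
      have hn' : n ≤ 2 := by omega
      interval_cases n
      · rw [divPow_zero, Module.End.one_apply, S.kE_vec b hR hne, S.vec_of_notMem b hup, if_pos rfl]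
      · rw [p1, kE_zv, if_neg one_ne_zero, divPow_zero, Module.End.one_apply]
      · rw [p2, S.kE_neg_root b hR, if_neg two_ne_zero, p1]
    · obtain ⟨h3, h4⟩ := S.str hR h2 hne
      rw [S.up_eq_zero hR h2 hne hup] at h3 h4
      have hm : μ + (-(n : ℤ)) • clRoot D.A i ∈ S.R := (h4 _).2 (by omega)
      have hne' := (S.str_ne hR h2 hne hm).2
      rw [neg_smul, ← sub_eq_add_neg] at hm hne'
      rw [S.divPow_opF_vec b hR h2 hne hup, S.kE_vec b hm hne', S.divPow_opF_vec b hR h2 hne hup]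
      split_ifs with h5
      · subst h5
        rw [Nat.cast_zero, zero_smul, sub_zero, S.vec_of_notMem b hup]
      · congr 1
        rw [show ((n - 1 : ℕ) : ℤ) = n - 1 by omega]
        module

theorem IsModel.isKashiwaraF (h : S.IsModel b ρ) (i : I) : IsKashiwaraF ρ i (S.kF b i) := by
  intro μ x n hx he hn
  rw [h.wtSpace] at hx
  rw [(h i).1] at he
  rw [(h i).2.1]
  rcases S.highest_cases b hx he with rfl | ⟨rfl, -, h1, h2⟩ | ⟨c, rfl, hR, h1⟩
  · simp
  · have : n = 0 := by rw [Pi.zero_apply] at hn; omega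
    subst this
    rw [divPow_succ_apply, divPow_zero, Module.End.one_apply, h1, h2, smul_zero]
  · have hne : μ ≠ -clRoot D.A i := fun h2 => by
      rw [h2, Pi.neg_apply, clRoot_self] at hn; omega
    have hup := h1.resolve_left hne
    simp only [map_smul]
    congr 1
    by_cases h2 : μ = clRoot D.A i
    · subst h2
      rw [clRoot_self] at hn
      obtain ⟨p1, p2, p3⟩ := S.divPow_opF_root b hR
      have hn' : n ≤ 2 := by omega
      interval_cases n
      · rw [divPow_zero, Module.End.one_apply, S.kF_root b hR, p1]
      · rw [p1, kF_zv, p2]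
      · rw [p2, S.kF_vec b (S.neg_mem hR) (clRoot_ne_neg i).symm,
          S.vec_of_notMem b (S.neg_two_notMem i hR), p3]
    · obtain ⟨h3, h4⟩ := S.str hR h2 hne
      rw [S.up_eq_zero hR h2 hne hup] at h3 h4
      have hm : μ + (-(n : ℤ)) • clRoot D.A i ∈ S.R := (h4 _).2 (by omega)
      have hne' := (S.str_ne hR h2 hne hm).1
      rw [neg_smul, ← sub_eq_add_neg] at hm hne'
      rw [S.divPow_opF_vec b hR h2 hne hup, S.kF_vec b hm hne', S.divPow_opF_vec b hR h2 hne hup]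
      congr 1
      push_cast
      module

/-- The module is spanned by the `f_i`-strings of weight vectors killed by `e_i`. -/
theorem IsModel.string_ext (h : S.IsModel b ρ) (i : I) {T T' : Module.End BaseField V}
    (hT : ∀ (μ : Pcl I) (x : V) (n : ℕ), x ∈ QuantumAffine.wtSpace ρ μ → ρ (ge D i) x = 0 →
      (n : ℤ) ≤ μ i → T (D.divPow i (ρ (gf D i)) n x) = T' (D.divPow i (ρ (gf D i)) n x)) :
    T = T' := by
  simp only [h.wtSpace, (h i).1, (h i).2.1] at hT
  have hroot : clRoot D.A i ∈ S.R → ∀ n : ℕ, n ≤ 2 →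
      T (D.divPow i (S.opF b i) n (S.vec b (clRoot D.A i))) =
        T' (D.divPow i (S.opF b i) n (S.vec b (clRoot D.A i))) := fun hi n hn =>
    hT _ _ n (S.vec_mem_modWt b _) (by
      rw [S.opE_vec b hi (clRoot_ne_neg i), S.vec_of_notMem b (S.two_notMem i hi), smul_zero])
      (by rw [clRoot_self]; omega)
  have hy : ∀ j, j ≠ i → T (S.yv b j) = T' (S.yv b j) := fun j hj => by
    have := hT 0 (S.yv b j) 0 (S.yv_mem_modWt b j) (by rw [opE_yv, if_neg hj]) (by simp)
    rwa [divPow_zero] at this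
  refine S.op_ext b (fun μ hμ => ?_) fun j hj => ?_
  · by_cases h1 : μ = clRoot D.A i
    · subst h1
      have := hroot hμ 0 (by omega)
      rwa [divPow_zero] at this
    by_cases h2 : μ = -clRoot D.A i
    · subst h2
      have hi := S.neg_mem_iff.1 hμ
      have := hroot hi 2 le_rfl
      rwa [(S.divPow_opF_root b hi).2.1] at this
    obtain ⟨h3, h4⟩ := S.str hμ h1 h2
    have hm := (h4 (S.up i μ)).2 (by omega)
    obtain ⟨h5, h6⟩ := S.str_ne hμ h1 h2 hm
    have htop : μ + (S.up i μ : ℤ) • clRoot D.A i + clRoot D.A i ∉ S.R := by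
      have := (h4 (S.up i μ + 1)).not.2 (by omega)
      rwa [add_smul, one_smul, ← add_assoc] at this
    have := hT _ _ (S.up i μ) (S.vec_mem_modWt b (μ + (S.up i μ : ℤ) • clRoot D.A i)) (by
      rw [S.opE_vec b hm h6, S.vec_of_notMem b htop, smul_zero]) (by
      rw [Pi.add_apply, Pi.smul_apply, clRoot_self, smul_eq_mul]; omega)
    rwa [S.divPow_opF_vec b hm h5 h6 htop, add_sub_cancel_right] at this
  · by_cases hji : j = i
    · subst hji
      have h1 := hroot hj 1 (by omega)
      rw [(S.divPow_opF_root b hj).1, zv, map_sum, map_sum,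
        ← Finset.add_sum_erase _ _ (Finset.mem_univ j),
        ← Finset.add_sum_erase (Finset.univ) (fun k => T' (D.zCoeff j k • S.yv b k)) (Finset.mem_univ j),
        Finset.sum_congr rfl fun k hk => by
          rw [map_smul, hy k (Finset.ne_of_mem_erase hk), ← map_smul]] at h1
      have h2 := add_right_cancel h1
      rwa [zCoeff_self, one_smul] at h2
    · exact hy j hji

/-- The Kashiwara operator is `kE`, since it is determined by its values on strings. -/
theorem IsModel.eTilde_eq (h : S.IsModel b ρ) (i : I) : eTilde ρ i = S.kE b i := by
  have hex : ∃ T, IsKashiwaraE ρ i T := ⟨_, h.isKashiwaraE i⟩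
  rw [eTilde, dif_pos hex]
  exact h.string_ext i fun μ x n hx he hn =>
    (hex.choose_spec μ x n hx he hn).trans (h.isKashiwaraE i μ x n hx he hn).symm

theorem IsModel.fTilde_eq (h : S.IsModel b ρ) (i : I) : fTilde ρ i = S.kF b i := by
  have hex : ∃ T, IsKashiwaraF ρ i T := ⟨_, h.isKashiwaraF i⟩
  rw [fTilde, dif_pos hex]
  exact h.string_ext i fun μ x n hx he hn =>
    (hex.choose_spec μ x n hx he hn).trans (h.isKashiwaraF i μ x n hx he hn).symm

/-! ### The crystal graph -/

open Classical in
/-- The action of `ẽ_i` on the index set of the basis at `q = 0`. -/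
def crysE (S : D.StringSystem ϖ) (i : I) : S.Idx → Option S.Idx
  | .inl μ => if h : μ.1 = -clRoot D.A i then some (.inr ⟨i, S.neg_root i (h ▸ μ.2)⟩)
      else if h : μ.1 + clRoot D.A i ∈ S.R then some (.inl ⟨_, h⟩) else none
  | .inr j => if h : j.1 = i then some (.inl ⟨clRoot D.A i, h ▸ j.2⟩) else none

open Classical in
/-- The action of `f̃_i` on the index set of the basis at `q = 0`. -/
def crysF (S : D.StringSystem ϖ) (i : I) : S.Idx → Option S.Idx
  | .inl μ => if h : μ.1 = clRoot D.A i then some (.inr ⟨i, h ▸ μ.2⟩)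
      else if h : μ.1 - clRoot D.A i ∈ S.R then some (.inl ⟨_, h⟩) else none
  | .inr j => if h : j.1 = i then some (.inl ⟨-clRoot D.A i, S.neg_mem (h ▸ j.2)⟩) else none

/-- The crystal operators are partial inverses of each other. -/
theorem crysF_eq_some_iff (i : I) (k l : S.Idx) : S.crysF i k = some l ↔ S.crysE i l = some k := by
  rcases k with ⟨μ, hμ⟩ | ⟨j, hj⟩ <;> rcases l with ⟨ν, hν⟩ | ⟨m, hm⟩ <;>
    simp only [crysE, crysF]
  · have h0 := S.ne_zero hμ
    have h0' := S.ne_zero hν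
    by_cases h1 : μ = clRoot D.A i
    · rw [dif_pos h1]
      by_cases h2 : ν = -clRoot D.A i
      · simp [h2]
      · rw [dif_neg h2]
        have : ν + clRoot D.A i ≠ μ := fun h => h0' (by rw [h1] at h; exact add_eq_right.1 h)
        split_ifs <;> simp [this]
    · rw [dif_neg h1]
      by_cases h2 : ν = -clRoot D.A i
      · rw [dif_pos h2]
        have : μ - clRoot D.A i ≠ ν := fun h => h0 (by
          rw [h2, sub_eq_add_neg] at h; exact add_eq_right.1 h)
        split_ifs <;> simp [this]
      · rw [dif_neg h2]
        have key : μ - clRoot D.A i = ν ↔ ν + clRoot D.A i = μ :=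
          ⟨fun h => by rw [← h, sub_add_cancel], fun h => by rw [← h, add_sub_cancel_right]⟩
        split_ifs with h3 h4 h4
        · simpa using key
        · simp only [Option.some.injEq, Sum.inl.injEq, Subtype.mk.injEq, iff_false]
          exact fun h => h4 (by rwa [key.1 h])
        · simp only [Option.some.injEq, Sum.inl.injEq, Subtype.mk.injEq, false_iff]
          exact fun h => h3 (by rwa [key.2 h])
        · simp
  · by_cases h1 : μ = clRoot D.A i
    · rw [dif_pos h1]
      by_cases h2 : m = i
      · subst h2; simp [h1]
      · rw [dif_neg h2]; simp [Ne.symm h2]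
    · rw [dif_neg h1]
      split_ifs <;> simp [Ne.symm h1]
  · by_cases h1 : ν = -clRoot D.A i
    · rw [dif_pos h1]
      by_cases h2 : j = i
      · subst h2; simp [h1]
      · rw [dif_neg h2]; simp [Ne.symm h2]
    · rw [dif_neg h1]
      split_ifs <;> simp [Ne.symm h1]
  · split_ifs <;> simp

/-- The Kashiwara operator moves the basis along the crystal graph, except that it maps `v_{-α_i}`
to `z_i` and not to `y_i`. -/
theorem kE_basis (i : I) (k : S.Idx) : S.kE b i (b k) = (S.crysE i k).elim 0 b ∨
    clRoot D.A i ∈ S.R ∧ S.kE b i (b k) = S.zv b i ∧ (S.crysE i k).elim 0 b = S.yv b i := by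
  rcases k with ⟨μ, hμ⟩ | ⟨j, hj⟩
  · rw [← vec_of_mem S b hμ]
    by_cases h1 : μ = -clRoot D.A i
    · subst h1
      have hi := S.neg_mem_iff.1 hμ
      refine Or.inr ⟨hi, S.kE_neg_root b hi, ?_⟩
      simp only [crysE, dif_pos]
      rw [yv_of_mem S b hi]; rfl
    · left
      rw [S.kE_vec b hμ h1]
      simp only [crysE, dif_neg h1]
      split_ifs with h2
      · rw [vec_of_mem S b h2]; rfl
      · rw [vec_of_notMem S b h2]; rfl
  · left
    rw [← yv_of_mem S b hj, kE_yv]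
    simp only [crysE]
    split_ifs with h1
    · subst h1; rw [vec_of_mem S b hj]; rfl
    · rfl

/-- The Kashiwara operator moves the basis along the crystal graph, except that it maps `v_{α_i}`
to `z_i` and not to `y_i`. -/
theorem kF_basis (i : I) (k : S.Idx) : S.kF b i (b k) = (S.crysF i k).elim 0 b ∨
    clRoot D.A i ∈ S.R ∧ S.kF b i (b k) = S.zv b i ∧ (S.crysF i k).elim 0 b = S.yv b i := by
  rcases k with ⟨μ, hμ⟩ | ⟨j, hj⟩
  · rw [← vec_of_mem S b hμ]
    by_cases h1 : μ = clRoot D.A i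
    · subst h1
      refine Or.inr ⟨hμ, S.kF_root b hμ, ?_⟩
      simp only [crysF, dif_pos]
      rw [yv_of_mem S b hμ]; rfl
    · left
      rw [S.kF_vec b hμ h1]
      simp only [crysF, dif_neg h1]
      split_ifs with h2
      · rw [vec_of_mem S b h2]; rfl
      · rw [vec_of_notMem S b h2]; rfl
  · left
    rw [← yv_of_mem S b hj, kF_yv]
    simp only [crysF]
    split_ifs with h1
    · subst h1; rw [vec_of_mem S b (S.neg_mem hj)]; rfl
    · rfl

end StringSystem
end AffineDatum

/-! ### Crystal lattices that contain the basis -/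

namespace CrystalLattice

variable {I : Type u} [Fintype I] [DecidableEq I] {D : AffineDatum I}
  {V : Type v} [AddCommGroup V] [Module BaseField V]
  {ρ : Uq D →ₐ[BaseField] Module.End BaseField V} (Λ : CrystalLattice ρ)

/-- The class of a lattice vector at `q = 0`. -/
def toFiber (x : V) (hx : x ∈ Λ.L) : Λ.Fiber := Submodule.Quotient.mk ⟨x, hx⟩

theorem eBar_toFiber (i : I) (x : V) (hx : x ∈ Λ.L) :
    Λ.eBar i (Λ.toFiber x hx) = Λ.toFiber (eTilde ρ i x) (Λ.stable_e i x hx) := rfl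

theorem fBar_toFiber (i : I) (x : V) (hx : x ∈ Λ.L) :
    Λ.fBar i (Λ.toFiber x hx) = Λ.toFiber (fTilde ρ i x) (Λ.stable_f i x hx) := rfl

theorem toFiber_congr {x y : V} (h : x = y) (hx : x ∈ Λ.L) : Λ.toFiber x hx = Λ.toFiber y (h ▸ hx) := by
  subst h; rfl

theorem toFiber_zero {x : V} (h : x = 0) (hx : x ∈ Λ.L) : Λ.toFiber x hx = 0 := by
  subst h; rfl

theorem exists_toFiber (β : Λ.Fiber) : ∃ x hx, Λ.toFiber x hx = β := by
  obtain ⟨⟨x, hx⟩, rfl⟩ := Submodule.Quotient.mk_surjective _ β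
  exact ⟨x, hx, rfl⟩

theorem smul_mem_m0 {a : BaseField} {y : V} (ha : 0 < ord a) (hy : y ∈ Λ.L) (hay : a • y ∈ Λ.L) :
    (⟨a • y, hay⟩ : Λ.L) ∈ m0 • (⊤ : Submodule A0 Λ.L) := by
  have h1 : (⟨a, ha.le⟩ : A0) ∈ m0 := ha
  exact Submodule.smul_mem_smul h1 (Submodule.mem_top (x := (⟨y, hy⟩ : Λ.L)))

theorem toFiber_smul_eq_zero {a : BaseField} {y : V} (ha : 0 < ord a) (hy : y ∈ Λ.L)
    (hay : a • y ∈ Λ.L) : Λ.toFiber (a • y) hay = 0 :=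
  (Submodule.Quotient.mk_eq_zero _).2 (Λ.smul_mem_m0 ha hy hay)

end CrystalLattice

namespace AffineDatum

variable {I : Type u} [Fintype I] [DecidableEq I] {D : AffineDatum I} {ϖ : Pcl I}

namespace StringSystem

variable {S : D.StringSystem ϖ} {V : Type v} [AddCommGroup V] [Module BaseField V]
  {b : Module.Basis S.Idx BaseField V} {ρ : Uq D →ₐ[BaseField] Module.End BaseField V}

theorem vec_mem_of_basis {L : Submodule A0 V} (hb : ∀ k, b k ∈ L) (μ : Pcl I) : S.vec b μ ∈ L := by
  by_cases hμ : μ ∈ S.R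
  · rw [vec_of_mem S b hμ]; exact hb _
  · rw [vec_of_notMem S b hμ]; exact L.zero_mem

theorem yv_mem_of_basis {L : Submodule A0 V} (hb : ∀ k, b k ∈ L) (j : I) : S.yv b j ∈ L := by
  by_cases hj : clRoot D.A j ∈ S.R
  · rw [yv_of_mem S b hj]; exact hb _
  · rw [yv_of_notMem S b hj]; exact L.zero_mem

theorem zv_mem_of_yv {L : Submodule A0 V} (hy : ∀ j, S.yv b j ∈ L) {i : I}
    (hi : clRoot D.A i ∈ S.R) : S.zv b i ∈ L := by
  refine L.sum_mem fun j _ => ?_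
  by_cases hj : clRoot D.A j ∈ S.R
  · exact L.smul_mem ⟨_, S.zCoeff_mem hi hj⟩ (hy j)
  · rw [yv_of_notMem S b hj, smul_zero]; exact L.zero_mem

/-- At `q = 0` the vectors `z_i` and `y_i` coincide. -/
theorem toFiber_zv (Λ : CrystalLattice ρ) (hy : ∀ j, S.yv b j ∈ Λ.L) {i : I} (hi : clRoot D.A i ∈ S.R) :
    Λ.toFiber (S.zv b i) (zv_mem_of_yv hy hi) = Λ.toFiber (S.yv b i) (hy i) := by
  refine (Submodule.Quotient.eq _).2 ?_
  have hmem : ∀ j, D.zCoeff i j • S.yv b j ∈ Λ.L := fun j => by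
    by_cases hj : clRoot D.A j ∈ S.R
    · exact Λ.L.smul_mem ⟨_, S.zCoeff_mem hi hj⟩ (hy j)
    · rw [yv_of_notMem S b hj, smul_zero]; exact Λ.L.zero_mem
  have h1 : (⟨S.zv b i, zv_mem_of_yv hy hi⟩ : Λ.L) - ⟨S.yv b i, hy i⟩ =
      ∑ j ∈ Finset.univ.erase i, ⟨D.zCoeff i j • S.yv b j, hmem j⟩ := by
    apply Subtype.ext
    rw [AddSubgroupClass.coe_sub, AddSubmonoidClass.coe_finsetSum]
    simp only
    rw [zv, ← Finset.add_sum_erase _ _ (Finset.mem_univ i), zCoeff_self, one_smul,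
      add_sub_cancel_left]
  rw [h1]
  refine Submodule.sum_mem _ fun j hj => ?_
  by_cases hjR : clRoot D.A j ∈ S.R
  · exact Λ.smul_mem_m0 (S.ord_zCoeff_pos (Finset.ne_of_mem_erase hj).symm hi hjR) (hy j) (hmem j)
  · have h0 : (⟨D.zCoeff i j • S.yv b j, hmem j⟩ : Λ.L) = 0 :=
      Subtype.ext (by simp [yv_of_notMem S b hjR])
    rw [h0]
    exact Submodule.zero_mem _

section Classes

variable (h : S.IsModel b ρ) (Λ : CrystalLattice ρ) (hb : ∀ k, b k ∈ Λ.L)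

/-- The class of a basis vector. -/
def cls (k : S.Idx) : Λ.Fiber := Λ.toFiber (b k) (hb k)

include h in
theorem eBar_cls (i : I) (k : S.Idx) : Λ.eBar i (cls Λ hb k) = (S.crysE i k).elim 0 (cls Λ hb) := by
  have h1 : (S.crysE i k).elim 0 (cls Λ hb) = Λ.toFiber ((S.crysE i k).elim 0 b) (by
      cases S.crysE i k with
      | none => exact Λ.L.zero_mem
      | some l => exact hb l) := by
    cases S.crysE i k with
    | none => rfl
    | some l => rfl
  rw [h1, cls, Λ.eBar_toFiber]
  rcases S.kE_basis (b := b) i k with h2 | ⟨hi, h2, h3⟩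
  · exact Λ.toFiber_congr (by rw [h.eTilde_eq, h2]) _
  · rw [Λ.toFiber_congr (show eTilde ρ i (b k) = S.zv b i by rw [h.eTilde_eq, h2]),
      Λ.toFiber_congr h3]
    exact toFiber_zv Λ (yv_mem_of_basis hb) hi

include h in
theorem fBar_cls (i : I) (k : S.Idx) : Λ.fBar i (cls Λ hb k) = (S.crysF i k).elim 0 (cls Λ hb) := by
  have h1 : (S.crysF i k).elim 0 (cls Λ hb) = Λ.toFiber ((S.crysF i k).elim 0 b) (by
      cases S.crysF i k with
      | none => exact Λ.L.zero_mem
      | some l => exact hb l) := by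
    cases S.crysF i k with
    | none => rfl
    | some l => rfl
  rw [h1, cls, Λ.fBar_toFiber]
  rcases S.kF_basis (b := b) i k with h2 | ⟨hi, h2, h3⟩
  · exact Λ.toFiber_congr (by rw [h.fTilde_eq, h2]) _
  · rw [Λ.toFiber_congr (show fTilde ρ i (b k) = S.zv b i by rw [h.fTilde_eq, h2]),
      Λ.toFiber_congr h3]
    exact toFiber_zv Λ (yv_mem_of_basis hb) hi

include h in
theorem hasWeight_cls (k : S.Idx) : Λ.HasWeight (cls Λ hb k) (S.idxWt k) :=
  ⟨⟨b k, hb k⟩, by rw [h.wtSpace]; exact S.idx_mem_modWt b k, rfl⟩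

variable (hL : Λ.L = Submodule.span A0 (Set.range b))
include hL

theorem span_cls : Submodule.span (A0 ⧸ m0) (Set.range (cls Λ hb)) = ⊤ := by
  rw [eq_top_iff]
  rintro β -
  obtain ⟨x, hx, rfl⟩ := Λ.exists_toFiber β
  have hx' := hx
  rw [hL] at hx'
  induction hx' using Submodule.span_induction with
  | mem x hx2 =>
    obtain ⟨k, rfl⟩ := hx2
    exact Submodule.subset_span ⟨k, rfl⟩
  | zero => rw [Λ.toFiber_zero rfl]; exact Submodule.zero_mem _
  | add x y hx2 hy2 ih1 ih2 =>
    exact Submodule.add_mem _ (ih1 (hL ▸ hx2)) (ih2 (hL ▸ hy2))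
  | smul a x hx2 ih =>
    exact Submodule.smul_mem _ (Ideal.Quotient.mk m0 a) (ih (hL ▸ hx2))

theorem repr_mem {x : V} (hx : x ∈ Λ.L) (k : S.Idx) : b.repr x k ∈ A0 := by
  rw [hL] at hx
  have := b.restrictScalars_repr_apply A0 ⟨x, hx⟩ k
  rw [← this]
  exact Subtype.prop _

/-- A coordinate on the lattice. -/
def coordL (k : S.Idx) : Λ.L →ₗ[A0] A0 where
  toFun x := ⟨b.repr x.1 k, repr_mem Λ hL x.2 k⟩
  map_add' x y := Subtype.ext (by simp)
  map_smul' a x := Subtype.ext (by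
    change b.repr ((a : BaseField) • x.1) k = a * b.repr x.1 k
    rw [map_smul, Finsupp.smul_apply, smul_eq_mul])

/-- The coordinates of the fiber with respect to the classes of the basis. -/
theorem exists_coord (k : S.Idx) : ∃ π : Λ.Fiber →ₗ[A0] A0 ⧸ m0,
    ∀ x hx, π (Λ.toFiber x hx) = Ideal.Quotient.mk m0 ⟨b.repr x k, repr_mem Λ hL hx k⟩ := by
  have hker : m0 • (⊤ : Submodule A0 Λ.L) ≤ LinearMap.ker ((Submodule.mkQ m0).comp (coordL Λ hL k)) := by
    refine Submodule.smul_le.2 fun a ha y _ => ?_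
    rw [LinearMap.mem_ker, map_smul]
    exact (Submodule.Quotient.mk_eq_zero m0).2 (m0.mul_mem_right _ ha)
  exact ⟨Submodule.liftQ _ _ hker, fun x hx => rfl⟩

theorem linearIndependent_cls : LinearIndependent (A0 ⧸ m0) (cls Λ hb) := by
  classical
  rw [linearIndependent_iff']
  intro s g hg k hk
  obtain ⟨π, hπ⟩ := exists_coord Λ hL k
  obtain ⟨a, ha⟩ : ∃ a : S.Idx → A0, ∀ l, Ideal.Quotient.mk m0 (a l) = g l :=
    ⟨fun l => (Ideal.Quotient.mk_surjective (g l)).choose,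
      fun l => (Ideal.Quotient.mk_surjective (g l)).choose_spec⟩
  have h1 : ∑ l ∈ s, a l • cls Λ hb l = 0 := by
    rw [← hg]
    exact Finset.sum_congr rfl fun l _ => by rw [← ha]; rfl
  have h2 := congrArg π h1
  rw [map_sum, map_zero, Finset.sum_eq_single_of_mem k hk] at h2
  · rw [map_smul, cls, hπ] at h2
    have h3 : (⟨b.repr (b k) k, repr_mem Λ hL (hb k) k⟩ : A0) = 1 := Subtype.ext (by simp)
    rw [h3] at h2
    rw [← ha]
    change Ideal.Quotient.mk m0 (a k * 1) = 0 at h2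
    rwa [mul_one] at h2
  · intro l _ hlk
    have h3 : (⟨b.repr (b l) k, repr_mem Λ hL (hb l) k⟩ : A0) = 0 := Subtype.ext (by simp [hlk])
    rw [map_smul, cls, hπ, h3, map_zero, smul_zero]

theorem cls_injective : Function.Injective (cls Λ hb) := (linearIndependent_cls Λ hb hL).injective

theorem cls_ne_zero (k : S.Idx) : cls Λ hb k ≠ 0 := (linearIndependent_cls Λ hb hL).ne_zero k

include h in
theorem hasWeight_cls_iff (k : S.Idx) (ν : Pcl I) :
    Λ.HasWeight (cls Λ hb k) ν ↔ ν = S.idxWt k := by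
  refine ⟨fun hν => ?_, fun hν => hν ▸ hasWeight_cls h Λ hb k⟩
  obtain ⟨⟨y, hy⟩, hyν, hyk⟩ := hν
  rw [h.wtSpace, mem_modWt_iff] at hyν
  by_contra hne
  have h0 : b.repr y k = 0 := by
    by_contra hk
    exact hne (hyν k hk).symm
  obtain ⟨π, hπ⟩ := exists_coord Λ hL k
  have h1 : π (cls Λ hb k) = 0 := by
    rw [← hyk]
    refine (hπ y hy).trans ?_
    have : (⟨b.repr y k, repr_mem Λ hL hy k⟩ : A0) = 0 := Subtype.ext h0
    rw [this, map_zero]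
  rw [cls, hπ] at h1
  have h3 : (⟨b.repr (b k) k, repr_mem Λ hL (hb k) k⟩ : A0) = 1 := Subtype.ext (by simp)
  rw [h3, map_one] at h1
  exact one_ne_zero h1

end Classes

/-! ### Existence of a crystal basis -/

/-- The lattice spanned by the basis. -/
def stdLattice (h : S.IsModel b ρ) : CrystalLattice ρ where
  L := Submodule.span A0 (Set.range b)
  free := by
    obtain ⟨n, ⟨e⟩⟩ := Finite.exists_equiv_fin S.Idx
    refine ⟨ULift (Fin n), b.reindex (e.trans Equiv.ulift.symm), ?_⟩
    rw [Module.Basis.range_reindex]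
  weights := by
    refine le_antisymm (Submodule.span_le.2 ?_) (iSup_le fun μ => inf_le_left)
    rintro _ ⟨k, rfl⟩
    refine Submodule.mem_iSup_of_mem (S.idxWt k) ⟨Submodule.subset_span ⟨k, rfl⟩, ?_⟩
    rw [h.wtSpace]
    exact S.idx_mem_modWt b k
  stable_e i x hx := by
    have hb : ∀ k, b k ∈ Submodule.span A0 (Set.range b) := fun k => Submodule.subset_span ⟨k, rfl⟩
    rw [h.eTilde_eq]
    induction hx using Submodule.span_induction with
    | mem x hx =>
      obtain ⟨k, rfl⟩ := hx
      rcases S.kE_basis (b := b) i k with h2 | ⟨hi, h2, -⟩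
      · rw [h2]
        cases S.crysE i k with
        | none => exact Submodule.zero_mem _
        | some l => exact hb l
      · rw [h2]; exact zv_mem_of_yv (yv_mem_of_basis hb) hi
    | zero => rw [map_zero]; exact Submodule.zero_mem _
    | add x y _ _ h1 h2 => rw [map_add]; exact Submodule.add_mem _ h1 h2
    | smul a x _ h1 =>
      rw [(S.kE b i).map_smul_of_tower]; exact Submodule.smul_mem _ _ h1
  stable_f i x hx := by
    have hb : ∀ k, b k ∈ Submodule.span A0 (Set.range b) := fun k => Submodule.subset_span ⟨k, rfl⟩
    rw [h.fTilde_eq]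
    induction hx using Submodule.span_induction with
    | mem x hx =>
      obtain ⟨k, rfl⟩ := hx
      rcases S.kF_basis (b := b) i k with h2 | ⟨hi, h2, -⟩
      · rw [h2]
        cases S.crysF i k with
        | none => exact Submodule.zero_mem _
        | some l => exact hb l
      · rw [h2]; exact zv_mem_of_yv (yv_mem_of_basis hb) hi
    | zero => rw [map_zero]; exact Submodule.zero_mem _
    | add x y _ _ h1 h2 => rw [map_add]; exact Submodule.add_mem _ h1 h2
    | smul a x _ h1 =>
      rw [(S.kF b i).map_smul_of_tower]; exact Submodule.smul_mem _ _ h1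

/-- The crystal basis of the module: the lattice spanned by the basis, and the classes of the basis
vectors. -/
theorem IsModel.nonempty_crystalBasis (h : S.IsModel b ρ) : Nonempty (CrystalBasis ρ) := by
  have hb : ∀ k, b k ∈ (stdLattice h).L := fun k => Submodule.subset_span ⟨k, rfl⟩
  have helim : ∀ o : Option S.Idx, o.elim 0 (cls (stdLattice h) hb) ∈ Set.range (cls (stdLattice h) hb)
      ∨ o.elim 0 (cls (stdLattice h) hb) = 0 := fun o => by
    cases o with
    | none => exact Or.inr rfl
    | some l => exact Or.inl ⟨l, rfl⟩
  have helim' : ∀ (o : Option S.Idx) (l : S.Idx),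
      o.elim 0 (cls (stdLattice h) hb) = cls (stdLattice h) hb l ↔ o = some l := fun o l => by
    cases o with
    | none => simpa using (cls_ne_zero (stdLattice h) hb rfl l).symm
    | some m => simpa using (cls_injective (stdLattice h) hb rfl).eq_iff
  refine ⟨{ stdLattice h with
    B := Set.range (cls (stdLattice h) hb)
    linInd := (linearIndependent_cls (stdLattice h) hb rfl).linearIndepOn_id
    span := span_cls (stdLattice h) hb rfl
    hasWeight := ?_
    eBar_mem := ?_
    fBar_mem := ?_
    eBar_fBar := ?_ }⟩
  · rintro _ ⟨k, rfl⟩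
    exact ⟨_, hasWeight_cls h (stdLattice h) hb k⟩
  · rintro i _ ⟨k, rfl⟩
    have := eBar_cls h (stdLattice h) hb i k
    exact (congrArg (fun x => x ∈ Set.range (cls (stdLattice h) hb) ∨ x = 0) this).mpr (helim _)
  · rintro i _ ⟨k, rfl⟩
    have := fBar_cls h (stdLattice h) hb i k
    exact (congrArg (fun x => x ∈ Set.range (cls (stdLattice h) hb) ∨ x = 0) this).mpr (helim _)
  · rintro i _ ⟨k, rfl⟩ _ ⟨l, rfl⟩
    refine (congrArg (· = _) (fBar_cls h (stdLattice h) hb i k)).to_iff.trans ?_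
    refine Iff.trans ?_ (congrArg (· = _) (eBar_cls h (stdLattice h) hb i l)).to_iff.symm
    rw [helim', helim', S.crysF_eq_some_iff]

end StringSystem
end AffineDatum

namespace AffineDatum

variable {I : Type u} [Fintype I] [DecidableEq I] {D : AffineDatum I} {ϖ : Pcl I}

namespace StringSystem

/-! ### Transport of structure -/

section Map

variable (S : D.StringSystem ϖ) {V : Type v} [AddCommGroup V] [Module BaseField V]
  {V' : Type*} [AddCommGroup V'] [Module BaseField V'] (b : Module.Basis S.Idx BaseField V)
  (φ : V ≃ₗ[BaseField] V')

theorem vec_map (μ : Pcl I) : S.vec (b.map φ) μ = φ (S.vec b μ) := by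
  by_cases h : μ ∈ S.R
  · rw [vec_of_mem S _ h, vec_of_mem S _ h, Module.Basis.map_apply]
  · rw [vec_of_notMem S _ h, vec_of_notMem S _ h, map_zero]

theorem yv_map (j : I) : S.yv (b.map φ) j = φ (S.yv b j) := by
  by_cases h : clRoot D.A j ∈ S.R
  · rw [yv_of_mem S _ h, yv_of_mem S _ h, Module.Basis.map_apply]
  · rw [yv_of_notMem S _ h, yv_of_notMem S _ h, map_zero]

theorem zv_map (i : I) : S.zv (b.map φ) i = φ (S.zv b i) := by
  simp only [zv, map_sum, map_smul, yv_map]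

theorem opE_map (i : I) (x : V) : S.opE (b.map φ) i (φ x) = φ (S.opE b i x) := by
  suffices h : S.opE (b.map φ) i ∘ₗ φ.toLinearMap = φ.toLinearMap ∘ₗ S.opE b i from
    LinearMap.congr_fun h x
  refine b.ext fun k => ?_
  simp only [LinearMap.comp_apply, LinearEquiv.coe_coe]
  rw [← Module.Basis.map_apply, opE, opE, Module.Basis.constr_basis, Module.Basis.constr_basis]
  rcases k with μ | j
  · simp only [zv_map, vec_map]; split_ifs <;> simp
  · simp only [vec_map]; split_ifs <;> simp

theorem opF_map (i : I) (x : V) : S.opF (b.map φ) i (φ x) = φ (S.opF b i x) := by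
  suffices h : S.opF (b.map φ) i ∘ₗ φ.toLinearMap = φ.toLinearMap ∘ₗ S.opF b i from
    LinearMap.congr_fun h x
  refine b.ext fun k => ?_
  simp only [LinearMap.comp_apply, LinearEquiv.coe_coe]
  rw [← Module.Basis.map_apply, opF, opF, Module.Basis.constr_basis, Module.Basis.constr_basis]
  rcases k with μ | j
  · simp only [zv_map, vec_map]; split_ifs <;> simp
  · simp only [vec_map]; split_ifs <;> simp

theorem opK_map (i : I) (s : ℤ) (x : V) : S.opK (b.map φ) i s (φ x) = φ (S.opK b i s x) := by
  suffices h : S.opK (b.map φ) i s ∘ₗ φ.toLinearMap = φ.toLinearMap ∘ₗ S.opK b i s from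
    LinearMap.congr_fun h x
  refine b.ext fun k => ?_
  simp only [LinearMap.comp_apply, LinearEquiv.coe_coe]
  rw [← Module.Basis.map_apply, opK, opK, Module.Basis.constr_basis, Module.Basis.constr_basis]
  simp

variable {S b} {ρ : Uq D →ₐ[BaseField] Module.End BaseField V}
  {σ : Uq D →ₐ[BaseField] Module.End BaseField V'}

theorem IsModel.map (h : S.IsModel b ρ) (hσ : ∀ x v, σ x (φ v) = φ (ρ x v)) :
    S.IsModel (b.map φ) σ := fun i => by
  refine ⟨?_, ?_, ?_⟩ <;> refine LinearMap.ext fun x => ?_ <;> obtain ⟨x, rfl⟩ := φ.surjective x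
  · rw [hσ, (h i).1, opE_map]
  · rw [hσ, (h i).2.1, opF_map]
  · rw [hσ, (h i).2.2, opK_map]

end Map

/-! ### All crystal bases -/

variable {S : D.StringSystem ϖ} {V : Type v} [AddCommGroup V] [Module BaseField V]
  {b : Module.Basis S.Idx BaseField V} {ρ : Uq D →ₐ[BaseField] Module.End BaseField V}

theorem _root_.QuantumAffine.CrystalBasis.ne_zero (C : CrystalBasis ρ) {β : C.Fiber} (hβ : β ∈ C.B) :
    β ≠ 0 := C.linInd.ne_zero ⟨β, hβ⟩

/-- A crystal basis contains the class of a vector of weight `ϖ`: otherwise the coordinate of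
weight `ϖ` maps the lattice onto a finitely generated module `M` over the local ring with `M =
𝔪 M`. -/
theorem IsModel.exists_top (h : S.IsModel b ρ) (C : CrystalBasis ρ) :
    ∃ (c : BaseField) (hc : c • S.vec b ϖ ∈ C.L), C.toFiber _ hc ∈ C.B := by
  by_contra hno
  push Not at hno
  have hϖ : ϖ ∈ S.R := S.orbit_mem ϖ .refl
  set k : S.Idx := .inl ⟨ϖ, hϖ⟩
  -- The other elements of the crystal are classes of weight vectors of weights `ν ≠ ϖ`, so every
  -- class lifts to a lattice vector without component of weight `ϖ`.
  have hlift : ∀ β : C.Fiber, ∃ y hy, C.toFiber y hy = β ∧ b.repr y k = 0 := fun β => by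
    have hβ : β ∈ Submodule.span (A0 ⧸ m0) C.B := by rw [C.span]; trivial
    induction hβ using Submodule.span_induction with
    | mem β hβ =>
      obtain ⟨ν, ⟨y, hy⟩, hyν, hyβ⟩ := C.hasWeight β hβ
      refine ⟨y, hy, hyβ, ?_⟩
      rw [h.wtSpace] at hyν
      by_cases hν : ν = ϖ
      · subst hν
        obtain ⟨c, hc⟩ := S.eq_smul_vec b (S.ne_zero hϖ) hyν
        simp only at hc
        subst hc
        exact (hno c hy (by rw [show C.toFiber _ hy = β from hyβ]; exact hβ)).elim
      · rw [mem_modWt_iff] at hyν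
        by_contra h0
        exact hν (hyν k h0).symm
    | zero => exact ⟨0, C.L.zero_mem, C.toFiber_zero rfl _, by simp⟩
    | add β γ _ _ h1 h2 =>
      obtain ⟨y, hy, rfl, h1⟩ := h1
      obtain ⟨z, hz, rfl, h2⟩ := h2
      exact ⟨y + z, C.L.add_mem hy hz, rfl, by simp [h1, h2]⟩
    | smul a β _ h1 =>
      obtain ⟨y, hy, rfl, h1⟩ := h1
      obtain ⟨a, rfl⟩ := Ideal.Quotient.mk_surjective a
      refine ⟨(a : BaseField) • y, C.L.smul_mem a hy, rfl, ?_⟩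
      rw [map_smul, Finsupp.smul_apply, h1, smul_zero]
  set π : V →ₗ[A0] BaseField := (b.coord k).restrictScalars A0
  have hfin : Module.Finite BaseField V := Module.Finite.of_basis b
  obtain ⟨ι, b', hb'⟩ := C.free
  have hι : Finite ι := Module.Finite.finite_basis b'
  have hfg : (C.L.map π).FG := by
    rw [hb']
    exact (Submodule.fg_span (Set.finite_range b')).map π
  -- Subtracting such a lift from `x ∈ L` does not change `π x`, and the difference lies in `𝔪 L`.
  have hle : C.L.map π ≤ m0 • C.L.map π := by
    rintro _ ⟨x, hx, rfl⟩
    obtain ⟨y, hy, hxy, hy0⟩ := hlift (C.toFiber x hx)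
    have h1 := (Submodule.Quotient.eq _).1 hxy.symm
    have h2 : ∀ z ∈ m0 • (⊤ : Submodule A0 C.L), π z.1 ∈ m0 • C.L.map π := fun z hz => by
      induction hz using Submodule.smul_induction_on' with
      | smul a ha z _ =>
        have : π (a • z : C.L).1 = a • π z.1 := π.map_smul a z.1
        rw [this]
        exact Submodule.smul_mem_smul ha ⟨z.1, z.2, rfl⟩
      | add z _ w _ h1 h2 =>
        have : π (z + w : C.L).1 = π z.1 + π w.1 := π.map_add z.1 w.1
        rw [this]
        exact Submodule.add_mem _ h1 h2
    have h3 := h2 _ h1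
    have h4 : π (x - y) = π x := by
      rw [map_sub]
      exact sub_eq_self.2 hy0
    exact h4 ▸ h3
  have hbot := Submodule.eq_bot_of_le_smul_of_le_jacobson_bot m0 _ hfg hle m0_le_jacobson
  have hzero : b.coord k = 0 := b'.ext fun i => by
    have h1 : π (b' i) ∈ C.L.map π := ⟨b' i, by rw [hb']; exact Submodule.subset_span ⟨i, rfl⟩, rfl⟩
    rw [hbot] at h1
    exact h1
  have h1 := LinearMap.congr_fun hzero (b k)
  simp at h1

/-- An arrow of the crystal that can be reversed leads from `B` to `B`. -/
theorem fTilde_mem_B (C : CrystalBasis ρ) (i : I) {x y : V} (hx : ∃ hx : x ∈ C.L, C.toFiber x hx ∈ C.B)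
    (hf : fTilde ρ i x = y) (he : eTilde ρ i y = x) : ∃ hy : y ∈ C.L, C.toFiber y hy ∈ C.B := by
  obtain ⟨hx, hxB⟩ := hx
  subst hf
  refine ⟨C.stable_f i x hx, ?_⟩
  rw [← C.fBar_toFiber]
  refine (C.fBar_mem i _ hxB).resolve_right fun h0 => C.ne_zero hxB ?_
  have h1 := congrArg (C.eBar i) h0
  rw [C.fBar_toFiber, C.eBar_toFiber, map_zero, C.toFiber_congr he] at h1
  exact h1

theorem eTilde_mem_B (C : CrystalBasis ρ) (i : I) {x y : V} (hx : ∃ hx : x ∈ C.L, C.toFiber x hx ∈ C.B)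
    (he : eTilde ρ i x = y) (hf : fTilde ρ i y = x) : ∃ hy : y ∈ C.L, C.toFiber y hy ∈ C.B := by
  obtain ⟨hx, hxB⟩ := hx
  subst he
  refine ⟨C.stable_e i x hx, ?_⟩
  rw [← C.eBar_toFiber]
  refine (C.eBar_mem i _ hxB).resolve_right fun h0 => C.ne_zero hxB ?_
  have h1 := congrArg (C.fBar i) h0
  rw [C.eBar_toFiber, C.fBar_toFiber, map_zero, C.toFiber_congr hf] at h1
  exact h1

/-- Once the class of `v_ϖ` belongs to the crystal, so do the classes of all `v_μ`: the Kashiwara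
operators move `v_ϖ` to every `v_μ` along the strings, and each step can be reversed. -/
theorem IsModel.vec_mem_B (h : S.IsModel b ρ) (C : CrystalBasis ρ)
    (hϖ : ∃ hx : S.vec b ϖ ∈ C.L, C.toFiber _ hx ∈ C.B) :
    ∀ μ ∈ S.R, ∃ hx : S.vec b μ ∈ C.L, C.toFiber _ hx ∈ C.B := by
  refine S.conn (fun μ => ∃ hx : S.vec b μ ∈ C.L, C.toFiber _ hx ∈ C.B) hϖ ?_ ?_ ?_ ?_
  · intro μ hμ i hx hμi
    refine eTilde_mem_B C i hx ?_ ?_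
    · rw [h.eTilde_eq, S.kE_vec b hμ fun he => S.ne_zero hμi (by rw [he, neg_add_cancel])]
    · rw [h.fTilde_eq, S.kF_vec b hμi fun he => S.ne_zero hμ (by simpa using he),
        add_sub_cancel_right]
  · intro μ hμ i hx hμi
    refine fTilde_mem_B C i hx ?_ ?_
    · rw [h.fTilde_eq, S.kF_vec b hμ fun he => S.ne_zero hμi (by rw [he, sub_self])]
    · rw [h.eTilde_eq, S.kE_vec b hμi fun he => S.ne_zero hμ (by
        have : μ - clRoot D.A i + clRoot D.A i = 0 := by rw [he, neg_add_cancel]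
        rwa [sub_add_cancel] at this), sub_add_cancel]
  · intro i hi hx
    have hz := fTilde_mem_B C i hx (by rw [h.fTilde_eq, S.kF_root b hi])
      (by rw [h.eTilde_eq, kE_zv])
    exact fTilde_mem_B C i hz (by rw [h.fTilde_eq, kF_zv]) (by rw [h.eTilde_eq, S.kE_neg_root b hi])
  · intro i hi hx
    have hz := eTilde_mem_B C i hx (by rw [h.eTilde_eq, S.kE_neg_root b hi])
      (by rw [h.fTilde_eq, kF_zv])
    exact eTilde_mem_B C i hz (by rw [h.eTilde_eq, kE_zv]) (by rw [h.fTilde_eq, S.kF_root b hi])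

/-- If the lattice vector `x` is not zero at `q = 0`, its multiples in the lattice have coefficients in
the local ring. -/
theorem _root_.QuantumAffine.CrystalLattice.mem_A0_of_smul_mem (Λ : CrystalLattice ρ) {x : V}
    (hx : x ∈ Λ.L) (hx0 : Λ.toFiber x hx ≠ 0) {c : BaseField} (hc : c • x ∈ Λ.L) : c ∈ A0 := by
  by_contra hcA
  have hc0 : c ≠ 0 := fun h0 => hcA (h0 ▸ A0.zero_mem)
  refine hx0 ?_
  have h1 : c⁻¹ • c • x = x := inv_smul_smul₀ hc0 x
  rw [← Λ.toFiber_congr h1 (h1.symm ▸ hx)]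
  exact Λ.toFiber_smul_eq_zero (inv_ord_pos_of_notMem hcA) hc _

/-- The crystal contains the classes of the `z_j`. These lattice vectors generate the `y_j` over
`𝐀₀`, because the matrix between the two is invertible, and `y_j` and `z_j` have the same
class. -/
theorem IsModel.basis_mem_B (h : S.IsModel b ρ) (C : CrystalBasis ρ)
    (hϖ : ∃ hx : S.vec b ϖ ∈ C.L, C.toFiber _ hx ∈ C.B) (k : S.Idx) :
    ∃ hx : b k ∈ C.L, C.toFiber _ hx ∈ C.B := by
  have hv := h.vec_mem_B C hϖ
  have hz : ∀ i, clRoot D.A i ∈ S.R → ∃ hx : S.zv b i ∈ C.L, C.toFiber _ hx ∈ C.B := fun i hi =>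
    fTilde_mem_B C i (hv _ hi) (by rw [h.fTilde_eq, S.kF_root b hi]) (by rw [h.eTilde_eq, kE_zv])
  have hy : ∀ j, S.yv b j ∈ C.L := fun j => by
    by_cases hj : clRoot D.A j ∈ S.R
    · exact S.yv_mem_of_zv b C.L (fun i hi => (hz i hi).1) hj
    · rw [yv_of_notMem S b hj]; exact C.L.zero_mem
  rcases k with ⟨μ, hμ⟩ | ⟨j, hj⟩
  · rw [← vec_of_mem S b hμ]; exact hv μ hμ
  · rw [← yv_of_mem S b hj]
    refine ⟨hy j, ?_⟩
    rw [← toFiber_zv C.toCrystalLattice hy hj]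
    exact (hz j hj).2

/-- A crystal lattice whose crystal contains the class of `v_ϖ` is spanned by the basis. -/
theorem IsModel.lattice_eq (h : S.IsModel b ρ) (C : CrystalBasis ρ)
    (hϖ : ∃ hx : S.vec b ϖ ∈ C.L, C.toFiber _ hx ∈ C.B) :
    C.L = Submodule.span A0 (Set.range b) := by
  have hbB := h.basis_mem_B C hϖ
  have hv := h.vec_mem_B C hϖ
  refine le_antisymm ?_ (Submodule.span_le.2 (by rintro _ ⟨k, rfl⟩; exact (hbB k).1))
  have hb : ∀ k, b k ∈ Submodule.span A0 (Set.range b) := fun k => Submodule.subset_span ⟨k, rfl⟩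
  rw [C.weights]
  refine iSup_le fun μ => ?_
  rintro x ⟨hx, hxμ⟩
  change x ∈ QuantumAffine.wtSpace ρ μ at hxμ
  rw [h.wtSpace] at hxμ
  by_cases hμ : μ = 0
  · subst hμ
    obtain ⟨c, rfl, hc⟩ := S.eq_sum_yv b hxμ
    refine Submodule.sum_mem _ fun j _ => ?_
    by_cases hj : clRoot D.A j ∈ S.R
    -- The operator `f̃_j` maps the vector to its coefficient at `y_j` times `v_{-α_j}`. As the
    -- class of `v_{-α_j}` is not zero, the coefficient lies in `𝐀₀`.
    · have h1 := C.stable_f j _ hx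
      rw [h.fTilde_eq, map_sum, Finset.sum_eq_single_of_mem j (Finset.mem_univ j) fun k _ hk => by
        rw [map_smul, kF_yv, if_neg hk, smul_zero], map_smul, kF_yv, if_pos rfl] at h1
      obtain ⟨h2, h3⟩ := hv _ (S.neg_mem hj)
      have h4 := C.mem_A0_of_smul_mem h2 (C.ne_zero h3) h1
      exact Submodule.smul_mem _ (⟨c j, h4⟩ : A0) (yv_mem_of_basis hb j)
    · rw [hc j hj, zero_smul]; exact Submodule.zero_mem _
  · obtain ⟨c, rfl⟩ := S.eq_smul_vec b hμ hxμ
    by_cases hR : μ ∈ S.R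
    · obtain ⟨h2, h3⟩ := hv μ hR
      have h4 := C.mem_A0_of_smul_mem h2 (C.ne_zero h3) hx
      exact Submodule.smul_mem _ (⟨c, h4⟩ : A0) (vec_mem_of_basis hb μ)
    · rw [S.vec_of_notMem b hR, smul_zero]; exact Submodule.zero_mem _

/-- The crystal basis attached to a basis of a model. -/
def IsStd (b : Module.Basis S.Idx BaseField V) (C : CrystalBasis ρ) : Prop :=
  C.L = Submodule.span A0 (Set.range b) ∧
    ∃ hb : ∀ k, b k ∈ C.L, C.B = Set.range (cls C.toCrystalLattice hb)

/-- After rescaling the basis, every crystal basis is the standard one: the scalar is chosen such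
that the vector of weight `ϖ` has its class in the crystal. -/
theorem IsModel.exists_isStd (h : S.IsModel b ρ) (C : CrystalBasis ρ) :
    ∃ b' : Module.Basis S.Idx BaseField V, S.IsModel b' ρ ∧ IsStd b' C := by
  obtain ⟨c, hc, hcB⟩ := h.exists_top C
  have hc0 : c ≠ 0 := fun h0 => C.ne_zero hcB (C.toFiber_zero (by rw [h0, zero_smul]) _)
  set φ : V ≃ₗ[BaseField] V := LinearEquiv.smulOfNeZero BaseField V c hc0
  have h' : S.IsModel (b.map φ) ρ := h.map φ fun x v => map_smul (ρ x) c v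
  have hϖ : ∃ hx : S.vec (b.map φ) ϖ ∈ C.L, C.toFiber _ hx ∈ C.B := by
    rw [vec_map]; exact ⟨hc, hcB⟩
  have hL := h'.lattice_eq C hϖ
  have hB := h'.basis_mem_B C hϖ
  have hb : ∀ k, b.map φ k ∈ C.L := fun k => (hB k).1
  refine ⟨b.map φ, h', hL, hb, Set.Subset.antisymm (fun β hβ => ?_) ?_⟩
  · by_contra hn
    have hsub : Set.range (cls C.toCrystalLattice hb) ⊆ C.B := by
      rintro _ ⟨k, rfl⟩; exact (hB k).2
    -- The classes of the basis span the fibre, so a further element of the crystal would be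
    -- linearly dependent on them.
    have h1 := C.linInd.notMem_span_image (s := {x | x.1 ∈ Set.range (cls C.toCrystalLattice hb)})
      (x := ⟨β, hβ⟩) hn
    refine h1 ?_
    have h2 : ((↑) : C.B → C.Fiber) '' {x | x.1 ∈ Set.range (cls C.toCrystalLattice hb)} =
        Set.range (cls C.toCrystalLattice hb) := by
      ext γ
      constructor
      · rintro ⟨x, hx, rfl⟩; exact hx
      · exact fun hγ => ⟨⟨γ, hsub hγ⟩, hγ, rfl⟩
    rw [h2, span_cls C.toCrystalLattice hb hL]
    trivial
  · rintro _ ⟨k, rfl⟩; exact (hB k).2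

end StringSystem
end AffineDatum

namespace AffineDatum

variable {I : Type u} [Fintype I] [DecidableEq I] {D : AffineDatum I} {ϖ : Pcl I}

namespace StringSystem

theorem idxWt_inl (S : D.StringSystem ϖ) {μ : Pcl I} (hμ : μ ∈ S.R) : S.idxWt (.inl ⟨μ, hμ⟩) = μ := rfl

theorem idxWt_inr (S : D.StringSystem ϖ) {j : I} (hj : clRoot D.A j ∈ S.R) :
    S.idxWt (.inr ⟨j, hj⟩) = 0 := rfl

/-! ### The formulas on the space with basis `v_b` -/

section Realize

variable {S : D.StringSystem ϖ} {V : Type v} [AddCommGroup V] [Module BaseField V]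
  {b : Module.Basis S.Idx BaseField V} {ρ : Uq D →ₐ[BaseField] Module.End BaseField V}
  (h : S.IsModel b ρ) (C : CrystalBasis ρ) (hL : C.L = Submodule.span A0 (Set.range b))
  (hb : ∀ k, b k ∈ C.L) (hB : C.B = Set.range (cls C.toCrystalLattice hb))

include hB in
theorem cls_mem_B (k : S.Idx) : cls C.toCrystalLattice hb k ∈ C.B := hB ▸ ⟨k, rfl⟩

/-- The bijection of the index set with the crystal. -/
def idxEquiv : S.Idx ≃ C.B :=
  Equiv.ofBijective (fun k => ⟨cls C.toCrystalLattice hb k, cls_mem_B C hb hB k⟩)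
    ⟨fun _ _ hkl => cls_injective C.toCrystalLattice hb hL (congrArg Subtype.val hkl),
      fun β => by
        obtain ⟨k, hk⟩ := (Set.ext_iff.1 hB _).1 β.2
        exact ⟨k, Subtype.ext hk⟩⟩

/-- The isomorphism that sends `v_b` to the basis vector of class `b`. -/
def spaceEquiv : C.Space ≃ₗ[BaseField] V :=
  Finsupp.basisSingleOne.equiv b (idxEquiv C hL hb hB).symm

theorem spaceEquiv_single (k : S.Idx) :
    spaceEquiv C hL hb hB (Finsupp.single (idxEquiv C hL hb hB k) 1) = b k := by
  have := Finsupp.basisSingleOne.equiv_apply (R := BaseField) (idxEquiv C hL hb hB k) b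
    (idxEquiv C hL hb hB).symm
  rwa [Finsupp.coe_basisSingleOne, Equiv.symm_apply_apply] at this

theorem spaceEquiv_vec (k : S.Idx) :
    spaceEquiv C hL hb hB (C.vec (cls C.toCrystalLattice hb k)) = b k := by
  rw [CrystalBasis.vec, dif_pos (cls_mem_B C hb hB k)]
  exact spaceEquiv_single C hL hb hB k

theorem vec_zero : C.vec 0 = 0 := dif_neg fun h0 => C.ne_zero h0 rfl

theorem spaceEquiv_elim (o : Option S.Idx) :
    spaceEquiv C hL hb hB (C.vec (o.elim 0 (cls C.toCrystalLattice hb))) = o.elim 0 b := by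
  cases o with
  | none => exact (congrArg _ (vec_zero C)).trans (map_zero _)
  | some k => exact spaceEquiv_vec C hL hb hB k

include h hL in
theorem wt_cls (k : S.Idx) : C.wt (cls C.toCrystalLattice hb k) = S.idxWt k := by
  have hex : ∃ μ, C.HasWeight (cls C.toCrystalLattice hb k) μ :=
    ⟨_, hasWeight_cls h C.toCrystalLattice hb k⟩
  rw [CrystalBasis.wt, dif_pos hex]
  exact (hasWeight_cls_iff h C.toCrystalLattice hb hL k _).1 hex.choose_spec

include h in
theorem realizesModule {eAct fAct : I → C.B → C.Space}
    (he : ∀ i k, spaceEquiv C hL hb hB (eAct i (idxEquiv C hL hb hB k)) = S.opE b i (b k))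
    (hf : ∀ i k, spaceEquiv C hL hb hB (fAct i (idxEquiv C hL hb hB k)) = S.opF b i (b k)) :
    C.RealizesModule eAct fAct := by
  set Φ := spaceEquiv C hL hb hB with hΦ
  refine ⟨((Φ.symm.conjAlgEquiv BaseField : Module.End BaseField V →ₐ[BaseField]
    Module.End BaseField C.Space)).comp ρ, fun i β => ?_, Φ, fun x y => ?_⟩
  · obtain ⟨k, rfl⟩ := (idxEquiv C hL hb hB).surjective β
    have key : ∀ x : Uq D, ((Φ.symm.conjAlgEquiv BaseField : Module.End BaseField V →ₐ[BaseField]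
        Module.End BaseField C.Space)).comp ρ x (Finsupp.single (idxEquiv C hL hb hB k) 1) =
        Φ.symm (ρ x (b k)) := fun x => by
      rw [← spaceEquiv_single C hL hb hB k]; rfl
    rw [key, key, key, (h i).1, (h i).2.1, (h i).2.2]
    refine ⟨?_, ?_, ?_⟩
    · rw [← he, Φ.symm_apply_apply]
    · rw [← hf, Φ.symm_apply_apply]
    · have h1 : C.wt (idxEquiv C hL hb hB k : C.Fiber) = S.idxWt k := wt_cls h C hL hb k
      rw [h1, (S.mem_modWt b).1 (S.idx_mem_modWt b k) i, map_smul, ← spaceEquiv_single C hL hb hB k,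
        ← hΦ, Φ.symm_apply_apply]
  · change Φ (Φ.symm (ρ x (Φ y))) = _
    rw [Φ.apply_symm_apply]

/-! ### The minuscule formulas -/

/-- In a string system with `⟨h_i, μ⟩ ∈ {0, ±1}` no simple root is a weight, and the strings have at
most two members. -/
theorem minuscule_opE (hm : ∀ μ ∈ S.R, ∀ i, -1 ≤ μ i ∧ μ i ≤ 1) (i : I) (k : S.Idx) :
    S.opE b i (b k) = (S.crysE i k).elim 0 b := by
  have hroot : ∀ j, clRoot D.A j ∉ S.R := fun j hj => by
    have := hm _ hj j
    rw [clRoot_self] at this; omega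
  rcases k with ⟨μ, hμ⟩ | ⟨j, hj⟩
  · have hne : μ ≠ -clRoot D.A i := fun h0 => hroot i (S.neg_root i (h0 ▸ hμ))
    have hne' : μ ≠ clRoot D.A i := fun h0 => hroot i (h0 ▸ hμ)
    rw [← vec_of_mem S b hμ, S.opE_vec b hμ hne]
    simp only [crysE, dif_neg hne]
    split_ifs with h2
    · obtain ⟨h3, h4⟩ := S.str hμ hne' hne
      have h5 := hm _ h2 i
      rw [Pi.add_apply, clRoot_self] at h5
      have h6 : S.down i μ = 0 := by
        by_contra h0
        have h7 := hm _ ((h4 (-1)).2 (by omega)) i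
        rw [Pi.add_apply, Pi.smul_apply, clRoot_self, smul_eq_mul] at h7
        omega
      rw [h6, zero_add, qInt_one, one_smul, vec_of_mem S b h2]; rfl
    · rw [vec_of_notMem S b h2, smul_zero]; rfl
  · exact absurd hj (hroot j)

theorem minuscule_opF (hm : ∀ μ ∈ S.R, ∀ i, -1 ≤ μ i ∧ μ i ≤ 1) (i : I) (k : S.Idx) :
    S.opF b i (b k) = (S.crysF i k).elim 0 b := by
  have hroot : ∀ j, clRoot D.A j ∉ S.R := fun j hj => by
    have := hm _ hj j
    rw [clRoot_self] at this; omega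
  rcases k with ⟨μ, hμ⟩ | ⟨j, hj⟩
  · have hne : μ ≠ -clRoot D.A i := fun h0 => hroot i (S.neg_root i (h0 ▸ hμ))
    have hne' : μ ≠ clRoot D.A i := fun h0 => hroot i (h0 ▸ hμ)
    rw [← vec_of_mem S b hμ, S.opF_vec b hμ hne']
    simp only [crysF, dif_neg hne']
    split_ifs with h2
    · obtain ⟨h3, h4⟩ := S.str hμ hne' hne
      have h5 := hm _ h2 i
      rw [Pi.sub_apply, clRoot_self] at h5
      have h6 : S.up i μ = 0 := by
        by_contra h0
        have h7 := hm _ ((h4 1).2 (by omega)) i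
        rw [Pi.add_apply, Pi.smul_apply, clRoot_self, smul_eq_mul] at h7
        omega
      rw [h6, zero_add, qInt_one, one_smul, vec_of_mem S b h2]; rfl
    · rw [vec_of_notMem S b h2, smul_zero]; rfl
  · exact absurd hj (hroot j)

include h hL hB in
theorem realizesModule_minuscule (hm : ∀ μ ∈ S.R, ∀ i, -1 ≤ μ i ∧ μ i ≤ 1) :
    C.RealizesModule C.minusculeE C.minusculeF := by
  refine realizesModule h C hL hb hB (fun i k => ?_) fun i k => ?_
  · rw [minuscule_opE hm, ← spaceEquiv_elim C hL hb hB]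
    exact congrArg (fun x => spaceEquiv C hL hb hB (C.vec x)) (eBar_cls h C.toCrystalLattice hb i k)
  · rw [minuscule_opF hm, ← spaceEquiv_elim C hL hb hB]
    exact congrArg (fun x => spaceEquiv C hL hb hB (C.vec x)) (fBar_cls h C.toCrystalLattice hb i k)

/-! ### The adjoint formulas -/

open Classical in
/-- The class of `v_μ`, and `0` if `μ` is not a weight. -/
def vcls (C : CrystalBasis ρ) (hb : ∀ k, b k ∈ C.L) (μ : Pcl I) : C.Fiber :=
  if hμ : μ ∈ S.R then cls C.toCrystalLattice hb (.inl ⟨μ, hμ⟩) else 0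

include hL in
theorem vcls_ne_zero_iff (μ : Pcl I) : vcls C hb μ ≠ 0 ↔ μ ∈ S.R := by
  rw [vcls]
  split_ifs with hμ
  · exact iff_of_true (cls_ne_zero C.toCrystalLattice hb hL _) hμ
  · exact iff_of_false (fun h0 => h0 rfl) hμ

include h in
theorem fBar_vcls {i : I} {μ : Pcl I} (hμ : μ ≠ clRoot D.A i)
    (hs : μ - clRoot D.A i ∈ S.R → μ ∈ S.R) : C.fBar i (vcls C hb μ) = vcls C hb (μ - clRoot D.A i) := by
  by_cases hR : μ ∈ S.R
  · rw [vcls, dif_pos hR, fBar_cls h]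
    simp only [crysF, dif_neg hμ, vcls]
    split_ifs <;> rfl
  · rw [vcls, dif_neg hR, map_zero, vcls, dif_neg (mt hs hR)]

include h in
theorem eBar_vcls {i : I} {μ : Pcl I} (hμ : μ ≠ -clRoot D.A i)
    (hs : μ + clRoot D.A i ∈ S.R → μ ∈ S.R) : C.eBar i (vcls C hb μ) = vcls C hb (μ + clRoot D.A i) := by
  by_cases hR : μ ∈ S.R
  · rw [vcls, dif_pos hR, eBar_cls h]
    simp only [crysE, dif_neg hμ, vcls]
    split_ifs <;> rfl
  · rw [vcls, dif_neg hR, map_zero, vcls, dif_neg (mt hs hR)]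

include h hL in
/-- The Kashiwara operators move `v_μ` along the string without passing through the weight `0`, so
`φ_i` counts the steps down inside the set of weights. -/
theorem phi_vec {i : I} {μ : Pcl I} (hμ : μ ∈ S.R) (h1 : μ ≠ clRoot D.A i) :
    C.phi i (vcls C hb μ) = S.down i μ := by
  have hpow : ∀ n : ℕ, (C.fBar i ^ n) (vcls C hb μ) = vcls C hb (μ - (n : ℤ) • clRoot D.A i) := by
    intro n
    induction n with
    | zero => simp
    | succ n ih =>
      have e2 : μ - ((n + 1 : ℕ) : ℤ) • clRoot D.A i = μ - (n : ℤ) • clRoot D.A i - clRoot D.A i := by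
        push_cast; module
      have e3 : ∀ n : ℤ, μ - n • clRoot D.A i = μ + (-n) • clRoot D.A i := fun n => by module
      rw [pow_succ', Module.End.mul_apply, ih, e2]
      by_cases h2 : μ = -clRoot D.A i
      · -- the string of `-α_i` stops at once, and `0` is not a weight
        subst h2
        have hi := S.neg_mem_iff.1 hμ
        have hns : ∀ n : ℕ, -clRoot D.A i - ((n + 1 : ℕ) : ℤ) • clRoot D.A i ∉ S.R := fun n hn => by
          have e : -clRoot D.A i - ((n + 1 : ℕ) : ℤ) • clRoot D.A i =
            (-(n : ℤ) - 2) • clRoot D.A i := by push_cast; module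
          rw [e] at hn
          have := (S.string_root i hi _).1 hn
          omega
        refine fBar_vcls h C hb (fun h3 => ?_) fun h3 => absurd (e2 ▸ h3) (hns n)
        have := congrFun h3 i
        simp only [Pi.sub_apply, Pi.neg_apply, Pi.smul_apply, clRoot_self, smul_eq_mul] at this
        omega
      · obtain ⟨h3, h4⟩ := S.str hμ h1 h2
        have hne : μ - (n : ℤ) • clRoot D.A i ≠ clRoot D.A i ∨ μ - (n : ℤ) • clRoot D.A i ∉ S.R := by
          by_cases h5 : μ - (n : ℤ) • clRoot D.A i ∈ S.R
          · rw [e3] at h5 ⊢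
            exact Or.inl (S.str_ne hμ h1 h2 h5).1
          · exact Or.inr h5
        have hs : μ - (n : ℤ) • clRoot D.A i - clRoot D.A i ∈ S.R → μ - (n : ℤ) • clRoot D.A i ∈ S.R := by
          rw [← e2, e3, e3, h4, h4]; omega
        rcases hne with h5 | h5
        · exact fBar_vcls h C hb h5 hs
        · rw [vcls, dif_neg h5, map_zero, vcls, dif_neg (mt hs h5)]
  simp only [CrystalBasis.phi, hpow, vcls_ne_zero_iff C hL hb]
  rfl

include h hL in
theorem eps_vec {i : I} {μ : Pcl I} (hμ : μ ∈ S.R) (h1 : μ ≠ -clRoot D.A i) :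
    C.eps i (vcls C hb μ) = S.up i μ := by
  have hpow : ∀ n : ℕ, (C.eBar i ^ n) (vcls C hb μ) = vcls C hb (μ + (n : ℤ) • clRoot D.A i) := by
    intro n
    induction n with
    | zero => simp
    | succ n ih =>
      have e2 : μ + ((n + 1 : ℕ) : ℤ) • clRoot D.A i = μ + (n : ℤ) • clRoot D.A i + clRoot D.A i := by
        push_cast; module
      rw [pow_succ', Module.End.mul_apply, ih, e2]
      by_cases h2 : μ = clRoot D.A i
      · -- the string of `α_i` stops at once, and `0` is not a weight
        subst h2
        have hns : ∀ n : ℕ, clRoot D.A i + ((n + 1 : ℕ) : ℤ) • clRoot D.A i ∉ S.R := fun n hn => by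
          have e : clRoot D.A i + ((n + 1 : ℕ) : ℤ) • clRoot D.A i =
            ((n : ℤ) + 2) • clRoot D.A i := by push_cast; module
          rw [e] at hn
          have := (S.string_root i hμ _).1 hn
          omega
        refine eBar_vcls h C hb (fun h3 => ?_) fun h3 => absurd (e2 ▸ h3) (hns n)
        have := congrFun h3 i
        simp only [Pi.add_apply, Pi.neg_apply, Pi.smul_apply, clRoot_self, smul_eq_mul] at this
        omega
      · obtain ⟨h3, h4⟩ := S.str hμ h2 h1
        have hs : μ + (n : ℤ) • clRoot D.A i + clRoot D.A i ∈ S.R → μ + (n : ℤ) • clRoot D.A i ∈ S.R := by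
          rw [← e2, h4, h4]; omega
        by_cases h5 : μ + (n : ℤ) • clRoot D.A i ∈ S.R
        · exact eBar_vcls h C hb (S.str_ne hμ h2 h1 h5).2 hs
        · rw [vcls, dif_neg h5, map_zero, vcls, dif_neg (mt hs h5)]
  simp only [CrystalBasis.eps, hpow, vcls_ne_zero_iff C hL hb]
  rfl

include h hL in
/-- The vector `y_i` of the crystal lies in the middle of its string. -/
theorem phi_eps_yv {i : I} (hi : clRoot D.A i ∈ S.R) :
    C.phi i (cls C.toCrystalLattice hb (.inr ⟨i, hi⟩)) = 1 ∧
      C.eps i (cls C.toCrystalLattice hb (.inr ⟨i, hi⟩)) = 1 := by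
  have hf1 : C.fBar i (cls C.toCrystalLattice hb (.inr ⟨i, hi⟩)) = vcls C hb (-clRoot D.A i) := by
    rw [fBar_cls h, vcls, dif_pos (S.neg_mem hi)]; simp [crysF]
  have hf2 : C.fBar i (vcls C hb (-clRoot D.A i)) = 0 := by
    rw [fBar_vcls h C hb (clRoot_ne_neg i).symm fun _ => S.neg_mem hi, vcls,
      dif_neg (S.neg_two_notMem i hi)]
  have he1 : C.eBar i (cls C.toCrystalLattice hb (.inr ⟨i, hi⟩)) = vcls C hb (clRoot D.A i) := by
    rw [eBar_cls h, vcls, dif_pos hi]; simp [crysE]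
  have he2 : C.eBar i (vcls C hb (clRoot D.A i)) = 0 := by
    rw [eBar_vcls h C hb (clRoot_ne_neg i) fun _ => hi, vcls, dif_neg (S.two_notMem i hi)]
  have key : ∀ (T : C.Fiber →ₗ[A0] C.Fiber) (x y : C.Fiber), x ≠ 0 → T x = y → y ≠ 0 → T y = 0 →
      sSup {n : ℕ | (T ^ n) x ≠ 0} = 1 := fun T x y hx hxy hy hy0 => by
    refine sSup_of_iff_le fun n => ?_
    rw [Set.mem_ofPred_eq]
    rcases n with _ | _ | n
    · simpa using hx
    · simpa [hxy] using hy
    · rw [pow_succ, Module.End.mul_apply, hxy, pow_succ, Module.End.mul_apply, hy0, map_zero]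
      simp
  exact ⟨key _ _ _ (cls_ne_zero C.toCrystalLattice hb hL _) hf1
      ((vcls_ne_zero_iff C hL hb _).2 (S.neg_mem hi)) hf2,
    key _ _ _ (cls_ne_zero C.toCrystalLattice hb hL _) he1
      ((vcls_ne_zero_iff C hL hb _).2 hi) he2⟩

include h hL hB in
theorem xRoot_eq (j : I) : C.xRoot j = vcls C hb (clRoot D.A j) := by
  -- `v_{α_j}` is the only basis vector of weight `α_j`.
  have hwt : ∀ k : S.Idx, C.wt (cls C.toCrystalLattice hb k) = clRoot D.A j →
      ∃ hj : clRoot D.A j ∈ S.R, k = .inl ⟨clRoot D.A j, hj⟩ := fun k hk => by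
    rw [wt_cls h C hL hb] at hk
    rcases k with ⟨μ, hμ⟩ | ⟨l, hl⟩
    · simp only [idxWt] at hk; subst hk; exact ⟨hμ, rfl⟩
    · have := congrFun hk j
      rw [clRoot_self] at this
      simp [idxWt] at this
  by_cases hj : clRoot D.A j ∈ S.R
  · have hex : ∃ β ∈ C.B, C.wt β = clRoot D.A j :=
      ⟨_, cls_mem_B C hb hB (.inl ⟨_, hj⟩), wt_cls h C hL hb _⟩
    rw [CrystalBasis.xRoot, dif_pos hex, vcls, dif_pos hj]
    obtain ⟨h1, h2⟩ := hex.choose_spec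
    obtain ⟨k, hk⟩ := (Set.ext_iff.1 hB _).1 h1
    rw [← hk] at h2 ⊢
    obtain ⟨_, rfl⟩ := hwt k h2
    rfl
  · rw [vcls, dif_neg hj, CrystalBasis.xRoot, dif_neg]
    rintro ⟨β, hβ, hβw⟩
    obtain ⟨k, rfl⟩ := (Set.ext_iff.1 hB _).1 hβ
    exact hj (hwt k hβw).1

include h in
theorem spaceEquiv_yElt (j : I) : spaceEquiv C hL hb hB (C.vec (C.yElt j)) = S.yv b j := by
  rw [CrystalBasis.yElt, xRoot_eq h C hL hb hB, vcls]
  split_ifs with hj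
  · have h1 : C.fBar j (cls C.toCrystalLattice hb (.inl ⟨clRoot D.A j, hj⟩)) =
        cls C.toCrystalLattice hb (.inr ⟨j, hj⟩) := by
      rw [fBar_cls h]; simp [crysF]
    rw [h1, spaceEquiv_vec, yv_of_mem S b hj]
  · rw [map_zero, vec_zero, map_zero, yv_of_notMem S b hj]

include h in
theorem spaceEquiv_zeroVec (i : I) : spaceEquiv C hL hb hB (C.zeroVec i) = S.zv b i := by
  rw [CrystalBasis.zeroVec, map_add, map_sum, spaceEquiv_yElt h, zv,
    ← Finset.add_sum_erase _ _ (Finset.mem_univ i), zCoeff_self, one_smul]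
  congr 1
  rw [Finset.sum_congr rfl fun j _ => by rw [map_smul, spaceEquiv_yElt h]]
  have hsub : (Finset.univ.filter fun j => j ≠ i ∧ D.A i j ≠ 0) ⊆ Finset.univ.erase i := fun j hj => by
    rw [Finset.mem_filter] at hj
    exact Finset.mem_erase.2 ⟨hj.2.1, Finset.mem_univ j⟩
  rw [← Finset.sum_subset hsub fun j hj hj' => ?_]
  · refine Finset.sum_congr rfl fun j hj => ?_
    rw [Finset.mem_filter] at hj
    have := D.off_diag i j hj.2.1.symm
    rw [zCoeff, show (-D.A i j).toNat = (D.A i j).natAbs by omega]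
  · have h0 : D.A i j = 0 := by
      by_contra h0
      exact hj' (Finset.mem_filter.2 ⟨Finset.mem_univ j, Finset.ne_of_mem_erase hj, h0⟩)
    rw [zCoeff, h0, Int.natAbs_zero, qInt_zero, zero_div, zero_smul]

include h hL hB in
theorem realizesModule_adjoint : C.RealizesModule C.adjointE C.adjointF := by
  have hcv : ∀ {μ} (hμ : μ ∈ S.R), cls C.toCrystalLattice hb (.inl ⟨μ, hμ⟩) = vcls C hb μ := fun hμ => by
    rw [vcls, dif_pos hμ]
  have hval : ∀ k, (idxEquiv C hL hb hB k : C.Fiber) = cls C.toCrystalLattice hb k := fun k => rfl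
  have hne : ∀ k, cls C.toCrystalLattice hb k ≠ 0 := cls_ne_zero C.toCrystalLattice hb hL
  -- The case distinction is on the edge of the crystal graph: to or from a vector `y_j`, between
  -- two nonzero weights, or none.
  refine realizesModule h C hL hb hB (fun i k => ?_) fun i k => ?_
  · rw [CrystalBasis.adjointE, hval, eBar_cls h]
    rcases k with ⟨μ, hμ⟩ | ⟨j, hj⟩
    · rw [← vec_of_mem S b hμ]
      by_cases h1 : μ = -clRoot D.A i
      · subst h1
        have hi := S.neg_mem_iff.1 hμ
        have hc : S.crysE i (.inl ⟨-clRoot D.A i, hμ⟩) = some (.inr ⟨i, hi⟩) := by simp [crysE]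
        rw [hc, Option.elim_some, if_neg (hne _), wt_cls h C hL hb, idxWt_inr, if_neg (not_not.2 rfl),
          spaceEquiv_zeroVec h, S.opE_neg_root b hi]
      rw [S.opE_vec b hμ h1]
      by_cases h2 : μ + clRoot D.A i ∈ S.R
      · have hc : S.crysE i (.inl ⟨μ, hμ⟩) = some (.inl ⟨_, h2⟩) := by simp [crysE, h1, h2]
        rw [hc, Option.elim_some, if_neg (hne _), wt_cls h C hL hb, idxWt_inl, if_pos (S.ne_zero h2), map_smul,
          spaceEquiv_vec, hcv hμ, phi_vec h C hL hb hμ fun h3 => S.two_notMem i (h3 ▸ hμ) (h3 ▸ h2),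
          vec_of_mem S b h2]
      · have hc : S.crysE i (.inl ⟨μ, hμ⟩) = none := by simp [crysE, h1, h2]
        rw [hc, Option.elim_none, if_pos rfl, map_zero, vec_of_notMem S b h2, smul_zero]
    · rw [← yv_of_mem S b hj, opE_yv]
      by_cases h1 : j = i
      · subst h1
        have hc : S.crysE j (.inr ⟨j, hj⟩) = some (.inl ⟨_, hj⟩) := by simp [crysE]
        rw [hc, Option.elim_some, if_neg (hne _), wt_cls h C hL hb, idxWt_inl, if_pos (S.ne_zero hj), map_smul,
          spaceEquiv_vec, (phi_eps_yv h C hL hb hj).1, if_pos rfl, vec_of_mem S b hj]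
      · have hc : S.crysE i (.inr ⟨j, hj⟩) = none := by simp [crysE, h1]
        rw [hc, Option.elim_none, if_pos rfl, map_zero, if_neg h1]
  · rw [CrystalBasis.adjointF, hval, fBar_cls h]
    rcases k with ⟨μ, hμ⟩ | ⟨j, hj⟩
    · rw [← vec_of_mem S b hμ]
      by_cases h1 : μ = clRoot D.A i
      · subst h1
        have hc : S.crysF i (.inl ⟨clRoot D.A i, hμ⟩) = some (.inr ⟨i, hμ⟩) := by simp [crysF]
        rw [hc, Option.elim_some, if_neg (hne _), wt_cls h C hL hb, idxWt_inr, if_neg (not_not.2 rfl),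
          spaceEquiv_zeroVec h, S.opF_root b hμ]
      rw [S.opF_vec b hμ h1]
      by_cases h2 : μ - clRoot D.A i ∈ S.R
      · have hc : S.crysF i (.inl ⟨μ, hμ⟩) = some (.inl ⟨_, h2⟩) := by simp [crysF, h1, h2]
        rw [hc, Option.elim_some, if_neg (hne _), wt_cls h C hL hb, idxWt_inl, if_pos (S.ne_zero h2), map_smul,
          spaceEquiv_vec, hcv hμ, eps_vec h C hL hb hμ fun h3 => S.neg_two_notMem i
            (S.neg_mem_iff.1 (h3 ▸ hμ)) (h3 ▸ h2), vec_of_mem S b h2]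
      · have hc : S.crysF i (.inl ⟨μ, hμ⟩) = none := by simp [crysF, h1, h2]
        rw [hc, Option.elim_none, if_pos rfl, map_zero, vec_of_notMem S b h2, smul_zero]
    · rw [← yv_of_mem S b hj, opF_yv]
      by_cases h1 : j = i
      · subst h1
        have hc : S.crysF j (.inr ⟨j, hj⟩) = some (.inl ⟨_, S.neg_mem hj⟩) := by simp [crysF]
        rw [hc, Option.elim_some, if_neg (hne _), wt_cls h C hL hb, idxWt_inl, if_pos (S.ne_zero (S.neg_mem hj)),
          map_smul, spaceEquiv_vec, (phi_eps_yv h C hL hb hj).2, if_pos rfl,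
          vec_of_mem S b (S.neg_mem hj)]
      · have hc : S.crysF i (.inr ⟨j, hj⟩) = none := by simp [crysF, h1]
        rw [hc, Option.elim_none, if_pos rfl, map_zero, if_neg h1]

end Realize

end StringSystem
end AffineDatum

/-! ### Extremal vectors -/

section Words

variable {I : Type u} {U : Type v} [AddCommGroup U] [Module BaseField U]

/-- The vectors obtained from the vectors in `s` by the operators `T j`, `j ∈ J`. -/
inductive IsWord (T : I → Module.End BaseField U) (J : Set I) (s : Set U) : U → Prop
  | base {x : U} (h : x ∈ s) : IsWord T J s x
  | step {x : U} (j : I) (hj : j ∈ J) (h : IsWord T J s x) : IsWord T J s (T j x)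

/-- The smallest subspace that contains `s` and is stable under the operators `T j`, `j ∈ J`. -/
def opClosure (T : I → Module.End BaseField U) (J : Set I) (s : Set U) : Submodule BaseField U :=
  Submodule.span BaseField {x | IsWord T J s x}

variable {T : I → Module.End BaseField U} {J : Set I} {s : Set U}

theorem subset_opClosure {x : U} (h : x ∈ s) : x ∈ opClosure T J s := Submodule.subset_span (.base h)

theorem map_span_le {A : Module.End BaseField U} {t : Set U} {N : Submodule BaseField U}
    (h : ∀ x ∈ t, A x ∈ N) {x : U} (hx : x ∈ Submodule.span BaseField t) : A x ∈ N := by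
  have : Submodule.span BaseField t ≤ N.comap A := Submodule.span_le.2 h
  exact this hx

theorem opClosure_stable {j : I} (hj : j ∈ J) {x : U} (hx : x ∈ opClosure T J s) :
    T j x ∈ opClosure T J s :=
  map_span_le (fun _ hy => Submodule.subset_span (IsWord.step j hj hy)) hx

theorem opClosure_le {N : Submodule BaseField U} (hs : ∀ x ∈ s, x ∈ N)
    (hN : ∀ j ∈ J, ∀ x ∈ N, T j x ∈ N) : opClosure T J s ≤ N := by
  refine Submodule.span_le.2 fun x hx => ?_
  induction hx with
  | base h => exact hs _ h
  | step j hj _ ih => exact hN j hj _ ih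

/-- An operator that commutes with the `T j` maps the closure of `s` to every stable subspace that
contains the image of `s`. -/
theorem map_opClosure_of_comm {A : Module.End BaseField U} (hA : ∀ j ∈ J, ∀ x, A (T j x) = T j (A x))
    {N : Submodule BaseField U} (hs : ∀ x ∈ s, A x ∈ N) (hN : ∀ j ∈ J, ∀ x ∈ N, T j x ∈ N) {x : U}
    (hx : x ∈ opClosure T J s) : A x ∈ N := by
  refine map_span_le (fun y hy => ?_) hx
  induction hy with
  | base h => exact hs _ h
  | step j hj _ ih => rw [hA j hj]; exact hN j hj _ ih

end Words

variable {I : Type u} [Fintype I] [DecidableEq I]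

/-- Extremal vectors `w μ`, `μ ∈ O`, in a space with weight spaces `G μ` on which operators `E i`,
`F i` satisfy the relations of `U_q'(𝔤)` except the Serre relations. -/
structure ExtremalFamily (D : AffineDatum I) {U : Type v} [AddCommGroup U] [Module BaseField U]
    (E F : I → Module.End BaseField U) (G : Pcl I → Submodule BaseField U) (O : Set (Pcl I))
    (w : Pcl I → U) : Prop where
  comm_ne : ∀ i j, i ≠ j → ∀ x, E i (F j x) = F j (E i x)
  comm : ∀ i μ, ∀ x ∈ G μ, E i (F i x) = F i (E i x) + qNum (D.qi i) (μ i) • x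
  E_mem : ∀ i μ, ∀ x ∈ G μ, E i x ∈ G (μ + clRoot D.A i)
  F_mem : ∀ i μ, ∀ x ∈ G μ, F i x ∈ G (μ - clRoot D.A i)
  reflect_mem : ∀ μ ∈ O, ∀ i, reflect D.A i μ ∈ O
  mem : ∀ μ ∈ O, w μ ∈ G μ
  raise : ∀ μ ∈ O, ∀ j, 0 ≤ μ j → E j (w μ) = 0
  lower : ∀ μ ∈ O, ∀ j, μ j ≤ 0 → F j (w μ) = 0
  divF : ∀ μ ∈ O, ∀ j, 0 ≤ μ j → D.divPow j (F j) (μ j).toNat (w μ) = w (reflect D.A j μ)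
  divE : ∀ μ ∈ O, ∀ j, μ j ≤ 0 → D.divPow j (E j) (-μ j).toNat (w μ) = w (reflect D.A j μ)

namespace ExtremalFamily

variable {D : AffineDatum I} {U : Type v} [AddCommGroup U] [Module BaseField U]
  {E F : I → Module.End BaseField U} {G : Pcl I → Submodule BaseField U} {O : Set (Pcl I)}
  {w : Pcl I → U}

/-- The roles of `E` and `F` may be exchanged. -/
theorem symm (h : ExtremalFamily D E F G O w) :
    ExtremalFamily D F E (fun μ => G (-μ)) {μ | -μ ∈ O} fun μ => w (-μ) where
  comm_ne i j hij x := (h.comm_ne j i hij.symm x).symm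
  comm i μ x hx := by
    rw [h.comm i _ x hx, Pi.neg_apply, qNum_neg, neg_smul]; abel
  E_mem i μ x hx := by
    have := h.F_mem i _ x hx
    rwa [neg_add, ← sub_eq_add_neg]
  F_mem i μ x hx := by
    have := h.E_mem i _ x hx
    rwa [neg_sub', sub_neg_eq_add]
  reflect_mem μ hμ i := by
    rw [Set.mem_ofPred_eq, ← D.reflect_neg]; exact h.reflect_mem _ hμ i
  mem μ hμ := h.mem _ hμ
  raise μ hμ j hj := h.lower _ hμ j (by rw [Pi.neg_apply]; omega)
  lower μ hμ j hj := h.raise _ hμ j (by rw [Pi.neg_apply]; omega)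
  divF μ hμ j hj := by
    have := h.divE _ hμ j (by rw [Pi.neg_apply]; omega)
    rwa [Pi.neg_apply, neg_neg, D.reflect_neg] at this
  divE μ hμ j hj := by
    have := h.divF _ hμ j (by rw [Pi.neg_apply]; omega)
    rwa [Pi.neg_apply, D.reflect_neg] at this

variable (h : ExtremalFamily D E F G O w)
include h

theorem F_pow_mem {i : I} {μ : Pcl I} {x : U} (hx : x ∈ G μ) (n : ℕ) : ∃ ν, (F i ^ n) x ∈ G ν := by
  induction n with
  | zero => exact ⟨μ, by simpa using hx⟩
  | succ n ih =>
    obtain ⟨ν, hν⟩ := ih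
    exact ⟨_, by rw [pow_succ', Module.End.mul_apply]; exact h.F_mem i ν _ hν⟩

theorem E_F_pow {i : I} {μ : Pcl I} {x : U} (hx : x ∈ G μ) (he : E i x = 0) (n : ℕ) :
    ∃ c : BaseField, E i ((F i ^ (n + 1)) x) = c • (F i ^ n) x := by
  induction n with
  | zero => exact ⟨qNum (D.qi i) (μ i), by simp [h.comm i μ x hx, he]⟩
  | succ n ih =>
    obtain ⟨c, hc⟩ := ih
    obtain ⟨ν, hν⟩ := h.F_pow_mem (i := i) hx (n + 1)
    refine ⟨c + qNum (D.qi i) (ν i), ?_⟩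
    rw [pow_succ', Module.End.mul_apply, h.comm i ν _ hν, hc, map_smul, ← Module.End.mul_apply,
      ← pow_succ', add_smul]

/-- The two descriptions of the vector of weight zero on the string of `±α_k`. -/
theorem F_root {k : I} (hk : clRoot D.A k ∈ O) : E k (w (-clRoot D.A k)) = F k (w (clRoot D.A k)) := by
  have hx := h.mem _ hk
  have h1 := h.divF _ hk k (by rw [D.clRoot_self]; norm_num)
  rw [D.reflect_clRoot, D.clRoot_self, show (2 : ℤ).toNat = 0 + 1 + 1 from rfl,
    divPow_succ_apply, divPow_succ_apply, divPow_zero, Module.End.one_apply, zero_add,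
    AffineDatum.qInt_one, inv_one, one_smul] at h1
  have h2 := h.comm k _ _ hx
  rw [h.raise _ hk k (by rw [D.clRoot_self]; norm_num), map_zero, zero_add, D.clRoot_self] at h2
  have h3 := h.comm k _ _ (h.F_mem k _ _ hx)
  rw [h2, sub_self, Pi.zero_apply, qNum_zero, zero_smul, add_zero, map_smul] at h3
  rw [← h1, map_smul, h3, smul_smul, AffineDatum.qInt_eq]
  exact (congrArg (· • _) (inv_mul_cancel₀ (by
    rw [← AffineDatum.qInt_eq]; exact D.qInt_ne_zero k two_pos))).trans (one_smul _ _)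

/-- If the operators in `J` lower the vectors of `s`, the commutation relations reduce the
stability under `E j` to its values on `s`. -/
theorem E_word {J : Set I} {s : Set U} (hs : ∀ x ∈ s, ∃ μ, x ∈ G μ) {j : I}
    (hE : ∀ x ∈ s, E j x ∈ opClosure F J s) {x : U} (hx : x ∈ opClosure F J s) :
    E j x ∈ opClosure F J s := by
  refine map_span_le (fun y hy => ?_) hx
  suffices hh : (∃ μ, y ∈ G μ) ∧ E j y ∈ opClosure F J s from hh.2
  induction hy with
  | base h0 => exact ⟨hs _ h0, hE _ h0⟩
  | step i hi hy ih =>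
    obtain ⟨⟨μ, hμ⟩, ih⟩ := ih
    refine ⟨⟨_, h.F_mem i μ _ hμ⟩, ?_⟩
    by_cases hij : j = i
    · subst hij
      rw [h.comm j μ _ hμ]
      exact Submodule.add_mem _ (opClosure_stable hi ih)
        (Submodule.smul_mem _ _ (Submodule.subset_span hy))
    · rw [h.comm_ne j i hij]
      exact opClosure_stable hi ih

/-- A set of extremal vectors stable under the reflections in `J` generates under the `F j` a
space stable under the `E j`: the vector `w μ` with `⟨h_j, μ⟩ < 0` is a divided power of `F j`
applied to the highest weight vector `w (s_j μ)`. -/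
theorem E_mem_closure {J : Set I} {Ω : Set (Pcl I)} (hΩ : Ω ⊆ O)
    (hr : ∀ μ ∈ Ω, ∀ j ∈ J, reflect D.A j μ ∈ Ω) {j : I} (hj : j ∈ J) {x : U}
    (hx : x ∈ opClosure F J (w '' Ω)) : E j x ∈ opClosure F J (w '' Ω) := by
  refine h.E_word (by rintro _ ⟨μ, hμ, rfl⟩; exact ⟨μ, h.mem μ (hΩ hμ)⟩) ?_ hx
  rintro _ ⟨μ, hμ, rfl⟩
  by_cases h0 : 0 ≤ μ j
  · rw [h.raise μ (hΩ hμ) j h0]; exact Submodule.zero_mem _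
  · have hμ' := hr μ hμ j hj
    have hval : reflect D.A j μ j = -μ j := by rw [reflect_apply, D.diag]; ring
    have h1 := h.divF _ (hΩ hμ') j (by rw [hval]; omega)
    rw [D.reflect_reflect] at h1
    obtain ⟨n, hn⟩ : ∃ n, (reflect D.A j μ j).toNat = n + 1 := ⟨(-μ j).toNat - 1, by omega⟩
    rw [hn, divPow_apply] at h1
    obtain ⟨c, hc⟩ := h.E_F_pow (h.mem _ (hΩ hμ')) (h.raise _ (hΩ hμ') j (by rw [hval]; omega)) n
    rw [← h1, map_smul, hc]
    refine Submodule.smul_mem _ _ (Submodule.smul_mem _ _ ?_)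
    clear h1 hc hn
    induction n with
    | zero => simpa using subset_opClosure (Set.mem_image_of_mem w hμ')
    | succ n ih => rw [pow_succ', Module.End.mul_apply]; exact opClosure_stable hj ih

/-- For a set of weights stable under the reflections in `J`, raising and lowering the extremal vectors
generate the same space. -/
theorem closure_eq {J : Set I} {Ω : Set (Pcl I)} (hΩ : Ω ⊆ O)
    (hr : ∀ μ ∈ Ω, ∀ j ∈ J, reflect D.A j μ ∈ Ω) :
    opClosure E J (w '' Ω) = opClosure F J (w '' Ω) := by
  refine le_antisymm (opClosure_le (fun _ => subset_opClosure) fun j hj x hx =>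
    h.E_mem_closure hΩ hr hj hx) (opClosure_le (fun _ => subset_opClosure) fun j hj x hx => ?_)
  have himg : (fun μ => w (-μ)) '' {μ | -μ ∈ Ω} = w '' Ω := by
    ext y
    constructor
    · rintro ⟨μ, hμ, rfl⟩; exact ⟨-μ, hμ, rfl⟩
    · rintro ⟨μ, hμ, rfl⟩
      exact ⟨-μ, by rwa [Set.mem_ofPred_eq, neg_neg], by simp only [neg_neg]⟩
  have := h.symm.E_mem_closure (J := J) (Ω := {μ | -μ ∈ Ω}) (fun μ hμ => hΩ hμ) (fun μ hμ j hj => by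
    rw [Set.mem_ofPred_eq, ← D.reflect_neg]; exact hr _ hμ j hj) hj (x := x) (by rwa [himg])
  rwa [himg] at this

theorem neg_root_mem_iff {k : I} : -clRoot D.A k ∈ O ↔ clRoot D.A k ∈ O := by
  constructor <;> intro hk <;> have := h.reflect_mem _ hk k
  · rwa [D.reflect_neg, D.reflect_clRoot, neg_neg] at this
  · rwa [D.reflect_clRoot] at this

/-- The vectors of weight zero on the strings of the roots `±α_k`, `k ∉ J`. -/
def zeroSet (D : AffineDatum I) (F : I → Module.End BaseField U) (O : Set (Pcl I)) (w : Pcl I → U)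
    (J : Set I) : Set U := {x | ∃ k, k ∉ J ∧ clRoot D.A k ∈ O ∧ x = F k (w (clRoot D.A k))}

theorem zeroSet_symm (J : Set I) :
    zeroSet D E {μ | -μ ∈ O} (fun μ => w (-μ)) J = zeroSet D F O w J := by
  ext x
  refine exists_congr fun k => and_congr_right fun _ => ?_
  rw [Set.mem_ofPred_eq, h.neg_root_mem_iff]
  exact and_congr_right fun hk => by rw [h.F_root hk]

theorem zeroSet_mem {J : Set I} {x : U} (hx : x ∈ zeroSet D F O w J) : ∃ μ, x ∈ G μ := by
  obtain ⟨k, -, hk, rfl⟩ := hx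
  exact ⟨_, h.F_mem k _ _ (h.mem _ hk)⟩

theorem word_mem {J : Set I} {s : Set U} (hs : ∀ x ∈ s, ∃ μ, x ∈ G μ) {x : U} (hx : IsWord E J s x) :
    ∃ μ, x ∈ G μ := by
  induction hx with
  | base h0 => exact hs _ h0
  | step i _ _ ih =>
    obtain ⟨μ, hμ⟩ := ih
    exact ⟨_, h.E_mem i μ _ hμ⟩

/-- The space obtained by first raising and then lowering the vectors of `s` is stable under both
kinds of operators. -/
theorem E_mem_word_closure {J : Set I} {s : Set U} (hs : ∀ x ∈ s, ∃ μ, x ∈ G μ) {j : I} (hj : j ∈ J)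
    {x : U} (hx : x ∈ opClosure F J {y | IsWord E J s y}) :
    E j x ∈ opClosure F J {y | IsWord E J s y} :=
  h.E_word (fun _ hy => h.word_mem hs hy)
    (fun _ hy => subset_opClosure (IsWord.step j hj hy)) hx

theorem word_closure_le {J : Set I} {s : Set U} (hs : ∀ x ∈ s, ∃ μ, x ∈ G μ) :
    opClosure E J {y | IsWord F J s y} ≤ opClosure F J {y | IsWord E J s y} := by
  refine opClosure_le (fun x hx => ?_) fun j hj x hx => h.E_mem_word_closure hs hj hx
  change IsWord F J s x at hx
  induction hx with
  | base h0 => exact subset_opClosure (IsWord.base h0)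
  | step j hj hx ih => exact opClosure_stable hj ih

/-- The span of the vectors obtained by the operators `E j`, `F j`, `j ∈ J`, from the extremal vectors
and from the vectors of weight zero on the strings of the roots `±α_k`, `k ∉ J`. -/
def hull (D : AffineDatum I) (E F : I → Module.End BaseField U) (O : Set (Pcl I)) (w : Pcl I → U)
    (J : Set I) : Submodule BaseField U :=
  opClosure F J (w '' O) ⊔ opClosure F J {y | IsWord E J (zeroSet D F O w J) y}

theorem hull_symm (J : Set I) : hull D F E {μ | -μ ∈ O} (fun μ => w (-μ)) J = hull D E F O w J := by
  have himg : (fun μ => w (-μ)) '' {μ | -μ ∈ O} = w '' O := by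
    ext y
    constructor
    · rintro ⟨μ, hμ, rfl⟩; exact ⟨-μ, hμ, rfl⟩
    · rintro ⟨μ, hμ, rfl⟩
      exact ⟨-μ, by rwa [Set.mem_ofPred_eq, neg_neg], by simp only [neg_neg]⟩
  rw [hull, hull, himg, h.zeroSet_symm, h.closure_eq le_rfl fun μ hμ j _ => h.reflect_mem μ hμ j]
  congr 1
  exact le_antisymm (h.word_closure_le fun _ => h.zeroSet_mem)
    (h.symm.word_closure_le fun _ hx => by
      obtain ⟨μ, hμ⟩ := h.zeroSet_mem hx
      exact ⟨-μ, by rwa [neg_neg]⟩)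

theorem F_short_mem_hull {J : Set I} {j : I} (hj : j ∈ J) {x : U} (hx : x ∈ hull D E F O w J) :
    F j x ∈ hull D E F O w J := by
  obtain ⟨y, hy, z, hz, rfl⟩ := Submodule.mem_sup.1 hx
  rw [map_add]
  exact Submodule.add_mem_sup (opClosure_stable hj hy) (opClosure_stable hj hz)

theorem E_short_mem_hull {J : Set I} {j : I} (hj : j ∈ J) {x : U} (hx : x ∈ hull D E F O w J) :
    E j x ∈ hull D E F O w J := by
  obtain ⟨y, hy, z, hz, rfl⟩ := Submodule.mem_sup.1 hx
  rw [map_add]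
  exact Submodule.add_mem_sup
    (h.E_mem_closure le_rfl (fun μ hμ j _ => h.reflect_mem μ hμ j) hj hy)
    (h.E_mem_word_closure (fun _ => h.zeroSet_mem) hj hz)

/-- The raising operators in the long directions act on the extremal vectors by reflections, except at
`-α_l`. -/
theorem E_long {l : I} (hl : ∀ μ ∈ O, (-1 ≤ μ l ∧ μ l ≤ 1) ∨ μ = clRoot D.A l ∨ μ = -clRoot D.A l)
    {μ : Pcl I} (hμ : μ ∈ O) (hne : μ ≠ -clRoot D.A l) : E l (w μ) = 0 ∨ E l (w μ) = w (reflect D.A l μ) := by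
  by_cases h0 : 0 ≤ μ l
  · exact Or.inl (h.raise μ hμ l h0)
  right
  have h1 : μ l = -1 := by
    rcases hl μ hμ with h1 | h1 | h1
    · omega
    · rw [h1, D.clRoot_self] at h0; norm_num at h0
    · exact absurd h1 hne
  have h2 := h.divE μ hμ l (by omega)
  rwa [h1, show (- -1 : ℤ).toNat = 0 + 1 from rfl, divPow_succ_apply, divPow_zero, Module.End.one_apply,
    zero_add, AffineDatum.qInt_one, inv_one, one_smul] at h2

section Long

variable {J : Set I}
  (hlong : ∀ l, l ∉ J → ∀ μ ∈ O, (-1 ≤ μ l ∧ μ l ≤ 1) ∨ μ = clRoot D.A l ∨ μ = -clRoot D.A l)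
  (hsum : ∀ k l, k ∉ J → l ∉ J → clRoot D.A k ∈ O → -clRoot D.A l ∈ O → ∀ n : I → ℤ,
    (∀ j, j ∉ J → n j = 0) → clRoot D.A k + D.rootComb n ≠ -clRoot D.A l)
include hlong

/-- The raising operators in the long directions map extremal vectors to extremal vectors or, at
`-α_l`, to the vector of weight zero on the string. -/
theorem E_long_extremal {l : I} (hl : l ∉ J) {μ : Pcl I} (hμ : μ ∈ O) :
    E l (w μ) ∈ hull D E F O w J := by
  by_cases hne : μ = -clRoot D.A l
  · subst hne
    have hlO := h.neg_root_mem_iff.1 hμ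
    rw [h.F_root hlO]
    exact Submodule.mem_sup_right (subset_opClosure (IsWord.base ⟨l, hl, hlO, rfl⟩))
  · rcases h.E_long (hlong l hl) hμ hne with h1 | h1
    · rw [h1]; exact Submodule.zero_mem _
    · rw [h1]
      exact Submodule.mem_sup_left (subset_opClosure ⟨_, h.reflect_mem μ hμ l, rfl⟩)

/-- The operator `E l` commutes with the `F j`, `j ∈ J`, so that only its values on the extremal
vectors matter. -/
theorem E_long_closure {l : I} (hl : l ∉ J) {x : U} (hx : x ∈ opClosure F J (w '' O)) :
    E l x ∈ hull D E F O w J :=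
  map_opClosure_of_comm (fun j hj => h.comm_ne l j fun he => hl (he ▸ hj))
    (by rintro _ ⟨μ, hμ, rfl⟩; exact h.E_long_extremal hlong hl hμ)
    (fun _ hj _ => h.F_short_mem_hull hj) hx

theorem F_long_closure {l : I} (hl : l ∉ J) {x : U} (hx : x ∈ opClosure E J (w '' O)) :
    F l x ∈ hull D E F O w J := by
  have hlong' : ∀ l, l ∉ J → ∀ μ ∈ {μ | -μ ∈ O}, (-1 ≤ μ l ∧ μ l ≤ 1) ∨ μ = clRoot D.A l ∨
      μ = -clRoot D.A l := fun l hl μ hμ => by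
    rcases hlong l hl _ hμ with h1 | h1 | h1
    · rw [Pi.neg_apply] at h1; left; omega
    · exact Or.inr (Or.inr (by rw [← h1, neg_neg]))
    · exact Or.inr (Or.inl (neg_injective h1))
  have himg : (fun μ => w (-μ)) '' {μ | -μ ∈ O} = w '' O := by
    ext y
    constructor
    · rintro ⟨μ, hμ, rfl⟩; exact ⟨-μ, hμ, rfl⟩
    · rintro ⟨μ, hμ, rfl⟩
      exact ⟨-μ, by rwa [Set.mem_ofPred_eq, neg_neg], by simp only [neg_neg]⟩
  have := h.symm.E_long_closure hlong' hl (x := x) (by rwa [himg])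
  rwa [h.hull_symm] at this

include hsum

/-- The vectors `E_{j_1} ⋯ E_{j_n} z_k` equal `F_k t` with `t` in the space generated by the extremal
vectors of weights in the coset of `α_k`, and this coset does not contain `-α_l`. -/
theorem E_long_word {l : I} (hl : l ∉ J) {x : U} (hx : IsWord E J (zeroSet D F O w J) x) :
    E l x ∈ hull D E F O w J := by
  obtain ⟨k, hk, hkO, t, ht, rfl⟩ : ∃ k, k ∉ J ∧ clRoot D.A k ∈ O ∧
      ∃ t, IsWord E J {w (clRoot D.A k)} t ∧ x = F k t := by
    induction hx with
    | base h0 =>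
      obtain ⟨k, hk, hkO, rfl⟩ := h0
      exact ⟨k, hk, hkO, _, .base rfl, rfl⟩
    | step j hj _ ih =>
      obtain ⟨k, hk, hkO, t, ht, rfl⟩ := ih
      exact ⟨k, hk, hkO, _, .step j hj ht, h.comm_ne j k (fun he => hk (he ▸ hj)) t⟩
  have hOr : ∀ μ ∈ O, ∀ j ∈ J, reflect D.A j μ ∈ O := fun μ hμ j _ => h.reflect_mem μ hμ j
  set Ω : Set (Pcl I) := {μ | μ ∈ O ∧ ∃ n : I → ℤ, (∀ j, j ∉ J → n j = 0) ∧
    μ = clRoot D.A k + D.rootComb n} with hΩ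
  have hΩO : Ω ⊆ O := fun μ hμ => hμ.1
  -- The coset of `α_k` modulo the simple roots in `J` is stable under the reflections in `J`.
  have hΩr : ∀ μ ∈ Ω, ∀ j ∈ J, reflect D.A j μ ∈ Ω := by
    rintro μ ⟨hμ, n, hn, hμn⟩ j hj
    refine ⟨h.reflect_mem μ hμ j, n - Pi.single j (μ j), fun i hi => ?_, ?_⟩
    · have : i ≠ j := fun he => hi (he ▸ hj)
      simp [hn i hi, this]
    · have h1 : D.rootComb (n - Pi.single j (μ j)) = D.rootComb n - μ j • clRoot D.A j := by
        simp only [AffineDatum.rootComb, Pi.sub_apply, sub_smul, Finset.sum_sub_distrib]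
        congr 1
        rw [Finset.sum_eq_single_of_mem j (Finset.mem_univ j) fun i _ hi => by simp [hi]]
        simp
      rw [h1, reflect, ← add_sub_assoc, ← hμn]
  have hkΩ : clRoot D.A k ∈ Ω := ⟨hkO, 0, by simp, by simp [AffineDatum.rootComb]⟩
  have htΩ : t ∈ opClosure F J (w '' Ω) := by
    rw [← h.closure_eq hΩO hΩr]
    have hle : opClosure E J {w (clRoot D.A k)} ≤ opClosure E J (w '' Ω) :=
      opClosure_le (by rintro _ rfl; exact subset_opClosure ⟨_, hkΩ, rfl⟩)
        fun _ hj _ => opClosure_stable hj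
    exact hle (Submodule.subset_span ht)
  have htO : t ∈ opClosure F J (w '' O) :=
    opClosure_le (by rintro _ ⟨μ, hμ, rfl⟩; exact subset_opClosure ⟨μ, hΩO hμ, rfl⟩)
      (fun _ hj _ => opClosure_stable hj) htΩ
  have hEt : E l t ∈ opClosure E J (w '' O) := by
    rw [h.closure_eq le_rfl hOr]
    refine map_opClosure_of_comm (fun j hj => h.comm_ne l j fun he => hl (he ▸ hj)) ?_
      (fun _ hj _ => opClosure_stable hj) htΩ
    rintro _ ⟨μ, ⟨hμ, n, hn, hμn⟩, rfl⟩
    have hne : μ ≠ -clRoot D.A l := fun he => by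
      rw [hμn] at he
      exact hsum k l hk hl hkO (by rw [← he, ← hμn]; exact hμ) n hn he
    rcases h.E_long (hlong l hl) hμ hne with h1 | h1
    · rw [h1]; exact Submodule.zero_mem _
    · rw [h1]; exact subset_opClosure ⟨_, h.reflect_mem μ hμ l, rfl⟩
  -- It remains to exchange `E l` and `F k` in `E l (F k t)`.
  have h1 := h.F_long_closure hlong hk hEt
  by_cases hlk : l = k
  · subst hlk
    obtain ⟨ν, hν⟩ := h.word_mem (by rintro _ rfl; exact ⟨_, h.mem _ hkO⟩) ht
    rw [h.comm l ν _ hν]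
    exact Submodule.add_mem _ h1 (Submodule.smul_mem _ _ (Submodule.mem_sup_left htO))
  · rw [h.comm_ne l k hlk]; exact h1

/-- The hull is stable under all raising operators: those in `J` act within its two parts, and the
long ones commute with the lowering operators in `J`. -/
theorem E_mem_hull (l : I) {x : U} (hx : x ∈ hull D E F O w J) : E l x ∈ hull D E F O w J := by
  by_cases hl : l ∈ J
  · exact h.E_short_mem_hull hl hx
  obtain ⟨y, hy, z, hz, rfl⟩ := Submodule.mem_sup.1 hx
  rw [map_add]
  refine Submodule.add_mem _ (h.E_long_closure hlong hl hy) ?_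
  exact map_opClosure_of_comm (fun j hj => h.comm_ne l j fun he => hl (he ▸ hj))
    (fun _ => h.E_long_word hlong hsum hl) (fun _ hj _ => h.F_short_mem_hull hj) hz

theorem F_mem_hull (l : I) {x : U} (hx : x ∈ hull D E F O w J) : F l x ∈ hull D E F O w J := by
  rw [← h.hull_symm] at hx ⊢
  refine h.symm.E_mem_hull (fun l hl μ hμ => ?_) (fun k l hk hl hkO hlO n hn => ?_) l hx
  · rcases hlong l hl _ hμ with h1 | h1 | h1
    · rw [Pi.neg_apply] at h1; left; omega
    · exact Or.inr (Or.inr (by rw [← h1, neg_neg]))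
    · exact Or.inr (Or.inl (neg_injective h1))
  · rw [Set.mem_ofPred_eq] at hkO hlO
    rw [neg_neg] at hlO
    exact hsum k l hk hl (h.neg_root_mem_iff.1 hkO) (h.neg_root_mem_iff.2 hlO) n hn

end Long

theorem hull_mem_of_scalar {J : Set I} {A : Module.End BaseField U}
    (hA : ∀ μ, ∃ c : BaseField, ∀ x ∈ G μ, A x = c • x) {x : U} (hx : x ∈ hull D E F O w J) :
    A x ∈ hull D E F O w J := by
  have key : ∀ s : Set U, (∀ y ∈ s, ∃ μ, y ∈ G μ) → ∀ y ∈ opClosure F J s, A y ∈ opClosure F J s :=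
    fun s hs y hy => by
      refine map_span_le (fun z hz => ?_) hy
      obtain ⟨μ, hμ⟩ := h.symm.word_mem (s := s) (J := J) (x := z) (fun x hx => by
        obtain ⟨μ, hμ⟩ := hs x hx
        exact ⟨-μ, by rwa [neg_neg]⟩) hz
      obtain ⟨c, hc⟩ := hA (-μ)
      rw [hc z hμ]
      exact Submodule.smul_mem _ _ (Submodule.subset_span hz)
  obtain ⟨y, hy, z, hz, rfl⟩ := Submodule.mem_sup.1 hx
  rw [map_add]
  refine Submodule.add_mem_sup (key _ ?_ y hy)
    (key _ (fun _ hx => h.word_mem (fun _ => h.zeroSet_mem) hx) z hz)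
  rintro _ ⟨μ, hμ, rfl⟩
  exact ⟨μ, h.mem μ hμ⟩

/-- If `ϖ` is maximal among the weights in `O` with respect to the simple roots in `J`, and is not a
combination of these, then `w ϖ` spans the part of weight `ϖ` of the hull. -/
theorem hull_le {J : Set I} {ϖ : Pcl I}
    (hdom : ∀ n : I → ℕ, (∀ j, j ∉ J → n j = 0) → ϖ + D.rootComb (fun j => (n j : ℤ)) ∈ O →
      ∀ j, n j = 0)
    (hϖ : ∀ n : I → ℤ, (∀ j, j ∉ J → n j = 0) → ϖ ≠ D.rootComb n) :
    hull D E F O w J ≤ Submodule.span BaseField {w ϖ} ⊔ ⨆ ν : {ν // ν ≠ ϖ}, G ν := by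
  have hsingle : ∀ (n : I → ℤ) (j : I), D.rootComb (n + Pi.single j 1) =
      D.rootComb n + clRoot D.A j := fun n j => by
    simp only [AffineDatum.rootComb, Pi.add_apply, add_smul, Finset.sum_add_distrib]
    congr 1
    rw [Finset.sum_eq_single_of_mem j (Finset.mem_univ j) fun i _ hi => by simp [hi]]
    simp
  have hsupp : ∀ (n : I → ℤ) (j : I), j ∈ J → (∀ i, i ∉ J → n i = 0) →
      ∀ i, i ∉ J → (n + Pi.single j 1 : I → ℤ) i = 0 := fun n j hj hn i hi => by
    have : i ≠ j := fun he => hi (he ▸ hj)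
    simp [hn i hi, this]
  have hG : ∀ ν x, x ∈ G ν → ν ≠ ϖ →
      x ∈ Submodule.span BaseField {w ϖ} ⊔ ⨆ ν : {ν // ν ≠ ϖ}, G ν := fun ν x hx hν =>
    Submodule.mem_sup_right (Submodule.mem_iSup_of_mem (⟨ν, hν⟩ : {ν // ν ≠ ϖ}) hx)
  -- The first part of the hull is spanned by vectors `F_{j_1} ⋯ F_{j_n} (w μ)` of weight `μ - ∑
  -- α_{j_i}`, which by maximality of `ϖ` is `ϖ` only for `n = 0`. The second part has its weights
  -- in the span of the simple roots in `J`.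
  refine sup_le (Submodule.span_le.2 fun x hx => ?_) (Submodule.span_le.2 fun x hx => ?_)
  · obtain ⟨μ, hμ, n, hn, hxG, hx0⟩ : ∃ μ ∈ O, ∃ n : I → ℕ, (∀ j, j ∉ J → n j = 0) ∧
        x ∈ G (μ - D.rootComb fun j => (n j : ℤ)) ∧ ((∀ j, n j = 0) → x = w μ) := by
      change IsWord F J _ x at hx
      induction hx with
      | base h0 =>
        obtain ⟨μ, hμ, rfl⟩ := h0
        exact ⟨μ, hμ, 0, by simp, by simpa [AffineDatum.rootComb] using h.mem μ hμ, fun _ => rfl⟩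
      | step j hj hx ih =>
        obtain ⟨μ, hμ, n, hn, hxG, -⟩ := ih
        refine ⟨μ, hμ, n + Pi.single j 1, fun i hi => ?_, ?_, fun h0 => ?_⟩
        · have : i ≠ j := fun he => hi (he ▸ hj)
          simp [hn i hi, this]
        · have h1 := h.F_mem j _ _ hxG
          have h2 : (fun i => ((n + Pi.single j 1 : I → ℕ) i : ℤ)) =
              (fun i => (n i : ℤ)) + Pi.single j 1 := by
            funext i
            by_cases hij : i = j
            · subst hij; simp
            · simp [hij]
          rwa [h2, hsingle, ← sub_sub]
        · have := h0 j
          simp at this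
    by_cases he : μ - D.rootComb (fun j => (n j : ℤ)) = ϖ
    · have hμ' : μ = ϖ + D.rootComb (fun j => (n j : ℤ)) := by rw [← he, sub_add_cancel]
      have hn0 := hdom n hn (hμ' ▸ hμ)
      have : μ = ϖ := by rw [hμ']; simp [AffineDatum.rootComb, hn0]
      rw [hx0 hn0, this]
      exact Submodule.mem_sup_left (Submodule.mem_span_singleton_self _)
    · exact hG _ x hxG he
  · have key : ∀ {y}, IsWord E J (zeroSet D F O w J) y → ∃ n : I → ℤ, (∀ j, j ∉ J → n j = 0) ∧
        y ∈ G (D.rootComb n) := fun {y} hy => by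
      induction hy with
      | base h0 =>
        obtain ⟨k, -, hk, rfl⟩ := h0
        have := h.F_mem k _ _ (h.mem _ hk)
        exact ⟨0, by simp, by simpa [AffineDatum.rootComb] using this⟩
      | step j hj _ ih =>
        obtain ⟨n, hn, hy⟩ := ih
        exact ⟨_, hsupp n j hj hn, by rw [hsingle]; exact h.E_mem j _ _ hy⟩
    obtain ⟨n, hn, hxG⟩ : ∃ n : I → ℤ, (∀ j, j ∉ J → n j = 0) ∧ x ∈ G (D.rootComb n) := by
      change IsWord F J _ x at hx
      induction hx with
      | base h0 => exact key h0
      | step j hj hx ih =>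
        obtain ⟨n, hn, hy⟩ := ih
        refine ⟨n - Pi.single j 1, fun i hi => ?_, ?_⟩
        · have : i ≠ j := fun he => hi (he ▸ hj)
          simp [hn i hi, this]
        · have h1 := hsingle (n - Pi.single j 1) j
          rw [sub_add_cancel] at h1
          have h2 := h.F_mem j _ _ hy
          rwa [h1, add_sub_cancel_right] at h2
    exact hG _ x hxG fun he => hϖ n hn he.symm

end ExtremalFamily

/-! ### Uniqueness of the fundamental representation -/

section Representations

variable {I : Type u} [Fintype I] [DecidableEq I] {D : AffineDatum I}
  {V : Type v} [AddCommGroup V] [Module BaseField V]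
  (ρ : Uq D →ₐ[BaseField] Module.End BaseField V)

/-- The generator `K_i⁻¹` of `U_q'(𝔤)`. -/
def gKinv (D : AffineDatum I) (i : I) : Uq D := RingQuot.mkAlgHom BaseField (Rel D) (fKinv i)

theorem rep_rel {x y : FreeAlgebra BaseField (Gen I)} (h : Rel D x y) (v : V) :
    ρ (RingQuot.mkAlgHom BaseField (Rel D) x) v = ρ (RingQuot.mkAlgHom BaseField (Rel D) y) v := by
  rw [RingQuot.mkAlgHom_rel BaseField h]

theorem rep_Kinv_K (i : I) (v : V) : ρ (gKinv D i) (ρ (gK D i) v) = v := by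
  have := rep_rel ρ (Rel.Kinv_K i) v
  simp only [map_mul, map_one, Module.End.mul_apply, Module.End.one_apply] at this
  exact this

theorem rep_K_e (i j : I) (v : V) :
    ρ (gK D i) (ρ (ge D j) v) = D.qi i ^ (D.A i j) • ρ (ge D j) (ρ (gK D i) v) := by
  have := rep_rel ρ (Rel.K_e i j) (ρ (gK D i) v)
  simp only [map_mul, map_smul, Module.End.mul_apply, LinearMap.smul_apply] at this
  have h2 := rep_Kinv_K ρ i v
  simp only [gKinv] at h2
  rwa [h2] at this

theorem rep_K_f (i j : I) (v : V) :
    ρ (gK D i) (ρ (gf D j) v) = D.qi i ^ (-D.A i j) • ρ (gf D j) (ρ (gK D i) v) := by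
  have := rep_rel ρ (Rel.K_f i j) (ρ (gK D i) v)
  simp only [map_mul, map_smul, Module.End.mul_apply, LinearMap.smul_apply] at this
  have h2 := rep_Kinv_K ρ i v
  simp only [gKinv] at h2
  rwa [h2] at this

theorem rep_e_f_ne {i j : I} (hij : i ≠ j) (v : V) :
    ρ (ge D i) (ρ (gf D j) v) = ρ (gf D j) (ρ (ge D i) v) := by
  have := rep_rel ρ (Rel.e_f_ne i j hij) v
  simp only [map_mul, map_sub, map_zero, Module.End.mul_apply, LinearMap.sub_apply,
    LinearMap.zero_apply] at this
  exact sub_eq_zero.1 this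

theorem rep_Kinv {i : I} {n : ℤ} {v : V} (hv : ρ (gK D i) v = D.qi i ^ n • v) :
    ρ (gKinv D i) v = D.qi i ^ (-n) • v := by
  have h1 := rep_Kinv_K ρ i v
  rw [hv, map_smul] at h1
  conv_rhs => rw [← h1]
  rw [smul_smul, ← zpow_add₀ (D.qi_ne_zero i), neg_add_cancel, zpow_zero, one_smul]

theorem rep_e_f {i : I} {n : ℤ} {v : V} (hv : ρ (gK D i) v = D.qi i ^ n • v) :
    ρ (ge D i) (ρ (gf D i) v) = ρ (gf D i) (ρ (ge D i) v) + qNum (D.qi i) n • v := by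
  have := rep_rel ρ (Rel.e_f_same i) v
  simp only [map_mul, map_sub, map_smul, Module.End.mul_apply, LinearMap.sub_apply,
    LinearMap.smul_apply] at this
  have h2 := rep_Kinv ρ hv
  simp only [gK, gKinv] at hv h2
  rw [hv, h2, ← sub_smul, smul_smul] at this
  rw [qNum, div_eq_inv_mul, ← sub_eq_iff_eq_add']
  exact this

/-- A subspace stable under the generators is invariant. -/
theorem isInvariant_of_generators {N : Submodule BaseField V}
    (he : ∀ i, ∀ x ∈ N, ρ (ge D i) x ∈ N) (hf : ∀ i, ∀ x ∈ N, ρ (gf D i) x ∈ N)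
    (hK : ∀ i, ∀ x ∈ N, ρ (gK D i) x ∈ N) (hK' : ∀ i, ∀ x ∈ N, ρ (gKinv D i) x ∈ N) :
    IsInvariant ρ N := by
  intro a
  obtain ⟨a, rfl⟩ := RingQuot.mkAlgHom_surjective BaseField (Rel D) a
  induction a using FreeAlgebra.induction with
  | grade0 c => intro y hy; simpa [Algebra.algebraMap_eq_smul_one] using N.smul_mem c hy
  | grade1 g =>
    cases g with
    | e i => exact he i
    | f i => exact hf i
    | K i => exact hK i
    | Kinv i => exact hK' i
  | mul a b iha ihb =>
    intro y hy
    rw [map_mul, map_mul, Module.End.mul_apply]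
    exact iha _ (ihb _ hy)
  | add a b iha ihb =>
    intro y hy
    rw [map_add, map_add, LinearMap.add_apply]
    exact N.add_mem (iha _ hy) (ihb _ hy)

/-- The weight spaces are independent. -/
theorem iSupIndep_wtSpace : iSupIndep (wtSpace ρ) := by
  have hcomm : ∀ i j, Commute (ρ (gK D i)) (ρ (gK D j)) := fun i j => LinearMap.ext fun v => by
    have := rep_rel ρ (Rel.K_comm i j) v
    simp only [map_mul, Module.End.mul_apply] at this
    exact this
  have h1 := Module.End.independent_iInf_maxGenEigenspace_of_forall_mapsTo (fun i => ρ (gK D i))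
    fun i j φ => Module.End.mapsTo_maxGenEigenspace_of_comm (hcomm j i) φ
  have hinj : Function.Injective fun (μ : Pcl I) (i : I) => D.qi i ^ μ i := fun μ ν hμν =>
    funext fun i => D.qi_zpow_injective i (congrFun hμν i)
  refine (h1.comp hinj).mono fun μ x hx => ?_
  rw [Function.comp_apply, Submodule.mem_iInf]
  intro i
  rw [Module.End.mem_maxGenEigenspace]
  refine ⟨1, ?_⟩
  rw [pow_one, LinearMap.sub_apply, LinearMap.smul_apply, Module.End.one_apply, hx i, sub_self]

theorem IsIntegrable.qTriple {ρ : Uq D →ₐ[BaseField] Module.End BaseField V} (h : IsIntegrable ρ) (i : I) :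
    QTriple (D.qi i) (ρ (ge D i)) (ρ (gf D i)) fun n => (ρ (gK D i)).eigenspace (D.qi i ^ n) :=
  qTriple_of_relations D i (fun x => by rw [rep_K_e, D.diag]) (fun x => by rw [rep_K_f, D.diag])
    (fun n x hx => rep_e_f ρ hx) (h.nilp_e i) (h.nilp_f i)

/-- The extremal vectors of the fundamental representation. -/
theorem IsFundamental.exists_family {ρ : Uq D →ₐ[BaseField] Module.End BaseField V} {r : I}
    (h : IsFundamental D r ρ) : ∃ w : Pcl I → V, w (D.varpi r) ≠ 0 ∧
      ExtremalFamily D (fun i => ρ (ge D i)) (fun i => ρ (gf D i)) (wtSpace ρ)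
        {μ | WeylOrbit D.A Set.univ (D.varpi r) μ} w := by
  obtain ⟨w, hw0, -, hwt, hnonneg, hneg, -⟩ := h.extremal
  refine ⟨w, hw0, fun i j hij x => rep_e_f_ne ρ hij x, fun i μ x hx => rep_e_f ρ (hx i),
    fun i μ x hx j => ?_, fun i μ x hx j => ?_, fun μ hμ i => WeylOrbit.step i (Set.mem_univ i) hμ, hwt,
    fun μ hμ j hj => (hnonneg μ hμ j hj).1, fun μ hμ j hj => ?_, fun μ hμ j hj => (hnonneg μ hμ j hj).2,
    fun μ hμ j hj => ?_⟩
  · rw [rep_K_e, hx j, map_smul, smul_smul, ← zpow_add₀ (D.qi_ne_zero j), add_comm]; rfl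
  · rw [rep_K_f, hx j, map_smul, smul_smul, ← zpow_add₀ (D.qi_ne_zero j), add_comm,
      ← sub_eq_add_neg]; rfl
  · rcases hj.lt_or_eq with h0 | h0
    · exact (hneg μ hμ j h0).1
    · by_cases hw : w μ = 0
      · rw [hw, map_zero]
      · have hmem : w μ ∈ (ρ (gK D j)).eigenspace (D.qi j ^ (0 : ℤ)) :=
          Module.End.mem_eigenspace_iff.2 (h0 ▸ hwt μ hμ j)
        have := ((h.integrable.qTriple j).highest hmem (hnonneg μ hμ j h0.ge).1 hw).2
        simpa using this
  · rcases hj.lt_or_eq with h0 | h0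
    · exact (hneg μ hμ j h0).2
    · rw [h0, reflect, h0, zero_smul, sub_zero, neg_zero, Int.toNat_zero, divPow_zero,
        Module.End.one_apply]

theorem divPow_prodMap {V' : Type*} [AddCommGroup V'] [Module BaseField V'] (i : I)
    (A : Module.End BaseField V) (B : Module.End BaseField V') (n : ℕ) (x : V) (y : V') :
    D.divPow i (A.prodMap B) n (x, y) = (D.divPow i A n x, D.divPow i B n y) := by
  induction n with
  | zero => simp [divPow_zero]
  | succ n ih => rw [divPow_succ_apply, ih, divPow_succ_apply, divPow_succ_apply]; rfl

theorem ExtremalFamily.prod {V' : Type*} [AddCommGroup V'] [Module BaseField V']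
    {E F : I → Module.End BaseField V} {G : Pcl I → Submodule BaseField V} {w : Pcl I → V}
    {E' F' : I → Module.End BaseField V'} {G' : Pcl I → Submodule BaseField V'} {w' : Pcl I → V'}
    {O : Set (Pcl I)} (h : ExtremalFamily D E F G O w) (h' : ExtremalFamily D E' F' G' O w') :
    ExtremalFamily D (fun i => (E i).prodMap (E' i)) (fun i => (F i).prodMap (F' i))
      (fun μ => (G μ).prod (G' μ)) O fun μ => (w μ, w' μ) where
  comm_ne i j hij x := Prod.ext (h.comm_ne i j hij x.1) (h'.comm_ne i j hij x.2)
  comm i μ x hx := Prod.ext (h.comm i μ x.1 hx.1) (h'.comm i μ x.2 hx.2)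
  E_mem i μ x hx := ⟨h.E_mem i μ x.1 hx.1, h'.E_mem i μ x.2 hx.2⟩
  F_mem i μ x hx := ⟨h.F_mem i μ x.1 hx.1, h'.F_mem i μ x.2 hx.2⟩
  reflect_mem := h.reflect_mem
  mem μ hμ := ⟨h.mem μ hμ, h'.mem μ hμ⟩
  raise μ hμ j hj := Prod.ext (h.raise μ hμ j hj) (h'.raise μ hμ j hj)
  lower μ hμ j hj := Prod.ext (h.lower μ hμ j hj) (h'.lower μ hμ j hj)
  divF μ hμ j hj := by rw [divPow_prodMap, h.divF μ hμ j hj, h'.divF μ hμ j hj]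
  divE μ hμ j hj := by rw [divPow_prodMap, h.divE μ hμ j hj, h'.divE μ hμ j hj]

/-- The product of two representations. -/
def prodRep {V' : Type*} [AddCommGroup V'] [Module BaseField V']
    (ρ' : Uq D →ₐ[BaseField] Module.End BaseField V') :
    Uq D →ₐ[BaseField] Module.End BaseField (V × V') :=
  (LinearMap.prodMapAlgHom BaseField V V').comp (ρ.prod ρ')

theorem prodRep_apply {V' : Type*} [AddCommGroup V'] [Module BaseField V']
    (ρ' : Uq D →ₐ[BaseField] Module.End BaseField V') (a : Uq D) :
    prodRep ρ ρ' a = (ρ a).prodMap (ρ' a) := rfl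

theorem mem_wtSpace_prodRep {V' : Type*} [AddCommGroup V'] [Module BaseField V']
    {ρ' : Uq D →ₐ[BaseField] Module.End BaseField V'} {μ : Pcl I} {x : V × V'}
    (h1 : x.1 ∈ wtSpace ρ μ) (h2 : x.2 ∈ wtSpace ρ' μ) : x ∈ wtSpace (prodRep ρ ρ') μ := fun i => by
  rw [prodRep_apply]
  exact Prod.ext (h1 i) (h2 i)

/-- A weight vector congruent, modulo the other weight spaces, to a multiple of a weight vector of
the same weight is that multiple. -/
theorem exists_eq_smul_of_mem_wtSpace {ϖ : Pcl I} {w x : V} (hw : w ∈ wtSpace ρ ϖ)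
    (hx : x ∈ wtSpace ρ ϖ) (h : x ∈ BaseField ∙ w ⊔ ⨆ ν : {ν : Pcl I // ν ≠ ϖ}, wtSpace ρ ν) :
    ∃ c : BaseField, x = c • w := by
  obtain ⟨y, hy, z, hz, rfl⟩ := Submodule.mem_sup.1 h
  obtain ⟨c, rfl⟩ := Submodule.mem_span_singleton.1 hy
  have hzw : z ∈ wtSpace ρ ϖ := by
    have := Submodule.sub_mem _ hx (Submodule.smul_mem _ c hw)
    rwa [add_sub_cancel_left] at this
  rw [iSup_subtype] at hz
  have hz0 := (Submodule.disjoint_def.1 (iSupIndep_wtSpace ρ ϖ)) z hzw hz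
  exact ⟨c, by rw [hz0, add_zero]⟩

/-- An invariant subspace of the product of two simple representations that contains `(w, w')` but
neither `(w, 0)` nor `(0, w')` is the graph of an isomorphism. -/
theorem exists_equiv_of_isInvariant_prod {V' : Type*} [AddCommGroup V'] [Module BaseField V']
    {ρ' : Uq D →ₐ[BaseField] Module.End BaseField V'}
    (hs : ∀ N, IsInvariant ρ N → N = ⊥ ∨ N = ⊤) (hs' : ∀ N, IsInvariant ρ' N → N = ⊥ ∨ N = ⊤)
    {X : Submodule BaseField (V × V')} (hX : ∀ a, ∀ x ∈ X, (ρ a x.1, ρ' a x.2) ∈ X)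
    {w : V} {w' : V'} (hw : w ≠ 0) (hw' : w' ≠ 0) (hmem : (w, w') ∈ X)
    (h1 : (w, 0) ∉ X) (h2 : (0, w') ∉ X) :
    ∃ φ : V ≃ₗ[BaseField] V', ∀ x v, ρ' x (φ v) = φ (ρ x v) := by
  have hbot1 : X.comap (LinearMap.inl BaseField V V') = ⊥ := by
    refine (hs _ fun a y hy => ?_).resolve_right fun htop => h1 ?_
    · have := hX a _ hy
      simpa using this
    · have : w ∈ X.comap (LinearMap.inl BaseField V V') := by rw [htop]; trivial
      exact this
  have hbot2 : X.comap (LinearMap.inr BaseField V V') = ⊥ := by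
    refine (hs' _ fun a y hy => ?_).resolve_right fun htop => h2 ?_
    · have := hX a _ hy
      simpa using this
    · have : w' ∈ X.comap (LinearMap.inr BaseField V V') := by rw [htop]; trivial
      exact this
  have htop1 : X.map (LinearMap.fst BaseField V V') = ⊤ := by
    refine (hs _ ?_).resolve_left fun hb => ?_
    · rintro a _ ⟨x, hx, rfl⟩
      exact ⟨_, hX a x hx, rfl⟩
    · have : w ∈ X.map (LinearMap.fst BaseField V V') := ⟨_, hmem, rfl⟩
      rw [hb] at this
      exact hw this
  have htop2 : X.map (LinearMap.snd BaseField V V') = ⊤ := by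
    refine (hs' _ ?_).resolve_left fun hb => ?_
    · rintro a _ ⟨x, hx, rfl⟩
      exact ⟨_, hX a x hx, rfl⟩
    · have : w' ∈ X.map (LinearMap.snd BaseField V V') := ⟨_, hmem, rfl⟩
      rw [hb] at this
      exact hw' this
  have e1 : Function.Bijective ((LinearMap.fst BaseField V V').comp X.subtype) := by
    constructor
    · rw [← LinearMap.ker_eq_bot, LinearMap.ker_eq_bot']
      rintro ⟨⟨x, y⟩, hxy⟩ hx
      change x = 0 at hx
      subst hx
      have : y ∈ X.comap (LinearMap.inr BaseField V V') := hxy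
      rw [hbot2, Submodule.mem_bot] at this
      subst this
      rfl
    · intro x
      obtain ⟨y, hy, hyx⟩ : x ∈ X.map (LinearMap.fst BaseField V V') := by rw [htop1]; trivial
      exact ⟨⟨y, hy⟩, hyx⟩
  have e2 : Function.Bijective ((LinearMap.snd BaseField V V').comp X.subtype) := by
    constructor
    · rw [← LinearMap.ker_eq_bot, LinearMap.ker_eq_bot']
      rintro ⟨⟨x, y⟩, hxy⟩ hy
      change y = 0 at hy
      subst hy
      have : x ∈ X.comap (LinearMap.inl BaseField V V') := hxy
      rw [hbot1, Submodule.mem_bot] at this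
      subst this
      rfl
    · intro x
      obtain ⟨y, hy, hyx⟩ : x ∈ X.map (LinearMap.snd BaseField V V') := by rw [htop2]; trivial
      exact ⟨⟨y, hy⟩, hyx⟩
  refine ⟨(LinearEquiv.ofBijective _ e1).symm.trans (LinearEquiv.ofBijective _ e2), fun a v => ?_⟩
  obtain ⟨x, rfl⟩ := (LinearEquiv.ofBijective _ e1).surjective v
  have h1 : ρ a (LinearEquiv.ofBijective _ e1 x) = LinearEquiv.ofBijective _ e1 ⟨_, hX a x x.2⟩ :=
    rfl
  rw [h1, LinearEquiv.trans_apply, LinearEquiv.trans_apply, LinearEquiv.symm_apply_apply,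
    LinearEquiv.symm_apply_apply]
  rfl

/-- Two fundamental representations are isomorphic: the hull of the diagonal extremal vectors in
their product is the graph of an isomorphism. -/
theorem IsFundamental.exists_equiv {ρ : Uq D →ₐ[BaseField] Module.End BaseField V} {r : I}
    {V' : Type*} [AddCommGroup V'] [Module BaseField V']
    {ρ' : Uq D →ₐ[BaseField] Module.End BaseField V'} (S : D.StringSystem (D.varpi r))
    (h : IsFundamental D r ρ) (h' : IsFundamental D r ρ') :
    ∃ φ : V ≃ₗ[BaseField] V', ∀ x v, ρ' x (φ v) = φ (ρ x v) := by
  obtain ⟨w, hw0, hw⟩ := h.exists_family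
  obtain ⟨w', hw0', hw'⟩ := h'.exists_family
  have hfam := hw.prod hw'
  obtain ⟨X, hX⟩ : ∃ X, X = ExtremalFamily.hull D (fun i => (ρ (ge D i)).prodMap (ρ' (ge D i)))
    (fun i => (ρ (gf D i)).prodMap (ρ' (gf D i))) {μ | WeylOrbit D.A Set.univ (D.varpi r) μ}
    (fun μ => (w μ, w' μ)) S.short := ⟨_, rfl⟩
  have hinv : IsInvariant (prodRep ρ ρ') X := by
    rw [hX]
    refine isInvariant_of_generators _ (fun i x hx => ?_) (fun i x hx => ?_) (fun i x hx => ?_)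
      (fun i x hx => ?_) <;> rw [prodRep_apply]
    · exact hfam.E_mem_hull S.weight_long S.long_sum i hx
    · exact hfam.F_mem_hull S.weight_long S.long_sum i hx
    · exact hfam.hull_mem_of_scalar (fun μ => ⟨D.qi i ^ μ i, fun y hy =>
        Prod.ext (hy.1 i) (hy.2 i)⟩) hx
    · exact hfam.hull_mem_of_scalar (fun μ => ⟨D.qi i ^ (-μ i), fun y hy =>
        Prod.ext (rep_Kinv ρ (hy.1 i)) (rep_Kinv ρ' (hy.2 i))⟩) hx
  have hwX : (w (D.varpi r), w' (D.varpi r)) ∈ X := by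
    rw [hX]; exact Submodule.mem_sup_left (subset_opClosure ⟨_, .refl, rfl⟩)
  have hle : ∀ μ, (wtSpace ρ μ).prod (wtSpace ρ' μ) ≤ wtSpace (prodRep ρ ρ') μ := fun μ y hy =>
    mem_wtSpace_prodRep ρ hy.1 hy.2
  -- The vectors of weight `ϖ` in the hull are the multiples of the diagonal vector.
  have hϖ : ∀ x ∈ X, x ∈ wtSpace (prodRep ρ ρ') (D.varpi r) →
      ∃ c : BaseField, x = c • (w (D.varpi r), w' (D.varpi r)) := fun x hx hxw => by
    rw [hX] at hx
    refine exists_eq_smul_of_mem_wtSpace (prodRep ρ ρ') (hle _ (hfam.mem _ .refl)) hxw ?_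
    have h1 := hfam.hull_le (J := S.short) (ϖ := D.varpi r) S.dominant_short S.ne_rootComb hx
    have h2 : (⨆ ν : {ν : Pcl I // ν ≠ D.varpi r}, (wtSpace ρ ν).prod (wtSpace ρ' ν)) ≤
        ⨆ ν : {ν : Pcl I // ν ≠ D.varpi r}, wtSpace (prodRep ρ ρ') ν := iSup_mono fun ν => hle ν.1
    have h3 := sup_le_sup_left h2 (BaseField ∙ (w (D.varpi r), w' (D.varpi r)))
    exact SetLike.le_def.1 h3 h1
  refine exists_equiv_of_isInvariant_prod ρ (fun N hN => h.simple.2 N hN)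
    (fun N hN => h'.simple.2 N hN) (fun a x hx => hinv a x hx) hw0 hw0' hwX (fun hmem => ?_)
    fun hmem => ?_
  · obtain ⟨c, hc⟩ := hϖ _ hmem (hle _ ⟨hw.mem _ .refl, Submodule.zero_mem _⟩)
    have hc0 : c = 0 := (smul_eq_zero.1 (congrArg Prod.snd hc).symm).resolve_right hw0'
    exact hw0 ((congrArg Prod.fst hc).trans (by rw [hc0, zero_smul]; rfl))
  · obtain ⟨c, hc⟩ := hϖ _ hmem (hle _ ⟨Submodule.zero_mem _, hw'.mem _ .refl⟩)
    have hc0 : c = 0 := (smul_eq_zero.1 (congrArg Prod.fst hc).symm).resolve_right hw0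
    exact hw0' ((congrArg Prod.snd hc).trans (by rw [hc0, zero_smul]; rfl))

end Representations

namespace AffineDatum

variable {I : Type u} [Fintype I] [DecidableEq I] {D : AffineDatum I} {r : I}

namespace StringSystem

/-- The model on a coordinate space is a fundamental representation, and it has a crystal basis. -/
theorem fundamentalExists (S : D.StringSystem (D.varpi r)) : FundamentalExists D r := by
  obtain ⟨n, ⟨e⟩⟩ := Finite.exists_equiv_fin S.Idx
  have h := S.isModel_rep ((Finsupp.basisSingleOne (R := BaseField) (ι := Fin n)).reindex e.symm)
  exact ⟨_, _, _, _, h.isFundamental, h.nonempty_crystalBasis⟩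

/-- Every fundamental representation is a model of the string system, by uniqueness. -/
theorem exists_isModel (S : D.StringSystem (D.varpi r)) {V : Type v} [AddCommGroup V]
    [Module BaseField V] {ρ : Uq D →ₐ[BaseField] Module.End BaseField V} (hρ : IsFundamental D r ρ) :
    ∃ b : Module.Basis S.Idx BaseField V, S.IsModel b ρ := by
  have h := S.isModel_rep (Finsupp.basisSingleOne (R := BaseField) (ι := S.Idx))
  obtain ⟨φ, hφ⟩ := h.isFundamental.exists_equiv S hρ
  exact ⟨_, h.map φ hφ⟩

end StringSystem

theorem mem_minusculeSystem {ϖ : Pcl I} {h0 : ϖ ≠ 0}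
    {hb : ∀ μ, WeylOrbit D.A Set.univ ϖ μ → ∀ i, -1 ≤ μ i ∧ μ i ≤ 1} {μ : Pcl I}
    (hμ : μ ∈ (D.minusculeSystem ϖ h0 hb).R) : WeylOrbit D.A Set.univ ϖ μ := by
  simpa [minusculeSystem] using hμ

end AffineDatum

end QuantumAffine

end

theorem mainTheorem12 {I : Type u} [Fintype I] [DecidableEq I]
    (D : QuantumAffine.AffineDatum I) (r : I) :
    (D.IsMinusculeNode r →
      QuantumAffine.FundamentalExists D r ∧
      ∀ (V : Type v) [AddCommGroup V] [Module QuantumAffine.BaseField V]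
        (ρ : QuantumAffine.Uq D →ₐ[QuantumAffine.BaseField]
          Module.End QuantumAffine.BaseField V),
        QuantumAffine.IsFundamental D r ρ →
        ∀ C : QuantumAffine.CrystalBasis ρ, C.RealizesModule C.minusculeE C.minusculeF) ∧
    (D.IsAdjointNode r →
      QuantumAffine.FundamentalExists D r ∧
      ∀ (V : Type v) [AddCommGroup V] [Module QuantumAffine.BaseField V]
        (ρ : QuantumAffine.Uq D →ₐ[QuantumAffine.BaseField]
          Module.End QuantumAffine.BaseField V),
        QuantumAffine.IsFundamental D r ρ →
        ∀ C : QuantumAffine.CrystalBasis ρ, C.RealizesModule C.adjointE C.adjointF) := by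
  refine ⟨fun hr => ?_, fun hr => ?_⟩
  · have hb := fun μ (hμ : QuantumAffine.WeylOrbit D.A Set.univ (D.varpi r) μ) j =>
      D.minuscule_bound hr hμ j
    refine ⟨(D.minusculeSystem (D.varpi r) (D.varpi_ne_zero hr.2.1) hb).fundamentalExists,
      fun V _ _ ρ hρ C => ?_⟩
    obtain ⟨b, h⟩ := (D.minusculeSystem (D.varpi r) (D.varpi_ne_zero hr.2.1) hb).exists_isModel hρ
    obtain ⟨b', h', hL, hb', hB⟩ := h.exists_isStd C
    exact QuantumAffine.AffineDatum.StringSystem.realizesModule_minuscule h' C hL hb' hB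
      fun μ hμ => hb μ (QuantumAffine.AffineDatum.mem_minusculeSystem hμ)
  · obtain ⟨S⟩ := D.exists_adjointSystem hr
    refine ⟨S.fundamentalExists, fun V _ _ ρ hρ C => ?_⟩
    obtain ⟨b, h⟩ := S.exists_isModel hρ
    obtain ⟨b', h', hL, hb', hB⟩ := h.exists_isStd C
    exact QuantumAffine.AffineDatum.StringSystem.realizesModule_adjoint h' C hL hb' hB
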